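/- **Setting.** Algebras are over $\mathbb{C}$ and need not be unital; an algebra $R$ *has local units* in a subset $U$ if for every finite $F\subseteq R$ there are $u,u'\in U$ with $ux=x=xu'$ for all $x\in F$; $M(R)$ is the multiplier algebra. Let $B$ be a commutative $*$-algebra with local units and let $\Gamma$ be a group, with unit $e$, acting on $B$ by $*$-automorphisms. A *$(B,\Gamma)^{ev}$-algebra* is a $*$-algebra $A=\bigoplus_{\gamma,\gamma'\in\Gamma}A_{\gamma,\gamma'}$ graded by $\Gamma\times\Gamma$, with $A_{\gamma,\gamma'}^*=A_{\gamma^{-1},\gamma'^{-1}}$ and local units in $A_{e,e}$, together with $*$-homomorphisms $r,s\colon B\to M(A)$ with commuting images such that $r(b),s(b)$ preserve the components, $x\,r(b)=r(\gamma(b))x$ and $x\,s(b)=s(\gamma'(b))x$ for $x\in A_{\gamma,\gamma'}$, and for each finite $F\subseteq A$ there are $b,b'\in B$ with $r(b)x=x=s(b')x$ for all $x\in F$. The *fiber product* $A\tilde\otimes A$ is the quotient of $\sum_{\gamma,\gamma',\gamma''}A_{\gamma,\gamma'}\otimes A_{\gamma',\gamma''}\subseteq A\otimes A$ by the ideal generated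 by $s(b)\otimes1-1\otimes r(b)$, $b\in B$. It is a $(B,\Gamma)^{ev}$-algebra with respect to $r(b)\otimes 1$, $1\otimes s(b)$ and the outer degrees. A *morphism* $A\to C$ is a non-degenerate, graded $*$-homomorphism $A\to M(C)$ that is linear over $r$ and $s$. The crossed product $B\rtimes\Gamma$ is a $(B,\Gamma)^{ev}$-algebra with $(B\rtimes\Gamma)_{\gamma,\gamma}=B\gamma$ and $r=s$ the inclusion of $B$; put $\sharp(\sum b_\gamma\gamma)=\sum b_\gamma=\flat(\sum\gamma b_\gamma)$. A *multiplier $(B,\Gamma)$-Hopf $*$-algebroid* is a $(B,\Gamma)^{ev}$-algebra $A$ with * a *comultiplication* $\Delta$: a coassociative morphism from $A$ to $A\tilde\otimes A$ such that $\Delta(a)(x\tilde\otimes1)$, $(x\tilde\otimes 1)\Delta(a)$, $\Delta(a)(1\tilde\otimes y)$, $(1\tilde\otimes y)\Delta(a)$ lie in $A\tilde\otimes A$ for all $a\in A$, $x\in A_{\gamma,e}$, $y\in A_{e,\gamma}$, $\gamma\in\Gamma$. Write $\Delta(a)=\sum a_{(1)}\tilde\otimes a_{(2)}$, and let ${}_sA\otimes_B{}_rA=A\otimes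 A/\langle s(b)a\otimes c-a\otimes r(b)c\rangle$ and $A_s\otimes_B A_r=A\otimes A/\langle a s(b)\otimes c-a\otimes c\,r(b)\rangle$. Put, for $x,y\in A$, $$T_1(x\otimes y)=\sum x_{(1)}\otimes x_{(2)}y\in{}_sA\otimes_B{}_rA,\qquad T_4(x\otimes y)=\sum y_{(1)}x\otimes y_{(2)}\in{}_sA\otimes_B{}_rA,$$ and $T_2(x\otimes y)=\sum xy_{(1)}\otimes y_{(2)}\in A_s\otimes_B A_r$; * a *counit* $\epsilon\colon A\to B\rtimes\Gamma$: a morphism with values in $B\rtimes\Gamma$ such that $\sum r(\sharp\epsilon(x_{(1)}))x_{(2)}y=xy=\sum xy_{(1)}s(\flat\epsilon(y_{(2)}))$; * an *antipode* $S\colon A\to A$: an anti-multiplicative linear bijection with $S(A_{\gamma,\gamma'})\subseteq A_{\gamma'^{-1},\gamma^{-1}}$, $S(r(b)x)=S(x)s(b)$, $S(s(b)x)=S(x)r(b)$, $\sum S(x_{(1)})x_{(2)}y=s(\flat\epsilon(x))y$, $\sum xy_{(1)}S(y_{(2)})=x\,r(\sharp\epsilon(y))$ and $\sum S(x_{(1)})\tilde\otimes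 S(x_{(2)})=\sum S(x)_{(2)}\tilde\otimes S(x)_{(1)}$. A *weight* for $(B,\Gamma)$ is a positive linear $\mu\colon B\to\mathbb{C}$ (that is, $\mu(b^*b)\ge0$) which is faithful ($\mu(Bb)=0$ implies $b=0$) and such that for each $\gamma$ there is some (necessarily unique) $D_\gamma\in M(B)$ with $\mu(\gamma(bD_\gamma))=\mu(b)$ for all $b$. Assume the following. * **(A1)** $A$ is a *measured* multiplier $(B,\Gamma)$-Hopf $*$-algebroid: it comes with a weight $\mu$ and linear maps $\phi,\psi\colon A\to B$ such that $\phi$ is $B$-bilinear with respect to $r$ and vanishes on $A_{\gamma,\gamma'}$ for $\gamma\ne e$, $\psi$ is $B$-bilinear with respect to $s$ and vanishes on $A_{\gamma,\gamma'}$ for $\gamma'\neq e$, $\sum s(\phi(x_{(2)}))x_{(1)}a=r(\phi(x))a$ and $\sum r(\psi(x_{(1)}))x_{(2)}a=s(\psi(x))a$ for all $x,a\in A$, $\phi(A)=B=\psi(A)$, and $\nu:=\mu\circ\phi=\mu\circ\psi$ is faithful and positive. * **(A2)** For each $b\in B$ there is a $C$ with $\mu(c^*b^*bc)\le C\mu(c^*c)$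 for all $c\in B$. * **(A3)** $(D_\gamma^{1/2})_{\gamma\in\Gamma}$ is a family in $M(B)$ with $D_e^{1/2}=1$, $(D_\gamma^{1/2})^*=D_\gamma^{1/2}$, $(D_\gamma^{1/2})^2=D_\gamma$, $D^{1/2}_{\gamma\gamma'}=\gamma'^{-1}(D_\gamma^{1/2})D_{\gamma'}^{1/2}$ and $\mu(c^*D_\gamma^{1/2}c)\ge0$ for all $\gamma,\gamma'\in\Gamma$, $c\in B$. Let $D^{1/2}(a)=r(D^{1/2}_{\gamma^{-1}})a$ and $\bar D^{1/2}(a)=s(D^{1/2}_{\gamma'^{-1}})a$ for $a\in A_{\gamma,\gamma'}$, extended linearly to $A$. **Hilbert spaces.** Let $\Lambda_\mu\colon B\to K$ and $\Lambda_\nu\colon A\to H$ be the completions with respect to $\langle b|b'\rangle=\mu(b^*b')$ and $\langle a|a'\rangle=\nu(a^*a')$, let $\pi_\mu(b)\Lambda_\mu(c)=\Lambda_\mu(bc)$, let $N=\pi_\mu(B)''\subseteq\mathcal{L}(K)$, and let $\tilde\mu$ be the weight on $N$ associated with the Hilbert algebra $\Lambda_\mu(B)$, with square-integrable elements $\mathfrak{N}_{\tilde\mu}$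 and GNS-map $\Lambda_{\tilde\mu}\colon\mathfrak{N}_{\tilde\mu}\to K$. For a normal unital $*$-representation $\rho$ of $N$ on a Hilbert space $L$, let $D(L_\rho)$ be the set of all $\xi\in L$ for which there is a bounded operator $R_\xi\colon K\to L$ with $R_\xi\Lambda_{\tilde\mu}(x)=\rho(x)\xi$ for all $x\in\mathfrak{N}_{\tilde\mu}$. Given two such representations $\rho$ on $L$ and $\sigma$ on $L'$, the *relative tensor product* $L\,{}_\rho\!\otimes_\sigma L'$ is the separated completion of $D(L_\rho)\otimes K\otimes D(L'_\sigma)$ with respect to $$\langle\xi\otimes\zeta\otimes\eta|\xi'\otimes\zeta'\otimes\eta'\rangle=\langle\zeta|R_\xi^*R_{\xi'}R_\eta^*R_{\eta'}\zeta'\rangle ,$$ with elementary tensors determined by $\xi\otimes R_\eta\zeta=\xi\otimes\zeta\otimes\eta=R_\xi\zeta\otimes\eta$. It is functorial with respect to intertwiners and associative; thus, if $\tau$ is a representation of $N$ on $L$ commuting with $\rho$, there is a representation $\tau\otimes1$ on $L\,{}_\rho\!\otimes_\sigma L'$, and likewise $1\otimes\tau$. **Theorem.** Under these assumptions, the following holds.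 1. There are pairwise commuting, normal, faithful, unital representations $\alpha,\beta,\hat\alpha,\hat\beta$ of $N$ on $H$ such that for all $b\in B$, $a\in A$, $$\alpha(\pi_\mu(b))\Lambda_\nu(a)=\Lambda_\nu(r(b)a),\quad \beta(\pi_\mu(b))\Lambda_\nu(a)=\Lambda_\nu(s(b)a),$$ $$\hat\beta(\pi_\mu(b))\Lambda_\nu(a)=\Lambda_\nu(a\,r(b)),\quad\hat\alpha(\pi_\mu(b))\Lambda_\nu(a)=\Lambda_\nu(a\,s(b)).$$ 2. There are unitaries $$W\colon H\,{}_\beta\!\otimes_\alpha H\to H\,{}_\alpha\!\otimes_{\hat\beta}H,\qquad V\colon H\,{}_{\hat\alpha}\!\otimes_\beta H\to H\,{}_\beta\!\otimes_\alpha H$$ such that for all $x,y\in A$, with the sums given by $T_4(x\otimes y)$ and $T_1(x\otimes y)$, respectively, $$W^*(\Lambda_\nu(x)\otimes\Lambda_\nu(y))=\sum\Lambda_\nu(y_{(1)}x)\otimes\Lambda_\nu(D^{1/2}(y_{(2)})),$$ $$V(\Lambda_\nu(x)\otimes\Lambda_\nu(y))=\sum\Lambda_\nu(\bar D^{1/2}(x_{(1)}))\otimes\Lambda_\nu(x_{(2)}y).$$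 3. $W$ is a pseudo-multiplicative unitary in the sense of Vallin: for all $x\in N$, $$W(1\otimes\hat\beta(x))=(\beta(x)\otimes1)W,\quad W(\hat\alpha(x)\otimes1)=(\hat\alpha(x)\otimes1)W,\quad W(\hat\beta(x)\otimes1)=(\hat\beta(x)\otimes1)W,$$ $$W(\alpha(x)\otimes1)=(1\otimes\alpha(x))W,\quad W(1\otimes\beta(x))=(1\otimes\beta(x))W,\quad W(1\otimes\hat\alpha(x))=(1\otimes\hat\alpha(x))W,$$ and the pentagon equation $W_{23}W_{12}=W_{12}W_{13}W_{23}$ holds for the operators from $H\,{}_\beta\!\otimes_\alpha H\,{}_\beta\!\otimes_\alpha H$ to $H\,{}_\alpha\!\otimes_{\hat\beta}H\,{}_\alpha\!\otimes_{\hat\beta}H$, where $W_{12}=W\otimes1$ and $W_{23}=1\otimes W$ (up to associativity isomorphisms), and $$W_{13}\colon H\,{}_\beta\!\otimes_{(1\otimes\alpha)}(H\,{}_\alpha\!\otimes_{\hat\beta}H)\to(H\,{}_\beta\!\otimes_\alpha H)\,{}_{(\alpha\otimes1)}\!\otimes_{\hat\beta}H$$ is $W$ acting on the first and third tensor factor.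 4. $V$ is a pseudo-multiplicative unitary in the same sense, with $(\alpha,\beta,\hat\beta,\hat\alpha)$ replaced by $(\beta,\hat\alpha,\alpha,\hat\beta)$: for all $x\in N$, $$V(1\otimes\alpha(x))=(\hat\alpha(x)\otimes1)V,\quad V(\hat\beta(x)\otimes1)=(\hat\beta(x)\otimes1)V,\quad V(\alpha(x)\otimes1)=(\alpha(x)\otimes1)V,$$ $$V(\beta(x)\otimes1)=(1\otimes\beta(x))V,\quad V(1\otimes\hat\alpha(x))=(1\otimes\hat\alpha(x))V,\quad V(1\otimes\hat\beta(x))=(1\otimes\hat\beta(x))V,$$ and $V_{23}V_{12}=V_{12}V_{13}V_{23}$. -/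

import Mathlib

open scoped TensorProduct InnerProductSpace ComplexOrder ComplexConjugate Topology
open Filter

set_option linter.unusedSectionVars false
set_option linter.checkUnivs false

namespace DynQG

noncomputable section

/-! ## Algebras with local units and multipliers -/

section Multipliers

variable (R : Type*) [NonUnitalRing R] [Module ℂ R] [IsScalarTower ℂ R R] [SMulCommClass ℂ R R]

/-- The multiplier algebra `M(R)`: pairs consisting of a map `x ↦ T x` (a right module map) and a
map `x ↦ x T` (a left module map) with `(x T) y = x (T y)`.  Products are
`(T T') x = T (T' x)` and `x (T T') = (x T) T'`. -/
def multSubalgebra : Subalgebra ℂ (Module.End ℂ R × (Module.End ℂ R)ᵐᵒᵖ) where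
  carrier := {T | (∀ x y, T.1 (x * y) = T.1 x * y) ∧
    (∀ x y, T.2.unop (x * y) = x * T.2.unop y) ∧ ∀ x y, T.2.unop x * y = x * T.1 y}
  mul_mem' := by
    rintro ⟨a, a'⟩ ⟨b, b'⟩ ⟨h1, h2, h3⟩ ⟨k1, k2, k3⟩
    refine ⟨fun x y => ?_, fun x y => ?_, fun x y => ?_⟩ <;>
      simp_all [Module.End.mul_apply]
  add_mem' := by
    rintro ⟨a, a'⟩ ⟨b, b'⟩ ⟨h1, h2, h3⟩ ⟨k1, k2, k3⟩
    refine ⟨fun x y => ?_, fun x y => ?_, fun x y => ?_⟩ <;>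
      simp_all [mul_add, add_mul]
  algebraMap_mem' c := by
    refine ⟨fun x y => ?_, fun x y => ?_, fun x y => ?_⟩ <;>
      simp [Algebra.algebraMap_eq_smul_one, smul_mul_assoc, mul_smul_comm]

/-- The multiplier algebra `M(R)` as a type. -/
def Mult : Type _ := multSubalgebra R

instance : Ring (Mult R) := inferInstanceAs (Ring (multSubalgebra R))
instance : Algebra ℂ (Mult R) := inferInstanceAs (Algebra ℂ (multSubalgebra R))

variable {R}

/-- `x ↦ T x`. -/
def Mult.left (T : Mult R) : R →ₗ[ℂ] R := T.1.1

/-- `x ↦ x T`. -/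
def Mult.right (T : Mult R) : R →ₗ[ℂ] R := T.1.2.unop

lemma Mult.left_add (T T' : Mult R) : (T + T').left = T.left + T'.left := rfl
lemma Mult.right_add (T T' : Mult R) : (T + T').right = T.right + T'.right := rfl
lemma Mult.left_smul (c : ℂ) (T : Mult R) : (c • T).left = c • T.left := rfl
lemma Mult.right_smul (c : ℂ) (T : Mult R) : (c • T).right = c • T.right := rfl

/-- Conjugation of an endomorphism by the involution. -/
def conjEnd [StarRing R] [StarModule ℂ R] (f : R →ₗ[ℂ] R) : R →ₗ[ℂ] R where
  toFun x := star (f (star x))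
  map_add' x y := by simp
  map_smul' c x := by simp [star_smul]

/-- The involution of `M(R)`: `T* x = (x* T)*` and `x T* = (T x*)*`. -/
instance Mult.instStar [StarRing R] [StarModule ℂ R] : Star (Mult R) where
  star T := ⟨(conjEnd T.right, MulOpposite.op (conjEnd T.left)), by
    obtain ⟨⟨a, a'⟩, h1, h2, h3⟩ := T
    refine ⟨fun x y => ?_, fun x y => ?_, fun x y => ?_⟩
    · simp_all [conjEnd, Mult.right]
    · simp_all [conjEnd, Mult.left]
    · have := congrArg star (h3 (star y) (star x))
      simpa [conjEnd, Mult.left, Mult.right] using this.symm⟩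

/-- The algebra `R` has local units lying in the set `U`. -/
structure HasLocalUnits (U : Set R) : Prop where
  left : ∀ F : Finset R, ∃ u ∈ U, ∀ x ∈ F, u * x = x
  right : ∀ F : Finset R, ∃ u ∈ U, ∀ x ∈ F, x * u = x

end Multipliers

/-! ## `(B, Γ)^ev`-algebras and their fiber product -/

section Algebraic

variable {B Γ A : Type*}
  [NonUnitalCommRing B] [Module ℂ B] [IsScalarTower ℂ B B] [SMulCommClass ℂ B B]
  [StarRing B] [StarModule ℂ B] [Group Γ]
  [NonUnitalRing A] [Module ℂ A] [IsScalarTower ℂ A A] [SMulCommClass ℂ A A]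
  [StarRing A] [StarModule ℂ A]

/-- A `(B, Γ)^ev`-algebra structure on the `*`-algebra `A`.  The `*`-homomorphism
`B ⊗ B → M(A)` is given by its two commuting legs `r` and `s`, i.e. it is
`b ⊗ b' ↦ r b * s b'`. -/
structure EvAlgebra (act : Γ →* (B ≃⋆ₐ[ℂ] B)) (A : Type*)
    [NonUnitalRing A] [Module ℂ A] [IsScalarTower ℂ A A] [SMulCommClass ℂ A A]
    [StarRing A] [StarModule ℂ A] where
  /-- the homogeneous components `A_{γ,γ'}` -/
  gr : Γ → Γ → Submodule ℂ A
  r : B →⋆ₙₐ[ℂ] Mult A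
  s : B →⋆ₙₐ[ℂ] Mult A
  gr_indep : iSupIndep fun g : Γ × Γ => gr g.1 g.2
  gr_sup : ⨆ g : Γ × Γ, gr g.1 g.2 = ⊤
  mul_mem : ∀ {γ γ' δ δ' x y}, x ∈ gr γ γ' → y ∈ gr δ δ' → x * y ∈ gr (γ * δ) (γ' * δ')
  star_mem : ∀ {γ γ' x}, x ∈ gr γ γ' → star x ∈ gr γ⁻¹ γ'⁻¹
  localUnits : HasLocalUnits (gr 1 1 : Set A)
  comm : ∀ b b', r b * s b' = s b' * r b
  r_mem : ∀ b {γ γ' x}, x ∈ gr γ γ' → (r b).left x ∈ gr γ γ'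
  s_mem : ∀ b {γ γ' x}, x ∈ gr γ γ' → (s b).left x ∈ gr γ γ'
  r_twist : ∀ b {γ γ' x}, x ∈ gr γ γ' → (r b).right x = (r (act γ b)).left x
  s_twist : ∀ b {γ γ' x}, x ∈ gr γ γ' → (s b).right x = (s (act γ' b)).left x
  r_localUnits : ∀ F : Finset A, ∃ b, ∀ x ∈ F, (r b).left x = x
  s_localUnits : ∀ F : Finset A, ∃ b, ∀ x ∈ F, (s b).left x = x

namespace EvAlgebra

variable {act : Γ →* (B ≃⋆ₐ[ℂ] B)} (𝒜 : EvAlgebra act A)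

/-- `b ↦ (x ↦ r(b) x)` -/
def rL : B →ₗ[ℂ] A →ₗ[ℂ] A where
  toFun b := (𝒜.r b).left
  map_add' x y := by rw [map_add, Mult.left_add]
  map_smul' c x := by rw [map_smul, Mult.left_smul]; rfl

/-- `b ↦ (x ↦ x r(b))` -/
def rR : B →ₗ[ℂ] A →ₗ[ℂ] A where
  toFun b := (𝒜.r b).right
  map_add' x y := by rw [map_add, Mult.right_add]
  map_smul' c x := by rw [map_smul, Mult.right_smul]; rfl

/-- `b ↦ (x ↦ s(b) x)` -/
def sL : B →ₗ[ℂ] A →ₗ[ℂ] A where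
  toFun b := (𝒜.s b).left
  map_add' x y := by rw [map_add, Mult.left_add]
  map_smul' c x := by rw [map_smul, Mult.left_smul]; rfl

/-- `b ↦ (x ↦ x s(b))` -/
def sR : B →ₗ[ℂ] A →ₗ[ℂ] A where
  toFun b := (𝒜.s b).right
  map_add' x y := by rw [map_add, Mult.right_add]
  map_smul' c x := by rw [map_smul, Mult.right_smul]; rfl

/-- The extension of `r` to `M(B)`, applied to `a`: `r(T) a = r(T b) a` for any `b ∈ B` with
`r(b) a = a`. -/
def rExt (T : Mult B) (a : A) : A :=
  𝒜.rL (T.left (𝒜.r_localUnits {a}).choose) a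

/-- The extension of `s` to `M(B)`, applied to `a`: `s(T) a = s(T b) a` for any `b ∈ B` with
`s(b) a = a`. -/
def sExt (T : Mult B) (a : A) : A :=
  𝒜.sL (T.left (𝒜.s_localUnits {a}).choose) a

/-- Elementary tensors `a ⊗ c` with `a ∈ A_{γ,γ'}` and `c ∈ A_{γ',γ''}`. -/
def matched (γ γ'' : Γ) : Set (A ⊗[ℂ] A) :=
  {t | ∃ (γ' : Γ) (a c : A), a ∈ 𝒜.gr γ γ' ∧ c ∈ 𝒜.gr γ' γ'' ∧ t = a ⊗ₜ c}

/-- The subalgebra `∑ A_{γ,γ'} ⊗ A_{γ',γ''}` of `A ⊗ A`. -/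
def prodGamma : NonUnitalSubalgebra ℂ (A ⊗[ℂ] A) where
  __ := Submodule.span ℂ (⋃ g : Γ × Γ, 𝒜.matched g.1 g.2)
  mul_mem' := by
    intro x y hx hy
    change x ∈ Submodule.span ℂ (⋃ g : Γ × Γ, 𝒜.matched g.1 g.2) at hx
    change y ∈ Submodule.span ℂ (⋃ g : Γ × Γ, 𝒜.matched g.1 g.2) at hy
    change x * y ∈ Submodule.span ℂ (⋃ g : Γ × Γ, 𝒜.matched g.1 g.2)
    induction hx using Submodule.span_induction with
    | zero => simp
    | add x₁ x₂ _ _ h₁ h₂ => rw [add_mul]; exact add_mem h₁ h₂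
    | smul c x₁ _ h₁ => rw [smul_mul_assoc]; exact Submodule.smul_mem _ _ h₁
    | mem x hx =>
      induction hy using Submodule.span_induction with
      | zero => simp
      | add x₁ x₂ _ _ h₁ h₂ => rw [mul_add]; exact add_mem h₁ h₂
      | smul c x₁ _ h₁ => rw [mul_smul_comm]; exact Submodule.smul_mem _ _ h₁
      | mem y hy =>
        obtain ⟨⟨γ, γ''⟩, γ', a, c, ha, hc, rfl⟩ := Set.mem_iUnion.1 hx
        obtain ⟨⟨δ, δ''⟩, δ', a', c', ha', hc', rfl⟩ := Set.mem_iUnion.1 hy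
        refine Submodule.subset_span (Set.mem_iUnion.2 ⟨(γ * δ, γ'' * δ''), γ' * δ', a * a',
          c * c', 𝒜.mul_mem ha ha', 𝒜.mul_mem hc hc', ?_⟩)
        simp

/-- The ideal of `∑ A_{γ,γ'} ⊗ A_{γ',γ''}` spanned by all `(s(b) ⊗ 1 - 1 ⊗ r(b)) (a ⊗ c)`. -/
def fiberIdeal : Submodule ℂ 𝒜.prodGamma :=
  Submodule.span ℂ {k | ∃ (b : B) (γ γ' γ'' : Γ) (a c : A), a ∈ 𝒜.gr γ γ' ∧ c ∈ 𝒜.gr γ' γ'' ∧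
    (k : A ⊗[ℂ] A) = 𝒜.sL b a ⊗ₜ c - a ⊗ₜ 𝒜.rL b c}

/-- The fiber product `A ⊗̃ A`. -/
def Fiber : Type _ := 𝒜.prodGamma ⧸ 𝒜.fiberIdeal

instance : AddCommGroup 𝒜.Fiber := inferInstanceAs (AddCommGroup (𝒜.prodGamma ⧸ 𝒜.fiberIdeal))
instance : Module ℂ 𝒜.Fiber := inferInstanceAs (Module ℂ (𝒜.prodGamma ⧸ 𝒜.fiberIdeal))

/-- The quotient map onto the fiber product. -/
def toFiber : 𝒜.prodGamma →ₗ[ℂ] 𝒜.Fiber := 𝒜.fiberIdeal.mkQ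

lemma toFiber_surjective : Function.Surjective 𝒜.toFiber := Submodule.mkQ_surjective _

variable {𝒜} in
lemma mem_prodGamma_induction {p : 𝒜.prodGamma → Prop}
    (tmul : ∀ (γ γ' γ'' : Γ) (a c : A), a ∈ 𝒜.gr γ γ' → c ∈ 𝒜.gr γ' γ'' →
      ∀ x : 𝒜.prodGamma, (x : A ⊗[ℂ] A) = a ⊗ₜ c → p x)
    (zero : p 0) (add : ∀ x y, p x → p y → p (x + y)) (smul : ∀ (c : ℂ) x, p x → p (c • x))
    (x : 𝒜.prodGamma) : p x := by
  obtain ⟨x, hx⟩ := x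
  change x ∈ Submodule.span ℂ (⋃ g : Γ × Γ, 𝒜.matched g.1 g.2) at hx
  induction hx using Submodule.span_induction with
  | zero => exact zero
  | add x₁ x₂ m₁ m₂ h₁ h₂ => exact add ⟨x₁, m₁⟩ ⟨x₂, m₂⟩ h₁ h₂
  | smul c x₁ m₁ h₁ => exact smul c ⟨x₁, m₁⟩ h₁
  | mem x hx =>
    obtain ⟨⟨γ, γ''⟩, γ', a, c, ha, hc, rfl⟩ := Set.mem_iUnion.1 hx
    exact tmul _ _ _ a c ha hc _ rfl

lemma rL_mul (b : B) (x y : A) : 𝒜.rL b (x * y) = 𝒜.rL b x * y := (𝒜.r b).2.1 x y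
lemma sL_mul (b : B) (x y : A) : 𝒜.sL b (x * y) = 𝒜.sL b x * y := (𝒜.s b).2.1 x y

lemma mul_rL (b : B) {γ γ' : Γ} {x : A} (hx : x ∈ 𝒜.gr γ γ') (y : A) :
    x * 𝒜.rL b y = 𝒜.rL (act γ b) (x * y) := by
  rw [rL_mul]
  exact ((𝒜.r b).2.2.2 x y).symm.trans (congrArg (· * y) (𝒜.r_twist b hx))

lemma mul_sL (b : B) {γ γ' : Γ} {x : A} (hx : x ∈ 𝒜.gr γ γ') (y : A) :
    x * 𝒜.sL b y = 𝒜.sL (act γ' b) (x * y) := by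
  rw [sL_mul]
  exact ((𝒜.s b).2.2.2 x y).symm.trans (congrArg (· * y) (𝒜.s_twist b hx))

lemma star_rL (b : B) {γ γ' : Γ} {x : A} (hx : x ∈ 𝒜.gr γ γ') :
    star (𝒜.rL b x) = 𝒜.rL (act γ⁻¹ (star b)) (star x) := by
  have h : 𝒜.r (star b) = star (𝒜.r b) := map_star 𝒜.r b
  have h2 : (𝒜.r (star b)).right (star x) = star ((𝒜.r b).left (star (star x))) := by
    rw [h]; rfl
  rw [star_star, 𝒜.r_twist _ (𝒜.star_mem hx)] at h2
  exact h2.symm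

lemma star_sL (b : B) {γ γ' : Γ} {x : A} (hx : x ∈ 𝒜.gr γ γ') :
    star (𝒜.sL b x) = 𝒜.sL (act γ'⁻¹ (star b)) (star x) := by
  have h : 𝒜.s (star b) = star (𝒜.s b) := map_star 𝒜.s b
  have h2 : (𝒜.s (star b)).right (star x) = star ((𝒜.s b).left (star (star x))) := by
    rw [h]; rfl
  rw [star_star, 𝒜.s_twist _ (𝒜.star_mem hx)] at h2
  exact h2.symm

lemma mul_mem_fiberIdeal_right {k : 𝒜.prodGamma} (hk : k ∈ 𝒜.fiberIdeal) (x : 𝒜.prodGamma) :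
    k * x ∈ 𝒜.fiberIdeal := by
  induction hk using Submodule.span_induction with
  | zero => simp
  | add x₁ x₂ _ _ h₁ h₂ => rw [add_mul]; exact add_mem h₁ h₂
  | smul c x₁ _ h₁ => rw [smul_mul_assoc]; exact Submodule.smul_mem _ _ h₁
  | mem k hk =>
    obtain ⟨b, γ, γ', γ'', a, c, ha, hc, hk⟩ := hk
    induction x using mem_prodGamma_induction with
    | zero => simp
    | add x₁ x₂ h₁ h₂ => rw [mul_add]; exact add_mem h₁ h₂
    | smul c x₁ h₁ => rw [mul_smul_comm]; exact Submodule.smul_mem _ _ h₁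
    | tmul δ δ' δ'' a' c' ha' hc' x hx =>
      refine Submodule.subset_span ⟨b, γ * δ, γ' * δ', γ'' * δ'', a * a', c * c',
        𝒜.mul_mem ha ha', 𝒜.mul_mem hc hc', ?_⟩
      have : ((k * x : 𝒜.prodGamma) : A ⊗[ℂ] A) = k * x := rfl
      rw [this, hk, hx, rL_mul, sL_mul, sub_mul]
      simp

lemma mul_mem_fiberIdeal_left {k : 𝒜.prodGamma} (hk : k ∈ 𝒜.fiberIdeal) (x : 𝒜.prodGamma) :
    x * k ∈ 𝒜.fiberIdeal := by
  induction hk using Submodule.span_induction with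
  | zero => simp
  | add x₁ x₂ _ _ h₁ h₂ => rw [mul_add]; exact add_mem h₁ h₂
  | smul c x₁ _ h₁ => rw [mul_smul_comm]; exact Submodule.smul_mem _ _ h₁
  | mem k hk =>
    obtain ⟨b, γ, γ', γ'', a, c, ha, hc, hk⟩ := hk
    induction x using mem_prodGamma_induction with
    | zero => simp
    | add x₁ x₂ h₁ h₂ => rw [add_mul]; exact add_mem h₁ h₂
    | smul c x₁ h₁ => rw [smul_mul_assoc]; exact Submodule.smul_mem _ _ h₁
    | tmul δ δ' δ'' a' c' ha' hc' x hx =>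
      refine Submodule.subset_span ⟨act δ' b, δ * γ, δ' * γ', δ'' * γ'', a' * a, c' * c,
        𝒜.mul_mem ha' ha, 𝒜.mul_mem hc' hc, ?_⟩
      have : ((x * k : 𝒜.prodGamma) : A ⊗[ℂ] A) = x * k := rfl
      rw [this, hk, hx, ← mul_rL _ _ hc', ← mul_sL _ _ ha', mul_sub]
      simp

/-- The product of the fiber product, as a bilinear map. -/
def fiberMul : 𝒜.Fiber →ₗ[ℂ] 𝒜.Fiber →ₗ[ℂ] 𝒜.Fiber :=
  𝒜.fiberIdeal.liftQ
    { toFun := fun x => 𝒜.fiberIdeal.mapQ 𝒜.fiberIdeal (LinearMap.mulLeft ℂ x)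
        fun k hk => 𝒜.mul_mem_fiberIdeal_left hk x
      map_add' := fun x y => by
        refine Submodule.linearMap_qext _ (LinearMap.ext fun z => ?_)
        exact (congrArg 𝒜.toFiber (add_mul x y z)).trans (map_add 𝒜.toFiber _ _)
      map_smul' := fun c x => by
        refine Submodule.linearMap_qext _ (LinearMap.ext fun z => ?_)
        exact (congrArg 𝒜.toFiber (smul_mul_assoc c x z)).trans (map_smul 𝒜.toFiber _ _) }
    (fun k hk => by
      refine LinearMap.mem_ker.2 (Submodule.linearMap_qext _ (LinearMap.ext fun z => ?_))
      exact (Submodule.Quotient.mk_eq_zero _).2 (𝒜.mul_mem_fiberIdeal_right hk z))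

instance : Mul 𝒜.Fiber := ⟨fun x y => 𝒜.fiberMul x y⟩

lemma toFiber_mul (x y : 𝒜.prodGamma) : 𝒜.toFiber (x * y) = 𝒜.toFiber x * 𝒜.toFiber y := rfl

instance : NonUnitalRing 𝒜.Fiber :=
  { (inferInstance : AddCommGroup 𝒜.Fiber) with
    mul := fun x y => 𝒜.fiberMul x y
    left_distrib := fun x y z => map_add (𝒜.fiberMul x) y z
    right_distrib := fun x y z => LinearMap.map_add₂ 𝒜.fiberMul x y z
    zero_mul := fun x => LinearMap.map_zero₂ 𝒜.fiberMul x
    mul_zero := fun x => map_zero (𝒜.fiberMul x)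
    mul_assoc := fun x y z => by
      obtain ⟨x, rfl⟩ := 𝒜.toFiber_surjective x
      obtain ⟨y, rfl⟩ := 𝒜.toFiber_surjective y
      obtain ⟨z, rfl⟩ := 𝒜.toFiber_surjective z
      exact congrArg 𝒜.toFiber (mul_assoc x y z) }

instance : IsScalarTower ℂ 𝒜.Fiber 𝒜.Fiber :=
  ⟨fun c x y => by
    change 𝒜.fiberMul (c • x) y = c • 𝒜.fiberMul x y
    simp⟩

instance : SMulCommClass ℂ 𝒜.Fiber 𝒜.Fiber :=
  ⟨fun c x y => by
    change c • 𝒜.fiberMul x y = 𝒜.fiberMul x (c • y)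
    simp⟩

lemma star_mem_prodGamma {x : A ⊗[ℂ] A} (hx : x ∈ 𝒜.prodGamma) : star x ∈ 𝒜.prodGamma := by
  change x ∈ Submodule.span ℂ (⋃ g : Γ × Γ, 𝒜.matched g.1 g.2) at hx
  change star x ∈ Submodule.span ℂ (⋃ g : Γ × Γ, 𝒜.matched g.1 g.2)
  induction hx using Submodule.span_induction with
  | zero => simp
  | add x₁ x₂ _ _ h₁ h₂ => rw [star_add]; exact add_mem h₁ h₂
  | smul c x₁ _ h₁ => rw [star_smul]; exact Submodule.smul_mem _ _ h₁
  | mem x hx =>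
    obtain ⟨⟨γ, γ''⟩, γ', a, c, ha, hc, rfl⟩ := Set.mem_iUnion.1 hx
    exact Submodule.subset_span (Set.mem_iUnion.2 ⟨(γ⁻¹, γ''⁻¹), γ'⁻¹, star a, star c,
      𝒜.star_mem ha, 𝒜.star_mem hc, rfl⟩)

lemma star_mem_fiberIdeal {k : 𝒜.prodGamma} (hk : k ∈ 𝒜.fiberIdeal) :
    (⟨star (k : A ⊗[ℂ] A), 𝒜.star_mem_prodGamma k.2⟩ : 𝒜.prodGamma) ∈ 𝒜.fiberIdeal := by
  induction hk using Submodule.span_induction with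
  | zero => convert! 𝒜.fiberIdeal.zero_mem
  | add x₁ x₂ _ _ h₁ h₂ => convert! add_mem h₁ h₂ using 1; ext; simp
  | smul c x₁ _ h₁ => convert! Submodule.smul_mem _ (star c) h₁ using 1; ext; simp
  | mem k hk =>
    obtain ⟨b, γ, γ', γ'', a, c, ha, hc, hk⟩ := hk
    refine Submodule.subset_span ⟨act γ'⁻¹ (star b), γ⁻¹, γ'⁻¹, γ''⁻¹, star a, star c,
      𝒜.star_mem ha, 𝒜.star_mem hc, ?_⟩
    rw [← star_sL _ _ ha, ← star_rL _ _ hc]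
    change star (k : A ⊗[ℂ] A) = _
    rw [hk, star_sub]
    simp

/-- The involution of the fiber product, `(a ⊗̃ c)* = a* ⊗̃ c*`. -/
instance : StarRing 𝒜.Fiber where
  star := Quotient.map' (fun x => ⟨star (x : A ⊗[ℂ] A), 𝒜.star_mem_prodGamma x.2⟩)
    (fun x y h => by
      have h' := (Submodule.quotientRel_def _).1 h
      refine (Submodule.quotientRel_def _).2 ?_
      convert! 𝒜.star_mem_fiberIdeal h' using 1
      ext
      simp)
  star_involutive x := by
    obtain ⟨x, rfl⟩ := 𝒜.toFiber_surjective x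
    exact congrArg 𝒜.toFiber (Subtype.ext (star_star (x : A ⊗[ℂ] A)))
  star_mul x y := by
    obtain ⟨x, rfl⟩ := 𝒜.toFiber_surjective x
    obtain ⟨y, rfl⟩ := 𝒜.toFiber_surjective y
    exact congrArg 𝒜.toFiber (Subtype.ext (star_mul (x : A ⊗[ℂ] A) y))
  star_add x y := by
    obtain ⟨x, rfl⟩ := 𝒜.toFiber_surjective x
    obtain ⟨y, rfl⟩ := 𝒜.toFiber_surjective y
    exact congrArg 𝒜.toFiber (Subtype.ext (star_add (x : A ⊗[ℂ] A) y))

instance : StarModule ℂ 𝒜.Fiber where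
  star_smul c x := by
    obtain ⟨x, rfl⟩ := 𝒜.toFiber_surjective x
    exact congrArg 𝒜.toFiber (Subtype.ext (star_smul c (x : A ⊗[ℂ] A)))

/-- The homogeneous components `(A ⊗̃ A)_{γ,γ''}` of the fiber product. -/
def fiberGr (γ γ'' : Γ) : Submodule ℂ 𝒜.Fiber :=
  Submodule.span ℂ {v | ∃ x : 𝒜.prodGamma, (x : A ⊗[ℂ] A) ∈ 𝒜.matched γ γ'' ∧ v = 𝒜.toFiber x}

/-! ### Operations on `A ⊗ A` by elements of one leg -/

/-- `t ↦ (x ⊗ 1) t` -/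
def mulL₁ (x : A) : A ⊗[ℂ] A →ₗ[ℂ] A ⊗[ℂ] A := (LinearMap.mulLeft ℂ x).rTensor A
/-- `t ↦ t (x ⊗ 1)` -/
def mulR₁ (x : A) : A ⊗[ℂ] A →ₗ[ℂ] A ⊗[ℂ] A := (LinearMap.mulRight ℂ x).rTensor A
/-- `t ↦ (1 ⊗ y) t` -/
def mulL₂ (y : A) : A ⊗[ℂ] A →ₗ[ℂ] A ⊗[ℂ] A := (LinearMap.mulLeft ℂ y).lTensor A
/-- `t ↦ t (1 ⊗ y)` -/
def mulR₂ (y : A) : A ⊗[ℂ] A →ₗ[ℂ] A ⊗[ℂ] A := (LinearMap.mulRight ℂ y).lTensor A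

/-- The multiplier `T (x ⊗̃ 1)` of `A ⊗̃ A` is the element of `A ⊗̃ A` represented by `g`. -/
def RightOne (T : Mult 𝒜.Fiber) (x : A) (g : 𝒜.prodGamma) : Prop :=
  ∀ w w' : 𝒜.prodGamma, (w' : A ⊗[ℂ] A) = mulL₁ x w →
    T.left (𝒜.toFiber w') = 𝒜.toFiber g * 𝒜.toFiber w

/-- The multiplier `T (1 ⊗̃ y)` of `A ⊗̃ A` is the element of `A ⊗̃ A` represented by `g`. -/
def RightTwo (T : Mult 𝒜.Fiber) (y : A) (g : 𝒜.prodGamma) : Prop :=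
  ∀ w w' : 𝒜.prodGamma, (w' : A ⊗[ℂ] A) = mulL₂ y w →
    T.left (𝒜.toFiber w') = 𝒜.toFiber g * 𝒜.toFiber w

/-- The multiplier `(x ⊗̃ 1) T` of `A ⊗̃ A` is the element of `A ⊗̃ A` represented by `g`. -/
def LeftOne (T : Mult 𝒜.Fiber) (x : A) (g : 𝒜.prodGamma) : Prop :=
  ∀ w w' : 𝒜.prodGamma, (w' : A ⊗[ℂ] A) = mulR₁ x w →
    T.right (𝒜.toFiber w') = 𝒜.toFiber w * 𝒜.toFiber g

/-- The multiplier `(1 ⊗̃ y) T` of `A ⊗̃ A` is the element of `A ⊗̃ A` represented by `g`. -/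
def LeftTwo (T : Mult 𝒜.Fiber) (y : A) (g : 𝒜.prodGamma) : Prop :=
  ∀ w w' : 𝒜.prodGamma, (w' : A ⊗[ℂ] A) = mulR₂ y w →
    T.right (𝒜.toFiber w') = 𝒜.toFiber w * 𝒜.toFiber g

/-- The kernel of `A ⊗ A → ₛA ⊗_B ᵣA`. -/
def balancedLeft : Submodule ℂ (A ⊗[ℂ] A) :=
  Submodule.span ℂ {t | ∃ (b : B) (a c : A), t = 𝒜.sL b a ⊗ₜ c - a ⊗ₜ 𝒜.rL b c}

/-- The kernel of `A ⊗ A → Aₛ ⊗_B Aᵣ`. -/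
def balancedRight : Submodule ℂ (A ⊗[ℂ] A) :=
  Submodule.span ℂ {t | ∃ (b : B) (a c : A), t = 𝒜.sR b a ⊗ₜ c - a ⊗ₜ 𝒜.rR b c}

/-- The kernel of the map from `A ⊗ A ⊗ A` to the tensor product over `B` in which
`a s(b) ⊗ m = a ⊗ m r(b)` in the first two legs and `s(b) m ⊗ c = m ⊗ r(b) c` in the last two. -/
def balancedMixed : Submodule ℂ (A ⊗[ℂ] (A ⊗[ℂ] A)) :=
  Submodule.span ℂ
    ({t | ∃ (b : B) (a m c : A), t = 𝒜.sR b a ⊗ₜ (m ⊗ₜ c) - a ⊗ₜ (𝒜.rR b m ⊗ₜ c)} ∪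
      {t | ∃ (b : B) (a m c : A), t = a ⊗ₜ (𝒜.sL b m ⊗ₜ c) - a ⊗ₜ (m ⊗ₜ 𝒜.rL b c)})

/-! ### The canonical maps `T₁`, `T₂`, `T₄`

They are given as relations: the third argument `t ∈ A ⊗ A` represents the value, which lives
in a tensor product over `B`.  A local unit `u` is used to multiply by elements of arbitrary
degree: for instance `Δ(x) (1 ⊗ y) = (Δ(x) (1 ⊗̃ u)) (1 ⊗ y)` if `u y = y`. -/

/-- `t` represents `T₁(x ⊗ y) = Δ(x) (1 ⊗ y) ∈ ₛA ⊗_B ᵣA`. -/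
def IsT₁ (Δ : A →⋆ₙₐ[ℂ] Mult 𝒜.Fiber) (x y : A) (t : A ⊗[ℂ] A) : Prop :=
  ∃ u ∈ 𝒜.gr 1 1, ∃ g : 𝒜.prodGamma, u * y = y ∧ 𝒜.RightTwo (Δ x) u g ∧
    t - mulR₂ y g ∈ 𝒜.balancedLeft

/-- `t` represents `T₂(x ⊗ y) = (x ⊗ 1) Δ(y) ∈ Aₛ ⊗_B Aᵣ`. -/
def IsT₂ (Δ : A →⋆ₙₐ[ℂ] Mult 𝒜.Fiber) (x y : A) (t : A ⊗[ℂ] A) : Prop :=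
  ∃ u ∈ 𝒜.gr 1 1, ∃ g : 𝒜.prodGamma, x * u = x ∧ 𝒜.LeftOne (Δ y) u g ∧
    t - mulL₁ x g ∈ 𝒜.balancedRight

/-- `t` represents `T₄(x ⊗ y) = Δ(y) (x ⊗ 1) ∈ ₛA ⊗_B ᵣA`. -/
def IsT₄ (Δ : A →⋆ₙₐ[ℂ] Mult 𝒜.Fiber) (x y : A) (t : A ⊗[ℂ] A) : Prop :=
  ∃ u ∈ 𝒜.gr 1 1, ∃ g : 𝒜.prodGamma, u * x = x ∧ 𝒜.RightOne (Δ y) u g ∧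
    t - mulR₁ x g ∈ 𝒜.balancedLeft

/-! ### Comultiplication, counit, antipode -/

/-- `Δ` is a comultiplication on `A`: a morphism of `(B, Γ)^ev`-algebras from `A` to `A ⊗̃ A`
(non-degenerate, graded, linear over `r` and `s`) such that the products of `Δ(a)` with
`x ⊗̃ 1` and `1 ⊗̃ y`, where `x ∈ A_{γ,e}` and `y ∈ A_{e,γ}`, lie in `A ⊗̃ A`, and which is
coassociative.  Coassociativity is the identity
`(a ⊗ 1 ⊗ 1) (Δ ⊗̃ id)(Δ(x)) (1 ⊗ 1 ⊗ c) = (a ⊗ 1 ⊗ 1) (id ⊗̃ Δ)(Δ(x)) (1 ⊗ 1 ⊗ c)`, evaluated as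
`∑ (a ⊗ 1) Δ(pᵢ) ⊗ qᵢ = ∑ uⱼ ⊗ Δ(vⱼ) (1 ⊗ c)` for `Δ(x) (1 ⊗ c) = ∑ pᵢ ⊗ qᵢ` and
`(a ⊗ 1) Δ(x) = ∑ uⱼ ⊗ vⱼ`. -/
structure IsComultiplication (Δ : A →⋆ₙₐ[ℂ] Mult 𝒜.Fiber) : Prop where
  nondeg_left : Submodule.span ℂ {v | ∃ a w, v = (Δ a).left w} = ⊤
  nondeg_right : Submodule.span ℂ {v | ∃ a w, v = (Δ a).right w} = ⊤
  graded_left : ∀ {γ γ' δ δ' a v}, a ∈ 𝒜.gr γ γ' → v ∈ 𝒜.fiberGr δ δ' →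
    (Δ a).left v ∈ 𝒜.fiberGr (γ * δ) (γ' * δ')
  graded_right : ∀ {γ γ' δ δ' a v}, a ∈ 𝒜.gr γ γ' → v ∈ 𝒜.fiberGr δ δ' →
    (Δ a).right v ∈ 𝒜.fiberGr (δ * γ) (δ' * γ')
  r_linear : ∀ b a v (w w' : 𝒜.prodGamma), (Δ a).left v = 𝒜.toFiber w →
    (w' : A ⊗[ℂ] A) = (𝒜.rL b).rTensor A w → (Δ (𝒜.rL b a)).left v = 𝒜.toFiber w'
  s_linear : ∀ b a v (w w' : 𝒜.prodGamma), (Δ a).left v = 𝒜.toFiber w →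
    (w' : A ⊗[ℂ] A) = (𝒜.sL b).lTensor A w → (Δ (𝒜.sL b a)).left v = 𝒜.toFiber w'
  right_one : ∀ a γ, ∀ x ∈ 𝒜.gr γ 1, ∃ g, 𝒜.RightOne (Δ a) x g
  left_one : ∀ a γ, ∀ x ∈ 𝒜.gr γ 1, ∃ g, 𝒜.LeftOne (Δ a) x g
  right_two : ∀ a γ, ∀ y ∈ 𝒜.gr 1 γ, ∃ g, 𝒜.RightTwo (Δ a) y g
  left_two : ∀ a γ, ∀ y ∈ 𝒜.gr 1 γ, ∃ g, 𝒜.LeftTwo (Δ a) y g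
  coassoc : ∀ (a x c : A) (n m : ℕ) (p q : Fin n → A) (u v : Fin m → A)
    (t : Fin n → A ⊗[ℂ] A) (t' : Fin m → A ⊗[ℂ] A),
    𝒜.IsT₁ Δ x c (∑ i, p i ⊗ₜ q i) → 𝒜.IsT₂ Δ a x (∑ j, u j ⊗ₜ v j) →
    (∀ i, 𝒜.IsT₂ Δ a (p i) (t i)) → (∀ j, 𝒜.IsT₁ Δ (v j) c (t' j)) →
    ∑ i, TensorProduct.assoc ℂ A A A (t i ⊗ₜ q i) - ∑ j, u j ⊗ₜ[ℂ] t' j ∈ 𝒜.balancedMixed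

end EvAlgebra

/-- The underlying vector space of the crossed product `B ⋊ Γ`: the function `f` stands for
`∑ f(γ) γ`. -/
abbrev Crossed (B Γ : Type*) [Zero B] := Γ →₀ B

namespace Crossed

variable (act : Γ →* (B ≃⋆ₐ[ℂ] B))

/-- The product of `B ⋊ Γ`, `b γ · b' γ' = b γ(b') γγ'`. -/
def mul (f g : Crossed B Γ) : Crossed B Γ :=
  f.sum fun γ b => g.sum fun γ' b' => Finsupp.single (γ * γ') (b * act γ b')

/-- The involution of `B ⋊ Γ`, `(b γ)* = γ⁻¹ b* = γ⁻¹(b*) γ⁻¹`. -/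
def star (f : Crossed B Γ) : Crossed B Γ :=
  f.sum fun γ b => Finsupp.single γ⁻¹ (act γ⁻¹ (Star.star b))

/-- `♯ : ∑ b_γ γ ↦ ∑ b_γ`. -/
def sharp : Crossed B Γ →ₗ[ℂ] B := Finsupp.lsum ℕ fun _ => LinearMap.id

/-- `♭ : ∑ γ b_γ ↦ ∑ b_γ`. -/
def flat : Crossed B Γ →ₗ[ℂ] B :=
  Finsupp.lsum ℕ fun γ =>
    { toFun := fun b => act γ⁻¹ b, map_add' := map_add _, map_smul' := map_smul _ }

end Crossed

namespace EvAlgebra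

variable {act : Γ →* (B ≃⋆ₐ[ℂ] B)} (𝒜 : EvAlgebra act A)

/-- `ε` is a counit: a proper morphism of `(B, Γ)^ev`-algebras `A → B ⋊ Γ` such that
`(ε ⊗̃ id) Δ = id = (id ⊗̃ ε) Δ`, i.e. `∑ r(ε♯(x₁)) x₂ y = x y = ∑ x y₁ s(ε♭(y₂))`. -/
structure IsCounit (Δ : A →⋆ₙₐ[ℂ] Mult 𝒜.Fiber) (ε : A →ₗ[ℂ] Crossed B Γ) : Prop where
  map_mul : ∀ x y, ε (x * y) = Crossed.mul act (ε x) (ε y)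
  map_star : ∀ x, ε (star x) = Crossed.star act (ε x)
  nondeg_left : Submodule.span ℂ {f | ∃ x g, f = Crossed.mul act (ε x) g} = ⊤
  nondeg_right : Submodule.span ℂ {f | ∃ x g, f = Crossed.mul act g (ε x)} = ⊤
  r_linear : ∀ b x γ, ε (𝒜.rL b x) γ = b * ε x γ
  s_linear : ∀ b x γ, ε (𝒜.sL b x) γ = b * ε x γ
  graded : ∀ {γ γ' x}, x ∈ 𝒜.gr γ γ' → ∀ δ, ¬ (δ = γ ∧ δ = γ') → ε x δ = 0
  counit_left : ∀ x y t, 𝒜.IsT₁ Δ x y t →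
    TensorProduct.lift (𝒜.rL ∘ₗ Crossed.sharp ∘ₗ ε) t = x * y
  counit_right : ∀ x y t, 𝒜.IsT₂ Δ x y t →
    TensorProduct.lift (𝒜.sR ∘ₗ Crossed.flat act ∘ₗ ε).flip t = x * y

/-- `S` is an antipode: a linear bijection which, as a map to `A^{co,op}`, is multiplicative,
graded and linear over `r` and `s`, and which satisfies `∑ S(x₁) x₂ y = s(ε♭(x)) y`,
`∑ x y₁ S(y₂) = x r(ε♯(y))` and `∑ S(x₁) ⊗̃ S(x₂) = ∑ S(x)₂ ⊗̃ S(x)₁`.  The last relation is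
multiplied by `S(y)` to read `∑ S(x₂ y) ⊗ S(x₁) = (S(y) ⊗ 1) Δ(S(x))`. -/
structure IsAntipode (Δ : A →⋆ₙₐ[ℂ] Mult 𝒜.Fiber) (ε : A →ₗ[ℂ] Crossed B Γ)
    (S : A ≃ₗ[ℂ] A) : Prop where
  map_mul : ∀ x y, S (x * y) = S y * S x
  graded : ∀ {γ γ' x}, x ∈ 𝒜.gr γ γ' → S x ∈ 𝒜.gr γ'⁻¹ γ⁻¹
  r_linear : ∀ b x, S (𝒜.rL b x) = 𝒜.sR b (S x)
  s_linear : ∀ b x, S (𝒜.sL b x) = 𝒜.rR b (S x)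
  antipode_left : ∀ x y t, 𝒜.IsT₁ Δ x y t →
    TensorProduct.lift (LinearMap.mul ℂ A ∘ₗ (S : A →ₗ[ℂ] A)) t =
      𝒜.sL (Crossed.flat act (ε x)) y
  antipode_right : ∀ x y t, 𝒜.IsT₂ Δ x y t →
    TensorProduct.lift ((LinearMap.mul ℂ A).compl₂ (S : A →ₗ[ℂ] A)) t =
      𝒜.rR (Crossed.sharp (ε y)) x
  comul : ∀ x y t, 𝒜.IsT₁ Δ x y t →
    𝒜.IsT₂ Δ (S y) (S x) (TensorProduct.map S.toLinearMap S.toLinearMap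
      (TensorProduct.comm ℂ A A t))

/-! ### Integrals and weights -/

/-- `φ` is a left integral: a morphism of `(B, Γ)`-modules `(A, r) → B` such that
`∑ s(φ(x₂)) x₁ a = r(φ(x)) a`. -/
structure IsLeftIntegral (Δ : A →⋆ₙₐ[ℂ] Mult 𝒜.Fiber) (φ : A →ₗ[ℂ] B) : Prop where
  left_linear : ∀ b x, φ (𝒜.rL b x) = b * φ x
  right_linear : ∀ b x, φ (𝒜.rR b x) = φ x * b
  graded : ∀ {γ γ' x}, x ∈ 𝒜.gr γ γ' → γ ≠ 1 → φ x = 0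
  invariant : ∀ a x t, 𝒜.IsT₄ Δ a x t →
    TensorProduct.lift (𝒜.sL ∘ₗ φ).flip t = 𝒜.rL (φ x) a

/-- `ψ` is a right integral: a morphism of `(B, Γ)`-modules `(A, s) → B` such that
`∑ r(ψ(x₁)) x₂ a = s(ψ(x)) a`. -/
structure IsRightIntegral (Δ : A →⋆ₙₐ[ℂ] Mult 𝒜.Fiber) (ψ : A →ₗ[ℂ] B) : Prop where
  left_linear : ∀ b x, ψ (𝒜.sL b x) = b * ψ x
  right_linear : ∀ b x, ψ (𝒜.sR b x) = ψ x * b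
  graded : ∀ {γ γ' x}, x ∈ 𝒜.gr γ γ' → γ' ≠ 1 → ψ x = 0
  invariant : ∀ x a t, 𝒜.IsT₁ Δ x a t →
    TensorProduct.lift (𝒜.rL ∘ₗ ψ) t = 𝒜.sL (ψ x) a

end EvAlgebra

/-- A faithful positive functional on a `*`-algebra. -/
structure IsFaithfulPositive {C : Type*} [NonUnitalRing C] [Module ℂ C] [StarRing C]
    (ω : C →ₗ[ℂ] ℂ) : Prop where
  faithful : ∀ c, (∀ d, ω (d * c) = 0) → c = 0
  positive : ∀ c, 0 ≤ ω (star c * c)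

/-- `μ` is a weight for `(B, Γ)` with Radon-Nikodym cocycle `D`. -/
structure IsWeight (act : Γ →* (B ≃⋆ₐ[ℂ] B)) (μ : B →ₗ[ℂ] ℂ) (D : Γ → Mult B) : Prop
    extends IsFaithfulPositive μ where
  quasi_invariant : ∀ γ b, μ (act γ ((D γ).right b)) = μ b

/-- `(A, Δ, ε, S, μ, φ, ψ)` is a measured multiplier `(B, Γ)`-Hopf `*`-algebroid; `D` is the
Radon-Nikodym cocycle of the weight `μ`. -/
structure IsMeasuredHopfAlgebroid {act : Γ →* (B ≃⋆ₐ[ℂ] B)} (𝒜 : EvAlgebra act A)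
    (Δ : A →⋆ₙₐ[ℂ] Mult 𝒜.Fiber) (ε : A →ₗ[ℂ] Crossed B Γ) (S : A ≃ₗ[ℂ] A)
    (μ : B →ₗ[ℂ] ℂ) (D : Γ → Mult B) (φ ψ : A →ₗ[ℂ] B) : Prop where
  comultiplication : 𝒜.IsComultiplication Δ
  counit : 𝒜.IsCounit Δ ε
  antipode : 𝒜.IsAntipode Δ ε S
  weight : IsWeight act μ D
  left_integral : 𝒜.IsLeftIntegral Δ φ
  right_integral : 𝒜.IsRightIntegral Δ ψ
  total : IsFaithfulPositive (μ ∘ₗ φ)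
  coincide : μ ∘ₗ φ = μ ∘ₗ ψ
  left_surjective : Function.Surjective φ
  right_surjective : Function.Surjective ψ

/-- The weight `μ` has bounded left multiplications. -/
def BoundedGNS (μ : B →ₗ[ℂ] ℂ) : Prop :=
  ∀ b, ∃ C : ℝ, ∀ c, (μ (star (b * c) * (b * c))).re ≤ C * (μ (star c * c)).re

/-- `E` is a positive square root of the cocycle `D` in `M(B)`. -/
structure IsSqrtCocycle (act : Γ →* (B ≃⋆ₐ[ℂ] B)) (μ : B →ₗ[ℂ] ℂ) (D E : Γ → Mult B) : Prop where
  one : E 1 = 1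
  selfAdjoint : ∀ γ, star (E γ) = E γ
  sq : ∀ γ, E γ * E γ = D γ
  cocycle : ∀ γ γ' b, (E (γ * γ')).left b =
    act γ'⁻¹ ((E γ).left (act γ' ((E γ').left b)))
  positive : ∀ γ c, 0 ≤ μ (star c * (E γ).left c)

end Algebraic

/-! ## Hilbert spaces obtained from sesquilinear forms -/

section Completion

variable {E : Type*} [AddCommGroup E] [Module ℂ E]

/-- Positivity of a sesquilinear form (conjugate-linear in the first variable). -/
def IsPositiveForm (f : E →ₗ⋆[ℂ] E →ₗ[ℂ] ℂ) : Prop := ∀ x, 0 ≤ f x x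

lemma IsPositiveForm.conj_symm {f : E →ₗ⋆[ℂ] E →ₗ[ℂ] ℂ} (hf : IsPositiveForm f) (x y : E) :
    conj (f y x) = f x y := by
  have h0 : ∀ z, (f z z).im = 0 := fun z => (Complex.nonneg_iff.1 (hf z)).2.symm
  have h1 := h0 (x + y)
  have h2 := h0 (x + Complex.I • y)
  simp only [map_add, LinearMap.add_apply, LinearMap.map_smulₛₗ, LinearMap.smul_apply, map_smul,
    smul_eq_mul, Complex.add_im, Complex.mul_im, Complex.mul_re, Complex.conj_I, Complex.neg_re,
    Complex.neg_im, Complex.I_re, Complex.I_im, Complex.add_re, h0] at h1 h2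
  apply Complex.ext <;> simp <;> linarith

open Classical in
/-- A form whose positivity is not required in advance: the form itself if it is positive, and
zero otherwise. -/
def safeForm (f : E →ₗ⋆[ℂ] E →ₗ[ℂ] ℂ) : E →ₗ⋆[ℂ] E →ₗ[ℂ] ℂ :=
  if IsPositiveForm f then f else 0

lemma safeForm_pos (f : E →ₗ⋆[ℂ] E →ₗ[ℂ] ℂ) : IsPositiveForm (safeForm f) := by
  unfold safeForm
  split_ifs with h
  · exact h
  · intro x; simp

/-- The space `E` equipped with the semi-inner product given by the form `f`. -/
def PreHilb (_f : E →ₗ⋆[ℂ] E →ₗ[ℂ] ℂ) : Type _ := E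

variable (f : E →ₗ⋆[ℂ] E →ₗ[ℂ] ℂ)

instance : AddCommGroup (PreHilb f) := inferInstanceAs (AddCommGroup E)
instance : Module ℂ (PreHilb f) := inferInstanceAs (Module ℂ E)

/-- The semi-inner product. -/
@[reducible] def PreHilb.core : PreInnerProductSpace.Core ℂ (PreHilb f) where
  inner := fun v w => safeForm f v w
  conj_inner_symm x y := (safeForm_pos f).conj_symm x y
  re_inner_nonneg x := (Complex.nonneg_iff.1 (safeForm_pos f x)).1
  add_left x y z := LinearMap.map_add₂ (safeForm f) x y z
  smul_left x y c := LinearMap.map_smulₛₗ₂ (safeForm f) c x y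

instance : SeminormedAddCommGroup (PreHilb f) :=
  @InnerProductSpace.Core.toSeminormedAddCommGroup ℂ _ _ _ _ (PreHilb.core f)

instance : InnerProductSpace ℂ (PreHilb f) := InnerProductSpace.ofCore (PreHilb.core f)

/-- The Hilbert space obtained by separated completion of `E` with respect to the positive
form `f`. -/
def Hilb : Type _ := UniformSpace.Completion (PreHilb f)

instance : NormedAddCommGroup (Hilb f) :=
  inferInstanceAs (NormedAddCommGroup (UniformSpace.Completion (PreHilb f)))
instance : InnerProductSpace ℂ (Hilb f) :=
  inferInstanceAs (InnerProductSpace ℂ (UniformSpace.Completion (PreHilb f)))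
instance : CompleteSpace (Hilb f) :=
  inferInstanceAs (CompleteSpace (UniformSpace.Completion (PreHilb f)))

/-- The canonical map from `E` to its separated completion. -/
def Hilb.of : E →ₗ[ℂ] Hilb f where
  toFun x := ((show PreHilb f from x : PreHilb f) : UniformSpace.Completion (PreHilb f))
  map_add' x y := UniformSpace.Completion.coe_add _ _
  map_smul' c x := (UniformSpace.Completion.toComplₗᵢ (𝕜 := ℂ) (E := PreHilb f)).map_smul c x

lemma Hilb.inner_of (hf : IsPositiveForm f) (x y : E) : ⟪Hilb.of f x, Hilb.of f y⟫_ℂ = f x y := by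
  refine (UniformSpace.Completion.inner_coe _ _).trans ?_
  change safeForm f x y = f x y
  rw [safeForm, if_pos hf]

lemma Hilb.dense_of : DenseRange (Hilb.of f) :=
  UniformSpace.Completion.denseRange_coe (α := PreHilb f)

end Completion

/-! ## The base and its representations -/

section GNS

/-- The form `(a, a') ↦ ω(a* a')`. -/
def gnsForm {C : Type*} [NonUnitalRing C] [Module ℂ C] [IsScalarTower ℂ C C] [SMulCommClass ℂ C C]
    [StarRing C] [StarModule ℂ C] (ω : C →ₗ[ℂ] ℂ) : C →ₗ⋆[ℂ] C →ₗ[ℂ] ℂ :=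
  LinearMap.mk₂'ₛₗ _ _ (fun a a' => ω (star a * a'))
    (fun a b c => by simp [add_mul]) (fun z a b => by simp [star_smul, smul_mul_assoc])
    (fun a b c => by simp [mul_add]) (fun z a b => by simp [mul_smul_comm])

/-- The Hilbert space completion of `C` with respect to `⟨a|a'⟩ = ω(a* a')`. -/
abbrev GNS {C : Type*} [NonUnitalRing C] [Module ℂ C] [IsScalarTower ℂ C C] [SMulCommClass ℂ C C]
    [StarRing C] [StarModule ℂ C] (ω : C →ₗ[ℂ] ℂ) : Type _ := Hilb (gnsForm ω)

/-- The canonical map `Λ_ω : C → GNS ω`. -/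
abbrev Lam {C : Type*} [NonUnitalRing C] [Module ℂ C] [IsScalarTower ℂ C C] [SMulCommClass ℂ C C]
    [StarRing C] [StarModule ℂ C] (ω : C →ₗ[ℂ] ℂ) : C →ₗ[ℂ] GNS ω := Hilb.of (gnsForm ω)

variable {B : Type*} [NonUnitalCommRing B] [Module ℂ B] [IsScalarTower ℂ B B]
  [SMulCommClass ℂ B B] [StarRing B] [StarModule ℂ B] (μ : B →ₗ[ℂ] ℂ)

open Classical in
/-- The bounded operator `π_μ(b)` on `K = GNS μ` with `π_μ(b) Λ_μ(c) = Λ_μ(b c)`. -/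
def piOp (b : B) : GNS μ →L[ℂ] GNS μ :=
  if h : ∃ T : GNS μ →L[ℂ] GNS μ, ∀ c, T (Lam μ c) = Lam μ (b * c) then h.choose else 0

/-- The von Neumann algebra `N = π_μ(B)''`. -/
def baseVN : StarSubalgebra ℂ (GNS μ →L[ℂ] GNS μ) :=
  StarSubalgebra.centralizer ℂ
    (StarSubalgebra.centralizer ℂ (Set.range (piOp μ)) : Set (GNS μ →L[ℂ] GNS μ))

lemma piOp_mem (b : B) : piOp μ b ∈ baseVN μ :=
  (StarSubalgebra.mem_centralizer_iff ℂ).2 fun g hg => by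
    have hg' := (StarSubalgebra.mem_centralizer_iff ℂ).1 hg (piOp μ b) ⟨b, rfl⟩
    refine ⟨hg'.1.symm, ?_⟩
    simpa using congrArg star hg'.2

/-- `π_μ(b)` as an element of `N`. -/
def basePi (b : B) : baseVN μ := ⟨piOp μ b, piOp_mem μ b⟩

/-- `x` is square-integrable for the weight `μ̃` on `N` associated with the Hilbert algebra
`Λ_μ(B)`, with `Λ_μ̃(x) = ζ`: this means that `ζ` is a left bounded vector and `x` is the
operator of left multiplication by `ζ`, i.e. `x Λ_μ(b) = ζ b = π_μ(b) ζ`. -/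
def IsSquareIntegrable (x : baseVN μ) (ζ : GNS μ) : Prop :=
  ∀ b, (x : GNS μ →L[ℂ] GNS μ) (Lam μ b) = piOp μ b ζ

/-- Unital `*`-representations of `N` on a Hilbert space. -/
abbrev Rep (H : Type*) [NormedAddCommGroup H] [InnerProductSpace ℂ H] [CompleteSpace H] : Type _ :=
  baseVN μ →⋆ₐ[ℂ] (H →L[ℂ] H)

variable {μ}

section Rep

variable {H H₁ H₂ H₃ H₁' H₂' : Type*}
  [NormedAddCommGroup H] [InnerProductSpace ℂ H] [CompleteSpace H]
  [NormedAddCommGroup H₁] [InnerProductSpace ℂ H₁] [CompleteSpace H₁]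
  [NormedAddCommGroup H₂] [InnerProductSpace ℂ H₂] [CompleteSpace H₂]
  [NormedAddCommGroup H₃] [InnerProductSpace ℂ H₃] [CompleteSpace H₃]
  [NormedAddCommGroup H₁'] [InnerProductSpace ℂ H₁'] [CompleteSpace H₁']
  [NormedAddCommGroup H₂'] [InnerProductSpace ℂ H₂'] [CompleteSpace H₂']

/-- Normality of a representation: continuity on bounded sets with respect to the weak operator
topologies (equivalently, `σ`-weak continuity). -/
def IsNormal (ρ : Rep μ H) : Prop :=
  ∀ (l : Filter (baseVN μ)) (x : baseVN μ) (C : ℝ), (∀ᶠ y in l, ‖y‖ ≤ C) →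
    (∀ ζ ζ' : GNS μ, Tendsto (fun y : baseVN μ => ⟪ζ, (y : GNS μ →L[ℂ] GNS μ) ζ'⟫_ℂ) l
      (𝓝 ⟪ζ, (x : GNS μ →L[ℂ] GNS μ) ζ'⟫_ℂ)) →
    ∀ ξ ξ' : H, Tendsto (fun y => ⟪ξ, ρ y ξ'⟫_ℂ) l (𝓝 ⟪ξ, ρ x ξ'⟫_ℂ)

/-- The vectors `ξ` that are bounded with respect to `ρ` and `μ̃`, each together with the (unique)
operator `R = R_ξ : K → H` with `R Λ_μ̃(x) = ρ(x) ξ` for all square-integrable `x ∈ N`. -/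
def Bdd (ρ : Rep μ H) : Submodule ℂ (H × (GNS μ →L[ℂ] H)) where
  carrier := {v | ∀ x ζ, IsSquareIntegrable μ x ζ → v.2 ζ = ρ x v.1}
  add_mem' h h' x ζ hx := by simp [h x ζ hx, h' x ζ hx]
  zero_mem' x ζ _ := by simp
  smul_mem' c v h x ζ hx := by simp [h x ζ hx]

/-- `R_ξ`, linear in `ξ`. -/
def Bdd.op (ρ : Rep μ H) : Bdd ρ →ₗ[ℂ] (GNS μ →L[ℂ] H) := LinearMap.snd ℂ _ _ ∘ₗ (Bdd ρ).subtype

/-! ### The relative tensor product -/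

/-- `ξ' ⊗ ζ' ⊗ η' ↦ R_{ξ'} R_η* R_{η'} ζ'` -/
def relOp (ρ₁ : Rep μ H₁) (ρ₂ : Rep μ H₂) (η : Bdd ρ₂) :
    Bdd ρ₁ ⊗[ℂ] (GNS μ ⊗[ℂ] Bdd ρ₂) →ₗ[ℂ] H₁ :=
  TensorProduct.lift
    (LinearMap.mk₂ ℂ
      (fun (ξ' : Bdd ρ₁) (t : GNS μ ⊗[ℂ] Bdd ρ₂) =>
        Bdd.op ρ₁ ξ' (TensorProduct.lift
          (LinearMap.mk₂ ℂ
            (fun (ζ' : GNS μ) (η' : Bdd ρ₂) =>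
              ContinuousLinearMap.adjoint (Bdd.op ρ₂ η) (Bdd.op ρ₂ η' ζ'))
            (by simp) (by simp) (by simp) (by simp)) t))
      (by simp) (by simp) (by simp) (by simp))

lemma relOp_tmul (ρ₁ : Rep μ H₁) (ρ₂ : Rep μ H₂) (η : Bdd ρ₂) (ξ' : Bdd ρ₁) (ζ' : GNS μ)
    (η' : Bdd ρ₂) : relOp ρ₁ ρ₂ η (ξ' ⊗ₜ (ζ' ⊗ₜ η')) =
      Bdd.op ρ₁ ξ' (ContinuousLinearMap.adjoint (Bdd.op ρ₂ η) (Bdd.op ρ₂ η' ζ')) := rfl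

lemma relOp_add (ρ₁ : Rep μ H₁) (ρ₂ : Rep μ H₂) (η₁ η₂ : Bdd ρ₂) :
    relOp ρ₁ ρ₂ (η₁ + η₂) = relOp ρ₁ ρ₂ η₁ + relOp ρ₁ ρ₂ η₂ := by
  refine TensorProduct.ext (LinearMap.ext fun ξ' => TensorProduct.ext
    (LinearMap.ext fun ζ' => LinearMap.ext fun η' => ?_))
  simp [relOp_tmul]

lemma relOp_smul (ρ₁ : Rep μ H₁) (ρ₂ : Rep μ H₂) (c : ℂ) (η : Bdd ρ₂) :
    relOp ρ₁ ρ₂ (c • η) = conj c • relOp ρ₁ ρ₂ η := by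
  refine TensorProduct.ext (LinearMap.ext fun ξ' => TensorProduct.ext
    (LinearMap.ext fun ζ' => LinearMap.ext fun η' => ?_))
  change Bdd.op ρ₁ ξ' (ContinuousLinearMap.adjoint (Bdd.op ρ₂ (c • η)) (Bdd.op ρ₂ η' ζ')) =
    conj c • Bdd.op ρ₁ ξ' (ContinuousLinearMap.adjoint (Bdd.op ρ₂ η) (Bdd.op ρ₂ η' ζ'))
  rw [map_smul (Bdd.op ρ₂), map_smulₛₗ, _root_.smul_apply, map_smul]

/-- The form below with the first vector an elementary tensor. -/
def relFormAux (ρ₁ : Rep μ H₁) (ρ₂ : Rep μ H₂) (ξ : Bdd ρ₁) :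
    (GNS μ ⊗[ℂ] Bdd ρ₂) →ₗ⋆[ℂ] (Bdd ρ₁ ⊗[ℂ] (GNS μ ⊗[ℂ] Bdd ρ₂)) →ₗ[ℂ] ℂ :=
  TensorProduct.lift
    (LinearMap.mk₂'ₛₗ (starRingEnd ℂ) (starRingEnd ℂ)
      (fun (ζ : GNS μ) (η : Bdd ρ₂) => (innerₛₗ ℂ (Bdd.op ρ₁ ξ ζ)) ∘ₗ relOp ρ₁ ρ₂ η)
      (fun ζ₁ ζ₂ η => LinearMap.ext fun t => (congrArg (fun v => ⟪v, relOp ρ₁ ρ₂ η t⟫_ℂ)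
        (map_add (Bdd.op ρ₁ ξ) ζ₁ ζ₂)).trans (inner_add_left _ _ _))
      (fun c ζ η => LinearMap.ext fun t => (congrArg (fun v => ⟪v, relOp ρ₁ ρ₂ η t⟫_ℂ)
        (map_smul (Bdd.op ρ₁ ξ) c ζ)).trans (inner_smul_left _ _ _))
      (fun ζ η₁ η₂ => LinearMap.ext fun t => (congrArg (fun f => ⟪Bdd.op ρ₁ ξ ζ, f t⟫_ℂ)
        (relOp_add ρ₁ ρ₂ η₁ η₂)).trans (inner_add_right _ _ _))
      (fun c ζ η => LinearMap.ext fun t => (congrArg (fun f => ⟪Bdd.op ρ₁ ξ ζ, f t⟫_ℂ)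
        (relOp_smul ρ₁ ρ₂ c η)).trans (inner_smul_right _ _ _)))

lemma relFormAux_tmul (ρ₁ : Rep μ H₁) (ρ₂ : Rep μ H₂) (ξ : Bdd ρ₁) (ζ : GNS μ) (η : Bdd ρ₂) :
    relFormAux ρ₁ ρ₂ ξ (ζ ⊗ₜ η) = (innerₛₗ ℂ (Bdd.op ρ₁ ξ ζ)) ∘ₗ relOp ρ₁ ρ₂ η := rfl

/-- The form `⟨ξ ⊗ ζ ⊗ η | ξ' ⊗ ζ' ⊗ η'⟩ = ⟨ζ | (R_ξ* R_{ξ'}) (R_η* R_{η'}) ζ'⟩` on the algebraic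
tensor product `D(H₁, ρ₁) ⊗ K ⊗ D(H₂, ρ₂)`. -/
def relForm (ρ₁ : Rep μ H₁) (ρ₂ : Rep μ H₂) :
    (Bdd ρ₁ ⊗[ℂ] (GNS μ ⊗[ℂ] Bdd ρ₂)) →ₗ⋆[ℂ] (Bdd ρ₁ ⊗[ℂ] (GNS μ ⊗[ℂ] Bdd ρ₂)) →ₗ[ℂ] ℂ :=
  TensorProduct.lift
    { toFun := relFormAux ρ₁ ρ₂
      map_add' := fun ξ₁ ξ₂ => by
        refine TensorProduct.ext (LinearMap.ext fun ζ => LinearMap.ext fun η => ?_)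
        refine LinearMap.ext fun t => ?_
        exact (congrArg (fun g : GNS μ →L[ℂ] H₁ => ⟪g ζ, relOp ρ₁ ρ₂ η t⟫_ℂ)
          (map_add (Bdd.op ρ₁) ξ₁ ξ₂)).trans (inner_add_left _ _ _)
      map_smul' := fun c ξ => by
        refine TensorProduct.ext (LinearMap.ext fun ζ => LinearMap.ext fun η => ?_)
        refine LinearMap.ext fun t => ?_
        exact (congrArg (fun g : GNS μ →L[ℂ] H₁ => ⟪g ζ, relOp ρ₁ ρ₂ η t⟫_ℂ)
          (map_smul (Bdd.op ρ₁) c ξ)).trans (inner_smul_left _ _ _) }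

lemma relForm_tmul (ρ₁ : Rep μ H₁) (ρ₂ : Rep μ H₂) (ξ ξ' : Bdd ρ₁) (ζ ζ' : GNS μ)
    (η η' : Bdd ρ₂) : relForm ρ₁ ρ₂ (ξ ⊗ₜ (ζ ⊗ₜ η)) (ξ' ⊗ₜ (ζ' ⊗ₜ η')) =
      ⟪ζ, ContinuousLinearMap.adjoint (Bdd.op ρ₁ ξ) (Bdd.op ρ₁ ξ'
        (ContinuousLinearMap.adjoint (Bdd.op ρ₂ η) (Bdd.op ρ₂ η' ζ')))⟫_ℂ := by
  rw [ContinuousLinearMap.adjoint_inner_right]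
  rfl

/-- The relative tensor product `H₁ ⊗_μ̃ H₂` with respect to `ρ₁` and `ρ₂`. -/
def RT (ρ₁ : Rep μ H₁) (ρ₂ : Rep μ H₂) : Type _ :=
  Hilb (E := Bdd ρ₁ ⊗[ℂ] (GNS μ ⊗[ℂ] Bdd ρ₂)) (relForm ρ₁ ρ₂)

instance (ρ₁ : Rep μ H₁) (ρ₂ : Rep μ H₂) : NormedAddCommGroup (RT ρ₁ ρ₂) :=
  inferInstanceAs (NormedAddCommGroup (Hilb (E := Bdd ρ₁ ⊗[ℂ] (GNS μ ⊗[ℂ] Bdd ρ₂)) _))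
instance (ρ₁ : Rep μ H₁) (ρ₂ : Rep μ H₂) : InnerProductSpace ℂ (RT ρ₁ ρ₂) :=
  inferInstanceAs (InnerProductSpace ℂ (Hilb (E := Bdd ρ₁ ⊗[ℂ] (GNS μ ⊗[ℂ] Bdd ρ₂)) _))
instance (ρ₁ : Rep μ H₁) (ρ₂ : Rep μ H₂) : CompleteSpace (RT ρ₁ ρ₂) :=
  inferInstanceAs (CompleteSpace (Hilb (E := Bdd ρ₁ ⊗[ℂ] (GNS μ ⊗[ℂ] Bdd ρ₂)) _))

/-- The class of `ξ ⊗ ζ ⊗ η` in the relative tensor product. -/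
def elem {ρ₁ : Rep μ H₁} {ρ₂ : Rep μ H₂} (ξ : Bdd ρ₁) (ζ : GNS μ) (η : Bdd ρ₂) : RT ρ₁ ρ₂ :=
  Hilb.of (E := Bdd ρ₁ ⊗[ℂ] (GNS μ ⊗[ℂ] Bdd ρ₂)) (relForm ρ₁ ρ₂) (ξ ⊗ₜ (ζ ⊗ₜ η))

/-- `v` is the elementary tensor `ξ ⊗_μ̃ η`, where `ξ` is bounded and `η` is arbitrary.  For
`η = R_{η₀} ζ₀` this is the class of `ξ ⊗ ζ₀ ⊗ η₀`. -/
def IsTens {ρ₁ : Rep μ H₁} {ρ₂ : Rep μ H₂} (ξ : Bdd ρ₁) (η : H₂) (v : RT ρ₁ ρ₂) : Prop :=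
  ∀ (ξ' : Bdd ρ₁) (ζ' : GNS μ) (η' : Bdd ρ₂), ⟪elem ξ' ζ' η', v⟫_ℂ =
    ⟪ζ', ContinuousLinearMap.adjoint (Bdd.op ρ₁ ξ') (Bdd.op ρ₁ ξ
      (ContinuousLinearMap.adjoint (Bdd.op ρ₂ η') η))⟫_ℂ

open Classical in
/-- The elementary tensor `ξ ⊗_μ̃ η` for a bounded vector `ξ` and an arbitrary `η`. -/
def tens (ρ₁ : Rep μ H₁) (ρ₂ : Rep μ H₂) (ξ : H₁) (η : H₂) : RT ρ₁ ρ₂ :=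
  if h : ∃ v : RT ρ₁ ρ₂, ∃ ξ₀ : Bdd ρ₁, ξ₀.1.1 = ξ ∧ IsTens ξ₀ η v then h.choose else 0

/-- `ξ` is bounded with respect to `ρ` and `μ̃`. -/
def IsBddVec (ρ : Rep μ H) (ξ : H) : Prop := ∃ ξ₀ : Bdd ρ, ξ₀.1.1 = ξ

/-- `X = S ⊗_μ̃ T`, where `S` and `T` intertwine the representations involved. -/
structure IsTensorMap {ρ₁ : Rep μ H₁} {ρ₂ : Rep μ H₂} {ρ₁' : Rep μ H₁'} {ρ₂' : Rep μ H₂'}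
    (S : H₁ →L[ℂ] H₁') (T : H₂ →L[ℂ] H₂') (X : RT ρ₁ ρ₂ →L[ℂ] RT ρ₁' ρ₂') : Prop where
  left_intertwines : ∀ x ξ, S (ρ₁ x ξ) = ρ₁' x (S ξ)
  right_intertwines : ∀ x η, T (ρ₂ x η) = ρ₂' x (T η)
  map_elem : ∀ (ξ : Bdd ρ₁) (ζ : GNS μ) (η : Bdd ρ₂) (ξ' : Bdd ρ₁') (η' : Bdd ρ₂'),
    ξ'.1 = (S ξ.1.1, S ∘L ξ.1.2) → η'.1 = (T η.1.1, T ∘L η.1.2) → X (elem ξ ζ η) = elem ξ' ζ η'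

/-- `τ = σ ⊗_μ̃ 1`. -/
def IsAmpLeft {ρ₁ : Rep μ H₁} {ρ₂ : Rep μ H₂} (σ : Rep μ H₁) (τ : Rep μ (RT ρ₁ ρ₂)) : Prop :=
  ∀ x, IsTensorMap (σ x) (ContinuousLinearMap.id ℂ H₂) (τ x)

/-- `τ = 1 ⊗_μ̃ σ`. -/
def IsAmpRight {ρ₁ : Rep μ H₁} {ρ₂ : Rep μ H₂} (σ : Rep μ H₂) (τ : Rep μ (RT ρ₁ ρ₂)) : Prop :=
  ∀ x, IsTensorMap (ContinuousLinearMap.id ℂ H₁) (σ x) (τ x)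

/-- `F` is the flip `ξ ⊗_μ̃ η ↦ η ⊗_μ̃ ξ`. -/
def IsFlip {ρ₁ : Rep μ H₁} {ρ₂ : Rep μ H₂} (F : RT ρ₁ ρ₂ ≃ₗᵢ[ℂ] RT ρ₂ ρ₁) : Prop :=
  ∀ ξ ζ η, F (elem ξ ζ η) = elem η ζ ξ

/-- `F` is the associativity isomorphism
`(H₁ ⊗_μ̃ H₂) ⊗_μ̃ H₃ → H₁ ⊗_μ̃ (H₂ ⊗_μ̃ H₃)`, `(ξ ⊗ η) ⊗ ζ ↦ ξ ⊗ (η ⊗ ζ)`.  Here `σ`, `τ` are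
commuting representations on `H₂`, and `σ' = σ ⊗ 1` and `τ' = 1 ⊗ τ`. -/
structure IsAssoc {ρ : Rep μ H₁} {σ τ : Rep μ H₂} {ω : Rep μ H₃} {τ' : Rep μ (RT ρ σ)}
    {σ' : Rep μ (RT τ ω)} (F : RT τ' ω ≃ₗᵢ[ℂ] RT ρ σ') : Prop where
  left : IsAmpRight τ τ'
  right : IsAmpLeft σ σ'
  map_tens : ∀ ξ η ζ, IsBddVec ρ ξ → IsBddVec τ η →
    F (tens τ' ω (tens ρ σ ξ η) ζ) = tens ρ σ' ξ (tens τ ω η ζ)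

/-- The images of two representations commute. -/
def Commuting (ρ σ : Rep μ H) : Prop := ∀ x y, Commute (ρ x) (σ y)

/-- `W : H_b ⊗_μ̃ _aH → H_a ⊗_μ̃ _cH` is a pseudo-multiplicative unitary with respect to the
commuting, faithful, normal representations `a`, `b`, `c` of `N`.  The representations `la = a ⊗ 1`,
`lc = c ⊗ 1`, `rb = 1 ⊗ b`, `rc = 1 ⊗ c` act on the domain, and `lb' = b ⊗ 1`, `lc' = c ⊗ 1`,
`ra' = 1 ⊗ a`, `rb' = 1 ⊗ b` act on the range of `W`.  The operators of the pentagon are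
`W₁₂ = W ⊗ 1` on `(H_b ⊗ _aH)_{rb} ⊗ _aH` and on `(H_b ⊗ _aH)_{la} ⊗ _cH`,
`W₂₃ = 1 ⊗ W` on `H_a ⊗ _{lc}(H_b ⊗ _aH)` and on `H_b ⊗ _{la}(H_b ⊗ _aH)`, and
`W₁₃ : H_b ⊗ _{ra'}(H_a ⊗ _cH) → (H_b ⊗ _aH)_{la} ⊗ _cH`, which is obtained from `W ⊗ 1` on
`(H_b ⊗ _aH)_{rc} ⊗ _aH` by flips and associativity isomorphisms. -/
structure IsPseudoMultiplicativeUnitary (a b c : Rep μ H) (W : RT b a ≃ₗᵢ[ℂ] RT a c) :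
    Prop where
  normal : IsNormal a ∧ IsNormal b ∧ IsNormal c
  faithful : Function.Injective a ∧ Function.Injective b ∧ Function.Injective c
  commuting : Commuting a b ∧ Commuting a c ∧ Commuting b c
  pentagon : ∃ (la lc rb rc : Rep μ (RT b a)) (lb' lc' ra' rb' : Rep μ (RT a c)),
    (IsAmpLeft a la ∧ IsAmpLeft c lc ∧ IsAmpRight b rb ∧ IsAmpRight c rc ∧
      IsAmpLeft b lb' ∧ IsAmpLeft c lc' ∧ IsAmpRight a ra' ∧ IsAmpRight b rb') ∧
    (∀ x v, W (rc x v) = lb' x (W v)) ∧ (∀ x v, W (lc x v) = lc' x (W v)) ∧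
    (∀ x v, W (la x v) = ra' x (W v)) ∧ (∀ x v, W (rb x v) = rb' x (W v)) ∧
    ∃ (F : RT a c ≃ₗᵢ[ℂ] RT c a) (la'' rb'' : Rep μ (RT c a)) (F' : RT c la ≃ₗᵢ[ℂ] RT la c)
      (A₁ : RT rb a ≃ₗᵢ[ℂ] RT b la) (A₂ : RT rb' a ≃ₗᵢ[ℂ] RT a lc)
      (A₃ : RT ra' c ≃ₗᵢ[ℂ] RT a lc') (A₄ : RT rc a ≃ₗᵢ[ℂ] RT b la'')
      (A₅ : RT rb'' a ≃ₗᵢ[ℂ] RT c la)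
      (W₁₂ : RT rb a →L[ℂ] RT rb' a) (W₂₃ : RT a lc →L[ℂ] RT a lc')
      (W₂₃' : RT b la →L[ℂ] RT b ra') (W₁₂' : RT la c →L[ℂ] RT ra' c)
      (F₂₃ : RT b ra' →L[ℂ] RT b la'') (W₁₂'' : RT rc a →L[ℂ] RT lb' a)
      (F₁₂ : RT lb' a →L[ℂ] RT rb'' a) (W₁₃ : RT b ra' →L[ℂ] RT la c),
      (IsFlip F ∧ IsAmpLeft a la'' ∧ IsAmpRight b rb'' ∧ IsFlip F') ∧
      (IsAssoc A₁ ∧ IsAssoc A₂ ∧ IsAssoc A₃ ∧ IsAssoc A₄ ∧ IsAssoc A₅) ∧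
      IsTensorMap (W : RT b a →L[ℂ] RT a c) (ContinuousLinearMap.id ℂ H) W₁₂ ∧
      IsTensorMap (ContinuousLinearMap.id ℂ H) (W : RT b a →L[ℂ] RT a c) W₂₃ ∧
      IsTensorMap (ContinuousLinearMap.id ℂ H) (W : RT b a →L[ℂ] RT a c) W₂₃' ∧
      IsTensorMap (W : RT b a →L[ℂ] RT a c) (ContinuousLinearMap.id ℂ H) W₁₂' ∧
      IsTensorMap (ContinuousLinearMap.id ℂ H) (F : RT a c →L[ℂ] RT c a) F₂₃ ∧
      IsTensorMap (W : RT b a →L[ℂ] RT a c) (ContinuousLinearMap.id ℂ H) W₁₂'' ∧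
      IsTensorMap (F : RT a c →L[ℂ] RT c a) (ContinuousLinearMap.id ℂ H) F₁₂ ∧
      (∀ v, W₁₃ v = F' (A₅ (F₁₂ (W₁₂'' (A₄.symm (F₂₃ v)))))) ∧
      ∀ v, W₂₃ (A₂ (W₁₂ v)) = A₃ (W₁₂' (W₁₃ (W₂₃' (A₁ v))))

/-- The fourth representation `d` is faithful, normal, commutes with `a`, `b`, `c`, and satisfies
`W (d ⊗ 1) = (d ⊗ 1) W` and `W (1 ⊗ d) = (1 ⊗ d) W`. -/
structure IntertwinesFourth (a b c d : Rep μ H) (W : RT b a ≃ₗᵢ[ℂ] RT a c) : Prop where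
  normal : IsNormal d
  faithful : Function.Injective d
  commuting : Commuting d a ∧ Commuting d b ∧ Commuting d c
  intertwines : ∃ (ld rd : Rep μ (RT b a)) (ld' rd' : Rep μ (RT a c)),
    IsAmpLeft d ld ∧ IsAmpRight d rd ∧ IsAmpLeft d ld' ∧ IsAmpRight d rd' ∧
    (∀ x v, W (ld x v) = ld' x (W v)) ∧ ∀ x v, W (rd x v) = rd' x (W v)

end Rep
end GNS

/-! ## The fundamental unitaries -/

section Fundamental

variable {B Γ A : Type*}
  [NonUnitalCommRing B] [Module ℂ B] [IsScalarTower ℂ B B] [SMulCommClass ℂ B B]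
  [StarRing B] [StarModule ℂ B] [Group Γ]
  [NonUnitalRing A] [Module ℂ A] [IsScalarTower ℂ A A] [SMulCommClass ℂ A A]
  [StarRing A] [StarModule ℂ A] {act : Γ →* (B ≃⋆ₐ[ℂ] B)}

/-- `ρ` is the representation with `ρ(π_μ(b)) Λ_ν(x) = Λ_ν(m b x)`. -/
def IsInducedBy {μ : B →ₗ[ℂ] ℂ} {ν : A →ₗ[ℂ] ℂ} (m : B →ₗ[ℂ] A →ₗ[ℂ] A)
    (ρ : Rep μ (GNS ν)) : Prop :=
  ∀ b x, ρ (basePi μ b) (Lam ν x) = Lam ν (m b x)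

/-- `W* (Λ(x) ⊗ Λ(y)) = ∑ Λ(y₁ x) ⊗ Λ(D^{1/2}(y₂))`, where `∑ y₁ x ⊗ y₂ = T₄(x ⊗ y)` and
`D^{1/2}(q) = r(D^{1/2}_{γ⁻¹}) q` for `q ∈ A_{γ,γ'}`. -/
def IsFundamentalW (𝒜 : EvAlgebra act A) (Δ : A →⋆ₙₐ[ℂ] Mult 𝒜.Fiber) {μ : B →ₗ[ℂ] ℂ}
    (ν : A →ₗ[ℂ] ℂ) (E : Γ → Mult B) (α β βh : Rep μ (GNS ν)) (W : RT β α ≃ₗᵢ[ℂ] RT α βh) :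
    Prop :=
  ∀ (x y : A) (n : ℕ) (p q : Fin n → A) (γ γ' : Fin n → Γ), (∀ i, q i ∈ 𝒜.gr (γ i) (γ' i)) →
    𝒜.IsT₄ Δ x y (∑ i, p i ⊗ₜ q i) →
    W.symm (tens α βh (Lam ν x) (Lam ν y)) =
      ∑ i, tens β α (Lam ν (p i)) (Lam ν (𝒜.rExt (E (γ i)⁻¹) (q i)))

/-- `V (Λ(x) ⊗ Λ(y)) = ∑ Λ(D̄^{1/2}(x₁)) ⊗ Λ(x₂ y)`, where `∑ x₁ ⊗ x₂ y = T₁(x ⊗ y)` and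
`D̄^{1/2}(p) = s(D^{1/2}_{γ'⁻¹}) p` for `p ∈ A_{γ,γ'}`. -/
def IsFundamentalV (𝒜 : EvAlgebra act A) (Δ : A →⋆ₙₐ[ℂ] Mult 𝒜.Fiber) {μ : B →ₗ[ℂ] ℂ}
    (ν : A →ₗ[ℂ] ℂ) (E : Γ → Mult B) (α β αh : Rep μ (GNS ν)) (V : RT αh β ≃ₗᵢ[ℂ] RT β α) :
    Prop :=
  ∀ (x y : A) (n : ℕ) (p q : Fin n → A) (γ γ' : Fin n → Γ), (∀ i, p i ∈ 𝒜.gr (γ i) (γ' i)) →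
    𝒜.IsT₁ Δ x y (∑ i, p i ⊗ₜ q i) →
    V (tens αh β (Lam ν x) (Lam ν y)) =
      ∑ i, tens β α (Lam ν (𝒜.sExt (E (γ' i)⁻¹) (p i))) (Lam ν (q i))

end Fundamental

end
end DynQG

/-! The algebraic core is that `T₄` and `T₁` are isometric for suitable inner products and have full
range. The analytic core is that all representations involved are controlled by bounded operators
from `K`, so that relative tensor products can be computed from Gram operators.

Base. As `B` is commutative with local units, the commutant of `π_μ(B)` is commutative
(`commute_of_commute_piOp`), and `N` equals this commutant. Hence an operator on `K` that commutes
with `π_μ(B)` already lies in `N`. A representation is `Good` if its intertwiners from `K` have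
total ranges. For good representations, bounded vectors are total, and intertwining on `π_μ(B)`
implies intertwining on `N`. Conversely, operators `Lᵢ` from `K` with total ranges and all `Lᵢ* Lⱼ`
in `N` produce a good representation (`exists_rep`). The four representations on `H` and all
amplifications on relative tensor products arise in this way.

Gram operators. For right multiplication, `ν((x r(b))* y r(b')) = μ(b* φ(x* y) b')`. Left
multiplication picks up a twist by the degree, which quasi-invariance of `μ` compensates once
`D^{1/2}` is inserted (`IsExpectation.gram_rL`). This is why `D^{1/2}` occurs in the formulas for
`W` and `V`.

Unitarity. The inner product of the images of `x ⊗ y` and `x' ⊗ y'` is the value of `ν` at `x* (id ⊗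
φ)(Δ(y* y')) x'`. Left invariance turns it into `ν(x* r(φ(y* y')) x')`, which is the inner product
of the given tensors (`inner_tensL_canRel`). The range is full because the antipode supplies
preimages under `T₁` (`IsAntipode.exists_T₁_dense`); the map `x ↦ S(x)*` exchanges `T₁` and `T₄` and
carries this over.

Relations. The intertwining relations are checked on generators. The pentagon equation comes from a
pentagon identity for `T₁`, a consequence of coassociativity (`IsComultiplication.T₁_pentagon`),
together with the compatibility of `D^{1/2}` with products and with `Δ` (`CoSystem.isCompat_sqrtD`).

Symmetry. `CoSystem` collects what the construction of `W` uses. Applied to the algebra `co` with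
exchanged legs and to `ψ`, the construction gives a second unitary, and `V` is its inverse
conjugated by flips. -/

namespace DynQG

noncomputable section

/-! ## Total families and operators determined by Gram matrices -/

section Total

variable {ι κ X Y Z : Type*}
  [NormedAddCommGroup X] [InnerProductSpace ℂ X] [CompleteSpace X]
  [NormedAddCommGroup Y] [InnerProductSpace ℂ Y] [CompleteSpace Y]
  [NormedAddCommGroup Z] [InnerProductSpace ℂ Z] [CompleteSpace Z]

/-- A family of vectors with trivial orthogonal complement. -/
def Total (e : ι → X) : Prop := ∀ x, (∀ i, ⟪e i, x⟫_ℂ = 0) → x = 0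

lemma Total.ext {e : ι → X} (he : Total e) {x y : X} (h : ∀ i, ⟪e i, x⟫_ℂ = ⟪e i, y⟫_ℂ) :
    x = y :=
  sub_eq_zero.1 (he _ fun i => by rw [inner_sub_right, h i, sub_self])

lemma Total.denseRange {e : ι → X} (he : Total e) :
    DenseRange (Finsupp.linearCombination ℂ e) := by
  have h : (Submodule.span ℂ (Set.range e)).topologicalClosure = ⊤ := by
    rw [Submodule.topologicalClosure_eq_top_iff, eq_bot_iff]
    intro x hx
    refine (Submodule.mem_bot ℂ).2 (he x fun i => ?_)
    exact (Submodule.mem_orthogonal _ _).1 hx _ (Submodule.subset_span ⟨i, rfl⟩)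
  have h2 : Dense ((Submodule.span ℂ (Set.range e) : Submodule ℂ X) : Set X) :=
    Submodule.dense_iff_topologicalClosure_eq_top.2 h
  rw [← Finsupp.range_linearCombination] at h2
  rw [DenseRange, ← LinearMap.coe_range]
  exact h2

lemma total_of_denseRange {E : Type*} [AddCommGroup E] [Module ℂ E] {f : E →ₗ[ℂ] X}
    (hf : DenseRange f) : Total f := by
  intro x hx
  have h : ∀ y, ⟪y, x⟫_ℂ = 0 := fun y =>
    hf.induction (P := fun y => ⟪y, x⟫_ℂ = 0) (by rintro _ ⟨z, rfl⟩; exact hx z)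
      (isClosed_eq (by fun_prop) (by fun_prop)) y
  exact inner_self_eq_zero.1 (h x)

/-- If every `e i` is a limit of combinations of the `f j`, then `f` is total as well. -/
lemma Total.of_orthogonal {e : ι → X} (he : Total e) {f : κ → X}
    (h : ∀ x, (∀ j, ⟪f j, x⟫_ℂ = 0) → ∀ i, ⟪e i, x⟫_ℂ = 0) : Total f :=
  fun x hx => he x (h x hx)

lemma Total.clm_ext {e : ι → X} (he : Total e) {S T : X →L[ℂ] Y} (h : ∀ i, S (e i) = T (e i)) :
    S = T := by
  refine ContinuousLinearMap.ext fun x => ext_inner_left ℂ fun y => ?_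
  have : ContinuousLinearMap.adjoint S y = ContinuousLinearMap.adjoint T y :=
    he.ext fun i => by
      rw [ContinuousLinearMap.adjoint_inner_right, ContinuousLinearMap.adjoint_inner_right, h i]
  rw [← ContinuousLinearMap.adjoint_inner_left, ← ContinuousLinearMap.adjoint_inner_left, this]

lemma Total.map {e : ι → X} (he : Total e) (U : X ≃ₗᵢ[ℂ] Y) : Total fun i => U (e i) := by
  intro y hy
  have : U.symm y = 0 := he _ fun i => by
    rw [← hy i, ← U.inner_map_map, U.apply_symm_apply]
  simpa using congrArg U this

/-- The image of a total family under an operator is total in a total family of ranges. -/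
lemma Total.comp {e : ι → X} (he : Total e) {T : κ → X →L[ℂ] Y}
    (hT : Total fun p : κ × X => T p.1 p.2) : Total fun p : κ × ι => T p.1 (e p.2) :=
  hT.of_orthogonal fun y hy p => by
    have : ContinuousLinearMap.adjoint (T p.1) y = 0 := he _ fun i => by
      rw [ContinuousLinearMap.adjoint_inner_right, hy (p.1, i)]
    rw [← ContinuousLinearMap.adjoint_inner_right, this, inner_zero_right]

lemma inner_linearCombination_gram {e : ι → X} {f : ι → Y} {P : X →L[ℂ] X}
    (h : ∀ i j, ⟪f i, f j⟫_ℂ = ⟪e i, P (e j)⟫_ℂ) (c d : ι →₀ ℂ) :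
    ⟪Finsupp.linearCombination ℂ f c, Finsupp.linearCombination ℂ f d⟫_ℂ =
      ⟪Finsupp.linearCombination ℂ e c, P (Finsupp.linearCombination ℂ e d)⟫_ℂ := by
  induction c using Finsupp.induction_linear with
  | zero => simp
  | add c c' h₁ h₂ => simp only [map_add, inner_add_left, h₁, h₂]
  | single i z =>
    induction d using Finsupp.induction_linear with
    | zero => simp
    | add c c' h₁ h₂ => simp only [map_add, inner_add_right, h₁, h₂]
    | single j w =>
      simp only [Finsupp.linearCombination_single, map_smul, inner_smul_left, inner_smul_right, h]

/-- For `x = ∑ cᵢ eᵢ` the hypothesis gives `‖∑ cᵢ fᵢ‖² = ⟪x, P x⟫ ≤ ‖P‖ ‖x‖²`, so the assignment is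
well defined on combinations and bounded by `√‖P‖`. Creation operators are obtained from this with
`P` in the image of `N`. -/
lemma exists_clm_of_gram {e : ι → X} (he : Total e) {f : ι → Y} (P : X →L[ℂ] X)
    (h : ∀ i j, ⟪f i, f j⟫_ℂ = ⟪e i, P (e j)⟫_ℂ) : ∃ T : X →L[ℂ] Y, ∀ i, T (e i) = f i := by
  have hn : ∀ c, ‖Finsupp.linearCombination ℂ f c‖ ≤
      Real.sqrt ‖P‖ * ‖Finsupp.linearCombination ℂ e c‖ := by
    intro c
    have h1 := inner_linearCombination_gram h c c
    have h2 : ‖Finsupp.linearCombination ℂ f c‖ ^ 2 ≤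
        ‖P‖ * ‖Finsupp.linearCombination ℂ e c‖ ^ 2 := by
      rw [← inner_self_eq_norm_sq (𝕜 := ℂ), h1]
      refine (RCLike.re_le_norm _).trans ((norm_inner_le_norm _ _).trans ?_)
      calc _ ≤ ‖Finsupp.linearCombination ℂ e c‖ * (‖P‖ * ‖Finsupp.linearCombination ℂ e c‖) := by
            gcongr; exact P.le_opNorm _
        _ = _ := by ring
    refine abs_le_of_sq_le_sq' ?_ (by positivity) |>.2
    rw [mul_pow, Real.sq_sqrt (norm_nonneg _)]
    exact h2
  refine ⟨(Finsupp.linearCombination ℂ f).extendOfNorm (Finsupp.linearCombination ℂ e),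
    fun i => ?_⟩
  have := LinearMap.extendOfNorm_eq he.denseRange ⟨_, hn⟩ (Finsupp.single i 1)
  simpa using this

lemma exists_isometryEquiv_of_gram {e : ι → X} (he : Total e) {f : ι → Y} (hf : Total f)
    (h : ∀ i j, ⟪f i, f j⟫_ℂ = ⟪e i, e j⟫_ℂ) : ∃ U : X ≃ₗᵢ[ℂ] Y, ∀ i, U (e i) = f i := by
  obtain ⟨T, hT⟩ := exists_clm_of_gram he (f := f) (ContinuousLinearMap.id ℂ X) (by simpa using h)
  obtain ⟨T', hT'⟩ := exists_clm_of_gram hf (f := e) (ContinuousLinearMap.id ℂ Y)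
    (by simpa using fun i j => (h i j).symm)
  have h1 : T' ∘L T = ContinuousLinearMap.id ℂ X := he.clm_ext fun i => by simp [hT, hT']
  have h2 : T ∘L T' = ContinuousLinearMap.id ℂ Y := hf.clm_ext fun i => by simp [hT, hT']
  have h3 : ContinuousLinearMap.adjoint T ∘L T = ContinuousLinearMap.id ℂ X :=
    he.clm_ext fun i => he.ext fun j => by
      simp [ContinuousLinearMap.adjoint_inner_right, hT, h]
  refine ⟨⟨LinearEquiv.ofLinearMap T.toLinearMap T'.toLinearMap
    (LinearMap.ext fun x => DFunLike.congr_fun h2 x)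
    (LinearMap.ext fun x => DFunLike.congr_fun h1 x), fun x => ?_⟩, fun i => hT i⟩
  change ‖T x‖ = ‖x‖
  rw [← sq_eq_sq₀ (norm_nonneg _) (norm_nonneg _), ← inner_self_eq_norm_sq (𝕜 := ℂ),
    ← inner_self_eq_norm_sq (𝕜 := ℂ), ← ContinuousLinearMap.adjoint_inner_right]
  exact congrArg (fun v => RCLike.re ⟪x, v⟫_ℂ) (DFunLike.congr_fun h3 x)

/-- Being obtained by functional calculus, the root commutes with whatever commutes with `P`; this
keeps square roots inside commutants. -/
lemma exists_sqrt_commute (P : X →L[ℂ] X) (hP : 0 ≤ P) :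
    ∃ R : X →L[ℂ] X, star R = R ∧ R * R = P ∧ ∀ T, Commute P T → Commute R T := by
  refine ⟨CFC.sqrt P, ?_, CFC.sqrt_mul_sqrt_self P hP, fun T hT => ?_⟩
  · exact (IsSelfAdjoint.of_nonneg (CFC.sqrt_nonneg P)).star_eq
  · exact hT.cfcₙ_nnreal _

end Total

/-! ## The base -/

section Base

variable {B : Type*} [NonUnitalCommRing B] [Module ℂ B] [IsScalarTower ℂ B B]
  [SMulCommClass ℂ B B] [StarRing B] [StarModule ℂ B]

/-- The properties of the functional `μ` used in the construction of the base. -/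
structure IsBaseFunctional (μ : B →ₗ[ℂ] ℂ) : Prop where
  positive : ∀ c, 0 ≤ μ (star c * c)
  bounded : BoundedGNS μ
  units : HasLocalUnits (Set.univ : Set B)

variable {μ : B →ₗ[ℂ] ℂ} (hμ : IsBaseFunctional μ)

lemma IsBaseFunctional.exists_unit (hμ : IsBaseFunctional μ) (F : Finset B) :
    ∃ u, ∀ x ∈ F, u * x = x := by
  obtain ⟨u, -, hu⟩ := hμ.units.left F
  exact ⟨u, hu⟩

include hμ in
lemma inner_Lam (b c : B) : ⟪Lam μ b, Lam μ c⟫_ℂ = μ (star b * c) :=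
  Hilb.inner_of (gnsForm μ) hμ.positive b c

lemma total_Lam {C : Type*} [NonUnitalRing C] [Module ℂ C] [IsScalarTower ℂ C C]
    [SMulCommClass ℂ C C] [StarRing C] [StarModule ℂ C] (ω : C →ₗ[ℂ] ℂ) : Total (Lam ω) :=
  total_of_denseRange (Hilb.dense_of _)

include hμ in
-- `piOp` has the default value zero if no bounded multiplication operator exists; `BoundedGNS`
-- excludes this case.
lemma piOp_Lam (b c : B) : piOp μ b (Lam μ c) = Lam μ (b * c) := by
  have h : ∃ T : GNS μ →L[ℂ] GNS μ, ∀ c, T (Lam μ c) = Lam μ (b * c) := by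
    obtain ⟨C, hC⟩ := hμ.bounded b
    -- The constant `C` is not assumed nonnegative, hence the absolute value under the root.
    have hn : ∀ c, ‖(Lam μ ∘ₗ LinearMap.mulLeft ℂ b) c‖ ≤ Real.sqrt |C| * ‖Lam μ c‖ := by
      intro c
      refine abs_le_of_sq_le_sq' ?_ (by positivity) |>.2
      rw [mul_pow, Real.sq_sqrt (abs_nonneg _), ← inner_self_eq_norm_sq (𝕜 := ℂ),
        ← inner_self_eq_norm_sq (𝕜 := ℂ), inner_Lam hμ, LinearMap.comp_apply, inner_Lam hμ]
      refine (hC c).trans (mul_le_mul_of_nonneg_right (le_abs_self C) ?_)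
      exact (Complex.nonneg_iff.1 (hμ.positive c)).1
    exact ⟨_, LinearMap.extendOfNorm_eq (Hilb.dense_of _) ⟨_, hn⟩⟩
  rw [piOp, dif_pos h]
  exact h.choose_spec c

include hμ in
lemma piOp_mul (b c : B) : piOp μ (b * c) = piOp μ b * piOp μ c :=
  (total_Lam μ).clm_ext fun d => by
    simp [piOp_Lam hμ, mul_apply_eq_comp, mul_assoc]

include hμ in
lemma piOp_comm (b c : B) : piOp μ b * piOp μ c = piOp μ c * piOp μ b := by
  rw [← piOp_mul hμ, ← piOp_mul hμ, mul_comm]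

include hμ in
lemma piOp_star (b : B) : piOp μ (star b) = star (piOp μ b) :=
  (total_Lam μ).clm_ext fun c => (total_Lam μ).ext fun d => by
    rw [ContinuousLinearMap.star_eq_adjoint, ContinuousLinearMap.adjoint_inner_right,
      piOp_Lam hμ, piOp_Lam hμ, inner_Lam hμ, inner_Lam hμ, star_mul, mul_assoc]

include hμ in
lemma total_piOp : Total fun p : B × GNS μ => piOp μ p.1 p.2 :=
  (total_Lam μ).of_orthogonal fun x hx b => by
    obtain ⟨u, hu⟩ := hμ.exists_unit {b}
    rw [← hu b (by simp), ← piOp_Lam hμ]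
    exact hx (u, Lam μ b)

include hμ in
-- Local units make the ranges of the `π_μ(b)` total, and closure under adjoints turns totality of
-- ranges into triviality of the joint kernel.
lemma eq_zero_of_piOp {ζ : GNS μ} (h : ∀ b, piOp μ b ζ = 0) : ζ = 0 :=
  total_piOp hμ _ fun p => by
    rw [← ContinuousLinearMap.adjoint_inner_right, ← ContinuousLinearMap.star_eq_adjoint,
      ← piOp_star hμ, h, inner_zero_right]

include hμ in
lemma eq_of_piOp {ζ ζ' : GNS μ} (h : ∀ b, piOp μ b ζ = piOp μ b ζ') : ζ = ζ' :=
  sub_eq_zero.1 (eq_zero_of_piOp hμ fun b => by rw [map_sub, h, sub_self])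

include hμ in
-- With a common unit `u` for `b` and `c`, both sides equal `⟪Λ(u*), π_μ(c b) T Λ(u)⟫`, which is
-- symmetric in `b` and `c`.
lemma inner_Lam_star_swap {T : GNS μ →L[ℂ] GNS μ} (hT : ∀ b, Commute T (piOp μ b)) (b c : B) :
    ⟪Lam μ (star c), T (Lam μ b)⟫_ℂ = ⟪Lam μ (star b), T (Lam μ c)⟫_ℂ := by
  classical
  obtain ⟨u, hu⟩ := hμ.exists_unit {b, c}
  have key : ∀ b c, u * b = b → u * c = c → ⟪Lam μ (star c), T (Lam μ b)⟫_ℂ =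
      ⟪Lam μ (star u), piOp μ (c * b) (T (Lam μ u))⟫_ℂ := by
    intro b c hb hc
    have h1 : T (Lam μ b) = piOp μ b (T (Lam μ u)) := by
      rw [← mul_apply_eq_comp, ← (hT b).eq, mul_apply_eq_comp,
        piOp_Lam hμ, mul_comm, hb]
    have h2 : Lam μ (star c) = piOp μ (star c) (Lam μ (star u)) := by
      rw [piOp_Lam hμ, ← star_mul, hc]
    rw [h1, h2, piOp_star hμ, ContinuousLinearMap.star_eq_adjoint,
      ContinuousLinearMap.adjoint_inner_left, piOp_mul hμ, mul_apply_eq_comp]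
  rw [key b c (hu b (by simp)) (hu c (by simp)), key c b (hu c (by simp)) (hu b (by simp)),
    mul_comm]

include hμ in
/-- The commutant of `π_μ(B)` is commutative. -/
lemma commute_of_commute_piOp {S T : GNS μ →L[ℂ] GNS μ} (hS : ∀ b, Commute S (piOp μ b))
    (hT : ∀ b, Commute T (piOp μ b)) : Commute S T := by
  have hadj : ∀ {T : GNS μ →L[ℂ] GNS μ}, (∀ b, Commute T (piOp μ b)) →
      ∀ b, Commute (star T) (piOp μ b) := fun h b => by
    rw [← star_star b, piOp_star hμ]
    exact (h (star b)).star_star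
  -- The modular conjugation `J Λ(b) = Λ(b*)`, isometric because `μ(b b*) = μ(b* b)` in a
  -- commutative algebra.
  let L : B →ₗ⋆[ℂ] GNS μ :=
    { toFun := fun b => Lam μ (star b), map_add' := by simp, map_smul' := by simp }
  have hn : ∀ b, ‖L b‖ ≤ 1 * ‖Lam μ b‖ := fun b => by
    rw [one_mul, ← sq_le_sq₀ (norm_nonneg _) (norm_nonneg _), ← inner_self_eq_norm_sq (𝕜 := ℂ),
      ← inner_self_eq_norm_sq (𝕜 := ℂ)]
    change RCLike.re ⟪Lam μ (star b), Lam μ (star b)⟫_ℂ ≤ _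
    rw [inner_Lam hμ, inner_Lam hμ, star_star, mul_comm]
  let J : GNS μ →SL[starRingEnd ℂ] GNS μ := L.extendOfNorm (Lam μ)
  have hJ : ∀ b, J (Lam μ b) = Lam μ (star b) := fun b =>
    LinearMap.extendOfNorm_eq (Hilb.dense_of _) ⟨1, hn⟩ b
  have swap : ∀ {T : GNS μ →L[ℂ] GNS μ}, (∀ b, Commute T (piOp μ b)) → ∀ (ξ : GNS μ) (b : B),
      ⟪Lam μ (star b), T ξ⟫_ℂ = ⟪J ξ, T (Lam μ b)⟫_ℂ := by
    intro T hT ξ b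
    refine (Hilb.dense_of (gnsForm μ)).induction
      (P := fun ξ => ⟪Lam μ (star b), T ξ⟫_ℂ = ⟪J ξ, T (Lam μ b)⟫_ℂ) ?_
      (isClosed_eq (by fun_prop) (by fun_prop)) ξ
    rintro _ ⟨c, rfl⟩
    change ⟪Lam μ (star b), T (Lam μ c)⟫_ℂ = ⟪J (Lam μ c), T (Lam μ b)⟫_ℂ
    rw [hJ, inner_Lam_star_swap hμ hT]
  -- On the commutant `J T Λ(c) = T* Λ(c*)`. Then `⟪Λ(b), S T Λ(c)⟫ = ⟪T* Λ(c*), S Λ(b*)⟫ = ⟪Λ(c*),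
  -- T S Λ(b*)⟫`, and the swap identity for `T S` gives `⟪Λ(b), T S Λ(c)⟫`.
  have hJT : ∀ {T : GNS μ →L[ℂ] GNS μ}, (∀ b, Commute T (piOp μ b)) → ∀ c,
      J (T (Lam μ c)) = star T (Lam μ (star c)) := by
    intro T hT c
    refine (total_Lam μ).ext fun b => ?_
    have h1 := swap (fun b => Commute.one_left _ : ∀ b, Commute 1 (piOp μ b)) (T (Lam μ c)) b
    simp only [one_apply_eq_self] at h1
    rw [← inner_conj_symm, ← h1, inner_Lam_star_swap hμ hT, inner_conj_symm,
      ContinuousLinearMap.star_eq_adjoint, ContinuousLinearMap.adjoint_inner_right]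
  refine (total_Lam μ).clm_ext fun c => (total_Lam μ).ext fun b => ?_
  have h := swap hS (T (Lam μ c)) (star b)
  rw [star_star, hJT hT] at h
  simp only [mul_apply_eq_comp]
  rw [h, ContinuousLinearMap.star_eq_adjoint, ContinuousLinearMap.adjoint_inner_left]
  have h2 := inner_Lam_star_swap hμ (T := T * S) (fun b => (hT b).mul_left (hS b)) c (star b)
  rw [star_star] at h2
  simpa using h2.symm

include hμ in
-- The commutant of `π_μ(B)` is commutative, hence contained in its own commutant, which is `N`.
-- Together with `commute_piOp` this identifies `N` with the commutant of `π_μ(B)`, so that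
-- membership in `N` need only be tested against `B`.
lemma mem_baseVN {T : GNS μ →L[ℂ] GNS μ} (hT : ∀ b, Commute T (piOp μ b)) : T ∈ baseVN μ := by
  refine (StarSubalgebra.mem_centralizer_iff ℂ).2 fun g hg => ?_
  have hg' : ∀ b, Commute g (piOp μ b) := fun b =>
    ((StarSubalgebra.mem_centralizer_iff ℂ).1 hg _ ⟨b, rfl⟩).1.symm
  have hg'' : ∀ b, Commute (star g) (piOp μ b) := fun b => by
    rw [← star_star b, piOp_star hμ]
    exact (hg' (star b)).star_star
  exact ⟨(commute_of_commute_piOp hμ hg' hT).eq, (commute_of_commute_piOp hμ hg'' hT).eq⟩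

include hμ in
lemma commute_piOp (x : baseVN μ) (b : B) : Commute (x : GNS μ →L[ℂ] GNS μ) (piOp μ b) := by
  have h : piOp μ b ∈ StarSubalgebra.centralizer ℂ (Set.range (piOp μ)) := by
    refine (StarSubalgebra.mem_centralizer_iff ℂ).2 ?_
    rintro _ ⟨c, rfl⟩
    exact ⟨piOp_comm hμ c b, by rw [← piOp_star hμ, piOp_comm hμ]⟩
  exact ((StarSubalgebra.mem_centralizer_iff ℂ).1 x.2 _ h).1.symm

include hμ in
lemma baseVN_commute (x y : baseVN μ) :
    Commute (x : GNS μ →L[ℂ] GNS μ) (y : GNS μ →L[ℂ] GNS μ) :=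
  commute_of_commute_piOp hμ (commute_piOp hμ x) (commute_piOp hμ y)

include hμ in
lemma commute_baseVN {T : GNS μ →L[ℂ] GNS μ} (hT : ∀ b, Commute T (piOp μ b)) (x : baseVN μ) :
    Commute T (x : GNS μ →L[ℂ] GNS μ) :=
  baseVN_commute hμ ⟨T, mem_baseVN hμ hT⟩ x

include hμ in
lemma isSquareIntegrable_basePi (b : B) : IsSquareIntegrable μ (basePi μ b) (Lam μ b) :=
  fun c => by
    change piOp μ b (Lam μ c) = _
    rw [piOp_Lam hμ, piOp_Lam hμ, mul_comm]

/-! ## Representations of the base with a total set of bounded vectors -/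

section Good

variable {H H₁ H₂ : Type*}
  [NormedAddCommGroup H] [InnerProductSpace ℂ H] [CompleteSpace H]
  [NormedAddCommGroup H₁] [InnerProductSpace ℂ H₁] [CompleteSpace H₁]
  [NormedAddCommGroup H₂] [InnerProductSpace ℂ H₂] [CompleteSpace H₂]

/-- The operators `K → H` that intertwine the identity representation of `N` and `ρ`. -/
def Inter (ρ : Rep μ H) : Set (GNS μ →L[ℂ] H) :=
  {L | ∀ (x : baseVN μ) ζ, L ((x : GNS μ →L[ℂ] GNS μ) ζ) = ρ x (L ζ)}

/-- A representation is good if the ranges of its intertwiners from `K` are total. -/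
def Good (ρ : Rep μ H) : Prop := Total fun p : Inter ρ × GNS μ => (p.1 : GNS μ →L[ℂ] H) p.2

lemma good_of_total {ι : Type*} {ρ : Rep μ H} {L : ι → GNS μ →L[ℂ] H} (hL : ∀ i, L i ∈ Inter ρ)
    (h : Total fun p : ι × GNS μ => L p.1 p.2) : Good ρ :=
  h.of_orthogonal fun _ hx p => hx (⟨L p.1, hL p.1⟩, p.2)

lemma adjoint_rep (ρ : Rep μ H) (x : baseVN μ) :
    ContinuousLinearMap.adjoint (ρ x) = ρ (star x) := by
  rw [map_star, ContinuousLinearMap.star_eq_adjoint]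

lemma basePi_mul (b c : B) (hμ : IsBaseFunctional μ) :
    basePi μ (b * c) = basePi μ b * basePi μ c := Subtype.ext (piOp_mul hμ b c)

/-- The adjoint of an intertwiner. -/
lemma Inter.adjoint {ρ : Rep μ H} {L : GNS μ →L[ℂ] H} (hL : L ∈ Inter ρ) (x : baseVN μ) (ξ : H) :
    ContinuousLinearMap.adjoint L (ρ x ξ) =
      (x : GNS μ →L[ℂ] GNS μ) (ContinuousLinearMap.adjoint L ξ) := by
  refine ext_inner_left ℂ fun ζ => ?_
  have hx : ContinuousLinearMap.adjoint (x : GNS μ →L[ℂ] GNS μ) =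
    ((star x : baseVN μ) : GNS μ →L[ℂ] GNS μ) := rfl
  rw [ContinuousLinearMap.adjoint_inner_right, ← ContinuousLinearMap.adjoint_inner_left, adjoint_rep,
    ← hL, ← ContinuousLinearMap.adjoint_inner_left (x : GNS μ →L[ℂ] GNS μ), hx,
    ContinuousLinearMap.adjoint_inner_right]

include hμ in
/-- A map that intertwines two good representations on `π_μ(B)` intertwines them on `N`. -/
lemma Good.intertwines {ρ₁ : Rep μ H₁} {ρ₂ : Rep μ H₂} (h₁ : Good ρ₁) (h₂ : Good ρ₂)
    {S : H₁ →L[ℂ] H₂} (hS : ∀ b ξ, S (ρ₁ (basePi μ b) ξ) = ρ₂ (basePi μ b) (S ξ))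
    (x : baseVN μ) (ξ : H₁) : S (ρ₁ x ξ) = ρ₂ x (S ξ) := by
  suffices S ∘L ρ₁ x = ρ₂ x ∘L S from DFunLike.congr_fun this ξ
  refine h₁.clm_ext ?_
  rintro ⟨⟨L, hL⟩, ζ⟩
  refine h₂.ext ?_
  rintro ⟨⟨L', hL'⟩, ζ'⟩
  simp only [ContinuousLinearMap.comp_apply]
  -- Compressed to `K` by intertwiners, `S` commutes with `π_μ(B)` and hence with all of `N`.
  have hT : ∀ b, Commute (ContinuousLinearMap.adjoint L' ∘L S ∘L L) (piOp μ b) := fun b => by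
    refine ContinuousLinearMap.ext fun η => ?_
    simp only [mul_apply_eq_comp, ContinuousLinearMap.comp_apply]
    have := hL (basePi μ b) η
    change L (piOp μ b η) = _ at this
    rw [this, hS, Inter.adjoint hL']
    rfl
  rw [← hL x ζ, ← ContinuousLinearMap.adjoint_inner_right, ← ContinuousLinearMap.adjoint_inner_right,
    Inter.adjoint hL']
  exact congrArg (fun v => ⟪ζ', v⟫_ℂ) (DFunLike.congr_fun (commute_baseVN hμ hT x).eq ζ)

include hμ in
-- The adjoints of the intertwiners separate the points of `H` and carry the question to `K`, where
-- `eq_of_piOp` answers it.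
lemma Good.eq_of_basePi {ρ : Rep μ H} (h : Good ρ) {ξ ξ' : H}
    (hξ : ∀ b, ρ (basePi μ b) ξ = ρ (basePi μ b) ξ') : ξ = ξ' := by
  refine h.ext ?_
  rintro ⟨⟨L, hL⟩, ζ⟩
  change ⟪L ζ, ξ⟫_ℂ = ⟪L ζ, ξ'⟫_ℂ
  rw [← ContinuousLinearMap.adjoint_inner_right, ← ContinuousLinearMap.adjoint_inner_right]
  congr 1
  refine eq_of_piOp hμ fun b => ?_
  have := congrArg (ContinuousLinearMap.adjoint L) (hξ b)
  rwa [Inter.adjoint hL, Inter.adjoint hL] at this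

include hμ in
lemma Bdd.op_Lam {ρ : Rep μ H} (ξ : Bdd ρ) (b : B) :
    Bdd.op ρ ξ (Lam μ b) = ρ (basePi μ b) ξ.1.1 :=
  ξ.2 _ _ (isSquareIntegrable_basePi hμ b)

include hμ in
-- The defining relation of `R_ξ`, evaluated on `Λ_μ(B)`, only gives intertwining with `π_μ(B)`. The
-- compressions `L* R_ξ` then commute with `π_μ(B)`, hence with `N`, and the ranges of the `L` are
-- total.
lemma Good.op_mem {ρ : Rep μ H} (h : Good ρ) (ξ : Bdd ρ) : Bdd.op ρ ξ ∈ Inter ρ := by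
  intro x ζ
  suffices Bdd.op ρ ξ ∘L (x : GNS μ →L[ℂ] GNS μ) = ρ x ∘L Bdd.op ρ ξ from DFunLike.congr_fun this ζ
  have hb : ∀ (b : B) (ζ : GNS μ), Bdd.op ρ ξ (piOp μ b ζ) = ρ (basePi μ b) (Bdd.op ρ ξ ζ) := by
    intro b ζ
    suffices Bdd.op ρ ξ ∘L piOp μ b = ρ (basePi μ b) ∘L Bdd.op ρ ξ from DFunLike.congr_fun this ζ
    refine (total_Lam μ).clm_ext fun c => ?_
    simp only [ContinuousLinearMap.comp_apply]
    rw [piOp_Lam hμ, Bdd.op_Lam hμ, Bdd.op_Lam hμ, basePi_mul _ _ hμ, map_mul,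
      mul_apply_eq_comp]
  refine ContinuousLinearMap.ext fun ζ => h.ext ?_
  rintro ⟨⟨L, hL⟩, ζ'⟩
  have hT : ∀ b, Commute (ContinuousLinearMap.adjoint L ∘L Bdd.op ρ ξ) (piOp μ b) := fun b => by
    refine ContinuousLinearMap.ext fun η => ?_
    simp only [mul_apply_eq_comp, ContinuousLinearMap.comp_apply]
    rw [hb, Inter.adjoint hL]
    rfl
  simp only [ContinuousLinearMap.comp_apply]
  rw [← ContinuousLinearMap.adjoint_inner_right, ← ContinuousLinearMap.adjoint_inner_right,
    Inter.adjoint hL]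
  exact congrArg (fun v => ⟪ζ', v⟫_ℂ) (DFunLike.congr_fun (commute_baseVN hμ hT x).eq ζ)

include hμ in
-- Boundedness of a vector may be tested on `Λ_μ(B)` instead of on all square-integrable elements:
-- `R ζ` and `ρ(x) ξ` agree after applying each `ρ(π_μ(b))`, and these operators separate vectors.
lemma Good.mem_Bdd {ρ : Rep μ H} (h : Good ρ) {ξ : H} {R : GNS μ →L[ℂ] H} (hR : R ∈ Inter ρ)
    (hξ : ∀ b, R (Lam μ b) = ρ (basePi μ b) ξ) : (ξ, R) ∈ Bdd ρ := by
  intro x ζ hx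
  refine h.eq_of_basePi hμ fun b => ?_
  change ρ (basePi μ b) (R ζ) = _
  rw [← hR]
  change R (piOp μ b ζ) = _
  rw [← hx b, hR, hξ, ← mul_apply_eq_comp, ← mul_apply_eq_comp, ← map_mul,
    ← map_mul]
  exact congrArg (fun y => ρ y ξ) (Subtype.ext (commute_piOp hμ x b).eq)

include hμ in
lemma Inter.comp_mem {ρ : Rep μ H} {R : GNS μ →L[ℂ] H} (hR : R ∈ Inter ρ) {T : GNS μ →L[ℂ] GNS μ}
    (hT : ∀ b, Commute T (piOp μ b)) : R ∘L T ∈ Inter ρ := fun x ζ => by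
  simp only [ContinuousLinearMap.comp_apply]
  rw [← hR]
  exact congrArg R (DFunLike.congr_fun (commute_baseVN hμ hT x).eq ζ)

include hμ in
lemma Good.bdd_of_inter {ρ : Rep μ H} (h : Good ρ) {R : GNS μ →L[ℂ] H} (hR : R ∈ Inter ρ) (b : B) :
    (R (Lam μ b), R ∘L piOp μ b) ∈ Bdd ρ := by
  refine h.mem_Bdd hμ (Inter.comp_mem hμ hR fun c => ?_) fun c => ?_
  · exact piOp_comm hμ b c
  · rw [← hR]
    change R (piOp μ b (Lam μ c)) = R (piOp μ c (Lam μ b))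
    rw [piOp_Lam hμ, piOp_Lam hμ, mul_comm]

include hμ in
-- An intertwiner `L` need not be of the form `R_ξ`, but `L π_μ(b)` is, and the ranges of the
-- `π_μ(b)` are total in `K`.
lemma Good.total_op {ρ : Rep μ H} (h : Good ρ) :
    Total fun p : Bdd ρ × GNS μ => Bdd.op ρ p.1 p.2 :=
  h.of_orthogonal fun x hx p => by
    obtain ⟨⟨L, hL⟩, ζ⟩ := p
    change ⟪L ζ, x⟫_ℂ = 0
    rw [← ContinuousLinearMap.adjoint_inner_right]
    suffices ContinuousLinearMap.adjoint L x = 0 by rw [this, inner_zero_right]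
    refine total_piOp hμ _ fun q => ?_
    rw [ContinuousLinearMap.adjoint_inner_right]
    exact hx (⟨_, h.bdd_of_inter hμ hL q.1⟩, q.2)

include hμ in
-- `R_ξ` is determined by `ξ` on the dense subspace `Λ_μ(B)`; hence elements of `Bdd ρ` may be
-- treated as vectors.
lemma Bdd.op_eq_of_fst {ρ : Rep μ H} {ξ η : Bdd ρ} (e : ξ.1.1 = η.1.1) :
    Bdd.op ρ ξ = Bdd.op ρ η :=
  (total_Lam μ).clm_ext fun b => by rw [Bdd.op_Lam hμ, Bdd.op_Lam hμ, e]

include hμ in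
lemma Bdd.ext_fst {ρ : Rep μ H} {ξ η : Bdd ρ} (e : ξ.1.1 = η.1.1) : ξ = η :=
  Subtype.ext (Prod.ext e (Bdd.op_eq_of_fst hμ e))

include hμ in
/-- The map `(L, L') ↦ L* L'` takes intertwiners to elements of `N`. -/
lemma Inter.gram_commute {ρ : Rep μ H} {L L' : GNS μ →L[ℂ] H} (hL : L ∈ Inter ρ)
    (hL' : L' ∈ Inter ρ) (b : B) :
    Commute (ContinuousLinearMap.adjoint L ∘L L') (piOp μ b) := by
  refine ContinuousLinearMap.ext fun η => ?_
  simp only [mul_apply_eq_comp, ContinuousLinearMap.comp_apply]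
  have := hL' (basePi μ b) η
  change L' (piOp μ b η) = _ at this
  rw [this, Inter.adjoint hL]
  rfl

/-- `R_ξ* R_η ∈ N`. -/
def gram (hμ : IsBaseFunctional μ) {ρ : Rep μ H} (h : Good ρ) (ξ η : Bdd ρ) : baseVN μ :=
  ⟨ContinuousLinearMap.adjoint (Bdd.op ρ ξ) ∘L Bdd.op ρ η,
    mem_baseVN hμ (Inter.gram_commute hμ (h.op_mem hμ ξ) (h.op_mem hμ η))⟩

lemma gram_apply {ρ : Rep μ H} (h : Good ρ) (ξ η : Bdd ρ) (ζ : GNS μ) :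
    (gram hμ h ξ η : GNS μ →L[ℂ] GNS μ) ζ =
      ContinuousLinearMap.adjoint (Bdd.op ρ ξ) (Bdd.op ρ η ζ) := rfl

/-- Moving `T` to the other side gives `T* Lᵢ* Lⱼ S`, and `T*` also commutes with the Gram entries
because their adjoints are again Gram entries. -/
lemma linearCombination_gram_shift {ι : Type*} {L : ι → GNS μ →L[ℂ] H} {T : GNS μ →L[ℂ] GNS μ}
    (hT : ∀ i j, Commute (ContinuousLinearMap.adjoint (L i) ∘L L j) T)
    (S : GNS μ →L[ℂ] GNS μ) (c d : ι × GNS μ →₀ ℂ) :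
    ⟪Finsupp.linearCombination ℂ (fun p : ι × GNS μ => L p.1 (T p.2)) c,
      Finsupp.linearCombination ℂ (fun p : ι × GNS μ => L p.1 (S p.2)) d⟫_ℂ =
    ⟪Finsupp.linearCombination ℂ (fun p : ι × GNS μ => L p.1 p.2) c,
      Finsupp.linearCombination ℂ (fun p : ι × GNS μ => L p.1 ((star T * S) p.2)) d⟫_ℂ := by
  have hT' : ∀ i j, Commute (ContinuousLinearMap.adjoint (L i) ∘L L j) (star T) := fun i j => by
    have := (hT j i).star_star
    rwa [ContinuousLinearMap.star_eq_adjoint (_ ∘L _), ContinuousLinearMap.adjoint_comp,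
      ContinuousLinearMap.adjoint_adjoint] at this
  induction c using Finsupp.induction_linear with
  | zero => simp
  | add c c' h₁ h₂ => simp only [map_add, inner_add_left, h₁, h₂]
  | single i z =>
    induction d using Finsupp.induction_linear with
    | zero => simp
    | add c c' h₁ h₂ => simp only [map_add, inner_add_right, h₁, h₂]
    | single j w =>
      simp only [Finsupp.linearCombination_single, inner_smul_left, inner_smul_right]
      congr 2
      rw [← ContinuousLinearMap.adjoint_inner_right, ← ContinuousLinearMap.adjoint_inner_right,
        ← ContinuousLinearMap.adjoint_inner_right, ← ContinuousLinearMap.star_eq_adjoint T]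
      exact congrArg (fun v => ⟪i.2, v⟫_ℂ)
        (DFunLike.congr_fun (hT' i.1 j.1).eq (S j.2)).symm

include hμ in
/-- Operators `K → H` with total ranges and Gram matrix in `N` induce a good representation. -/
lemma exists_rep {ι : Type*} {L : ι → GNS μ →L[ℂ] H}
    (htot : Total fun p : ι × GNS μ => L p.1 p.2)
    (hL : ∀ i j b, Commute (ContinuousLinearMap.adjoint (L i) ∘L L j) (piOp μ b)) :
    ∃ ρ : Rep μ H, Good ρ ∧ (∀ x, ‖ρ x‖ ≤ ‖x‖) ∧ ∀ i, L i ∈ Inter ρ := by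
  have hN : ∀ i j (x : baseVN μ), Commute (ContinuousLinearMap.adjoint (L i) ∘L L j)
      (x : GNS μ →L[ℂ] GNS μ) := fun i j x => commute_baseVN hμ (hL i j) x
  have ex : ∀ x : baseVN μ, ∃ T : H →L[ℂ] H, ‖T‖ ≤ ‖x‖ ∧ ∀ i ζ,
      T (L i ζ) = L i ((x : GNS μ →L[ℂ] GNS μ) ζ) := by
    intro x
    let X : GNS μ →L[ℂ] GNS μ := x
    -- The square root `R` of this difference satisfies `R² + X* X = ‖X‖²` and still commutes with
    -- the Gram entries.
    have hpos : 0 ≤ ((‖X‖ ^ 2 : ℝ) : ℂ) • (1 : GNS μ →L[ℂ] GNS μ) - star X * X := by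
      rw [ContinuousLinearMap.nonneg_iff_isPositive, ContinuousLinearMap.isPositive_iff_complex]
      intro ζ
      have e : ⟪(((‖X‖ ^ 2 : ℝ) : ℂ) • (1 : GNS μ →L[ℂ] GNS μ) - star X * X) ζ, ζ⟫_ℂ =
          ((‖X‖ ^ 2 * ‖ζ‖ ^ 2 - ‖X ζ‖ ^ 2 : ℝ) : ℂ) := by
        simp only [sub_apply, smul_apply,
          one_apply_eq_self, mul_apply_eq_comp, inner_sub_left,
          inner_smul_left, ContinuousLinearMap.star_eq_adjoint,
          ContinuousLinearMap.adjoint_inner_left, inner_self_eq_norm_sq_to_K]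
        simp
      rw [e]
      refine ⟨rfl, ?_⟩
      have := X.le_opNorm ζ
      have h2 : ‖X ζ‖ ^ 2 ≤ (‖X‖ * ‖ζ‖) ^ 2 := by gcongr
      simp only [RCLike.re_to_complex, Complex.ofReal_re]
      nlinarith
    obtain ⟨R, hR1, hR2, hR3⟩ := exists_sqrt_commute _ hpos
    have hcomm : ∀ i j, Commute (ContinuousLinearMap.adjoint (L i) ∘L L j) R := fun i j => by
      refine (hR3 _ (Commute.symm ?_)).symm
      have h1 : Commute (ContinuousLinearMap.adjoint (L i) ∘L L j) (star X * X) :=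
        (hN i j (star x)).mul_right (hN i j x)
      exact ((Commute.one_right _).smul_right _).sub_right h1
    -- The shift lemma for `R` and for `X` gives `‖∑ L R ζ‖² + ‖∑ L X ζ‖² = ‖X‖² ‖∑ L ζ‖²`. Thus `L
    -- ζ ↦ L X ζ` is well defined with norm at most `‖X‖`.
    have key : ∀ c : ι × GNS μ →₀ ℂ,
        ‖Finsupp.linearCombination ℂ (fun p : ι × GNS μ => L p.1 (X p.2)) c‖ ≤
        ‖X‖ * ‖Finsupp.linearCombination ℂ (fun p : ι × GNS μ => L p.1 p.2) c‖ := by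
      intro c
      have h1 := linearCombination_gram_shift hcomm R c c
      have h2 := linearCombination_gram_shift (fun i j => hN i j x) X c c
      rw [hR1, hR2] at h1
      have h3 : Finsupp.linearCombination ℂ (fun p : ι × GNS μ =>
          L p.1 ((((‖X‖ ^ 2 : ℝ) : ℂ) • (1 : GNS μ →L[ℂ] GNS μ) - star X * X) p.2)) c =
          ((‖X‖ ^ 2 : ℝ) : ℂ) • Finsupp.linearCombination ℂ (fun p : ι × GNS μ => L p.1 p.2) c -
          Finsupp.linearCombination ℂ (fun p : ι × GNS μ => L p.1 ((star X * X) p.2)) c := by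
        induction c using Finsupp.induction_linear with
        | zero => simp
        | add c c' h₁ h₂ => 
          simp only [map_add, smul_add] at h₁ h₂ ⊢
          rw [h₁ (linearCombination_gram_shift hcomm R c c ▸ by rw [hR1, hR2])
            (linearCombination_gram_shift (fun i j => hN i j x) X c c),
            h₂ (linearCombination_gram_shift hcomm R c' c' ▸ by rw [hR1, hR2])
            (linearCombination_gram_shift (fun i j => hN i j x) X c' c')]
          abel
        | single i z =>
          simp only [Finsupp.linearCombination_single, sub_apply,
            smul_apply, one_apply_eq_self, map_sub, map_smul,
            smul_sub]
          rw [smul_comm]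
      rw [h3, inner_sub_right, ← h2, inner_smul_right] at h1
      have h4 := congrArg RCLike.re h1
      rw [inner_self_eq_norm_sq, map_sub, inner_self_eq_norm_sq, ← RCLike.ofReal_eq_complex_ofReal,
        RCLike.re_ofReal_mul, inner_self_eq_norm_sq] at h4
      refine abs_le_of_sq_le_sq' ?_ (by positivity) |>.2
      nlinarith [sq_nonneg ‖Finsupp.linearCombination ℂ (fun p : ι × GNS μ => L p.1 (R p.2)) c‖]
    refine ⟨(Finsupp.linearCombination ℂ (fun p : ι × GNS μ => L p.1 (X p.2))).extendOfNorm
      (Finsupp.linearCombination ℂ (fun p : ι × GNS μ => L p.1 p.2)), LinearMap.opNorm_extendOfNorm_le htot.denseRange (norm_nonneg X) key,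
      fun i ζ => ?_⟩
    have := LinearMap.extendOfNorm_eq htot.denseRange ⟨_, key⟩ (Finsupp.single (i, ζ) 1)
    simpa using this
  choose T hTn hT using ex
  refine ⟨{ toFun := T, map_one' := ?_, map_mul' := fun x y => ?_, map_zero' := ?_,
            map_add' := fun x y => ?_, commutes' := fun c => ?_, map_star' := fun x => ?_ },
    ?_, hTn, fun i x ζ => (hT x i ζ).symm⟩
  · exact htot.clm_ext fun p => by simp [hT]
  · exact htot.clm_ext fun p => by simp [hT]
  · exact htot.clm_ext fun p => by simp [hT]
  · exact htot.clm_ext fun p => by simp [hT]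
  · exact htot.clm_ext fun p => by simp [hT, Algebra.algebraMap_eq_smul_one]
  · refine htot.clm_ext fun p => htot.ext fun q => ?_
    rw [hT, ContinuousLinearMap.star_eq_adjoint, ContinuousLinearMap.adjoint_inner_right, hT,
      ← ContinuousLinearMap.adjoint_inner_right, ← ContinuousLinearMap.adjoint_inner_right]
    have h1 := DFunLike.congr_fun (hN q.1 p.1 (star x)).eq p.2
    simp only [mul_apply_eq_comp, ContinuousLinearMap.comp_apply] at h1
    rw [h1, ← ContinuousLinearMap.adjoint_inner_left]
    have : ContinuousLinearMap.adjoint (((star x : baseVN μ)) : GNS μ →L[ℂ] GNS μ) = x :=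
      star_star (x : GNS μ →L[ℂ] GNS μ)
    rw [this, ContinuousLinearMap.adjoint_inner_right]
  · exact good_of_total (fun i x ζ => (hT x i ζ).symm) htot

end Good

end Base

/-! ## The relative tensor product of good representations -/

section Positivity

variable {ι K X : Type*} [Fintype ι]
  [NormedAddCommGroup K] [InnerProductSpace ℂ K] [CompleteSpace K]
  [NormedAddCommGroup X] [InnerProductSpace ℂ X] [CompleteSpace X]

open Classical in
lemma proj_adjoint_proj (i j : ι) (ζ : K) :
    PiLp.proj (𝕜 := ℂ) 2 (fun _ : ι => K) i
      (ContinuousLinearMap.adjoint (PiLp.proj (𝕜 := ℂ) 2 (fun _ : ι => K) j) ζ) =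
      if i = j then ζ else 0 := by
  have : ContinuousLinearMap.adjoint (PiLp.proj (𝕜 := ℂ) 2 (fun _ : ι => K) j) ζ =
      WithLp.toLp 2 (Pi.single j ζ) := by
    refine ext_inner_left ℂ fun v => ?_
    rw [ContinuousLinearMap.adjoint_inner_right, PiLp.inner_apply, Finset.sum_eq_single j]
    · simp
    · intro m _ hm
      simp [Pi.single_eq_of_ne hm]
    · simp
  rw [this]
  simp [Pi.single_apply]

/-- Operators `L i` with Gram matrix commuting with a set of operators have a Gram matrix of the
form `L i* L j = ∑ₘ X m i* X m j` with entries commuting with the same operators. -/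
lemma exists_gram_factor (L : ι → K →L[ℂ] X) :
    ∃ Y : ι → ι → K →L[ℂ] K,
      (∀ i j ζ, ContinuousLinearMap.adjoint (L i) (L j ζ) =
        ∑ m, ContinuousLinearMap.adjoint (Y m i) (Y m j ζ)) ∧
      ∀ T : K →L[ℂ] K, (∀ i j, Commute (ContinuousLinearMap.adjoint (L i) ∘L L j) T) →
        ∀ m i, Commute (Y m i) T := by
  classical
  let pr : ι → PiLp 2 (fun _ : ι => K) →L[ℂ] K := fun i => PiLp.proj (𝕜 := ℂ) 2 (fun _ : ι => K) i
  let inc : ι → K →L[ℂ] PiLp 2 (fun _ : ι => K) := fun i => ContinuousLinearMap.adjoint (pr i)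
  have pr_inc : ∀ i j ζ, pr i (inc j ζ) = if i = j then ζ else 0 := proj_adjoint_proj
  have sum_inc : ∀ v, ∑ i, inc i (pr i v) = v := fun v => ext_inner_left ℂ fun w => by
    rw [inner_sum, PiLp.inner_apply]
    exact Finset.sum_congr rfl fun i _ => ContinuousLinearMap.adjoint_inner_right _ _ _
  obtain ⟨LL, LL_apply⟩ : ∃ LL : PiLp 2 (fun _ : ι => K) →L[ℂ] X,
      ∀ v, LL v = ∑ i, L i (pr i v) := ⟨∑ i, L i ∘L pr i, fun v => by simp⟩
  have LL_inc : ∀ j ζ, LL (inc j ζ) = L j ζ := fun j ζ => by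
    rw [LL_apply, Finset.sum_eq_single j (fun i _ hi => by rw [pr_inc, if_neg hi, map_zero])
      (by simp), pr_inc, if_pos rfl]
  -- This is the Gram matrix, viewed as a positive operator on the `ι`-fold direct sum of `K`; the
  -- entries of its square root are the `Y m i`.
  have hpos : 0 ≤ ContinuousLinearMap.adjoint LL ∘L LL := by
    rw [ContinuousLinearMap.nonneg_iff_isPositive]
    exact ContinuousLinearMap.isPositive_adjoint_comp_self LL
  obtain ⟨R, hR1, hR2, hR3⟩ := exists_sqrt_commute _ hpos
  refine ⟨fun m i => pr m ∘L R ∘L inc i, fun i j ζ => ?_, fun T hT m i => ?_⟩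
  · refine ext_inner_left ℂ fun ζ' => ?_
    rw [ContinuousLinearMap.adjoint_inner_right, inner_sum, ← LL_inc, ← LL_inc,
      ← ContinuousLinearMap.adjoint_inner_right, ← ContinuousLinearMap.comp_apply, ← hR2,
      mul_apply_eq_comp, ← ContinuousLinearMap.adjoint_inner_left,
      ← ContinuousLinearMap.star_eq_adjoint, hR1, PiLp.inner_apply]
    refine Finset.sum_congr rfl fun m _ => ?_
    rw [ContinuousLinearMap.adjoint_inner_right]
    rfl
  -- `dT` is the diagonal matrix with entries `T`. Entrywise commutation with `T` means that the
  -- matrix commutes with `dT`, and the square root inherits this.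
  · obtain ⟨dT, dT_apply⟩ : ∃ dT : PiLp 2 (fun _ : ι => K) →L[ℂ] PiLp 2 (fun _ : ι => K),
        ∀ v, dT v = ∑ i, inc i (T (pr i v)) := ⟨∑ i, inc i ∘L T ∘L pr i, fun v => by simp⟩
    have dT_inc : ∀ j ζ, dT (inc j ζ) = inc j (T ζ) := fun j ζ => by
      rw [dT_apply, Finset.sum_eq_single j (fun i _ hi => by rw [pr_inc, if_neg hi]; simp)
        (by simp), pr_inc, if_pos rfl]
    have pr_dT : ∀ j v, pr j (dT v) = T (pr j v) := fun j v => by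
      rw [dT_apply, map_sum, Finset.sum_eq_single j
        (fun i _ hi => by rw [pr_inc, if_neg (Ne.symm hi)]) (by simp), pr_inc, if_pos rfl]
    have key : Commute (ContinuousLinearMap.adjoint LL ∘L LL) dT := by
      have hinc : ∀ i j ζ, pr i (ContinuousLinearMap.adjoint LL (L j ζ)) =
          ContinuousLinearMap.adjoint (L i) (L j ζ) := fun i j ζ => ext_inner_left ℂ fun ζ' => by
        rw [ContinuousLinearMap.adjoint_inner_right, ← ContinuousLinearMap.adjoint_inner_left (pr i),
          ContinuousLinearMap.adjoint_inner_right]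
        exact congrArg (fun w => ⟪w, L j ζ⟫_ℂ) (LL_inc i ζ')
      refine ContinuousLinearMap.ext fun v => ?_
      suffices h : ∀ j, ((ContinuousLinearMap.adjoint LL ∘L LL) * dT) (inc j (pr j v)) =
          (dT * (ContinuousLinearMap.adjoint LL ∘L LL)) (inc j (pr j v)) by
        have e : ∀ T : PiLp 2 (fun _ : ι => K) →L[ℂ] PiLp 2 (fun _ : ι => K),
            T v = ∑ j, T (inc j (pr j v)) := fun T => by rw [← map_sum, sum_inc]
        rw [e, e (dT * _)]
        exact Finset.sum_congr rfl fun j _ => h j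
      intro j
      rw [mul_apply_eq_comp, mul_apply_eq_comp, dT_inc, ContinuousLinearMap.comp_apply,
        ContinuousLinearMap.comp_apply, LL_inc, LL_inc,
        ← sum_inc (ContinuousLinearMap.adjoint LL (L j (T (pr j v)))), dT_apply]
      refine Finset.sum_congr rfl fun i _ => ?_
      rw [hinc, hinc]
      exact congrArg (inc i) (DFunLike.congr_fun (hT i j).eq (pr j v))
    have hR := (hR3 _ key).eq
    refine ContinuousLinearMap.ext fun ζ => ?_
    simp only [mul_apply_eq_comp, ContinuousLinearMap.comp_apply]
    rw [← dT_inc, ← pr_dT]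
    exact congrArg (pr m) (DFunLike.congr_fun hR (inc i ζ))

end Positivity

/-! ### Inner product, creation operators and elementary tensors -/

section RelativeTensor

variable {B : Type*} [NonUnitalCommRing B] [Module ℂ B] [IsScalarTower ℂ B B]
  [SMulCommClass ℂ B B] [StarRing B] [StarModule ℂ B]
  {μ : B →ₗ[ℂ] ℂ} (hμ : IsBaseFunctional μ)
  {H₁ H₂ H₃ H₁' H₂' : Type*}
  [NormedAddCommGroup H₁] [InnerProductSpace ℂ H₁] [CompleteSpace H₁]
  [NormedAddCommGroup H₂] [InnerProductSpace ℂ H₂] [CompleteSpace H₂]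
  [NormedAddCommGroup H₃] [InnerProductSpace ℂ H₃] [CompleteSpace H₃]
  [NormedAddCommGroup H₁'] [InnerProductSpace ℂ H₁'] [CompleteSpace H₁']
  [NormedAddCommGroup H₂'] [InnerProductSpace ℂ H₂'] [CompleteSpace H₂']
  {ρ₁ : Rep μ H₁} {ρ₂ : Rep μ H₂} {ρ₃ : Rep μ H₃} {ρ₁' : Rep μ H₁'} {ρ₂' : Rep μ H₂'}

lemma span_tmul_tmul {M N P : Type*} [AddCommGroup M] [Module ℂ M] [AddCommGroup N] [Module ℂ N]
    [AddCommGroup P] [Module ℂ P] :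
    Submodule.span ℂ (Set.range fun p : M × N × P => p.1 ⊗ₜ[ℂ] (p.2.1 ⊗ₜ[ℂ] p.2.2)) = ⊤ := by
  refine eq_top_iff.2 fun t _ => ?_
  induction t using TensorProduct.induction_on with
  | zero => simp
  | add x y hx hy => exact add_mem (hx trivial) (hy trivial)
  | tmul m u =>
    induction u using TensorProduct.induction_on with
    | zero => simp
    | add x y hx hy => rw [TensorProduct.tmul_add]; exact add_mem (hx trivial) (hy trivial)
    | tmul n p => exact Submodule.subset_span ⟨(m, n, p), rfl⟩

lemma exists_sum_tmul_tmul {M N P : Type*} [AddCommGroup M] [Module ℂ M] [AddCommGroup N]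
    [Module ℂ N] [AddCommGroup P] [Module ℂ P] (t : M ⊗[ℂ] (N ⊗[ℂ] P)) :
    ∃ (n : ℕ) (x : Fin n → M) (y : Fin n → N) (z : Fin n → P),
      t = ∑ i, x i ⊗ₜ[ℂ] (y i ⊗ₜ[ℂ] z i) := by
  have h : t ∈ Submodule.span ℂ
    (Set.range fun p : M × N × P => p.1 ⊗ₜ[ℂ] (p.2.1 ⊗ₜ[ℂ] p.2.2)) := by
    rw [span_tmul_tmul]; trivial
  obtain ⟨n, c, g, rfl⟩ := Submodule.mem_span_set'.1 h
  choose p hp using fun i => (g i).2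
  refine ⟨n, fun i => c i • (p i).1, fun i => (p i).2.1, fun i => (p i).2.2, ?_⟩
  refine Finset.sum_congr rfl fun i _ => ?_
  rw [← hp i, TensorProduct.smul_tmul']

include hμ in
-- Factoring `R_{ξᵢ}* R_{ξⱼ} = ∑ₘ Y_{mi}* Y_{mj}` with entries commuting with `N` turns the form at
-- `∑ ξᵢ ⊗ ζᵢ ⊗ ηᵢ` into `∑ₘ ‖∑ᵢ R_{ηᵢ} Y_{mi} ζᵢ‖²`. Without positivity the completion would be
-- formed with the zero form, by the definition of `safeForm`.
lemma relForm_pos (h₁ : Good ρ₁) (h₂ : Good ρ₂) : IsPositiveForm (E := Bdd ρ₁ ⊗[ℂ] (GNS μ ⊗[ℂ] Bdd ρ₂)) (relForm ρ₁ ρ₂) := by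
  intro t
  obtain ⟨n, ξ, ζ, η, rfl⟩ := exists_sum_tmul_tmul t
  obtain ⟨Y, hY1, hY2⟩ := exists_gram_factor fun i => Bdd.op ρ₁ (ξ i)
  have hY3 : ∀ (m i : Fin n) (x : baseVN μ), Commute (Y m i) (x : GNS μ →L[ℂ] GNS μ) :=
    fun m i x => hY2 _ (fun i j => commute_baseVN hμ
      (Inter.gram_commute hμ (h₁.op_mem hμ _) (h₁.op_mem hμ _)) x) m i
  have e : relForm ρ₁ ρ₂ (∑ i, ξ i ⊗ₜ[ℂ] (ζ i ⊗ₜ[ℂ] η i)) (∑ i, ξ i ⊗ₜ[ℂ] (ζ i ⊗ₜ[ℂ] η i)) =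
      ∑ m, ⟪∑ i, Bdd.op ρ₂ (η i) (Y m i (ζ i)), ∑ i, Bdd.op ρ₂ (η i) (Y m i (ζ i))⟫_ℂ := by
    simp only [map_sum, LinearMap.sum_apply, relForm_tmul, sum_inner, inner_sum, hY1]
    conv_rhs => rw [Finset.sum_comm]
    refine Finset.sum_congr rfl fun i _ => ?_
    conv_rhs => rw [Finset.sum_comm]
    refine Finset.sum_congr rfl fun j _ => Finset.sum_congr rfl fun m _ => ?_
    rw [ContinuousLinearMap.adjoint_inner_right]
    have := DFunLike.congr_fun (hY3 m i (gram hμ h₂ (η j) (η i))).eq (ζ i)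
    simp only [mul_apply_eq_comp, gram_apply] at this
    rw [this, ContinuousLinearMap.adjoint_inner_right]
  rw [e]
  refine Finset.sum_nonneg fun m _ => ?_
  rw [inner_self_eq_norm_sq_to_K, ← RCLike.ofReal_pow]
  exact RCLike.ofReal_nonneg.2 (sq_nonneg _)

include hμ in
lemma inner_elem (h₁ : Good ρ₁) (h₂ : Good ρ₂) (ξ ξ' : Bdd ρ₁) (ζ ζ' : GNS μ) (η η' : Bdd ρ₂) :
    ⟪elem ξ ζ η, elem ξ' ζ' η'⟫_ℂ =
      ⟪ζ, ContinuousLinearMap.adjoint (Bdd.op ρ₁ ξ) (Bdd.op ρ₁ ξ'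
        (ContinuousLinearMap.adjoint (Bdd.op ρ₂ η) (Bdd.op ρ₂ η' ζ')))⟫_ℂ :=
  (Hilb.inner_of (E := Bdd ρ₁ ⊗[ℂ] (GNS μ ⊗[ℂ] Bdd ρ₂)) _ (relForm_pos hμ h₁ h₂) _ _).trans (relForm_tmul _ _ _ _ _ _ _ _)

lemma total_hilb_of_span {E ι : Type*} [AddCommGroup E] [Module ℂ E] (f : E →ₗ⋆[ℂ] E →ₗ[ℂ] ℂ)
    {v : ι → E} (hv : Submodule.span ℂ (Set.range v) = ⊤) : Total fun i => Hilb.of f (v i) := by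
  refine (total_of_denseRange (Hilb.dense_of f)).of_orthogonal fun x hx t => ?_
  have ht : t ∈ Submodule.span ℂ (Set.range v) := by rw [hv]; trivial
  induction ht using Submodule.span_induction with
  | mem t ht => obtain ⟨p, rfl⟩ := ht; exact hx p
  | zero => rw [map_zero, inner_zero_left]
  | add t t' _ _ h h' => rw [map_add, inner_add_left, h, h', add_zero]
  | smul c t _ h => rw [map_smul, inner_smul_left, h, mul_zero]

lemma total_elem : Total fun p : Bdd ρ₁ × GNS μ × Bdd ρ₂ => elem p.1 p.2.1 p.2.2 := by
  have h := total_hilb_of_span (E := Bdd ρ₁ ⊗[ℂ] (GNS μ ⊗[ℂ] Bdd ρ₂)) (relForm ρ₁ ρ₂)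
    (span_tmul_tmul (M := Bdd ρ₁) (N := GNS μ) (P := Bdd ρ₂))
  exact fun x hx => h x hx

include hμ in
-- Both Gram operators lie in the commutative algebra `N`. This symmetry is what makes flips and
-- right creation operators available.
lemma gram_swap (h₁ : Good ρ₁) (h₂ : Good ρ₂) (ξ ξ' : Bdd ρ₁) (η η' : Bdd ρ₂) (ζ : GNS μ) :
    ContinuousLinearMap.adjoint (Bdd.op ρ₁ ξ) (Bdd.op ρ₁ ξ'
        (ContinuousLinearMap.adjoint (Bdd.op ρ₂ η) (Bdd.op ρ₂ η' ζ))) =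
      ContinuousLinearMap.adjoint (Bdd.op ρ₂ η) (Bdd.op ρ₂ η'
        (ContinuousLinearMap.adjoint (Bdd.op ρ₁ ξ) (Bdd.op ρ₁ ξ' ζ))) :=
  DFunLike.congr_fun (baseVN_commute hμ (gram hμ h₁ ξ ξ') (gram hμ h₂ η η')).eq ζ

lemma Inter.apply_gram {ρ : Rep μ H₁} {L : GNS μ →L[ℂ] H₁} (hL : L ∈ Inter ρ)
    (h₂ : Good ρ₂) (η η' : Bdd ρ₂) (ζ : GNS μ) :
    L (ContinuousLinearMap.adjoint (Bdd.op ρ₂ η) (Bdd.op ρ₂ η' ζ)) =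
      ρ (gram hμ h₂ η η') (L ζ) := by
  rw [← hL, gram_apply]

include hμ in
-- On the total family `R_η ζ`, the Gram matrix of `ξ ⊗ ζ ⊗ η` arises by inserting the bounded
-- operator `ρ₂(R_ξ* R_ξ)`.
lemma exists_cl (h₁ : Good ρ₁) (h₂ : Good ρ₂) (ξ : Bdd ρ₁) :
    ∃ T : H₂ →L[ℂ] RT ρ₁ ρ₂, ∀ (ζ : GNS μ) (η : Bdd ρ₂), T (Bdd.op ρ₂ η ζ) = elem ξ ζ η := by
  obtain ⟨T, hT⟩ := exists_clm_of_gram (h₂.total_op hμ)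
    (f := fun p : Bdd ρ₂ × GNS μ => elem ξ p.2 p.1) (ρ₂ (gram hμ h₁ ξ ξ)) fun p q => by
      rw [inner_elem hμ h₁ h₂, ← ContinuousLinearMap.adjoint_inner_right,
        ← Inter.apply_gram hμ (h₂.op_mem hμ q.1), gram_swap hμ h₁ h₂]
  exact ⟨T, fun ζ η => hT (η, ζ)⟩

include hμ in
lemma exists_cr (h₁ : Good ρ₁) (h₂ : Good ρ₂) (η : Bdd ρ₂) :
    ∃ T : H₁ →L[ℂ] RT ρ₁ ρ₂, ∀ (ξ : Bdd ρ₁) (ζ : GNS μ), T (Bdd.op ρ₁ ξ ζ) = elem ξ ζ η := by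
  obtain ⟨T, hT⟩ := exists_clm_of_gram (h₁.total_op hμ)
    (f := fun p : Bdd ρ₁ × GNS μ => elem p.1 p.2 η) (ρ₁ (gram hμ h₂ η η)) fun p q => by
      rw [inner_elem hμ h₁ h₂, ← ContinuousLinearMap.adjoint_inner_right,
        ← Inter.apply_gram hμ (h₁.op_mem hμ q.1)]
  exact ⟨T, fun ξ ζ => hT (ξ, ζ)⟩

/-- The creation operator `η ↦ ξ ⊗ η`. -/
def cl (hμ : IsBaseFunctional μ) (h₁ : Good ρ₁) (h₂ : Good ρ₂) (ξ : Bdd ρ₁) :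
    H₂ →L[ℂ] RT ρ₁ ρ₂ := (exists_cl hμ h₁ h₂ ξ).choose

/-- The creation operator `ξ ↦ ξ ⊗ η`. -/
def cr (hμ : IsBaseFunctional μ) (h₁ : Good ρ₁) (h₂ : Good ρ₂) (η : Bdd ρ₂) :
    H₁ →L[ℂ] RT ρ₁ ρ₂ := (exists_cr hμ h₁ h₂ η).choose

lemma cl_op (h₁ : Good ρ₁) (h₂ : Good ρ₂) (ξ : Bdd ρ₁) (ζ : GNS μ) (η : Bdd ρ₂) :
    cl hμ h₁ h₂ ξ (Bdd.op ρ₂ η ζ) = elem ξ ζ η := (exists_cl hμ h₁ h₂ ξ).choose_spec ζ η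

lemma cr_op (h₁ : Good ρ₁) (h₂ : Good ρ₂) (ξ : Bdd ρ₁) (ζ : GNS μ) (η : Bdd ρ₂) :
    cr hμ h₁ h₂ η (Bdd.op ρ₁ ξ ζ) = elem ξ ζ η := (exists_cr hμ h₁ h₂ η).choose_spec ξ ζ

lemma inner_elem_cl (h₁ : Good ρ₁) (h₂ : Good ρ₂) (ξ' : Bdd ρ₁) (ζ' : GNS μ) (η' : Bdd ρ₂)
    (ξ : Bdd ρ₁) (η : H₂) : ⟪elem ξ' ζ' η', cl hμ h₁ h₂ ξ η⟫_ℂ =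
    ⟪ζ', ContinuousLinearMap.adjoint (Bdd.op ρ₁ ξ') (Bdd.op ρ₁ ξ
      (ContinuousLinearMap.adjoint (Bdd.op ρ₂ η') η))⟫_ℂ := by
  rw [← ContinuousLinearMap.adjoint_inner_left]
  have : ContinuousLinearMap.adjoint (cl hμ h₁ h₂ ξ) (elem ξ' ζ' η') =
      Bdd.op ρ₂ η' (ContinuousLinearMap.adjoint (Bdd.op ρ₁ ξ) (Bdd.op ρ₁ ξ' ζ')) := by
    refine (h₂.total_op hμ).ext fun p => ?_
    rw [ContinuousLinearMap.adjoint_inner_right, cl_op, inner_elem hμ h₁ h₂, gram_swap hμ h₁ h₂,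
      ContinuousLinearMap.adjoint_inner_right]
  rw [this, ContinuousLinearMap.adjoint_inner_right,
    ← ContinuousLinearMap.adjoint_inner_right (Bdd.op ρ₂ η'),
    ContinuousLinearMap.adjoint_inner_left]

lemma isTens_cl (h₁ : Good ρ₁) (h₂ : Good ρ₂) (ξ : Bdd ρ₁) (η : H₂) :
    IsTens ξ η (cl hμ h₁ h₂ ξ η) := fun ξ' ζ' η' => inner_elem_cl hμ h₁ h₂ ξ' ζ' η' ξ η

/-- `tens` is a choice among vectors with prescribed scalar products. Since `ξ` determines `R_ξ` and
the classes `elem` are total, the choice is forced; the default value zero never occurs for bounded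
`ξ`. -/
lemma tens_eq_cl (h₁ : Good ρ₁) (h₂ : Good ρ₂) (ξ : Bdd ρ₁) (η : H₂) :
    tens ρ₁ ρ₂ ξ.1.1 η = cl hμ h₁ h₂ ξ η := by
  have h : ∃ v : RT ρ₁ ρ₂, ∃ ξ₀ : Bdd ρ₁, ξ₀.1.1 = ξ.1.1 ∧ IsTens ξ₀ η v :=
    ⟨_, ξ, rfl, isTens_cl hμ h₁ h₂ ξ η⟩
  rw [tens, dif_pos h]
  obtain ⟨ξ₀, e, hv⟩ := h.choose_spec
  obtain rfl := Bdd.ext_fst hμ e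
  exact total_elem.ext fun p => by
    rw [hv p.1 p.2.1 p.2.2, isTens_cl hμ h₁ h₂ _ η p.1 p.2.1 p.2.2]

/-- Paired with an elementary class, the two sides apply one Gram operator each, to `R_{η'}* η` and
to `R_{ξ'}* ξ`. Applying `π_μ(b)` replaces `η` by `R_η Λ(b)` and `ξ` by `R_ξ Λ(b)`, and the Gram
operators commute. -/
lemma cl_eq_cr (h₁ : Good ρ₁) (h₂ : Good ρ₂) (ξ : Bdd ρ₁) (η : Bdd ρ₂) :
    cl hμ h₁ h₂ ξ η.1.1 = cr hμ h₁ h₂ η ξ.1.1 := by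
  refine total_elem.ext fun p => ?_
  obtain ⟨ξ', ζ', η'⟩ := p
  rw [inner_elem_cl, ← cr_op hμ h₁ h₂]
  have h3 : ContinuousLinearMap.adjoint (cr hμ h₁ h₂ η') (cr hμ h₁ h₂ η ξ.1.1) =
      ρ₁ (gram hμ h₂ η' η) ξ.1.1 := by
    suffices ContinuousLinearMap.adjoint (cr hμ h₁ h₂ η') ∘L cr hμ h₁ h₂ η =
      ρ₁ (gram hμ h₂ η' η) from DFunLike.congr_fun this ξ.1.1
    refine (h₁.total_op hμ).clm_ext fun p => (h₁.total_op hμ).ext fun q => ?_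
    rw [ContinuousLinearMap.comp_apply, ContinuousLinearMap.adjoint_inner_right, cr_op, cr_op,
      inner_elem hμ h₁ h₂, ← ContinuousLinearMap.adjoint_inner_right,
      ← Inter.apply_gram hμ (h₁.op_mem hμ p.1)]
  rw [← ContinuousLinearMap.adjoint_inner_right (cr hμ h₁ h₂ η'), h3,
    ← ContinuousLinearMap.adjoint_inner_right]
  congr 1
  rw [Inter.adjoint (h₁.op_mem hμ ξ')]
  refine eq_of_piOp hμ fun b => ?_
  have e1 : piOp μ b (ContinuousLinearMap.adjoint (Bdd.op ρ₂ η') η.1.1) =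
      ContinuousLinearMap.adjoint (Bdd.op ρ₂ η') (Bdd.op ρ₂ η (Lam μ b)) := by
    rw [Bdd.op_Lam hμ, Inter.adjoint (h₂.op_mem hμ η')]; rfl
  have e2 : piOp μ b (ContinuousLinearMap.adjoint (Bdd.op ρ₁ ξ') ξ.1.1) =
      ContinuousLinearMap.adjoint (Bdd.op ρ₁ ξ') (Bdd.op ρ₁ ξ (Lam μ b)) := by
    rw [Bdd.op_Lam hμ, Inter.adjoint (h₁.op_mem hμ ξ')]; rfl
  have c1 := DFunLike.congr_fun (commute_piOp hμ (gram hμ h₁ ξ' ξ) b).eq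
    (ContinuousLinearMap.adjoint (Bdd.op ρ₂ η') η.1.1)
  have c2 := DFunLike.congr_fun (commute_piOp hμ (gram hμ h₂ η' η) b).eq
    (ContinuousLinearMap.adjoint (Bdd.op ρ₁ ξ') ξ.1.1)
  simp only [mul_apply_eq_comp, gram_apply] at c1 c2
  rw [← c1, e1, gram_apply, ← c2, e2, gram_swap hμ h₁ h₂]

lemma total_cl (h₁ : Good ρ₁) (h₂ : Good ρ₂) :
    Total fun p : Bdd ρ₁ × H₂ => cl hμ h₁ h₂ p.1 p.2 :=
  total_elem.of_orthogonal fun x hx p => by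
    rw [← cl_op hμ h₁ h₂]; exact hx (p.1, _)

lemma total_cr (h₁ : Good ρ₁) (h₂ : Good ρ₂) :
    Total fun p : Bdd ρ₂ × H₁ => cr hμ h₁ h₂ p.1 p.2 :=
  total_elem.of_orthogonal fun x hx p => by
    rw [← cr_op hμ h₁ h₂]; exact hx (p.2.2, _)

lemma adjoint_cl_cl (h₁ : Good ρ₁) (h₂ : Good ρ₂) (ξ ξ' : Bdd ρ₁) (η : H₂) :
    ContinuousLinearMap.adjoint (cl hμ h₁ h₂ ξ) (cl hμ h₁ h₂ ξ' η) = ρ₂ (gram hμ h₁ ξ ξ') η := by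
  suffices ContinuousLinearMap.adjoint (cl hμ h₁ h₂ ξ) ∘L cl hμ h₁ h₂ ξ' =
    ρ₂ (gram hμ h₁ ξ ξ') from DFunLike.congr_fun this η
  refine (h₂.total_op hμ).clm_ext fun p => (h₂.total_op hμ).ext fun q => ?_
  rw [ContinuousLinearMap.comp_apply, ContinuousLinearMap.adjoint_inner_right, cl_op, cl_op,
    inner_elem hμ h₁ h₂, ← ContinuousLinearMap.adjoint_inner_right,
    ← Inter.apply_gram hμ (h₂.op_mem hμ p.1), gram_swap hμ h₁ h₂]

lemma adjoint_cr_cr (h₁ : Good ρ₁) (h₂ : Good ρ₂) (η η' : Bdd ρ₂) (ξ : H₁) :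
    ContinuousLinearMap.adjoint (cr hμ h₁ h₂ η) (cr hμ h₁ h₂ η' ξ) = ρ₁ (gram hμ h₂ η η') ξ := by
  suffices ContinuousLinearMap.adjoint (cr hμ h₁ h₂ η) ∘L cr hμ h₁ h₂ η' =
    ρ₁ (gram hμ h₂ η η') from DFunLike.congr_fun this ξ
  refine (h₁.total_op hμ).clm_ext fun p => (h₁.total_op hμ).ext fun q => ?_
  rw [ContinuousLinearMap.comp_apply, ContinuousLinearMap.adjoint_inner_right, cr_op, cr_op,
    inner_elem hμ h₁ h₂, ← ContinuousLinearMap.adjoint_inner_right,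
    ← Inter.apply_gram hμ (h₁.op_mem hμ p.1)]

/-! ### Elementary tensors -/

include hμ in
lemma tens_add_right (h₁ : Good ρ₁) (h₂ : Good ρ₂) {ξ : H₁} (hξ : IsBddVec ρ₁ ξ) (η η' : H₂) :
    tens ρ₁ ρ₂ ξ (η + η') = tens ρ₁ ρ₂ ξ η + tens ρ₁ ρ₂ ξ η' := by
  obtain ⟨ξ, rfl⟩ := hξ
  simp only [tens_eq_cl hμ h₁ h₂, map_add]

include hμ in
lemma tens_smul_right (h₁ : Good ρ₁) (h₂ : Good ρ₂) {ξ : H₁} (hξ : IsBddVec ρ₁ ξ) (c : ℂ)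
    (η : H₂) : tens ρ₁ ρ₂ ξ (c • η) = c • tens ρ₁ ρ₂ ξ η := by
  obtain ⟨ξ, rfl⟩ := hξ
  simp only [tens_eq_cl hμ h₁ h₂, map_smul]

include hμ in
lemma tens_sum_right (h₁ : Good ρ₁) (h₂ : Good ρ₂) {ξ : H₁} (hξ : IsBddVec ρ₁ ξ) {ι : Type*}
    (s : Finset ι) (η : ι → H₂) :
    tens ρ₁ ρ₂ ξ (∑ i ∈ s, η i) = ∑ i ∈ s, tens ρ₁ ρ₂ ξ (η i) := by
  obtain ⟨ξ, rfl⟩ := hξ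
  simp only [tens_eq_cl hμ h₁ h₂, map_sum]

include hμ in
lemma tens_add_left (h₁ : Good ρ₁) (h₂ : Good ρ₂) {ξ ξ' : H₁} (hξ : IsBddVec ρ₁ ξ)
    (hξ' : IsBddVec ρ₁ ξ') (η : H₂) :
    tens ρ₁ ρ₂ (ξ + ξ') η = tens ρ₁ ρ₂ ξ η + tens ρ₁ ρ₂ ξ' η := by
  obtain ⟨ξ, rfl⟩ := hξ
  obtain ⟨ξ', rfl⟩ := hξ'
  rw [show ξ.1.1 + ξ'.1.1 = (ξ + ξ').1.1 from rfl]
  simp only [tens_eq_cl hμ h₁ h₂]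
  refine total_elem.ext fun p => ?_
  rw [inner_add_right, inner_elem_cl, inner_elem_cl, inner_elem_cl, map_add (Bdd.op ρ₁), add_apply,
    map_add, inner_add_right]

include hμ in
lemma tens_smul_left (h₁ : Good ρ₁) (h₂ : Good ρ₂) (c : ℂ) {ξ : H₁} (hξ : IsBddVec ρ₁ ξ)
    (η : H₂) : tens ρ₁ ρ₂ (c • ξ) η = c • tens ρ₁ ρ₂ ξ η := by
  obtain ⟨ξ, rfl⟩ := hξ
  rw [show c • ξ.1.1 = (c • ξ).1.1 from rfl]
  simp only [tens_eq_cl hμ h₁ h₂]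
  refine total_elem.ext fun p => ?_
  rw [inner_smul_right, inner_elem_cl, inner_elem_cl, map_smul (Bdd.op ρ₁), smul_apply,
    map_smul, inner_smul_right]

lemma IsBddVec.add {ξ ξ' : H₁} (hξ : IsBddVec ρ₁ ξ) (hξ' : IsBddVec ρ₁ ξ') :
    IsBddVec ρ₁ (ξ + ξ') := by
  obtain ⟨ξ, rfl⟩ := hξ
  obtain ⟨ξ', rfl⟩ := hξ'
  exact ⟨ξ + ξ', rfl⟩

lemma IsBddVec.zero : IsBddVec ρ₁ 0 := ⟨0, rfl⟩

lemma IsBddVec.sum {ι : Type*} (s : Finset ι) {ξ : ι → H₁} (hξ : ∀ i, IsBddVec ρ₁ (ξ i)) :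
    IsBddVec ρ₁ (∑ i ∈ s, ξ i) := by
  classical
  induction s using Finset.induction_on with
  | empty => exact IsBddVec.zero
  | insert i s hi h => rw [Finset.sum_insert hi]; exact (hξ i).add h

include hμ in
lemma tens_sum_left (h₁ : Good ρ₁) (h₂ : Good ρ₂) {ι : Type*} (s : Finset ι) {ξ : ι → H₁}
    (hξ : ∀ i, IsBddVec ρ₁ (ξ i)) (η : H₂) :
    tens ρ₁ ρ₂ (∑ i ∈ s, ξ i) η = ∑ i ∈ s, tens ρ₁ ρ₂ (ξ i) η := by
  classical
  induction s using Finset.induction_on with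
  | empty =>
    simpa using tens_smul_left hμ h₁ h₂ 0 (IsBddVec.zero (ρ₁ := ρ₁)) η
  | insert i s hi h =>
    rw [Finset.sum_insert hi, Finset.sum_insert hi,
      tens_add_left hμ h₁ h₂ (hξ i) (IsBddVec.sum s hξ), h]

include hμ in
-- Scalar products of the tensors `Λ_ν(x) ⊗ Λ_ν(y)` are computed from this formula once `gram_eq`
-- has identified the Gram operator with an element of `π_μ(B)`.
lemma inner_tens' (h₁ : Good ρ₁) (h₂ : Good ρ₂) (ξ ξ' : Bdd ρ₁) (η η' : Bdd ρ₂) :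
    ⟪tens ρ₁ ρ₂ ξ.1.1 η.1.1, tens ρ₁ ρ₂ ξ'.1.1 η'.1.1⟫_ℂ =
      ⟪ξ.1.1, ρ₁ (gram hμ h₂ η η') ξ'.1.1⟫_ℂ := by
  rw [tens_eq_cl hμ h₁ h₂, tens_eq_cl hμ h₁ h₂, cl_eq_cr, cl_eq_cr,
    ← ContinuousLinearMap.adjoint_inner_right, adjoint_cr_cr]

include hμ in
/-- Elementary tensors of total families, the first one consisting of bounded vectors whose
creation operators have total range, are total. -/
lemma total_tens (h₁ : Good ρ₁) (h₂ : Good ρ₂) {ι κ : Type*} {ξ : ι → H₁} {η : κ → H₂}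
    (hξ : ∀ i, IsBddVec ρ₁ (ξ i)) (hη : ∀ i, IsBddVec ρ₂ (η i)) (tξ : Total ξ) (tη : Total η) :
    Total fun p : ι × κ => tens ρ₁ ρ₂ (ξ p.1) (η p.2) := by
  refine (total_cl hμ h₁ h₂).of_orthogonal ?_
  rintro x hx ⟨ξ', η'⟩
  dsimp only
  rw [← ContinuousLinearMap.adjoint_inner_right]
  suffices ContinuousLinearMap.adjoint (cl hμ h₁ h₂ ξ') x = 0 by rw [this, inner_zero_right]
  refine tη _ fun k => ?_
  obtain ⟨η₀, hη₀⟩ := hη k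
  rw [ContinuousLinearMap.adjoint_inner_right, ← hη₀, cl_eq_cr]
  suffices ContinuousLinearMap.adjoint (cr hμ h₁ h₂ η₀) x = 0 by
    rw [← ContinuousLinearMap.adjoint_inner_right, this, inner_zero_right]
  refine tξ _ fun i => ?_
  obtain ⟨ξ₀, hξ₀⟩ := hξ i
  have := hx (i, k)
  dsimp only at this
  rw [← hξ₀, ← hη₀, tens_eq_cl hμ h₁ h₂, cl_eq_cr] at this
  rw [ContinuousLinearMap.adjoint_inner_right, ← hξ₀, this]

end RelativeTensor

/-! ### Amplifications, flips, associativity and tensor products of operators -/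

section RelativeTensorMaps

variable {B : Type*} [NonUnitalCommRing B] [Module ℂ B] [IsScalarTower ℂ B B]
  [SMulCommClass ℂ B B] [StarRing B] [StarModule ℂ B]
  {μ : B →ₗ[ℂ] ℂ} (hμ : IsBaseFunctional μ)
  {H₁ H₂ H₃ H₁' H₂' : Type*}
  [NormedAddCommGroup H₁] [InnerProductSpace ℂ H₁] [CompleteSpace H₁]
  [NormedAddCommGroup H₂] [InnerProductSpace ℂ H₂] [CompleteSpace H₂]
  [NormedAddCommGroup H₃] [InnerProductSpace ℂ H₃] [CompleteSpace H₃]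
  [NormedAddCommGroup H₁'] [InnerProductSpace ℂ H₁'] [CompleteSpace H₁']
  [NormedAddCommGroup H₂'] [InnerProductSpace ℂ H₂'] [CompleteSpace H₂']
  {ρ₁ : Rep μ H₁} {ρ₂ : Rep μ H₂} {ρ₃ : Rep μ H₃} {ρ₁' : Rep μ H₁'} {ρ₂' : Rep μ H₂'}

/-- The image of a bounded vector under an intertwiner. -/
def Bdd.map (S : H₁ →L[ℂ] H₁') (hS : ∀ x ξ, S (ρ₁ x ξ) = ρ₁' x (S ξ)) (ξ : Bdd ρ₁) : Bdd ρ₁' :=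
  ⟨(S ξ.1.1, S ∘L ξ.1.2), fun x ζ hx => by
    change S (ξ.1.2 ζ) = _
    rw [ξ.2 x ζ hx, hS]⟩

lemma Bdd.op_map (S : H₁ →L[ℂ] H₁') (hS : ∀ x ξ, S (ρ₁ x ξ) = ρ₁' x (S ξ)) (ξ : Bdd ρ₁)
    (ζ : GNS μ) : Bdd.op ρ₁' (Bdd.map S hS ξ) ζ = S (Bdd.op ρ₁ ξ ζ) := rfl

lemma IsBddVec.map (S : H₁ →L[ℂ] H₁') (hS : ∀ x ξ, S (ρ₁ x ξ) = ρ₁' x (S ξ)) {ξ : H₁}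
    (hξ : IsBddVec ρ₁ ξ) : IsBddVec ρ₁' (S ξ) := by
  obtain ⟨ξ, rfl⟩ := hξ
  exact ⟨Bdd.map S hS ξ, rfl⟩

include hμ in
-- The condition `map_elem` fixes `X` on vectors whose second leg has the form `R_η ζ`. Such vectors
-- are total, so continuity gives every second leg.
lemma IsTensorMap.map_tens (h₁ : Good ρ₁) (h₂ : Good ρ₂) (h₁' : Good ρ₁') (h₂' : Good ρ₂')
    {S : H₁ →L[ℂ] H₁'} {T : H₂ →L[ℂ] H₂'} {X : RT ρ₁ ρ₂ →L[ℂ] RT ρ₁' ρ₂'}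
    (h : IsTensorMap S T X) {ξ : H₁} (hξ : IsBddVec ρ₁ ξ) (η : H₂) :
    X (tens ρ₁ ρ₂ ξ η) = tens ρ₁' ρ₂' (S ξ) (T η) := by
  obtain ⟨ξ, rfl⟩ := hξ
  have e : S ξ.1.1 = (Bdd.map S h.left_intertwines ξ).1.1 := rfl
  rw [e, tens_eq_cl hμ h₁ h₂, tens_eq_cl hμ h₁' h₂']
  suffices X ∘L cl hμ h₁ h₂ ξ = cl hμ h₁' h₂' (Bdd.map S h.left_intertwines ξ) ∘L T from
    DFunLike.congr_fun this η
  refine (h₂.total_op hμ).clm_ext fun p => ?_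
  rw [ContinuousLinearMap.comp_apply, ContinuousLinearMap.comp_apply, cl_op,
    h.map_elem ξ p.2 p.1 (Bdd.map S h.left_intertwines ξ) (Bdd.map T h.right_intertwines p.1) rfl rfl, ← cl_op hμ h₁' h₂',
    Bdd.op_map]

/-! ### Amplifications -/

lemma IsAmpRight.cl (h₁ : Good ρ₁) (h₂ : Good ρ₂) {σ : Rep μ H₂} {τ : Rep μ (RT ρ₁ ρ₂)}
    (h : IsAmpRight σ τ) (x : baseVN μ) (ξ : Bdd ρ₁) (η : H₂) :
    τ x (cl hμ h₁ h₂ ξ η) = cl hμ h₁ h₂ ξ (σ x η) := by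
  rw [← tens_eq_cl, (h x).map_tens hμ h₁ h₂ h₁ h₂ ⟨ξ, rfl⟩]
  exact tens_eq_cl hμ h₁ h₂ ξ _

lemma IsAmpLeft.cr (h₁ : Good ρ₁) (h₂ : Good ρ₂) {σ : Rep μ H₁} {τ : Rep μ (RT ρ₁ ρ₂)}
    (h : IsAmpLeft σ τ) (x : baseVN μ) (η : Bdd ρ₂) (ξ : H₁) :
    τ x (cr hμ h₁ h₂ η ξ) = cr hμ h₁ h₂ η (σ x ξ) := by
  suffices τ x ∘L DynQG.cr hμ h₁ h₂ η = DynQG.cr hμ h₁ h₂ η ∘L σ x from DFunLike.congr_fun this ξ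
  refine (h₁.total_op hμ).clm_ext fun p => ?_
  rw [ContinuousLinearMap.comp_apply, ContinuousLinearMap.comp_apply, cr_op,
    (h x).map_elem p.1 p.2 η (Bdd.map (σ x) (h x).left_intertwines p.1) η rfl rfl,
    ← cr_op hμ h₁ h₂, Bdd.op_map]

include hμ in
-- The operators `ζ ↦ ξ ⊗ L ζ`, with `ξ` bounded and `L` an intertwiner of `σ`, have Gram entries
-- `L* ρ₂(R_ξ* R_{ξ'}) L'`. These lie in `N` because `ρ₂` and `σ` commute, and `exists_rep` then
-- yields the amplification together with its goodness.
lemma exists_ampRight (h₁ : Good ρ₁) (h₂ : Good ρ₂) {σ : Rep μ H₂} (hσ : Good σ)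
    (hc : Commuting ρ₂ σ) : ∃ τ : Rep μ (RT ρ₁ ρ₂), Good τ ∧ IsAmpRight σ τ := by
  obtain ⟨τ, hτ, -, hL⟩ := exists_rep hμ
    (L := fun p : Bdd ρ₁ × Inter σ => cl hμ h₁ h₂ p.1 ∘L (p.2 : GNS μ →L[ℂ] H₂))
    ((Total.comp hσ (total_cl hμ h₁ h₂)).of_orthogonal
      fun x hx p => hx ((p.1, p.2.1), p.2.2)) (fun p q b => by
        refine ContinuousLinearMap.ext fun ζ => ?_
        have h1 : (q.2 : GNS μ →L[ℂ] H₂) (piOp μ b ζ) =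
          σ (basePi μ b) ((q.2 : GNS μ →L[ℂ] H₂) ζ) := q.2.2 (basePi μ b) ζ
        simp only [mul_apply_eq_comp, ContinuousLinearMap.adjoint_comp,
          ContinuousLinearMap.comp_apply, adjoint_cl_cl]
        rw [h1, ← mul_apply_eq_comp, (hc _ _).eq, mul_apply_eq_comp, Inter.adjoint p.2.2]
        rfl)
  have hcl : ∀ x ξ η, τ x (cl hμ h₁ h₂ ξ η) = cl hμ h₁ h₂ ξ (σ x η) := by
    intro x ξ η
    suffices τ x ∘L cl hμ h₁ h₂ ξ = cl hμ h₁ h₂ ξ ∘L σ x from DFunLike.congr_fun this η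
    refine hσ.clm_ext fun p => ?_
    have h1 := hL (ξ, p.1) x p.2
    simp only [ContinuousLinearMap.comp_apply] at h1 ⊢
    rw [← h1, p.1.2]
  refine ⟨τ, hτ, fun x => ⟨fun _ _ => rfl, fun y η => ?_, fun ξ ζ η ξ' η' e e' => ?_⟩⟩
  · exact (DFunLike.congr_fun (hc y x).eq η).symm
  · obtain rfl : ξ' = ξ := Subtype.ext e
    rw [← cl_op hμ h₁ h₂, ← cl_op hμ h₁ h₂, hcl]
    exact congrArg _ (DFunLike.congr_fun (congrArg Prod.snd e') ζ).symm

include hμ in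
lemma exists_ampLeft (h₁ : Good ρ₁) (h₂ : Good ρ₂) {σ : Rep μ H₁} (hσ : Good σ)
    (hc : Commuting ρ₁ σ) : ∃ τ : Rep μ (RT ρ₁ ρ₂), Good τ ∧ IsAmpLeft σ τ := by
  obtain ⟨τ, hτ, -, hL⟩ := exists_rep hμ
    (L := fun p : Bdd ρ₂ × Inter σ => cr hμ h₁ h₂ p.1 ∘L (p.2 : GNS μ →L[ℂ] H₁))
    ((Total.comp hσ (total_cr hμ h₁ h₂)).of_orthogonal
      fun x hx p => hx ((p.1, p.2.1), p.2.2)) (fun p q b => by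
        refine ContinuousLinearMap.ext fun ζ => ?_
        have h1 : (q.2 : GNS μ →L[ℂ] H₁) (piOp μ b ζ) =
          σ (basePi μ b) ((q.2 : GNS μ →L[ℂ] H₁) ζ) := q.2.2 (basePi μ b) ζ
        simp only [mul_apply_eq_comp, ContinuousLinearMap.adjoint_comp,
          ContinuousLinearMap.comp_apply, adjoint_cr_cr]
        rw [h1, ← mul_apply_eq_comp, (hc _ _).eq, mul_apply_eq_comp, Inter.adjoint p.2.2]
        rfl)
  have hcr : ∀ x η ξ, τ x (cr hμ h₁ h₂ η ξ) = cr hμ h₁ h₂ η (σ x ξ) := by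
    intro x η ξ
    suffices τ x ∘L cr hμ h₁ h₂ η = cr hμ h₁ h₂ η ∘L σ x from DFunLike.congr_fun this ξ
    refine hσ.clm_ext fun p => ?_
    have h1 := hL (η, p.1) x p.2
    simp only [ContinuousLinearMap.comp_apply] at h1 ⊢
    rw [← h1, p.1.2]
  refine ⟨τ, hτ, fun x => ⟨fun y ξ => ?_, fun _ _ => rfl, fun ξ ζ η ξ' η' e e' => ?_⟩⟩
  · exact (DFunLike.congr_fun (hc y x).eq ξ).symm
  · obtain rfl : η' = η := Subtype.ext e'
    rw [← cr_op hμ h₁ h₂, ← cr_op hμ h₁ h₂, hcr]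
    exact congrArg _ (DFunLike.congr_fun (congrArg Prod.snd e) ζ).symm

include hμ in
lemma IsAmpRight.isBddVec (h₁ : Good ρ₁) (h₂ : Good ρ₂) {σ : Rep μ H₂} {τ : Rep μ (RT ρ₁ ρ₂)}
    (h : IsAmpRight σ τ) {ξ : H₁} {η : H₂} (hξ : IsBddVec ρ₁ ξ) (hη : IsBddVec σ η) :
    IsBddVec τ (tens ρ₁ ρ₂ ξ η) := by
  obtain ⟨ξ, rfl⟩ := hξ
  rw [tens_eq_cl hμ h₁ h₂]
  exact hη.map _ fun x η => (h.cl hμ h₁ h₂ x ξ η).symm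

include hμ in
-- The first vector has to be bounded twice: for `ρ₁`, so that the tensor makes sense, and for `σ`,
-- so that `σ ⊗ 1` acts on it in a bounded way.
lemma IsAmpLeft.isBddVec (h₁ : Good ρ₁) (h₂ : Good ρ₂) {σ : Rep μ H₁} {τ : Rep μ (RT ρ₁ ρ₂)}
    (h : IsAmpLeft σ τ) {ξ : H₁} {η : H₂} (hξ : IsBddVec ρ₁ ξ) (hξ' : IsBddVec σ ξ)
    (hη : IsBddVec ρ₂ η) : IsBddVec τ (tens ρ₁ ρ₂ ξ η) := by
  obtain ⟨ξ, rfl⟩ := hξ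
  obtain ⟨η, rfl⟩ := hη
  rw [tens_eq_cl hμ h₁ h₂, cl_eq_cr]
  exact hξ'.map _ fun x ξ => (h.cr hμ h₁ h₂ x η ξ).symm

include hμ in
lemma IsAmpLeft.map_tens (h₁ : Good ρ₁) (h₂ : Good ρ₂) {σ : Rep μ H₁} {τ : Rep μ (RT ρ₁ ρ₂)}
    (h : IsAmpLeft σ τ) (x : baseVN μ) {ξ : H₁} (hξ : IsBddVec ρ₁ ξ) (η : H₂) :
    τ x (tens ρ₁ ρ₂ ξ η) = tens ρ₁ ρ₂ (σ x ξ) η :=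
  (h x).map_tens hμ h₁ h₂ h₁ h₂ hξ η

include hμ in
lemma IsAmpRight.map_tens (h₁ : Good ρ₁) (h₂ : Good ρ₂) {σ : Rep μ H₂} {τ : Rep μ (RT ρ₁ ρ₂)}
    (h : IsAmpRight σ τ) (x : baseVN μ) {ξ : H₁} (hξ : IsBddVec ρ₁ ξ) (η : H₂) :
    τ x (tens ρ₁ ρ₂ ξ η) = tens ρ₁ ρ₂ ξ (σ x η) :=
  (h x).map_tens hμ h₁ h₂ h₁ h₂ hξ η

/-! ### Flips -/

include hμ in
lemma exists_flip (h₁ : Good ρ₁) (h₂ : Good ρ₂) :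
    ∃ F : RT ρ₁ ρ₂ ≃ₗᵢ[ℂ] RT ρ₂ ρ₁, IsFlip F := by
  obtain ⟨F, hF⟩ := exists_isometryEquiv_of_gram (total_elem (ρ₁ := ρ₁) (ρ₂ := ρ₂))
    (f := fun p : Bdd ρ₁ × GNS μ × Bdd ρ₂ => elem p.2.2 p.2.1 p.1)
    ((total_elem (ρ₁ := ρ₂) (ρ₂ := ρ₁)).of_orthogonal
      fun x hx p => hx (p.2.2, p.2.1, p.1)) (fun p q => by
      rw [inner_elem hμ h₂ h₁, inner_elem hμ h₁ h₂, gram_swap hμ h₁ h₂])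
  exact ⟨F, fun ξ ζ η => hF (ξ, ζ, η)⟩

include hμ in
lemma IsFlip.map_tens (h₁ : Good ρ₁) (h₂ : Good ρ₂) {F : RT ρ₁ ρ₂ ≃ₗᵢ[ℂ] RT ρ₂ ρ₁}
    (hF : IsFlip F) {ξ : H₁} {η : H₂} (hξ : IsBddVec ρ₁ ξ) (hη : IsBddVec ρ₂ η) :
    F (tens ρ₁ ρ₂ ξ η) = tens ρ₂ ρ₁ η ξ := by
  obtain ⟨ξ, rfl⟩ := hξ
  obtain ⟨η, rfl⟩ := hη
  rw [tens_eq_cl hμ h₁ h₂, tens_eq_cl hμ h₂ h₁, cl_eq_cr hμ h₂ h₁]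
  suffices (F : RT ρ₁ ρ₂ →L[ℂ] RT ρ₂ ρ₁) ∘L cl hμ h₁ h₂ ξ = cr hμ h₂ h₁ ξ from
    DFunLike.congr_fun this η.1.1
  refine (h₂.total_op hμ).clm_ext fun p => ?_
  rw [ContinuousLinearMap.comp_apply, cl_op, cr_op]
  exact hF _ _ _

include hμ in
/-- The flip intertwines amplifications. -/
lemma IsFlip.intertwines (h₁ : Good ρ₁) (h₂ : Good ρ₂) {F : RT ρ₁ ρ₂ ≃ₗᵢ[ℂ] RT ρ₂ ρ₁}
    (hF : IsFlip F) {σ : Rep μ H₂} {τ : Rep μ (RT ρ₁ ρ₂)} {τ' : Rep μ (RT ρ₂ ρ₁)}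
    (hτ : IsAmpRight σ τ) (hτ' : IsAmpLeft σ τ') (x : baseVN μ) (v : RT ρ₁ ρ₂) :
    F (τ x v) = τ' x (F v) := by
  suffices (F : RT ρ₁ ρ₂ →L[ℂ] RT ρ₂ ρ₁) ∘L τ x = τ' x ∘L (F : RT ρ₁ ρ₂ →L[ℂ] RT ρ₂ ρ₁) from
    DFunLike.congr_fun this v
  refine total_elem.clm_ext fun p => ?_
  change F (τ x (elem p.1 p.2.1 p.2.2)) = τ' x (F (elem p.1 p.2.1 p.2.2))
  rw [hF, (hτ x).map_elem p.1 p.2.1 p.2.2 p.1 (Bdd.map (σ x) (hτ x).right_intertwines p.2.2) rfl rfl,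
    hF, (hτ' x).map_elem p.2.2 p.2.1 p.1 (Bdd.map (σ x) (hτ x).right_intertwines p.2.2) p.1 rfl rfl]

include hμ in
lemma IsFlip.intertwines' (h₁ : Good ρ₁) (h₂ : Good ρ₂) {F : RT ρ₁ ρ₂ ≃ₗᵢ[ℂ] RT ρ₂ ρ₁}
    (hF : IsFlip F) {σ : Rep μ H₁} {τ : Rep μ (RT ρ₁ ρ₂)} {τ' : Rep μ (RT ρ₂ ρ₁)}
    (hτ : IsAmpLeft σ τ) (hτ' : IsAmpRight σ τ') (x : baseVN μ) (v : RT ρ₁ ρ₂) :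
    F (τ x v) = τ' x (F v) := by
  have hs : IsFlip F.symm := fun ξ ζ η => by rw [← hF, F.symm_apply_apply]
  have := hs.intertwines hμ h₂ h₁ hτ' hτ x (F v)
  rw [F.symm_apply_apply] at this
  rw [← this, F.apply_symm_apply]

/-! ### Associativity -/

include hμ in
-- The vector `ξ ⊗ η` is bounded for `1 ⊗ τ`, with operator `κ ↦ ξ ⊗ R_η κ`. On the total families
-- indexed by `ξ`, `η`, `κ`, `ζ`, both Gram matrices are built from `R_η* σ(R_ξ* R_{ξ'}) R_{η'}` and
-- the Gram operator of the `ζ`, so a unitary matches the families.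
lemma exists_assoc {ρ : Rep μ H₁} {σ τ : Rep μ H₂} {ω : Rep μ H₃} {τ' : Rep μ (RT ρ σ)}
    {σ' : Rep μ (RT τ ω)} (hρ : Good ρ) (hσ : Good σ) (hτ : Good τ) (hω : Good ω)
    (gτ : Good τ') (gσ : Good σ') (hc : Commuting σ τ) (ht : IsAmpRight τ τ')
    (hs : IsAmpLeft σ σ') : ∃ F : RT τ' ω ≃ₗᵢ[ℂ] RT ρ σ', IsAssoc F := by
  let m : Bdd ρ → Bdd τ → Bdd τ' := fun ξ η =>
    Bdd.map (cl hμ hρ hσ ξ) (fun x η => (ht.cl hμ hρ hσ x ξ η).symm) η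
  have hm : ∀ ξ η κ, Bdd.op τ' (m ξ η) κ = cl hμ hρ hσ ξ (Bdd.op τ η κ) := fun ξ η κ => rfl
  obtain ⟨F, hF⟩ := exists_isometryEquiv_of_gram (X := RT τ' ω) (Y := RT ρ σ')
    (e := fun p : Bdd ω × Bdd ρ × Bdd τ × GNS μ => elem (m p.2.1 p.2.2.1) p.2.2.2 p.1)
    ((Total.comp (Total.comp (hτ.total_op hμ) (total_cl hμ hρ hσ))
      (total_cr hμ gτ hω)).of_orthogonal (fun x hx p => by
        have := hx (p.1, p.2.1, p.2.2.1, p.2.2.2)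
        rw [← cr_op hμ gτ hω, hm] at this
        exact this))
    (f := fun p : Bdd ω × Bdd ρ × Bdd τ × GNS μ => cl hμ hρ gσ p.2.1 (elem p.2.2.1 p.2.2.2 p.1))
    ((Total.comp total_elem (total_cl hμ hρ gσ)).of_orthogonal
      (fun x hx p => hx (p.2.2.2, p.1, p.2.1, p.2.2.1))) (fun p q => by
      obtain ⟨ζ, ξ, η, κ⟩ := p
      obtain ⟨ζ', ξ', η', κ'⟩ := q
      dsimp only
      have e1 : ContinuousLinearMap.adjoint (Bdd.op τ' (m ξ η)) (Bdd.op τ' (m ξ' η') κ') =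
          ContinuousLinearMap.adjoint (Bdd.op τ η) (σ (gram hμ hρ ξ ξ') (Bdd.op τ η' κ')) := by
        refine ext_inner_left ℂ fun v => ?_
        rw [ContinuousLinearMap.adjoint_inner_right, ContinuousLinearMap.adjoint_inner_right, hm,
          hm, ← ContinuousLinearMap.adjoint_inner_right, adjoint_cl_cl]
      rw [inner_elem hμ gτ hω, gram_swap hμ gτ hω, e1, ← ContinuousLinearMap.adjoint_inner_right,
        adjoint_cl_cl, ← cr_op hμ hτ hω, ← cr_op hμ hτ hω, hs.cr,
        ← ContinuousLinearMap.adjoint_inner_right, adjoint_cr_cr,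
        ← ContinuousLinearMap.adjoint_inner_right, Inter.adjoint (hτ.op_mem hμ η)]
      rfl)
  refine ⟨F, ht, hs, ?_⟩
  rintro _ _ ζ ⟨ξ, rfl⟩ ⟨η, rfl⟩
  rw [tens_eq_cl hμ hρ hσ, tens_eq_cl hμ hτ hω, tens_eq_cl hμ hρ gσ]
  have e2 : cl hμ hρ hσ ξ η.1.1 = (m ξ η).1.1 := rfl
  rw [e2, tens_eq_cl hμ gτ hω]
  suffices (F : RT τ' ω →L[ℂ] RT ρ σ') ∘L cl hμ gτ hω (m ξ η) =
    cl hμ hρ gσ ξ ∘L cl hμ hτ hω η from DFunLike.congr_fun this ζ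
  refine (hω.total_op hμ).clm_ext fun p => ?_
  rw [ContinuousLinearMap.comp_apply, ContinuousLinearMap.comp_apply, cl_op, cl_op]
  exact hF (p.1, ξ, η, p.2)

/-! ### Tensor products of unitary intertwiners -/

include hμ in
lemma exists_tensorMap (h₁ : Good ρ₁) (h₂ : Good ρ₂) (h₁' : Good ρ₁') (h₂' : Good ρ₂')
    (S : H₁ ≃ₗᵢ[ℂ] H₁') (T : H₂ ≃ₗᵢ[ℂ] H₂') (hS : ∀ x ξ, S (ρ₁ x ξ) = ρ₁' x (S ξ))
    (hT : ∀ x η, T (ρ₂ x η) = ρ₂' x (T η)) :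
    ∃ X : RT ρ₁ ρ₂ ≃ₗᵢ[ℂ] RT ρ₁' ρ₂', IsTensorMap (S : H₁ →L[ℂ] H₁') (T : H₂ →L[ℂ] H₂')
      (X : RT ρ₁ ρ₂ →L[ℂ] RT ρ₁' ρ₂') := by
  let mS : Bdd ρ₁ → Bdd ρ₁' := fun ξ => Bdd.map (S : H₁ →L[ℂ] H₁') hS ξ
  let mT : Bdd ρ₂ → Bdd ρ₂' := fun ξ => Bdd.map (T : H₂ →L[ℂ] H₂') hT ξ
  have hS' : ∀ x ξ, S.symm (ρ₁' x ξ) = ρ₁ x (S.symm ξ) := fun x ξ => by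
    rw [← S.apply_symm_apply ξ, ← hS, S.symm_apply_apply, S.symm_apply_apply]
  have hT' : ∀ x ξ, T.symm (ρ₂' x ξ) = ρ₂ x (T.symm ξ) := fun x ξ => by
    rw [← T.apply_symm_apply ξ, ← hT, T.symm_apply_apply, T.symm_apply_apply]
  have sS : ∀ ξ', mS (Bdd.map (S.symm : H₁' →L[ℂ] H₁) hS' ξ') = ξ' := fun ξ' =>
    Bdd.ext_fst hμ (S.apply_symm_apply _)
  have sT : ∀ ξ', mT (Bdd.map (T.symm : H₂' →L[ℂ] H₂) hT' ξ') = ξ' := fun ξ' =>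
    Bdd.ext_fst hμ (T.apply_symm_apply _)
  obtain ⟨X, hX⟩ := exists_isometryEquiv_of_gram (total_elem (ρ₁ := ρ₁) (ρ₂ := ρ₂))
    (f := fun p : Bdd ρ₁ × GNS μ × Bdd ρ₂ => elem (mS p.1) p.2.1 (mT p.2.2))
    ((total_elem (ρ₁ := ρ₁') (ρ₂ := ρ₂')).of_orthogonal (fun x hx p => by
      have := hx (Bdd.map (S.symm : H₁' →L[ℂ] H₁) hS' p.1, p.2.1,
        Bdd.map (T.symm : H₂' →L[ℂ] H₂) hT' p.2.2)
      dsimp only at this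
      rwa [sS, sT] at this)) (fun p q => by
      have e1 : ∀ v, ContinuousLinearMap.adjoint (Bdd.op ρ₁' (mS p.1)) (Bdd.op ρ₁' (mS q.1) v) =
          ContinuousLinearMap.adjoint (Bdd.op ρ₁ p.1) (Bdd.op ρ₁ q.1 v) := fun v =>
        ext_inner_left ℂ fun w => by
          rw [ContinuousLinearMap.adjoint_inner_right, ContinuousLinearMap.adjoint_inner_right]
          exact S.inner_map_map _ _
      have e2 : ∀ v, ContinuousLinearMap.adjoint (Bdd.op ρ₂' (mT p.2.2))
          (Bdd.op ρ₂' (mT q.2.2) v) =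
          ContinuousLinearMap.adjoint (Bdd.op ρ₂ p.2.2) (Bdd.op ρ₂ q.2.2 v) := fun v =>
        ext_inner_left ℂ fun w => by
          rw [ContinuousLinearMap.adjoint_inner_right, ContinuousLinearMap.adjoint_inner_right]
          exact T.inner_map_map _ _
      rw [inner_elem hμ h₁' h₂', inner_elem hμ h₁ h₂, e1, e2])
  refine ⟨X, hS, hT, fun ξ ζ η ξ' η' e e' => ?_⟩
  obtain rfl : ξ' = mS ξ := Subtype.ext e
  obtain rfl : η' = mT η := Subtype.ext e'
  exact hX (ξ, ζ, η)

end RelativeTensorMaps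

/-! ## Elementary properties of `(B, Γ)^ev`-algebras -/

section EvBasics

variable {B Γ A : Type*}
  [NonUnitalCommRing B] [Module ℂ B] [IsScalarTower ℂ B B] [SMulCommClass ℂ B B]
  [StarRing B] [StarModule ℂ B] [Group Γ]
  [NonUnitalRing A] [Module ℂ A] [IsScalarTower ℂ A A] [SMulCommClass ℂ A A]
  [StarRing A] [StarModule ℂ A]

lemma Mult.left_mul_apply {R : Type*} [NonUnitalRing R] [Module ℂ R] [IsScalarTower ℂ R R]
    [SMulCommClass ℂ R R] (T : Mult R) (x y : R) : T.left (x * y) = T.left x * y := T.2.1 x y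

lemma Mult.right_mul_apply {R : Type*} [NonUnitalRing R] [Module ℂ R] [IsScalarTower ℂ R R]
    [SMulCommClass ℂ R R] (T : Mult R) (x y : R) : T.right (x * y) = x * T.right y := T.2.2.1 x y

lemma Mult.right_mul_left {R : Type*} [NonUnitalRing R] [Module ℂ R] [IsScalarTower ℂ R R]
    [SMulCommClass ℂ R R] (T : Mult R) (x y : R) : T.right x * y = x * T.left y := T.2.2.2 x y

/-- Multipliers of a commutative algebra with local units act in the same way on both sides. -/
lemma Mult.right_eq_left (hB : HasLocalUnits (Set.univ : Set B)) (T : Mult B) (b : B) :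
    T.right b = T.left b := by
  classical
  obtain ⟨u, -, hu⟩ := hB.right {T.right b, T.left b, b}
  rw [← hu (T.right b) (by simp), ← hu (T.left b) (by simp), T.right_mul_left, mul_comm b,
    ← T.left_mul_apply, ← T.left_mul_apply, mul_comm]

namespace EvAlgebra

variable {act : Γ →* (B ≃⋆ₐ[ℂ] B)} (𝒜 : EvAlgebra act A)

lemma gr_induction {p : A → Prop} (mem : ∀ γ γ', ∀ x ∈ 𝒜.gr γ γ', p x) (zero : p 0)
    (add : ∀ x y, p x → p y → p (x + y)) (x : A) : p x := by
  have hx : x ∈ ⨆ g : Γ × Γ, 𝒜.gr g.1 g.2 := 𝒜.gr_sup ▸ Submodule.mem_top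
  exact Submodule.iSup_induction (motive := p) _ hx (fun g y hy => mem _ _ y hy) zero add

/-- Linear maps can be prescribed on the homogeneous components. -/
lemma exists_graded_ext {V : Type*} [AddCommGroup V] [Module ℂ V] (f : Γ → Γ → A →ₗ[ℂ] V) :
    ∃ F : A →ₗ[ℂ] V, ∀ γ γ', ∀ x ∈ 𝒜.gr γ γ', F x = f γ γ' x := by
  classical
  have hI := DirectSum.isInternal_submodule_of_iSupIndep_of_iSup_eq_top 𝒜.gr_indep 𝒜.gr_sup
  let e := LinearEquiv.ofBijective (DirectSum.coeLinearMap fun g : Γ × Γ => 𝒜.gr g.1 g.2) hI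
  refine ⟨DirectSum.toModule ℂ _ V (fun g : Γ × Γ => f g.1 g.2 ∘ₗ (𝒜.gr g.1 g.2).subtype) ∘ₗ
    (e.symm : A →ₗ[ℂ] _), fun γ γ' x hx => ?_⟩
  have h : e.symm x = DirectSum.lof ℂ _ (fun g : Γ × Γ => 𝒜.gr g.1 g.2) (γ, γ') ⟨x, hx⟩ := by
    rw [LinearEquiv.symm_apply_eq]
    exact (DirectSum.coeLinearMap_lof (A := fun g : Γ × Γ => 𝒜.gr g.1 g.2) (i := (γ, γ')) ⟨x, hx⟩).symm
  simp only [LinearMap.comp_apply, LinearEquiv.coe_coe, h, DirectSum.toModule_lof]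
  rfl

lemma hom_ext {V : Type*} [AddCommGroup V] [Module ℂ V] {f g : A →ₗ[ℂ] V}
    (h : ∀ γ γ', ∀ x ∈ 𝒜.gr γ γ', f x = g x) : f = g :=
  LinearMap.ext fun x => 𝒜.gr_induction (p := fun x => f x = g x) h (by simp)
    (fun x y hx hy => by rw [map_add, map_add, hx, hy]) x

/-! ### The actions of `B` -/

lemma rL_mem (b : B) {γ γ' : Γ} {x : A} (hx : x ∈ 𝒜.gr γ γ') : 𝒜.rL b x ∈ 𝒜.gr γ γ' :=
  𝒜.r_mem b hx

lemma sL_mem (b : B) {γ γ' : Γ} {x : A} (hx : x ∈ 𝒜.gr γ γ') : 𝒜.sL b x ∈ 𝒜.gr γ γ' :=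
  𝒜.s_mem b hx

lemma exists_rL_unit (F : Finset A) : ∃ b, ∀ x ∈ F, 𝒜.rL b x = x := 𝒜.r_localUnits F

lemma rL_rL (b c : B) (x : A) : 𝒜.rL b (𝒜.rL c x) = 𝒜.rL (b * c) x := by
  have h : 𝒜.r (b * c) = 𝒜.r b * 𝒜.r c := map_mul _ _ _
  change _ = (𝒜.r (b * c)).left x
  rw [h]; rfl

lemma sL_sL (b c : B) (x : A) : 𝒜.sL b (𝒜.sL c x) = 𝒜.sL (b * c) x := by
  have h : 𝒜.s (b * c) = 𝒜.s b * 𝒜.s c := map_mul _ _ _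
  change _ = (𝒜.s (b * c)).left x
  rw [h]; rfl

lemma rL_comm (b c : B) (x : A) : 𝒜.rL b (𝒜.rL c x) = 𝒜.rL c (𝒜.rL b x) := by
  rw [rL_rL, rL_rL, mul_comm]

lemma rL_sL (b c : B) (x : A) : 𝒜.rL b (𝒜.sL c x) = 𝒜.sL c (𝒜.rL b x) :=
  LinearMap.congr_fun (congrArg Mult.left (𝒜.comm b c)) x

lemma rR_eq (b : B) {γ γ' : Γ} {x : A} (hx : x ∈ 𝒜.gr γ γ') : 𝒜.rR b x = 𝒜.rL (act γ b) x :=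
  𝒜.r_twist b hx

lemma sR_eq (b : B) {γ γ' : Γ} {x : A} (hx : x ∈ 𝒜.gr γ γ') : 𝒜.sR b x = 𝒜.sL (act γ' b) x :=
  𝒜.s_twist b hx

/-- On a homogeneous component, right multiplication is left multiplication by a translated element
of `B`. Mixed commutation relations thus reduce to those of left multiplications. -/
lemma rL_rR (b c : B) (x : A) : 𝒜.rL b (𝒜.rR c x) = 𝒜.rR c (𝒜.rL b x) :=
  LinearMap.congr_fun (f := 𝒜.rL b ∘ₗ 𝒜.rR c) (g := 𝒜.rR c ∘ₗ 𝒜.rL b) (𝒜.hom_ext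
    fun γ γ' x hx => by
      change 𝒜.rL b (𝒜.rR c x) = 𝒜.rR c (𝒜.rL b x)
      rw [𝒜.rR_eq c hx, 𝒜.rR_eq c (𝒜.rL_mem b hx), rL_comm]) x

lemma rL_sR (b c : B) (x : A) : 𝒜.rL b (𝒜.sR c x) = 𝒜.sR c (𝒜.rL b x) :=
  LinearMap.congr_fun (f := 𝒜.rL b ∘ₗ 𝒜.sR c) (g := 𝒜.sR c ∘ₗ 𝒜.rL b) (𝒜.hom_ext
    fun γ γ' x hx => by
      change 𝒜.rL b (𝒜.sR c x) = 𝒜.sR c (𝒜.rL b x)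
      rw [𝒜.sR_eq c hx, 𝒜.sR_eq c (𝒜.rL_mem b hx), rL_sL]) x

lemma mul_rL' (b : B) (x y : A) : x * 𝒜.rL b y = 𝒜.rR b x * y := ((𝒜.r b).right_mul_left x y).symm

lemma mul_sL' (b : B) (x y : A) : x * 𝒜.sL b y = 𝒜.sR b x * y := ((𝒜.s b).right_mul_left x y).symm

lemma rR_mul (b : B) (x y : A) : 𝒜.rR b (x * y) = x * 𝒜.rR b y := (𝒜.r b).right_mul_apply x y

lemma sR_mul (b : B) (x y : A) : 𝒜.sR b (x * y) = x * 𝒜.sR b y := (𝒜.s b).right_mul_apply x y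

lemma star_rL' (b : B) (x : A) : star (𝒜.rL b x) = 𝒜.rR (star b) (star x) := by
  have h : 𝒜.r (star b) = star (𝒜.r b) := map_star 𝒜.r b
  have h2 : (𝒜.r (star b)).right (star x) = star ((𝒜.r b).left (star (star x))) := by
    rw [h]; rfl
  rw [star_star] at h2
  exact h2.symm

lemma star_rR (b : B) (x : A) : star (𝒜.rR b x) = 𝒜.rL (star b) (star x) := by
  have := 𝒜.star_rL' (star b) (star x)
  rw [star_star, star_star] at this
  rw [← this, star_star]

lemma star_sL' (b : B) (x : A) : star (𝒜.sL b x) = 𝒜.sR (star b) (star x) := by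
  have h : 𝒜.s (star b) = star (𝒜.s b) := map_star 𝒜.s b
  have h2 : (𝒜.s (star b)).right (star x) = star ((𝒜.s b).left (star (star x))) := by
    rw [h]; rfl
  rw [star_star] at h2
  exact h2.symm

lemma star_sR (b : B) (x : A) : star (𝒜.sR b x) = 𝒜.sL (star b) (star x) := by
  have := 𝒜.star_sL' (star b) (star x)
  rw [star_star, star_star] at this
  rw [← this, star_star]

lemma rR_rR (b c : B) (x : A) : 𝒜.rR b (𝒜.rR c x) = 𝒜.rR (b * c) x := by
  rw [← star_star (𝒜.rR b _), star_rR, star_rR, rL_rL, ← star_mul, mul_comm c b, ← star_star x,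
    ← star_rR, star_star, star_star]

lemma exists_rR_unit (x : A) : ∃ b, 𝒜.rR b x = x := by
  obtain ⟨b, hb⟩ := 𝒜.exists_rL_unit {star x}
  exact ⟨star b, by rw [← star_star x, ← star_rL', hb _ (by simp)]⟩

lemma sL_rR (b c : B) (x : A) : 𝒜.sL b (𝒜.rR c x) = 𝒜.rR c (𝒜.sL b x) := by
  rw [← star_star (𝒜.sL b _), star_sL', star_rR, ← rL_sR, star_rL', star_sR, star_star, star_star,
    star_star]

/-- The algebra with the two legs exchanged. -/
def co : EvAlgebra act A where
  gr γ γ' := 𝒜.gr γ' γ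
  r := 𝒜.s
  s := 𝒜.r
  gr_indep := 𝒜.gr_indep.comp (f := Prod.swap) Prod.swap_injective
  gr_sup := ((Equiv.prodComm Γ Γ).iSup_comp (g := fun g : Γ × Γ => 𝒜.gr g.1 g.2)).trans 𝒜.gr_sup
  mul_mem := fun hx hy => 𝒜.mul_mem hx hy
  star_mem := fun hx => 𝒜.star_mem hx
  localUnits := 𝒜.localUnits
  comm b b' := (𝒜.comm b' b).symm
  r_mem b _ _ _ hx := 𝒜.s_mem b hx
  s_mem b _ _ _ hx := 𝒜.r_mem b hx
  r_twist b _ _ _ hx := 𝒜.s_twist b hx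
  s_twist b _ _ _ hx := 𝒜.r_twist b hx
  r_localUnits := 𝒜.s_localUnits
  s_localUnits := 𝒜.r_localUnits

lemma sR_rR (b c : B) (x : A) : 𝒜.sR b (𝒜.rR c x) = 𝒜.rR c (𝒜.sR b x) := by
  rw [← star_star (𝒜.sR b _), star_sR, star_rR, ← rL_sL, star_rL', star_sL', star_star, star_star,
    star_star]

lemma sL_sR (b c : B) (x : A) : 𝒜.sL b (𝒜.sR c x) = 𝒜.sR c (𝒜.sL b x) := 𝒜.co.rL_rR b c x

lemma exists_unit (F : Finset A) : ∃ u ∈ 𝒜.gr 1 1, ∀ x ∈ F, u * x = x := 𝒜.localUnits.left F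

lemma exists_unit_right (F : Finset A) : ∃ u ∈ 𝒜.gr 1 1, ∀ x ∈ F, x * u = x :=
  𝒜.localUnits.right F

include 𝒜 in
lemma eq_zero_of_mul (x : A) (h : ∀ y, y * x = 0) : x = 0 := by
  obtain ⟨u, -, hu⟩ := 𝒜.exists_unit {x}
  rw [← hu x (by simp), h]

/-! ### The extension of `r` to multipliers -/

/-- Since `(T b) c = T (b c)` is symmetric in `b` and `c`, the extension `rExt` does not depend on
the local unit chosen in its definition. -/
lemma rL_left_apply (T : Mult B) (b c : B) (x : A) :
    𝒜.rL (T.left b) (𝒜.rL c x) = 𝒜.rL (T.left c) (𝒜.rL b x) := by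
  rw [rL_rL, rL_rL, ← T.left_mul_apply, ← T.left_mul_apply, mul_comm]

lemma rExt_eq (T : Mult B) {b : B} {x : A} (h : 𝒜.rL b x = x) :
    𝒜.rExt T x = 𝒜.rL (T.left b) x := by
  obtain ⟨c, hc, e⟩ : ∃ c, 𝒜.rL c x = x ∧ 𝒜.rExt T x = 𝒜.rL (T.left c) x :=
    ⟨_, (𝒜.r_localUnits {x}).choose_spec x (Finset.mem_singleton_self x), rfl⟩
  rw [e]
  nth_rewrite 1 [← h]
  rw [rL_left_apply, hc]

lemma rExt_rL (T : Mult B) (b : B) (x : A) : 𝒜.rExt T (𝒜.rL b x) = 𝒜.rL (T.left b) x := by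
  classical
  obtain ⟨c, hc⟩ := 𝒜.exists_rL_unit {𝒜.rL b x, x}
  rw [𝒜.rExt_eq T (hc _ (by simp)), rL_left_apply, hc x (by simp)]

/-- `x ↦ r(T) x` -/
def rExtL (T : Mult B) : A →ₗ[ℂ] A where
  toFun := 𝒜.rExt T
  map_add' x y := by
    classical
    obtain ⟨b, hb⟩ := 𝒜.exists_rL_unit {x, y, x + y}
    rw [𝒜.rExt_eq T (hb x (by simp)), 𝒜.rExt_eq T (hb y (by simp)),
      𝒜.rExt_eq T (hb (x + y) (by simp)), map_add]
  map_smul' c x := by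
    classical
    obtain ⟨b, hb⟩ := 𝒜.exists_rL_unit {x}
    have hb' := hb x (by simp)
    rw [𝒜.rExt_eq T hb', 𝒜.rExt_eq T (b := b) (by rw [map_smul, hb']), map_smul, RingHom.id_apply]

lemma rExt_mem (T : Mult B) {γ γ' : Γ} {x : A} (hx : x ∈ 𝒜.gr γ γ') : 𝒜.rExt T x ∈ 𝒜.gr γ γ' :=
  𝒜.r_mem _ hx

lemma rExt_comm_rL (T : Mult B) (b : B) (x : A) :
    𝒜.rExt T (𝒜.rL b x) = 𝒜.rL b (𝒜.rExt T x) := by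
  obtain ⟨c, hc⟩ := 𝒜.exists_rL_unit {x}
  rw [𝒜.rExt_eq T (hc x (by simp)), rL_comm, ← rExt_rL, rL_comm, hc x (by simp)]

lemma rExt_sL (T : Mult B) (b : B) (x : A) : 𝒜.rExt T (𝒜.sL b x) = 𝒜.sL b (𝒜.rExt T x) := by
  obtain ⟨c, hc⟩ := 𝒜.exists_rL_unit {x}
  have h := hc x (by simp)
  rw [𝒜.rExt_eq T h, 𝒜.rExt_eq T (b := c) (by rw [rL_sL, h]), rL_sL]

end EvAlgebra

end EvBasics

/-! ## Square roots of the Radon-Nikodym cocycle -/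

section Cocycle

variable {B Γ A : Type*}
  [NonUnitalCommRing B] [Module ℂ B] [IsScalarTower ℂ B B] [SMulCommClass ℂ B B]
  [StarRing B] [StarModule ℂ B] [Group Γ]
  [NonUnitalRing A] [Module ℂ A] [IsScalarTower ℂ A A] [SMulCommClass ℂ A A]
  [StarRing A] [StarModule ℂ A]

/-- The properties of the square root of the Radon-Nikodym cocycle that are used below. -/
structure IsSymmetricCocycle (act : Γ →* (B ≃⋆ₐ[ℂ] B)) (μ : B →ₗ[ℂ] ℂ) (E : Γ → Mult B) :
    Prop where
  one : ∀ b, (E 1).left b = b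
  map_star : ∀ γ b, (E γ).left (star b) = star ((E γ).left b)
  cocycle : ∀ γ γ' b, (E (γ * γ')).left b =
    act γ'⁻¹ ((E γ).left (act γ' ((E γ').left b)))
  quasi_invariant : ∀ γ b, μ (act γ ((E γ).left ((E γ).left b))) = μ b

lemma IsSqrtCocycle.isSymmetricCocycle {act : Γ →* (B ≃⋆ₐ[ℂ] B)} {μ : B →ₗ[ℂ] ℂ}
    {D E : Γ → Mult B} (hB : HasLocalUnits (Set.univ : Set B)) (hD : IsWeight act μ D)
    (hE : IsSqrtCocycle act μ D E) : IsSymmetricCocycle act μ E where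
  one b := by rw [hE.one]; rfl
  map_star γ b := by
    have h : (star (E γ)).right (star b) = star ((E γ).left (star (star b))) := rfl
    rw [hE.selfAdjoint, star_star, Mult.right_eq_left hB] at h
    exact h
  cocycle := hE.cocycle
  quasi_invariant γ b := by
    have h := hD.quasi_invariant γ b
    have h2 : (E γ * E γ).right b = (E γ).right ((E γ).right b) := rfl
    rw [← hE.sq, h2, Mult.right_eq_left hB, Mult.right_eq_left hB] at h
    exact h

variable {act : Γ →* (B ≃⋆ₐ[ℂ] B)} {μ : B →ₗ[ℂ] ℂ} {E : Γ → Mult B}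

lemma act_inv_act (γ : Γ) (b : B) : act γ⁻¹ (act γ b) = b := by
  have : (act γ⁻¹ * act γ) b = b := by rw [← map_mul, inv_mul_cancel, map_one]; rfl
  exact this

lemma act_act_inv (γ : Γ) (b : B) : act γ (act γ⁻¹ b) = b := by
  have : (act γ * act γ⁻¹) b = b := by rw [← map_mul, mul_inv_cancel, map_one]; rfl
  exact this

lemma act_one (b : B) : act 1 b = b := by rw [map_one]; rfl

/-- At `γ γ⁻¹ = e` and the argument `γ(b)`, the cocycle identity has the form `γ(b) = γ(E_γ c)`. -/
lemma IsSymmetricCocycle.surjective (hE : IsSymmetricCocycle act μ E) (γ : Γ) (b : B) :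
    ∃ c, (E γ).left c = b := by
  have h := hE.cocycle γ γ⁻¹ (act γ b)
  rw [mul_inv_cancel, hE.one, inv_inv] at h
  exact ⟨_, ((act γ).injective h).symm⟩

namespace EvAlgebra

variable (𝒜 : EvAlgebra act A)

/-- The map `D^{1/2} : A → A`, given on `A_{γ,γ'}` by multiplication with `r(D_{γ⁻¹}^{1/2})`. -/
def sqrtD (E : Γ → Mult B) : A →ₗ[ℂ] A :=
  (𝒜.exists_graded_ext fun γ _ => 𝒜.rExtL (E γ⁻¹)).choose

lemma sqrtD_eq {γ γ' : Γ} {x : A} (hx : x ∈ 𝒜.gr γ γ') : 𝒜.sqrtD E x = 𝒜.rExt (E γ⁻¹) x :=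
  (𝒜.exists_graded_ext fun γ _ => 𝒜.rExtL (E γ⁻¹)).choose_spec γ γ' x hx

lemma sqrtD_mem {γ γ' : Γ} {x : A} (hx : x ∈ 𝒜.gr γ γ') : 𝒜.sqrtD E x ∈ 𝒜.gr γ γ' := by
  rw [𝒜.sqrtD_eq hx]; exact 𝒜.rExt_mem _ hx

lemma sqrtD_rL (b : B) (x : A) : 𝒜.sqrtD E (𝒜.rL b x) = 𝒜.rL b (𝒜.sqrtD E x) :=
  LinearMap.congr_fun (f := 𝒜.sqrtD E ∘ₗ 𝒜.rL b) (g := 𝒜.rL b ∘ₗ 𝒜.sqrtD E) (𝒜.hom_ext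
    fun γ γ' x hx => by
      change 𝒜.sqrtD E (𝒜.rL b x) = 𝒜.rL b (𝒜.sqrtD E x)
      rw [𝒜.sqrtD_eq hx, 𝒜.sqrtD_eq (𝒜.rL_mem b hx), rExt_comm_rL]) x

lemma sqrtD_sL (b : B) (x : A) : 𝒜.sqrtD E (𝒜.sL b x) = 𝒜.sL b (𝒜.sqrtD E x) :=
  LinearMap.congr_fun (f := 𝒜.sqrtD E ∘ₗ 𝒜.sL b) (g := 𝒜.sL b ∘ₗ 𝒜.sqrtD E) (𝒜.hom_ext
    fun γ γ' x hx => by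
      change 𝒜.sqrtD E (𝒜.sL b x) = 𝒜.sL b (𝒜.sqrtD E x)
      rw [𝒜.sqrtD_eq hx, 𝒜.sqrtD_eq (𝒜.sL_mem b hx), rExt_sL]) x

lemma sqrtD_rR (b : B) (x : A) : 𝒜.sqrtD E (𝒜.rR b x) = 𝒜.rR b (𝒜.sqrtD E x) :=
  LinearMap.congr_fun (f := 𝒜.sqrtD E ∘ₗ 𝒜.rR b) (g := 𝒜.rR b ∘ₗ 𝒜.sqrtD E) (𝒜.hom_ext
    fun γ γ' x hx => by
      change 𝒜.sqrtD E (𝒜.rR b x) = 𝒜.rR b (𝒜.sqrtD E x)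
      rw [𝒜.rR_eq b hx, 𝒜.rR_eq b (𝒜.sqrtD_mem hx), sqrtD_rL]) x

lemma sqrtD_sR (b : B) (x : A) : 𝒜.sqrtD E (𝒜.sR b x) = 𝒜.sR b (𝒜.sqrtD E x) :=
  LinearMap.congr_fun (f := 𝒜.sqrtD E ∘ₗ 𝒜.sR b) (g := 𝒜.sR b ∘ₗ 𝒜.sqrtD E) (𝒜.hom_ext
    fun γ γ' x hx => by
      change 𝒜.sqrtD E (𝒜.sR b x) = 𝒜.sR b (𝒜.sqrtD E x)
      rw [𝒜.sR_eq b hx, 𝒜.sR_eq b (𝒜.sqrtD_mem hx), sqrtD_sL]) x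

lemma sqrtD_of_one (hE : IsSymmetricCocycle act μ E) {γ' : Γ} {x : A} (hx : x ∈ 𝒜.gr 1 γ') :
    𝒜.sqrtD E x = x := by
  obtain ⟨c, hc⟩ := 𝒜.exists_rL_unit {x}
  rw [𝒜.sqrtD_eq hx, 𝒜.rExt_eq _ (hc x (by simp)), inv_one, hE.one, hc x (by simp)]

lemma sqrtD_surjective (hE : IsSymmetricCocycle act μ E) : Function.Surjective (𝒜.sqrtD E) := by
  intro x
  induction x using 𝒜.gr_induction with
  | mem γ γ' x hx =>
    obtain ⟨b, hb⟩ := 𝒜.exists_rL_unit {x}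
    obtain ⟨c, hc⟩ := hE.surjective γ⁻¹ b
    refine ⟨𝒜.rL c x, ?_⟩
    rw [𝒜.sqrtD_eq (𝒜.rL_mem c hx), rExt_rL, hc, hb x (by simp)]
  | zero => exact ⟨0, map_zero _⟩
  | add x y hx hy =>
    obtain ⟨x, rfl⟩ := hx
    obtain ⟨y, rfl⟩ := hy
    exact ⟨x + y, map_add _ _ _⟩

/-- `r(E_γ) ` can be moved through the inner product of elements of equal degree. -/
lemma star_rExt_mul (hE : IsSymmetricCocycle act μ E) (γ : Γ) (x y : A) :
    star (𝒜.rExt (E γ) x) * y = star x * 𝒜.rExt (E γ) y := by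
  obtain ⟨b, hb⟩ := 𝒜.exists_rL_unit {x}
  obtain ⟨c, hc⟩ := 𝒜.exists_rL_unit {y}
  have hb' := hb x (by simp)
  have hc' := hc y (by simp)
  rw [𝒜.rExt_eq _ hb', 𝒜.rExt_eq _ hc', star_rL', ← mul_rL', ← hE.map_star]
  nth_rewrite 1 [← hc']
  rw [rL_left_apply, rL_comm, mul_rL', ← star_rL', hb']

end EvAlgebra

end Cocycle

/-! ## Representations induced by actions on an algebra -/

section Induced

variable {B A : Type*} [NonUnitalCommRing B] [Module ℂ B] [IsScalarTower ℂ B B]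
  [SMulCommClass ℂ B B] [StarRing B] [StarModule ℂ B]
  [NonUnitalRing A] [Module ℂ A] [IsScalarTower ℂ A A] [SMulCommClass ℂ A A]
  [StarRing A] [StarModule ℂ A]
  {μ : B →ₗ[ℂ] ℂ} (hμ : IsBaseFunctional μ)
  {H : Type*} [NormedAddCommGroup H] [InnerProductSpace ℂ H] [CompleteSpace H]

/-- The functionals are eventually uniformly bounded, so convergence passes from the span of the
total family to its closure by an `ε/2` argument. The bound `|C| + 1` avoids division by zero. -/
lemma tendsto_zero_of_total {Y ι : Type*} {l : Filter Y} {f : Y → H →L[ℂ] ℂ} {C : ℝ}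
    (hC : ∀ᶠ y in l, ‖f y‖ ≤ C) {e : ι → H} (he : Total e)
    (h : ∀ i, Tendsto (fun y => f y (e i)) l (𝓝 0)) (ξ : H) :
    Tendsto (fun y => f y ξ) l (𝓝 0) := by
  have h' : ∀ c, Tendsto (fun y => f y (Finsupp.linearCombination ℂ e c)) l (𝓝 0) := by
    intro c
    induction c using Finsupp.induction_linear with
    | zero => simpa using tendsto_const_nhds
    | add c d hc hd => simpa using hc.add hd
    | single i z => simpa using (h i).const_mul z
  rw [Metric.tendsto_nhds]
  intro ε hε
  have hD : 0 < 2 * (|C| + 1) := by positivity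
  obtain ⟨_, hc, ⟨c, rfl⟩⟩ := Metric.dense_iff.1 he.denseRange ξ (ε / (2 * (|C| + 1)))
    (by positivity)
  filter_upwards [hC, Metric.tendsto_nhds.1 (h' c) (ε / 2) (by positivity)] with y h1 h2
  rw [dist_zero_right] at h2 ⊢
  have h3 : ‖f y (ξ - Finsupp.linearCombination ℂ e c)‖ ≤ ε / 2 := by
    refine ((f y).le_opNorm _).trans ?_
    have h4 : ‖ξ - Finsupp.linearCombination ℂ e c‖ ≤ ε / (2 * (|C| + 1)) := by
      rw [← dist_eq_norm, dist_comm]; exact (Metric.mem_ball.1 hc).le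
    have h5 : ‖f y‖ ≤ |C| + 1 := h1.trans ((le_abs_self C).trans (by linarith))
    calc ‖f y‖ * ‖ξ - Finsupp.linearCombination ℂ e c‖
        ≤ (|C| + 1) * (ε / (2 * (|C| + 1))) := by gcongr
      _ = ε / 2 := by field_simp
  calc ‖f y ξ‖ = ‖f y (ξ - Finsupp.linearCombination ℂ e c) +
        f y (Finsupp.linearCombination ℂ e c)‖ := by rw [← map_add, sub_add_cancel]
    _ ≤ _ := norm_add_le _ _
    _ < ε := by linarith

/-- Between vectors `L ζ` and `L' ζ'` the coefficient of `ρ(y)` is `⟪L'* L ζ, y ζ'⟫`, a coefficient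
of `y` on `K`. Contractivity of `ρ` allows an approximation argument in each of the two variables.
-/
lemma Good.isNormal {ρ : Rep μ H} (h : Good ρ) (hn : ∀ x, ‖ρ x‖ ≤ ‖x‖) : IsNormal ρ := by
  intro l x C hC hw
  have key : ∀ ξ ξ', Tendsto (fun y => ⟪ξ, (ρ y - ρ x) ξ'⟫_ℂ) l (𝓝 0) := by
    have hb : ∀ᶠ y in l, ‖ρ y - ρ x‖ ≤ C + ‖ρ x‖ := by
      filter_upwards [hC] with y hy
      exact (norm_sub_le _ _).trans (by gcongr; exact (hn y).trans hy)
    have h1 : ∀ p : Inter ρ × GNS μ, ∀ ξ' : H,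
        Tendsto (fun y => ⟪(p.1 : GNS μ →L[ℂ] H) p.2, (ρ y - ρ x) ξ'⟫_ℂ) l (𝓝 0) := by
      intro p
      refine tendsto_zero_of_total (f := fun y => innerSL ℂ ((p.1 : GNS μ →L[ℂ] H) p.2) ∘L
        (ρ y - ρ x)) (C := ‖(p.1 : GNS μ →L[ℂ] H) p.2‖ * (C + ‖ρ x‖)) ?_ h ?_
      · filter_upwards [hb] with y hy
        refine (ContinuousLinearMap.opNorm_comp_le _ _).trans ?_
        rw [innerSL_apply_norm]
        gcongr
      · rintro ⟨⟨L', hL'⟩, ζ'⟩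
        obtain ⟨⟨L, hL⟩, ζ⟩ := p
        have h2 := hw (ContinuousLinearMap.adjoint L' (L ζ)) ζ'
        have h3 := tendsto_sub_nhds_zero_iff.2 h2
        refine h3.congr fun y => ?_
        change _ = ⟪L ζ, (ρ y - ρ x) (L' ζ')⟫_ℂ
        rw [sub_apply, ← hL' y, ← hL' x, inner_sub_right, ContinuousLinearMap.adjoint_inner_left,
          ContinuousLinearMap.adjoint_inner_left]
    intro ξ ξ'
    have h4 := tendsto_zero_of_total (f := fun y => innerSL ℂ ((ρ y - ρ x) ξ'))
      (C := (C + ‖ρ x‖) * ‖ξ'‖) (l := l) ?_ h ?_ ξ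
    · have := (Complex.continuous_conj.tendsto 0).comp h4
      rw [map_zero] at this
      refine this.congr fun y => ?_
      exact inner_conj_symm _ _
    · filter_upwards [hb] with y hy
      rw [innerSL_apply_norm]
      exact ((ρ y - ρ x).le_opNorm _).trans (by gcongr)
    · intro p
      have := (Complex.continuous_conj.tendsto 0).comp (h1 p ξ')
      rw [map_zero] at this
      refine this.congr fun y => ?_
      exact inner_conj_symm _ _
  intro ξ ξ'
  refine tendsto_sub_nhds_zero_iff.1 ((key ξ ξ').congr fun y => ?_)
  rw [sub_apply, inner_sub_right]

include hμ in
-- `Good.intertwines` is applied twice, passing from `π_μ(B)` to `N` in one variable at a time.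
lemma Commuting.of_basePi {ρ σ : Rep μ H} (h₁ : Good ρ) (h₂ : Good σ)
    (h : ∀ b c, Commute (ρ (basePi μ b)) (σ (basePi μ c))) : Commuting ρ σ := by
  have h3 : ∀ b y, Commute (ρ (basePi μ b)) (σ y) := fun b y =>
    ContinuousLinearMap.ext fun ξ => h₂.intertwines hμ h₂ (S := ρ (basePi μ b))
      (fun c ξ => DFunLike.congr_fun (h b c).eq ξ) y ξ
  exact fun x y => ContinuousLinearMap.ext fun ξ => (h₁.intertwines hμ h₁ (S := σ y)
    (fun c ξ => (DFunLike.congr_fun (h3 c y).eq ξ).symm) x ξ).symm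

include hμ in
lemma piOp_zero : piOp μ 0 = 0 :=
  (total_Lam μ).clm_ext fun c => by rw [piOp_Lam hμ, zero_mul, map_zero, zero_apply]

include hμ in
lemma piOp_add (b b' : B) : piOp μ (b + b') = piOp μ b + piOp μ b' :=
  (total_Lam μ).clm_ext fun c => by
    rw [add_apply, piOp_Lam hμ, piOp_Lam hμ, piOp_Lam hμ, add_mul, map_add]

include hμ in
lemma piOp_smul (z : ℂ) (b : B) : piOp μ (z • b) = z • piOp μ b :=
  (total_Lam μ).clm_ext fun c => by
    rw [smul_apply, piOp_Lam hμ, piOp_Lam hμ, smul_mul_assoc, map_smul]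

include hμ in
-- The Gram operator is determined by its coefficients between vectors `Λ_μ(b)`. In this way the
-- `B`-valued expressions `φ(x* y)` become elements of `N`.
lemma gram_eq {ρ : Rep μ H} (h : Good ρ) {ξ η : Bdd ρ} {c : B}
    (hc : ∀ b b', ⟪ρ (basePi μ b) ξ.1.1, ρ (basePi μ b') η.1.1⟫_ℂ = μ (star b * (c * b'))) :
    gram hμ h ξ η = basePi μ c :=
  Subtype.ext ((total_Lam μ).clm_ext fun b' => (total_Lam μ).ext fun b => by
    change ⟪Lam μ b, ContinuousLinearMap.adjoint (Bdd.op ρ ξ) (Bdd.op ρ η (Lam μ b'))⟫_ℂ =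
      ⟪Lam μ b, piOp μ c (Lam μ b')⟫_ℂ
    rw [ContinuousLinearMap.adjoint_inner_right, Bdd.op_Lam hμ, Bdd.op_Lam hμ, hc, piOp_Lam hμ,
      inner_Lam hμ])

variable {ν : A →ₗ[ℂ] ℂ} (hν : ∀ c, 0 ≤ ν (star c * c))

include hν in
lemma inner_Lam_of_pos (a c : A) : ⟪Lam ν a, Lam ν c⟫_ℂ = ν (star a * c) :=
  Hilb.inner_of (gnsForm ν) hν a c

/-- The properties of the representation induced by an action. -/
structure IsInducedRep (m : B →ₗ[ℂ] A →ₗ[ℂ] A) (ρ : Rep μ (GNS ν)) : Prop where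
  good : Good ρ
  induced : IsInducedBy m ρ
  normal : IsNormal ρ
  bdd : ∀ a, IsBddVec ρ (Lam ν a)
  injective : Function.Injective ρ

include hμ hν in
-- For `a` in `G` the map `Λ_μ(b) ↦ Λ_ν(m b a)` is bounded, because its Gram matrix is that of
-- `π_μ(c)`; by linearity this holds for all `a`. The hypothesis `hadj` puts the mixed Gram entries
-- into the commutant of `π_μ(B)`, and `exists_rep` applies.
lemma exists_induced {m : B →ₗ[ℂ] A →ₗ[ℂ] A} (hmul : ∀ b c a, m b (m c a) = m (b * c) a)
    (hadj : ∀ b x y, ν (star x * m b y) = ν (star (m (star b) x) * y))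
    (hunit : ∀ a, ∃ b, m b a = a) {G : Set A} (hG : Submodule.span ℂ G = ⊤)
    (hgram : ∀ a ∈ G, ∃ c, ∀ b b', ν (star (m b a) * m b' a) = μ (star b * (c * b')))
    (hfaith : Submodule.span ℂ {c | ∃ a a', ∀ b b',
      ν (star (m b a) * m b' a') = μ (star b * (c * b'))} = ⊤) :
    ∃ ρ : Rep μ (GNS ν), IsInducedRep m ρ := by
  have hL : ∀ a, ∃ L : GNS μ →L[ℂ] GNS ν, ∀ b, L (Lam μ b) = Lam ν (m b a) := by
    intro a
    have ha : a ∈ Submodule.span ℂ G := hG ▸ Submodule.mem_top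
    induction ha using Submodule.span_induction with
    | zero => exact ⟨0, by simp⟩
    | add a a' _ _ h h' =>
      obtain ⟨L, hL⟩ := h
      obtain ⟨L', hL'⟩ := h'
      exact ⟨L + L', fun b => by rw [add_apply, hL, hL', map_add, map_add]⟩
    | smul z a _ h =>
      obtain ⟨L, hL⟩ := h
      exact ⟨z • L, fun b => by rw [smul_apply, hL, map_smul, map_smul]⟩
    | mem a ha =>
      obtain ⟨c, hc⟩ := hgram a ha
      exact exists_clm_of_gram (total_Lam μ) (piOp μ c) fun b b' => by
        rw [inner_Lam_of_pos hν, hc, piOp_Lam hμ, inner_Lam hμ]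
  choose L hL using hL
  have htot : Total fun p : A × GNS μ => L p.1 p.2 :=
    (total_Lam ν).of_orthogonal fun x hx a => by
      obtain ⟨b, hb⟩ := hunit a
      rw [← hb, ← hL]
      exact hx (a, Lam μ b)
  obtain ⟨ρ, hρ, hn, hi⟩ := exists_rep hμ htot (fun a a' c => by
    refine (total_Lam μ).clm_ext fun b' => (total_Lam μ).ext fun b => ?_
    simp only [mul_apply_eq_comp, ContinuousLinearMap.comp_apply]
    rw [ContinuousLinearMap.adjoint_inner_right, piOp_Lam hμ, hL, hL,
      ← ContinuousLinearMap.adjoint_inner_left (piOp μ c), ← ContinuousLinearMap.star_eq_adjoint,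
      ← piOp_star hμ, piOp_Lam hμ, ContinuousLinearMap.adjoint_inner_right, hL, hL,
      inner_Lam_of_pos hν, inner_Lam_of_pos hν, ← hmul, ← hmul, hadj])
  have hind : IsInducedBy m ρ := by
    intro b a
    obtain ⟨c, hc⟩ := hunit a
    have := hi a (basePi μ b) (Lam μ c)
    rw [hL, hc] at this
    rw [← this]
    change L a (piOp μ b (Lam μ c)) = _
    rw [piOp_Lam hμ, hL, ← hmul, hc]
  have hB : ∀ a, (Lam ν a, L a) ∈ Bdd ρ := fun a =>
    hρ.mem_Bdd hμ (hi a) fun b => by rw [hL, hind]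
  refine ⟨ρ, hρ, hind, hρ.isNormal hn, fun a => ⟨⟨_, hB a⟩, rfl⟩, ?_⟩
  rw [injective_iff_map_eq_zero]
  intro x hx
  -- If `R_a* R_{a'} = π_μ(c)`, then `π_μ(c) x = R_a* ρ(x) R_{a'} = 0`. By `hfaith` such `c` span
  -- `B`, and the operators `π_μ(c)` have no common kernel.
  have hpi : ∀ c, piOp μ c ∘L (x : GNS μ →L[ℂ] GNS μ) = 0 := by
    intro c
    have hc : c ∈ Submodule.span ℂ {c | ∃ a a', ∀ b b',
      ν (star (m b a) * m b' a') = μ (star b * (c * b'))} := hfaith ▸ Submodule.mem_top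
    induction hc using Submodule.span_induction with
    | zero => rw [piOp_zero hμ, ContinuousLinearMap.zero_comp]
    | add a a' _ _ h h' => rw [piOp_add hμ, ContinuousLinearMap.add_comp, h, h', add_zero]
    | smul z a _ h => rw [piOp_smul hμ, ContinuousLinearMap.smul_comp, h, smul_zero]
    | mem c hc =>
      obtain ⟨a, a', h⟩ := hc
      have e := congrArg Subtype.val (gram_eq hμ hρ (ξ := ⟨_, hB a⟩) (η := ⟨_, hB a'⟩) (c := c)
        fun b b' => by rw [hind, hind, inner_Lam_of_pos hν, h])
      change _ = piOp μ c at e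
      rw [← e]
      refine ContinuousLinearMap.ext fun ζ => ?_
      change ContinuousLinearMap.adjoint (L a) (L a' ((x : GNS μ →L[ℂ] GNS μ) ζ)) = 0
      rw [hi, hx, zero_apply, map_zero]
  exact Subtype.ext (ContinuousLinearMap.ext fun ζ => eq_zero_of_piOp hμ fun b =>
    DFunLike.congr_fun (hpi b) ζ)

end Induced


/-! ## The four representations -/

section Four

variable {B Γ A : Type*}
  [NonUnitalCommRing B] [Module ℂ B] [IsScalarTower ℂ B B] [SMulCommClass ℂ B B]
  [StarRing B] [StarModule ℂ B] [Group Γ]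
  [NonUnitalRing A] [Module ℂ A] [IsScalarTower ℂ A A] [SMulCommClass ℂ A A]
  [StarRing A] [StarModule ℂ A]
  {act : Γ →* (B ≃⋆ₐ[ℂ] B)} {𝒜 : EvAlgebra act A}
  {μ : B →ₗ[ℂ] ℂ} (hμ : IsBaseFunctional μ) {E : Γ → Mult B} (hE : IsSymmetricCocycle act μ E)
  {ν : A →ₗ[ℂ] ℂ}

/-- `φ` is a surjective `r`-bilinear graded map with `ν = μ ∘ φ` positive. -/
structure IsExpectation (𝒜 : EvAlgebra act A) (μ : B →ₗ[ℂ] ℂ) (ν : A →ₗ[ℂ] ℂ)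
    (φ : A →ₗ[ℂ] B) : Prop where
  left_linear : ∀ b x, φ (𝒜.rL b x) = b * φ x
  right_linear : ∀ b x, φ (𝒜.rR b x) = φ x * b
  graded : ∀ {γ γ' x}, x ∈ 𝒜.gr γ γ' → γ ≠ 1 → φ x = 0
  surjective : Function.Surjective φ
  eq : ∀ x, ν x = μ (φ x)
  positive : ∀ c, 0 ≤ ν (star c * c)

variable {φ : A →ₗ[ℂ] B} (hφ : IsExpectation 𝒜 μ ν φ)

include hφ

lemma IsExpectation.gram_rR (x y : A) (b b' : B) :
    ν (star (𝒜.rR b x) * 𝒜.rR b' y) = μ (star b * (φ (star x * y) * b')) := by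
  rw [𝒜.star_rR, ← 𝒜.rL_mul, ← 𝒜.rR_mul, hφ.eq, hφ.left_linear, hφ.right_linear]

lemma IsExpectation.orthogonal {γ γ' δ δ' : Γ} {x y : A} (hx : x ∈ 𝒜.gr γ γ')
    (hy : y ∈ 𝒜.gr δ δ') (h : γ ≠ δ) : φ (star x * y) = 0 :=
  hφ.graded (𝒜.mul_mem (𝒜.star_mem hx) hy) fun e => h (by simpa [inv_mul_eq_one] using e)

include hE in
-- Moving `r(b)` through `x*` twists it by `γ⁻¹`. The two factors `E_{γ⁻¹}` contributed by `D^{1/2}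
-- x` and `D^{1/2} y` multiply to the density for which `μ` is quasi-invariant under `γ⁻¹`, so the
-- twist falls on `φ(x* y)` only.
lemma IsExpectation.gram_rL {γ γ' δ' : Γ} {x y : A} (hx : x ∈ 𝒜.gr γ γ') (hy : y ∈ 𝒜.gr γ δ')
    (b b' : B) : ν (star (𝒜.rL b (𝒜.sqrtD E x)) * 𝒜.rL b' (𝒜.sqrtD E y)) =
      μ (star b * (act γ (φ (star x * y)) * b')) := by
  obtain ⟨c, hc⟩ := 𝒜.exists_rL_unit {y}
  have hc' := hc y (by simp)
  -- The unit `c` for `y`, moved through `x*`, becomes `γ⁻¹(c)`. Hence `c` is a unit for `γ(φ(x*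
  -- y))` and can be dropped at the end of the computation.
  have h1 : c * act γ (φ (star x * y)) = act γ (φ (star x * y)) := by
    have : φ (star x * y) = act γ⁻¹ c * φ (star x * y) := by
      conv_lhs => rw [← hc', 𝒜.mul_rL _ (𝒜.star_mem hx), hφ.left_linear]
    conv_rhs => rw [this, map_mul, act_act_inv]
  rw [𝒜.star_rL', ← 𝒜.mul_rL', 𝒜.rL_rL, 𝒜.sqrtD_eq hx, 𝒜.sqrtD_eq hy, 𝒜.star_rExt_mul hE,
    𝒜.rExt_eq _ hc', 𝒜.rL_rL, 𝒜.rExt_rL, 𝒜.mul_rL _ (𝒜.star_mem hx), hφ.eq, hφ.left_linear]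
  have h2 : (E γ⁻¹).left (star b * b' * (E γ⁻¹).left c) * act γ (φ (star x * y)) =
      (E γ⁻¹).left ((E γ⁻¹).left (star b * (act γ (φ (star x * y)) * b'))) := by
    rw [mul_comm (star b * b'), ← Mult.left_mul_apply, ← Mult.left_mul_apply,
      ← Mult.left_mul_apply]
    congr 2
    generalize act γ (φ (star x * y)) = z at h1 ⊢
    calc c * (star b * b') * z = (star b * b') * (c * z) := by rw [mul_comm c, mul_assoc]
      _ = star b * (z * b') := by rw [h1, mul_assoc, mul_comm b']
  rw [← hE.quasi_invariant γ⁻¹ (star b * _), ← h2, map_mul (act γ⁻¹), act_inv_act]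

include hE in
lemma IsExpectation.gram_rL_of_ne {γ γ' δ δ' : Γ} {x y : A} (hx : x ∈ 𝒜.gr γ γ')
    (hy : y ∈ 𝒜.gr δ δ') (h : γ ≠ δ) (b b' : B) :
    ν (star (𝒜.rL b (𝒜.sqrtD E x)) * 𝒜.rL b' (𝒜.sqrtD E y)) = 0 := by
  rw [hφ.eq, hφ.orthogonal (𝒜.rL_mem b (𝒜.sqrtD_mem hx)) (𝒜.rL_mem b' (𝒜.sqrtD_mem hy)) h,
    map_zero]

include hμ in
lemma IsExpectation.exists_rR : ∃ ρ : Rep μ (GNS ν), IsInducedRep 𝒜.rR ρ := by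
  refine exists_induced hμ hφ.positive (G := Set.univ) (fun b c a => 𝒜.rR_rR b c a)
    (fun b x y => ?_) 𝒜.exists_rR_unit Submodule.span_univ
    (fun a _ => ⟨_, hφ.gram_rR a a⟩) ?_
  · rw [𝒜.star_rR, star_star, ← 𝒜.rL_mul, ← 𝒜.rR_mul, hφ.eq, hφ.eq, hφ.left_linear,
      hφ.right_linear, mul_comm]
  · rw [eq_top_iff]
    intro c _
    obtain ⟨a, rfl⟩ := hφ.surjective c
    obtain ⟨u, -, hu⟩ := 𝒜.exists_unit {a}
    refine Submodule.subset_span ⟨star u, a, fun b b' => ?_⟩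
    rw [hφ.gram_rR, star_star, hu a (by simp)]

lemma span_sqrtD (hE : IsSymmetricCocycle act μ E) :
    Submodule.span ℂ {a | ∃ γ γ', ∃ x ∈ 𝒜.gr γ γ', a = 𝒜.sqrtD E x} = ⊤ := by
  rw [eq_top_iff]
  intro a _
  obtain ⟨x, rfl⟩ := 𝒜.sqrtD_surjective hE a
  induction x using 𝒜.gr_induction with
  | mem γ γ' x hx => exact Submodule.subset_span ⟨γ, γ', x, hx, rfl⟩
  | zero => rw [map_zero]; exact zero_mem _
  | add x y hx hy => rw [map_add]; exact add_mem (hx trivial) (hy trivial)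

include hμ hE in
-- The generators are `D^{1/2} x` with `x` homogeneous, where the Gram operator is known. For
-- faithfulness only the components with `γ = e` matter: `φ` vanishes on the others, and there
-- `D^{1/2}` is the identity.
lemma IsExpectation.exists_rL : ∃ ρ : Rep μ (GNS ν), IsInducedRep 𝒜.rL ρ := by
  refine exists_induced hμ hφ.positive (fun b c a => 𝒜.rL_rL b c a) (fun b x y => ?_)
    (fun a => ?_) (span_sqrtD (𝒜 := 𝒜) hφ hE) ?_ ?_
  · rw [𝒜.star_rL', star_star, 𝒜.mul_rL']
  · obtain ⟨b, hb⟩ := 𝒜.exists_rL_unit {a}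
    exact ⟨b, hb a (by simp)⟩
  · rintro _ ⟨γ, γ', x, hx, rfl⟩
    exact ⟨_, hφ.gram_rL hE hx hx⟩
  · rw [eq_top_iff]
    intro c _
    obtain ⟨a, rfl⟩ := hφ.surjective c
    induction a using 𝒜.gr_induction with
    | mem γ γ' a ha =>
      by_cases hγ : γ = 1
      · subst hγ
        obtain ⟨u, hu, hu'⟩ := 𝒜.exists_unit {a}
        have hu1 : star u ∈ 𝒜.gr 1 1 := by simpa using 𝒜.star_mem hu
        refine Submodule.subset_span ⟨star u, a, fun b b' => ?_⟩
        have := hφ.gram_rL hE hu1 ha b b'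
        rwa [star_star, hu' a (by simp), act_one, 𝒜.sqrtD_of_one hE hu1,
          𝒜.sqrtD_of_one hE ha] at this
      · rw [hφ.graded ha hγ]; exact zero_mem _
    | zero => rw [map_zero]; exact zero_mem _
    | add x y hx hy => rw [map_add]; exact add_mem (hx trivial) (hy trivial)

omit hφ in
include hμ in
/-- Representations induced by commuting actions commute. -/
lemma IsInducedRep.commuting {m m' : B →ₗ[ℂ] A →ₗ[ℂ] A} {ρ σ : Rep μ (GNS ν)}
    (h : IsInducedRep m ρ) (h' : IsInducedRep m' σ)
    (hm : ∀ b c a, m b (m' c a) = m' c (m b a)) : Commuting ρ σ :=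
  Commuting.of_basePi hμ h.good h'.good fun b c => (total_Lam ν).clm_ext fun a => by
    rw [mul_apply_eq_comp, mul_apply_eq_comp, h.induced, h'.induced, h.induced, h'.induced, hm]

end Four

/-! ## Calculus in the fiber product -/

section FiberCalculus

variable {B Γ A : Type*}
  [NonUnitalCommRing B] [Module ℂ B] [IsScalarTower ℂ B B] [SMulCommClass ℂ B B]
  [StarRing B] [StarModule ℂ B] [Group Γ]
  [NonUnitalRing A] [Module ℂ A] [IsScalarTower ℂ A A] [SMulCommClass ℂ A A]
  [StarRing A] [StarModule ℂ A]

namespace EvAlgebra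

variable {act : Γ →* (B ≃⋆ₐ[ℂ] B)} (𝒜 : EvAlgebra act A)

lemma mulL₁_tmul (x a c : A) : mulL₁ x (a ⊗ₜ[ℂ] c) = (x * a) ⊗ₜ c := rfl
lemma mulR₁_tmul (x a c : A) : mulR₁ x (a ⊗ₜ[ℂ] c) = (a * x) ⊗ₜ c := rfl
lemma mulL₂_tmul (x a c : A) : mulL₂ x (a ⊗ₜ[ℂ] c) = a ⊗ₜ (x * c) := rfl
lemma mulR₂_tmul (x a c : A) : mulR₂ x (a ⊗ₜ[ℂ] c) = a ⊗ₜ (c * x) := rfl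

/-- Two linear endomorphisms of `A ⊗ A` agree if they agree on elementary tensors. -/
lemma tensor_induction_eq {V : Type*} [AddCommGroup V] [Module ℂ V] {f g : A ⊗[ℂ] A →ₗ[ℂ] V}
    (h : ∀ a c, f (a ⊗ₜ c) = g (a ⊗ₜ c)) (t : A ⊗[ℂ] A) : f t = g t :=
  LinearMap.congr_fun (TensorProduct.ext' h) t

lemma mulL₁_mulL₁ (x y : A) (t : A ⊗[ℂ] A) : mulL₁ x (mulL₁ y t) = mulL₁ (x * y) t :=
  tensor_induction_eq (f := mulL₁ x ∘ₗ mulL₁ y) (fun a c => by simp [mulL₁_tmul, mul_assoc]) t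

lemma mulR₁_mulR₁ (x y : A) (t : A ⊗[ℂ] A) : mulR₁ x (mulR₁ y t) = mulR₁ (y * x) t :=
  tensor_induction_eq (f := mulR₁ x ∘ₗ mulR₁ y) (fun a c => by simp [mulR₁_tmul, mul_assoc]) t

lemma mulL₂_mulL₂ (x y : A) (t : A ⊗[ℂ] A) : mulL₂ x (mulL₂ y t) = mulL₂ (x * y) t :=
  tensor_induction_eq (f := mulL₂ x ∘ₗ mulL₂ y) (fun a c => by simp [mulL₂_tmul, mul_assoc]) t

lemma mulR₂_mulR₂ (x y : A) (t : A ⊗[ℂ] A) : mulR₂ x (mulR₂ y t) = mulR₂ (y * x) t :=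
  tensor_induction_eq (f := mulR₂ x ∘ₗ mulR₂ y) (fun a c => by simp [mulR₂_tmul, mul_assoc]) t

lemma mulR₁_mulR₂ (x y : A) (t : A ⊗[ℂ] A) : mulR₁ x (mulR₂ y t) = mulR₂ y (mulR₁ x t) :=
  tensor_induction_eq (f := mulR₁ x ∘ₗ mulR₂ y) (g := mulR₂ y ∘ₗ mulR₁ x) (fun a c => rfl) t

lemma mulL₁_mulL₂ (x y : A) (t : A ⊗[ℂ] A) : mulL₁ x (mulL₂ y t) = mulL₂ y (mulL₁ x t) :=
  tensor_induction_eq (f := mulL₁ x ∘ₗ mulL₂ y) (g := mulL₂ y ∘ₗ mulL₁ x) (fun a c => rfl) t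

lemma mulL₁_mulR₂ (x y : A) (t : A ⊗[ℂ] A) : mulL₁ x (mulR₂ y t) = mulR₂ y (mulL₁ x t) :=
  tensor_induction_eq (f := mulL₁ x ∘ₗ mulR₂ y) (g := mulR₂ y ∘ₗ mulL₁ x) (fun a c => rfl) t

lemma mulL₁_mul (x : A) (t t' : A ⊗[ℂ] A) : mulL₁ x (t * t') = mulL₁ x t * t' := by
  induction t using TensorProduct.induction_on with
  | zero => simp
  | add t₁ t₂ h₁ h₂ => simp only [add_mul, map_add, h₁, h₂]
  | tmul a c =>
    induction t' using TensorProduct.induction_on with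
    | zero => simp
    | add t₁ t₂ h₁ h₂ => simp only [mul_add, map_add, h₁, h₂]
    | tmul a' c' => simp [mulL₁_tmul, mul_assoc]

lemma mulL₂_mul (x : A) (t t' : A ⊗[ℂ] A) : mulL₂ x (t * t') = mulL₂ x t * t' := by
  induction t using TensorProduct.induction_on with
  | zero => simp
  | add t₁ t₂ h₁ h₂ => simp only [add_mul, map_add, h₁, h₂]
  | tmul a c =>
    induction t' using TensorProduct.induction_on with
    | zero => simp
    | add t₁ t₂ h₁ h₂ => simp only [mul_add, map_add, h₁, h₂]
    | tmul a' c' => simp [mulL₂_tmul, mul_assoc]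

lemma mulR₂_mul (x : A) (t t' : A ⊗[ℂ] A) : mulR₂ x (t * t') = t * mulR₂ x t' := by
  induction t using TensorProduct.induction_on with
  | zero => simp
  | add t₁ t₂ h₁ h₂ => simp only [add_mul, map_add, h₁, h₂]
  | tmul a c =>
    induction t' using TensorProduct.induction_on with
    | zero => simp
    | add t₁ t₂ h₁ h₂ => simp only [mul_add, map_add, h₁, h₂]
    | tmul a' c' => simp [mulR₂_tmul, mul_assoc]

lemma mulR₁_mul_left (x : A) (t t' : A ⊗[ℂ] A) : mulR₁ x t * t' = t * mulL₁ x t' := by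
  induction t using TensorProduct.induction_on with
  | zero => simp
  | add t₁ t₂ h₁ h₂ => simp only [add_mul, map_add, h₁, h₂]
  | tmul a c =>
    induction t' using TensorProduct.induction_on with
    | zero => simp
    | add t₁ t₂ h₁ h₂ => simp only [mul_add, map_add, h₁, h₂]
    | tmul a' c' => simp [mulR₁_tmul, mulL₁_tmul, mul_assoc]

lemma mulR₂_mul_left (x : A) (t t' : A ⊗[ℂ] A) : mulR₂ x t * t' = t * mulL₂ x t' := by
  induction t using TensorProduct.induction_on with
  | zero => simp
  | add t₁ t₂ h₁ h₂ => simp only [add_mul, map_add, h₁, h₂]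
  | tmul a c =>
    induction t' using TensorProduct.induction_on with
    | zero => simp
    | add t₁ t₂ h₁ h₂ => simp only [mul_add, map_add, h₁, h₂]
    | tmul a' c' => simp [mulR₂_tmul, mulL₂_tmul, mul_assoc]

lemma star_mulL₁ (x : A) (t : A ⊗[ℂ] A) : star (mulL₁ x t) = mulR₁ (star x) (star t) := by
  induction t using TensorProduct.induction_on with
  | zero => simp
  | add t₁ t₂ h₁ h₂ => simp only [star_add, map_add, h₁, h₂]
  | tmul a c => simp [mulL₁_tmul, mulR₁_tmul]

lemma star_mulL₂ (x : A) (t : A ⊗[ℂ] A) : star (mulL₂ x t) = mulR₂ (star x) (star t) := by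
  induction t using TensorProduct.induction_on with
  | zero => simp
  | add t₁ t₂ h₁ h₂ => simp only [star_add, map_add, h₁, h₂]
  | tmul a c => simp [mulL₂_tmul, mulR₂_tmul]

lemma star_mulR₁ (x : A) (t : A ⊗[ℂ] A) : star (mulR₁ x t) = mulL₁ (star x) (star t) := by
  rw [← star_star (mulL₁ _ _), star_mulL₁, star_star, star_star]

lemma star_mulR₂ (x : A) (t : A ⊗[ℂ] A) : star (mulR₂ x t) = mulL₂ (star x) (star t) := by
  rw [← star_star (mulL₂ _ _), star_mulL₂, star_star, star_star]

/-! ### Local units of `A ⊗ A` -/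

lemma exists_legs (t : A ⊗[ℂ] A) : ∃ F : Finset A,
    (∀ u, (∀ x ∈ F, u * x = x) → mulL₁ u t = t ∧ mulL₂ u t = t) ∧
    ∀ u, (∀ x ∈ F, x * u = x) → mulR₁ u t = t ∧ mulR₂ u t = t := by
  classical
  induction t using TensorProduct.induction_on with
  | zero => exact ⟨∅, by simp⟩
  | tmul a c =>
    refine ⟨{a, c}, fun u hu => ?_, fun u hu => ?_⟩
    · rw [mulL₁_tmul, mulL₂_tmul, hu a (by simp), hu c (by simp)]
      exact ⟨rfl, rfl⟩
    · rw [mulR₁_tmul, mulR₂_tmul, hu a (by simp), hu c (by simp)]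
      exact ⟨rfl, rfl⟩
  | add t₁ t₂ h₁ h₂ =>
    obtain ⟨F, hF, hF'⟩ := h₁
    obtain ⟨G, hG, hG'⟩ := h₂
    refine ⟨F ∪ G, fun u hu => ?_, fun u hu => ?_⟩
    · have h1 := hF u fun x hx => hu x (Finset.mem_union_left _ hx)
      have h2 := hG u fun x hx => hu x (Finset.mem_union_right _ hx)
      rw [map_add, map_add, h1.1, h1.2, h2.1, h2.2]
      exact ⟨rfl, rfl⟩
    · have h1 := hF' u fun x hx => hu x (Finset.mem_union_left _ hx)
      have h2 := hG' u fun x hx => hu x (Finset.mem_union_right _ hx)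
      rw [map_add, map_add, h1.1, h1.2, h2.1, h2.2]
      exact ⟨rfl, rfl⟩

lemma exists_tensor_unit (F : Finset A) (G : Finset (A ⊗[ℂ] A)) : ∃ u ∈ 𝒜.gr 1 1,
    (∀ x ∈ F, u * x = x) ∧ ∀ t ∈ G, mulL₁ u t = t ∧ mulL₂ u t = t := by
  classical
  choose L hL _ using fun t : A ⊗[ℂ] A => exists_legs t
  obtain ⟨u, hu, hu'⟩ := 𝒜.exists_unit (F ∪ G.biUnion L)
  exact ⟨u, hu, fun x hx => hu' x (Finset.mem_union_left _ hx), fun t ht => hL t u fun x hx =>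
    hu' x (Finset.mem_union_right _ (Finset.mem_biUnion.2 ⟨t, ht, hx⟩))⟩

lemma exists_tensor_unit_right (F : Finset A) (G : Finset (A ⊗[ℂ] A)) : ∃ u ∈ 𝒜.gr 1 1,
    (∀ x ∈ F, x * u = x) ∧ ∀ t ∈ G, mulR₁ u t = t ∧ mulR₂ u t = t := by
  classical
  choose L _ hL using fun t : A ⊗[ℂ] A => exists_legs t
  obtain ⟨u, hu, hu'⟩ := 𝒜.exists_unit_right (F ∪ G.biUnion L)
  exact ⟨u, hu, fun x hx => hu' x (Finset.mem_union_left _ hx), fun t ht => hL t u fun x hx =>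
    hu' x (Finset.mem_union_right _ (Finset.mem_biUnion.2 ⟨t, ht, hx⟩))⟩

/-! ### Homogeneous maps -/

/-- A linear map preserving the homogeneous components. -/
def IsGraded (f : A →ₗ[ℂ] A) : Prop := ∀ ⦃γ γ' x⦄, x ∈ 𝒜.gr γ γ' → f x ∈ 𝒜.gr γ γ'

lemma isGraded_id : 𝒜.IsGraded LinearMap.id := fun _ _ _ h => h

lemma isGraded_rL (b : B) : 𝒜.IsGraded (𝒜.rL b) := fun _ _ _ h => 𝒜.rL_mem b h

lemma isGraded_sL (b : B) : 𝒜.IsGraded (𝒜.sL b) := fun _ _ _ h => 𝒜.sL_mem b h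

variable {𝒜} in
lemma isGraded_mulLeft {u : A} (hu : u ∈ 𝒜.gr 1 1) : 𝒜.IsGraded (LinearMap.mulLeft ℂ u) :=
  fun γ γ' x hx => by simpa using 𝒜.mul_mem hu hx

variable {𝒜} in
lemma isGraded_mulRight {u : A} (hu : u ∈ 𝒜.gr 1 1) : 𝒜.IsGraded (LinearMap.mulRight ℂ u) :=
  fun γ γ' x hx => by simpa using 𝒜.mul_mem hx hu

variable {𝒜} in
lemma map_mem_span_matched {f g : A →ₗ[ℂ] A} (hf : 𝒜.IsGraded f) (hg : 𝒜.IsGraded g) {γ γ'' : Γ}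
    {t : A ⊗[ℂ] A} (ht : t ∈ Submodule.span ℂ (𝒜.matched γ γ'')) :
    TensorProduct.map f g t ∈ Submodule.span ℂ (𝒜.matched γ γ'') := by
  induction ht using Submodule.span_induction with
  | zero => rw [map_zero]; exact zero_mem _
  | add t₁ t₂ _ _ h₁ h₂ => rw [map_add]; exact add_mem h₁ h₂
  | smul z t _ h => rw [map_smul]; exact Submodule.smul_mem _ _ h
  | mem t h =>
    obtain ⟨γ', a, c, ha, hc, rfl⟩ := h
    exact Submodule.subset_span ⟨γ', f a, g c, hf ha, hg hc, rfl⟩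

lemma mem_prodGamma {t : A ⊗[ℂ] A} :
    t ∈ 𝒜.prodGamma ↔ t ∈ Submodule.span ℂ (⋃ g : Γ × Γ, 𝒜.matched g.1 g.2) := Iff.rfl

lemma mem_prodGamma_of_matched {γ γ'' : Γ} {t : A ⊗[ℂ] A}
    (ht : t ∈ Submodule.span ℂ (𝒜.matched γ γ'')) : t ∈ 𝒜.prodGamma :=
  Submodule.span_mono (Set.subset_iUnion (fun g : Γ × Γ => 𝒜.matched g.1 g.2) (γ, γ'')) ht

variable {𝒜} in
lemma map_mem_prodGamma {f g : A →ₗ[ℂ] A} (hf : 𝒜.IsGraded f) (hg : 𝒜.IsGraded g)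
    {t : A ⊗[ℂ] A} (ht : t ∈ 𝒜.prodGamma) : TensorProduct.map f g t ∈ 𝒜.prodGamma := by
  rw [mem_prodGamma] at ht ⊢
  induction ht using Submodule.span_induction with
  | zero => rw [map_zero]; exact zero_mem _
  | add t₁ t₂ _ _ h₁ h₂ => rw [map_add]; exact add_mem h₁ h₂
  | smul z t _ h => rw [map_smul]; exact Submodule.smul_mem _ _ h
  | mem t h =>
    obtain ⟨⟨γ, γ''⟩, γ', a, c, ha, hc, rfl⟩ := Set.mem_iUnion.1 h
    exact Submodule.subset_span (Set.mem_iUnion.2 ⟨(γ, γ''), γ', f a, g c, hf ha, hg hc, rfl⟩)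

/-- A tensor product of homogeneous maps, restricted to `∑ A_{γ,γ'} ⊗ A_{γ',γ''}`. -/
def mapProd {f g : A →ₗ[ℂ] A} (hf : 𝒜.IsGraded f) (hg : 𝒜.IsGraded g) :
    𝒜.prodGamma →ₗ[ℂ] 𝒜.prodGamma where
  toFun w := ⟨TensorProduct.map f g w, map_mem_prodGamma hf hg w.2⟩
  map_add' w w' := Subtype.ext (map_add _ _ _)
  map_smul' z w := Subtype.ext (map_smul _ _ _)

variable {𝒜} in
lemma mapProd_mem_fiberIdeal {f g : A →ₗ[ℂ] A} (hf : 𝒜.IsGraded f) (hg : 𝒜.IsGraded g)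
    (hs : ∀ b x, f (𝒜.sL b x) = 𝒜.sL b (f x)) (hr : ∀ b x, g (𝒜.rL b x) = 𝒜.rL b (g x))
    {k : 𝒜.prodGamma} (hk : k ∈ 𝒜.fiberIdeal) : 𝒜.mapProd hf hg k ∈ 𝒜.fiberIdeal := by
  induction hk using Submodule.span_induction with
  | zero => rw [map_zero]; exact zero_mem _
  | add t₁ t₂ _ _ h₁ h₂ => rw [map_add]; exact add_mem h₁ h₂
  | smul z t _ h => rw [map_smul]; exact Submodule.smul_mem _ _ h
  | mem k hk =>
    obtain ⟨b, γ, γ', γ'', a, c, ha, hc, hk⟩ := hk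
    refine Submodule.subset_span ⟨b, γ, γ', γ'', f a, g c, hf ha, hg hc, ?_⟩
    change TensorProduct.map f g (k : A ⊗[ℂ] A) = _
    rw [hk, map_sub, TensorProduct.map_tmul, TensorProduct.map_tmul, hs, hr]

variable {𝒜} in
lemma mul_sL_one {u : A} (hu : u ∈ 𝒜.gr 1 1) (b : B) (x : A) : u * 𝒜.sL b x = 𝒜.sL b (u * x) := by
  rw [𝒜.mul_sL b hu, act_one]

variable {𝒜} in
lemma mul_rL_one {u : A} (hu : u ∈ 𝒜.gr 1 1) (b : B) (x : A) : u * 𝒜.rL b x = 𝒜.rL b (u * x) := by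
  rw [𝒜.mul_rL b hu, act_one]

/-! ### Balanced subspaces -/

lemma toFiber_eq_iff {g g' : 𝒜.prodGamma} :
    𝒜.toFiber g = 𝒜.toFiber g' ↔ g - g' ∈ 𝒜.fiberIdeal := Submodule.Quotient.eq _

variable {𝒜} in
lemma fiberIdeal_le_left {k : 𝒜.prodGamma} (hk : k ∈ 𝒜.fiberIdeal) :
    (k : A ⊗[ℂ] A) ∈ 𝒜.balancedLeft := by
  induction hk using Submodule.span_induction with
  | zero => exact zero_mem _
  | add t₁ t₂ _ _ h₁ h₂ => exact add_mem h₁ h₂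
  | smul z t _ h => exact Submodule.smul_mem _ _ h
  | mem k hk =>
    obtain ⟨b, γ, γ', γ'', a, c, ha, hc, hk⟩ := hk
    exact Submodule.subset_span ⟨b, a, c, hk⟩

variable {𝒜} in
lemma toFiber_eq_left {g g' : 𝒜.prodGamma} (h : 𝒜.toFiber g = 𝒜.toFiber g') :
    (g : A ⊗[ℂ] A) - g' ∈ 𝒜.balancedLeft := fiberIdeal_le_left (𝒜.toFiber_eq_iff.1 h)

/-- A linear map preserves a subspace given by generators. -/
lemma span_map_le {V W : Type*} [AddCommGroup V] [Module ℂ V] [AddCommGroup W] [Module ℂ W]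
    {σ : ℂ →+* ℂ} {X : Set V} {Y : Submodule ℂ W} {f : V →ₛₗ[σ] W} (h : ∀ x ∈ X, f x ∈ Y) {t : V}
    (ht : t ∈ Submodule.span ℂ X) : f t ∈ Y := by
  induction ht using Submodule.span_induction with
  | zero => rw [map_zero]; exact zero_mem _
  | add t₁ t₂ _ _ h₁ h₂ => rw [map_add]; exact add_mem h₁ h₂
  | smul z t _ h => rw [f.map_smulₛₗ]; exact Submodule.smul_mem _ _ h
  | mem t ht => exact h t ht

variable {𝒜} in
lemma map_balancedLeft {f g : A →ₗ[ℂ] A} (hs : ∀ b x, f (𝒜.sL b x) = 𝒜.sL b (f x))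
    (hr : ∀ b x, g (𝒜.rL b x) = 𝒜.rL b (g x)) {t : A ⊗[ℂ] A} (ht : t ∈ 𝒜.balancedLeft) :
    TensorProduct.map f g t ∈ 𝒜.balancedLeft := by
  refine span_map_le (f := TensorProduct.map f g) ?_ ht
  rintro _ ⟨b, a, c, rfl⟩
  refine Submodule.subset_span ⟨b, f a, g c, ?_⟩
  rw [map_sub, TensorProduct.map_tmul, TensorProduct.map_tmul, hs, hr]

variable {𝒜} in
lemma mulR₁_balancedLeft (x : A) {t : A ⊗[ℂ] A} (ht : t ∈ 𝒜.balancedLeft) :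
    mulR₁ x t ∈ 𝒜.balancedLeft :=
  map_balancedLeft (f := LinearMap.mulRight ℂ x) (g := LinearMap.id)
    (fun b y => (𝒜.sL_mul b y x).symm) (fun _ _ => rfl) ht

variable {𝒜} in
lemma mulR₂_balancedLeft (x : A) {t : A ⊗[ℂ] A} (ht : t ∈ 𝒜.balancedLeft) :
    mulR₂ x t ∈ 𝒜.balancedLeft :=
  map_balancedLeft (f := LinearMap.id) (g := LinearMap.mulRight ℂ x)
    (fun _ _ => rfl) (fun b y => (𝒜.rL_mul b y x).symm) ht

variable {𝒜} in
lemma mulL₁_balancedLeft {x : A} (hx : x ∈ 𝒜.gr 1 1) {t : A ⊗[ℂ] A} (ht : t ∈ 𝒜.balancedLeft) :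
    mulL₁ x t ∈ 𝒜.balancedLeft :=
  map_balancedLeft (f := LinearMap.mulLeft ℂ x) (g := LinearMap.id)
    (fun b y => mul_sL_one hx b y) (fun _ _ => rfl) ht

variable {𝒜} in
lemma star_balancedLeft {t : A ⊗[ℂ] A} (ht : t ∈ 𝒜.balancedLeft) : star t ∈ 𝒜.balancedRight := by
  induction ht using Submodule.span_induction with
  | zero => rw [star_zero]; exact zero_mem _
  | add t₁ t₂ _ _ h₁ h₂ => rw [star_add]; exact add_mem h₁ h₂
  | smul z t _ h => rw [star_smul]; exact Submodule.smul_mem _ _ h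
  | mem t ht =>
    obtain ⟨b, a, c, rfl⟩ := ht
    refine Submodule.subset_span ⟨star b, star a, star c, ?_⟩
    rw [star_sub, TensorProduct.star_tmul, TensorProduct.star_tmul, 𝒜.star_sL', 𝒜.star_rL']

variable {𝒜} in
lemma star_balancedRight {t : A ⊗[ℂ] A} (ht : t ∈ 𝒜.balancedRight) : star t ∈ 𝒜.balancedLeft := by
  induction ht using Submodule.span_induction with
  | zero => rw [star_zero]; exact zero_mem _
  | add t₁ t₂ _ _ h₁ h₂ => rw [star_add]; exact add_mem h₁ h₂
  | smul z t _ h => rw [star_smul]; exact Submodule.smul_mem _ _ h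
  | mem t ht =>
    obtain ⟨b, a, c, rfl⟩ := ht
    refine Submodule.subset_span ⟨star b, star a, star c, ?_⟩
    rw [star_sub, TensorProduct.star_tmul, TensorProduct.star_tmul, 𝒜.star_sR, 𝒜.star_rR]

/-! ### Nondegeneracy -/

/-- The element `u ⊗ u` for `u ∈ A_{e,e}`. -/
def unitProd {u : A} (hu : u ∈ 𝒜.gr 1 1) : 𝒜.prodGamma :=
  ⟨u ⊗ₜ u, 𝒜.mem_prodGamma_of_matched (γ := 1) (γ'' := 1)
    (Submodule.subset_span ⟨1, u, u, hu, hu, rfl⟩)⟩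

lemma mul_tmul_eq (u : A) (t : A ⊗[ℂ] A) : t * (u ⊗ₜ u) = mulR₁ u (mulR₂ u t) := by
  induction t using TensorProduct.induction_on with
  | zero => simp
  | add t₁ t₂ h₁ h₂ => simp only [add_mul, map_add, h₁, h₂]
  | tmul a c => simp [mulR₁_tmul, mulR₂_tmul]

lemma tmul_mul_eq (u : A) (t : A ⊗[ℂ] A) : (u ⊗ₜ u) * t = mulL₁ u (mulL₂ u t) := by
  induction t using TensorProduct.induction_on with
  | zero => simp
  | add t₁ t₂ h₁ h₂ => simp only [mul_add, map_add, h₁, h₂]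
  | tmul a c => simp [mulL₁_tmul, mulL₂_tmul]

lemma exists_mul_unitProd (g : 𝒜.prodGamma) : ∃ u, ∃ hu : u ∈ 𝒜.gr 1 1,
    g * 𝒜.unitProd hu = g := by
  obtain ⟨u, hu, -, h⟩ := 𝒜.exists_tensor_unit_right ∅ {(g : A ⊗[ℂ] A)}
  have h' := h g (by simp)
  exact ⟨u, hu, Subtype.ext ((mul_tmul_eq u _).trans (by rw [h'.2, h'.1]))⟩

lemma exists_unitProd_mul (g : 𝒜.prodGamma) : ∃ u, ∃ hu : u ∈ 𝒜.gr 1 1,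
    𝒜.unitProd hu * g = g := by
  obtain ⟨u, hu, -, h⟩ := 𝒜.exists_tensor_unit ∅ {(g : A ⊗[ℂ] A)}
  have h' := h g (by simp)
  exact ⟨u, hu, Subtype.ext ((tmul_mul_eq u _).trans (by rw [h'.2, h'.1]))⟩

variable {𝒜} in
-- Elements `u ⊗ u` with `u ∈ A_{e,e}` act as local units, so a class in the fiber product is
-- determined by its products. Identities of multipliers can therefore be read as identities of
-- representatives.
lemma toFiber_ext_right {g g' : 𝒜.prodGamma}
    (h : ∀ w, 𝒜.toFiber (g * w) = 𝒜.toFiber (g' * w)) : 𝒜.toFiber g = 𝒜.toFiber g' := by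
  obtain ⟨u, hu, e⟩ := 𝒜.exists_mul_unitProd (g - g')
  rw [toFiber_eq_iff, ← e, sub_mul]
  exact 𝒜.toFiber_eq_iff.1 (h _)

variable {𝒜} in
lemma toFiber_ext_left {g g' : 𝒜.prodGamma}
    (h : ∀ w, 𝒜.toFiber (w * g) = 𝒜.toFiber (w * g')) : 𝒜.toFiber g = 𝒜.toFiber g' := by
  obtain ⟨u, hu, e⟩ := 𝒜.exists_unitProd_mul (g - g')
  rw [toFiber_eq_iff, ← e, mul_sub]
  exact 𝒜.toFiber_eq_iff.1 (h _)

/-- The involution of `∑ A_{γ,γ'} ⊗ A_{γ',γ''}`. -/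
def starProd (w : 𝒜.prodGamma) : 𝒜.prodGamma := ⟨star (w : A ⊗[ℂ] A), 𝒜.star_mem_prodGamma w.2⟩

lemma toFiber_starProd (w : 𝒜.prodGamma) : 𝒜.toFiber (𝒜.starProd w) = star (𝒜.toFiber w) := rfl

end EvAlgebra

end FiberCalculus

/-! ## Representatives of products with the comultiplication -/

section Representatives

variable {B Γ A : Type*}
  [NonUnitalCommRing B] [Module ℂ B] [IsScalarTower ℂ B B] [SMulCommClass ℂ B B]
  [StarRing B] [StarModule ℂ B] [Group Γ]
  [NonUnitalRing A] [Module ℂ A] [IsScalarTower ℂ A A] [SMulCommClass ℂ A A]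
  [StarRing A] [StarModule ℂ A]

namespace EvAlgebra

variable {act : Γ →* (B ≃⋆ₐ[ℂ] B)} {𝒜 : EvAlgebra act A}

lemma Mult.left_mul {R : Type*} [NonUnitalRing R] [Module ℂ R] [IsScalarTower ℂ R R]
    [SMulCommClass ℂ R R] (T T' : Mult R) (x : R) : (T * T').left x = T.left (T'.left x) := rfl

/-- A multiplication operator by an element of one leg and its adjoint. -/
structure IsLeg (L L' : 𝒜.prodGamma →ₗ[ℂ] 𝒜.prodGamma) : Prop where
  mul : ∀ w w', L (w * w') = L w * w'
  mul' : ∀ w w', L' (w * w') = L' w * w'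
  ideal' : ∀ w ∈ 𝒜.fiberIdeal, L' w ∈ 𝒜.fiberIdeal
  adjoint : ∀ w v, 𝒜.starProd (L w) * v = 𝒜.starProd w * L' v
  graded : ∀ (w : 𝒜.prodGamma) (γ γ' : Γ), (w : A ⊗[ℂ] A) ∈ Submodule.span ℂ (𝒜.matched γ γ') →
    (L w : A ⊗[ℂ] A) ∈ Submodule.span ℂ (𝒜.matched γ γ')

/-- The product of the multiplier `T` with the operator `L` is the element represented by `g`. -/
def RepVia (T : Mult 𝒜.Fiber) (L : 𝒜.prodGamma →ₗ[ℂ] 𝒜.prodGamma) (g : 𝒜.prodGamma) : Prop :=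
  ∀ w, T.left (𝒜.toFiber (L w)) = 𝒜.toFiber (g * w)

/-- `t ↦ (u ⊗ 1) t` on `∑ A_{γ,γ'} ⊗ A_{γ',γ''}`. -/
def leg₁ {u : A} (hu : u ∈ 𝒜.gr 1 1) : 𝒜.prodGamma →ₗ[ℂ] 𝒜.prodGamma :=
  𝒜.mapProd (isGraded_mulLeft hu) 𝒜.isGraded_id

/-- `t ↦ (1 ⊗ u) t` on `∑ A_{γ,γ'} ⊗ A_{γ',γ''}`. -/
def leg₂ {u : A} (hu : u ∈ 𝒜.gr 1 1) : 𝒜.prodGamma →ₗ[ℂ] 𝒜.prodGamma :=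
  𝒜.mapProd 𝒜.isGraded_id (isGraded_mulLeft hu)

lemma coe_leg₁ {u : A} (hu : u ∈ 𝒜.gr 1 1) (w : 𝒜.prodGamma) :
    (leg₁ hu w : A ⊗[ℂ] A) = mulL₁ u (w : A ⊗[ℂ] A) := rfl

lemma star_mem_one {u : A} (hu : u ∈ 𝒜.gr 1 1) : star u ∈ 𝒜.gr 1 1 := by
  simpa using 𝒜.star_mem hu

lemma isLeg_leg₁ {u : A} (hu : u ∈ 𝒜.gr 1 1) : IsLeg (leg₁ hu) (leg₁ (star_mem_one hu)) where
  mul w w' := Subtype.ext (mulL₁_mul u _ _)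
  mul' w w' := Subtype.ext (mulL₁_mul _ _ _)
  ideal' w hw := mapProd_mem_fiberIdeal _ _ (mul_sL_one (star_mem_one hu)) (fun _ _ => rfl) hw
  adjoint w v := Subtype.ext (by
    change star (mulL₁ u (w : A ⊗[ℂ] A)) * (v : A ⊗[ℂ] A) = star (w : A ⊗[ℂ] A) * mulL₁ (star u) v
    rw [star_mulL₁, mulR₁_mul_left])
  graded w γ γ' h := map_mem_span_matched (isGraded_mulLeft hu) 𝒜.isGraded_id h

lemma isLeg_leg₂ {u : A} (hu : u ∈ 𝒜.gr 1 1) : IsLeg (leg₂ hu) (leg₂ (star_mem_one hu)) where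
  mul w w' := Subtype.ext (mulL₂_mul u _ _)
  mul' w w' := Subtype.ext (mulL₂_mul _ _ _)
  ideal' w hw := mapProd_mem_fiberIdeal _ _ (fun _ _ => rfl) (mul_rL_one (star_mem_one hu)) hw
  adjoint w v := Subtype.ext (by
    change star (mulL₂ u (w : A ⊗[ℂ] A)) * (v : A ⊗[ℂ] A) = star (w : A ⊗[ℂ] A) * mulL₂ (star u) v
    rw [star_mulL₂, mulR₂_mul_left])
  graded w γ γ' h := map_mem_span_matched 𝒜.isGraded_id (isGraded_mulLeft hu) h

lemma rightOne_iff {T : Mult 𝒜.Fiber} {u : A} (hu : u ∈ 𝒜.gr 1 1) {g : 𝒜.prodGamma} :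
    𝒜.RightOne T u g ↔ RepVia T (leg₁ hu) g :=
  ⟨fun h w => h w _ rfl, fun h w w' e => by
    rw [show w' = leg₁ hu w from Subtype.ext e]; exact h w⟩

lemma rightTwo_iff {T : Mult 𝒜.Fiber} {u : A} (hu : u ∈ 𝒜.gr 1 1) {g : 𝒜.prodGamma} :
    𝒜.RightTwo T u g ↔ RepVia T (leg₂ hu) g :=
  ⟨fun h w => h w _ rfl, fun h w w' e => by
    rw [show w' = leg₂ hu w from Subtype.ext e]; exact h w⟩

section RepVia

variable {T T' : Mult 𝒜.Fiber} {L L' : 𝒜.prodGamma →ₗ[ℂ] 𝒜.prodGamma} {g g' : 𝒜.prodGamma}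

lemma RepVia.unique (h : RepVia T L g) (h' : RepVia T L g') : 𝒜.toFiber g = 𝒜.toFiber g' :=
  toFiber_ext_right fun w => by rw [← h, ← h']

lemma RepVia.congr (h : RepVia T L g) (e : 𝒜.toFiber g = 𝒜.toFiber g') : RepVia T L g' :=
  fun w => by rw [h, toFiber_mul, e, toFiber_mul]

lemma RepVia.add (h : RepVia T L g) (h' : RepVia T' L g') : RepVia (T + T') L (g + g') :=
  fun w => by rw [Mult.left_add, LinearMap.add_apply, h, h', add_mul, map_add]

lemma RepVia.smul (z : ℂ) (h : RepVia T L g) : RepVia (z • T) L (z • g) :=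
  fun w => by rw [Mult.left_smul, LinearMap.smul_apply, h, smul_mul_assoc, map_smul]

lemma repVia_zero : RepVia (0 : Mult 𝒜.Fiber) L 0 :=
  fun w => by
    rw [zero_mul, map_zero]
    have h := Mult.left_smul (0 : ℂ) (0 : Mult 𝒜.Fiber)
    rw [zero_smul, zero_smul] at h
    rw [h]; rfl

lemma exists_rep_of_mem_fiberGr {γ γ' : Γ} {v : 𝒜.Fiber} (hv : v ∈ 𝒜.fiberGr γ γ') :
    ∃ g : 𝒜.prodGamma, (g : A ⊗[ℂ] A) ∈ Submodule.span ℂ (𝒜.matched γ γ') ∧ 𝒜.toFiber g = v := by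
  unfold fiberGr at hv
  induction hv using Submodule.span_induction with
  | zero => exact ⟨0, zero_mem _, map_zero _⟩
  | add t₁ t₂ _ _ h₁ h₂ =>
    obtain ⟨g₁, h₁, rfl⟩ := h₁
    obtain ⟨g₂, h₂, rfl⟩ := h₂
    exact ⟨g₁ + g₂, add_mem h₁ h₂, map_add _ _ _⟩
  | smul z t _ h =>
    obtain ⟨g, h, rfl⟩ := h
    exact ⟨z • g, Submodule.smul_mem _ _ h, map_smul _ _ _⟩
  | mem v hv =>
    obtain ⟨x, hx, rfl⟩ := hv
    exact ⟨x, Submodule.subset_span hx, rfl⟩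

lemma toFiber_mem_fiberGr {γ γ' : Γ} {g : 𝒜.prodGamma}
    (hg : (g : A ⊗[ℂ] A) ∈ Submodule.span ℂ (𝒜.matched γ γ')) : 𝒜.toFiber g ∈ 𝒜.fiberGr γ γ' := by
  obtain ⟨g, hg'⟩ := g
  change g ∈ _ at hg
  induction hg using Submodule.span_induction with
  | zero => exact (map_zero 𝒜.toFiber).symm ▸ zero_mem (𝒜.fiberGr γ γ')
  | add t₁ t₂ m₁ m₂ h₁ h₂ =>
    have := add_mem (h₁ (𝒜.mem_prodGamma_of_matched m₁)) (h₂ (𝒜.mem_prodGamma_of_matched m₂))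
    rw [← map_add] at this
    exact this
  | smul z t m h =>
    have := Submodule.smul_mem _ z (h (𝒜.mem_prodGamma_of_matched m))
    rw [← map_smul] at this
    exact this
  | mem v hv => exact Submodule.subset_span ⟨_, hv, rfl⟩

variable {Δ : A →⋆ₙₐ[ℂ] Mult 𝒜.Fiber} (hΔ : 𝒜.IsComultiplication Δ)

include hΔ in
/-- The product of `Δ(a)` for homogeneous `a` has a homogeneous representative. -/
lemma RepVia.exists_graded (hL : IsLeg L L') {γ γ' : Γ} {a : A} (ha : a ∈ 𝒜.gr γ γ')
    (h : RepVia (Δ a) L g) : ∃ g₁ : 𝒜.prodGamma,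
      (g₁ : A ⊗[ℂ] A) ∈ Submodule.span ℂ (𝒜.matched γ γ') ∧ RepVia (Δ a) L g₁ := by
  -- Applying `Δ(a)` to `L(u ⊗ u)`, which has degree `(e, e)`, returns the class of `g`; gradedness
  -- of `Δ` places it in the degree of `a`.
  obtain ⟨u, hu, e⟩ := 𝒜.exists_mul_unitProd g
  have h1 : (𝒜.unitProd hu : A ⊗[ℂ] A) ∈ Submodule.span ℂ (𝒜.matched 1 1) :=
    Submodule.subset_span ⟨1, u, u, hu, hu, rfl⟩
  have h2 := hΔ.graded_left ha (toFiber_mem_fiberGr (hL.graded _ _ _ h1))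
  rw [h, e, mul_one, mul_one] at h2
  obtain ⟨g₁, hg, e'⟩ := exists_rep_of_mem_fiberGr h2
  exact ⟨g₁, hg, h.congr e'.symm⟩

/-- The representatives of `Δ(y)* Δ(y')`. -/
lemma RepVia.star_mul {M : 𝒜.prodGamma →ₗ[ℂ] 𝒜.prodGamma} {h : 𝒜.prodGamma} (hL : IsLeg L L')
    {y y' : A} (hg : RepVia (Δ y) L g) (hg' : RepVia (Δ y') M g')
    (hh : RepVia (Δ (star y * y')) M h) :
    𝒜.toFiber (𝒜.starProd g * g') = 𝒜.toFiber (L' h) := by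
  -- In terms of multipliers: `w* g* v = (Δ(y) L w)* v = (L w)* (Δ(y)* v) = w* L'(Δ(y)* v)`.
  have adj : ∀ w v, (Δ y).left (𝒜.toFiber (L w)) = 𝒜.toFiber (g * w) →
      ∀ z, (star (Δ y)).left (𝒜.toFiber v) = 𝒜.toFiber z →
      𝒜.toFiber (𝒜.starProd w * (𝒜.starProd g * v)) = 𝒜.toFiber (𝒜.starProd w * L' z) := by
    intro w v hw z hz
    have e0 : 𝒜.toFiber (𝒜.starProd w * L' z) =
        𝒜.toFiber (𝒜.starProd (L w)) * 𝒜.toFiber z := by rw [← hL.adjoint, toFiber_mul]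
    rw [e0, ← hz, ← (star (Δ y)).right_mul_left]
    have e1 : (star (Δ y)).right (𝒜.toFiber (𝒜.starProd (L w))) =
        star ((Δ y).left (𝒜.toFiber (L w))) := by
      change star ((Δ y).left (star (star (𝒜.toFiber (L w))))) = _
      rw [star_star]
    rw [e1, hw, ← toFiber_starProd, ← toFiber_mul]
    congr 1
    refine Subtype.ext ?_
    change star (w : A ⊗[ℂ] A) * (star (g : A ⊗[ℂ] A) * v) = star ((g : A ⊗[ℂ] A) * w) * v
    rw [StarMul.star_mul, mul_assoc]
  have hL' : ∀ z z' : 𝒜.prodGamma, 𝒜.toFiber z = 𝒜.toFiber z' →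
      𝒜.toFiber (L' z) = 𝒜.toFiber (L' z') := fun z z' e => by
    rw [toFiber_eq_iff] at e ⊢
    rw [← map_sub]
    exact hL.ideal' _ e
  refine toFiber_ext_right fun v => ?_
  refine toFiber_ext_left fun w => ?_
  obtain ⟨w, rfl⟩ : ∃ w', w = 𝒜.starProd w' := ⟨𝒜.starProd w, Subtype.ext (star_star _).symm⟩
  have key := adj w (g' * v) (hg w) (h * v) (by
    rw [← hg', ← hh, map_mul, map_star]; rfl)
  rw [mul_assoc, key, hL.mul']

lemma map_mul_left {f g : A →ₗ[ℂ] A} (hf : ∀ x y, f (x * y) = f x * y)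
    (hg : ∀ x y, g (x * y) = g x * y) (t t' : A ⊗[ℂ] A) :
    TensorProduct.map f g (t * t') = TensorProduct.map f g t * t' := by
  induction t using TensorProduct.induction_on with
  | zero => simp
  | add t₁ t₂ h₁ h₂ => simp only [add_mul, map_add, h₁, h₂]
  | tmul a c =>
    induction t' using TensorProduct.induction_on with
    | zero => simp
    | add t₁ t₂ h₁ h₂ => simp only [mul_add, map_add, h₁, h₂]
    | tmul a' c' => simp [hf, hg]

include hΔ in
lemma RepVia.r_linear {y : A} (b : B) (h : RepVia (Δ y) L g) :
    RepVia (Δ (𝒜.rL b y)) L (𝒜.mapProd (𝒜.isGraded_rL b) 𝒜.isGraded_id g) :=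
  fun w => hΔ.r_linear b y _ (g * w) _ (h w)
    (map_mul_left (𝒜.rL_mul b) (fun _ _ => rfl) _ _).symm

include hΔ in
lemma RepVia.s_linear {y : A} (b : B) (h : RepVia (Δ y) L g) :
    RepVia (Δ (𝒜.sL b y)) L (𝒜.mapProd 𝒜.isGraded_id (𝒜.isGraded_sL b) g) :=
  fun w => hΔ.s_linear b y _ (g * w) _ (h w)
    (map_mul_left (fun _ _ => rfl) (𝒜.sL_mul b) _ _).symm

/-- Representatives for a unit `u` restrict to those for any `v` with `u v = v`. Two local units are
compared by restricting from a common larger one. -/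
lemma RepVia.shrink₁ {u v : A} (hu : u ∈ 𝒜.gr 1 1) (hv : v ∈ 𝒜.gr 1 1) (e : u * v = v)
    (h : RepVia T (leg₁ hu) g) :
    RepVia T (leg₁ hv) (𝒜.mapProd (isGraded_mulRight hv) 𝒜.isGraded_id g) := fun w => by
  have h1 := h (leg₁ hv w)
  have e1 : leg₁ hu (leg₁ hv w) = leg₁ hv w := Subtype.ext ((mulL₁_mulL₁ u v _).trans (by rw [e]; rfl))
  rw [e1] at h1
  rw [h1]
  exact congrArg _ (Subtype.ext (mulR₁_mul_left v _ _).symm)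

lemma RepVia.shrink₂ {u v : A} (hu : u ∈ 𝒜.gr 1 1) (hv : v ∈ 𝒜.gr 1 1) (e : u * v = v)
    (h : RepVia T (leg₂ hu) g) :
    RepVia T (leg₂ hv) (𝒜.mapProd 𝒜.isGraded_id (isGraded_mulRight hv) g) := fun w => by
  have h1 := h (leg₂ hv w)
  have e1 : leg₂ hu (leg₂ hv w) = leg₂ hv w := Subtype.ext ((mulL₂_mulL₂ u v _).trans (by rw [e]; rfl))
  rw [e1] at h1
  rw [h1]
  exact congrArg _ (Subtype.ext (mulR₂_mul_left v _ _).symm)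

end RepVia

/-! ### Canonical relations -/

/-- The relation "`t` represents `∑ y₁ x ⊗ y₂`", where `R y u g` says that `g` represents
`Δ(y) (u ⊗ 1)`. -/
def canRel (𝒜 : EvAlgebra act A) (R : A → A → A ⊗[ℂ] A → Prop) (x y : A) (t : A ⊗[ℂ] A) : Prop :=
  ∃ u ∈ 𝒜.gr 1 1, ∃ g, u * x = x ∧ R y u g ∧ t - mulR₁ x g ∈ 𝒜.balancedLeft

/-- The kernel of `A ⊗ A ⊗ A → ₛA ⊗_B ᵣAₛ ⊗_B ᵣA`. -/
def balancedTriple (𝒜 : EvAlgebra act A) : Submodule ℂ (A ⊗[ℂ] (A ⊗[ℂ] A)) :=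
  Submodule.span ℂ
    ({t | ∃ (b : B) (p q r : A), t = 𝒜.sL b p ⊗ₜ (q ⊗ₜ r) - p ⊗ₜ (𝒜.rL b q ⊗ₜ r)} ∪
      {t | ∃ (b : B) (p q r : A), t = p ⊗ₜ (𝒜.sL b q ⊗ₜ r) - p ⊗ₜ (q ⊗ₜ 𝒜.rL b r)})

/-- The properties of a comultiplication that enter the construction of its fundamental
unitary. -/
structure CoSystem (𝒜 : EvAlgebra act A) (φ : A →ₗ[ℂ] B) (R : A → A → A ⊗[ℂ] A → Prop) :
    Prop where
  mem : ∀ {y u g}, R y u g → g ∈ 𝒜.prodGamma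
  exists_graded : ∀ {γ γ' y u}, u ∈ 𝒜.gr 1 1 → y ∈ 𝒜.gr γ γ' →
    ∃ g ∈ Submodule.span ℂ (𝒜.matched γ γ'), R y u g
  zero : ∀ {u}, u ∈ 𝒜.gr 1 1 → R 0 u 0
  add : ∀ {y y' u g g'}, u ∈ 𝒜.gr 1 1 → R y u g → R y' u g' → R (y + y') u (g + g')
  star_mul : ∀ {y y' u u' g g' h}, u ∈ 𝒜.gr 1 1 → u' ∈ 𝒜.gr 1 1 → R y u g → R y' u' g' →
    R (star y * y') u' h → star g * g' - mulL₁ (star u) h ∈ 𝒜.balancedLeft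
  r_linear : ∀ {y u g} b, u ∈ 𝒜.gr 1 1 → R y u g → R (𝒜.rL b y) u ((𝒜.rL b).rTensor A g)
  s_linear : ∀ {y u g} b, u ∈ 𝒜.gr 1 1 → R y u g → R (𝒜.sL b y) u ((𝒜.sL b).lTensor A g)
  indep : ∀ {x y t t'}, 𝒜.canRel R x y t → 𝒜.canRel R x y t' → t - t' ∈ 𝒜.balancedLeft
  invariant : ∀ {x y t}, 𝒜.canRel R x y t →
    TensorProduct.lift (𝒜.sL ∘ₗ φ).flip t = 𝒜.rL (φ y) x
  dense : ∀ p q, ∃ (n : ℕ) (x y : Fin n → A) (t : Fin n → A ⊗[ℂ] A),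
    (∀ i, 𝒜.canRel R (x i) (y i) (t i)) ∧ ∑ i, t i - p ⊗ₜ q ∈ 𝒜.balancedLeft
  pentagon : ∀ x y z, ∃ (n m k : ℕ) (p q : Fin n → A) (t : Fin n → A ⊗[ℂ] A) (u v : Fin m → A)
    (f g : Fin m → Fin k → A) (s : Fin m → Fin k → A ⊗[ℂ] A),
    𝒜.canRel R y z (∑ i, p i ⊗ₜ q i) ∧ (∀ i, 𝒜.canRel R x (p i) (t i)) ∧
    𝒜.canRel R x y (∑ j, u j ⊗ₜ v j) ∧ (∀ j, 𝒜.canRel R (u j) z (∑ l, f j l ⊗ₜ g j l)) ∧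
    (∀ j l, 𝒜.canRel R (v j) (g j l) (s j l)) ∧
    ∑ i, TensorProduct.assoc ℂ A A A (t i ⊗ₜ q i) - ∑ j, ∑ l, f j l ⊗ₜ[ℂ] s j l ∈
      𝒜.balancedTriple

end EvAlgebra

end Representatives

/-! ## The canonical maps of a comultiplication -/

section Canonical

variable {B Γ A : Type*}
  [NonUnitalCommRing B] [Module ℂ B] [IsScalarTower ℂ B B] [SMulCommClass ℂ B B]
  [StarRing B] [StarModule ℂ B] [Group Γ]
  [NonUnitalRing A] [Module ℂ A] [IsScalarTower ℂ A A] [SMulCommClass ℂ A A]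
  [StarRing A] [StarModule ℂ A]

lemma exists_fin_sum_tmul {M N : Type*} [AddCommGroup M] [Module ℂ M] [AddCommGroup N] [Module ℂ N]
    (t : M ⊗[ℂ] N) : ∃ (n : ℕ) (p : Fin n → M) (q : Fin n → N), t = ∑ i, p i ⊗ₜ[ℂ] q i := by
  induction t using TensorProduct.induction_on with
  | zero => exact ⟨0, Fin.elim0, Fin.elim0, by simp⟩
  | tmul x y => exact ⟨1, fun _ => x, fun _ => y, by simp⟩
  | add s t hs ht =>
    obtain ⟨n, p, q, rfl⟩ := hs
    obtain ⟨m, p', q', rfl⟩ := ht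
    exact ⟨n + m, Fin.append p p', Fin.append q q', by simp [Fin.sum_univ_add]⟩

/-- The involution exchanges `♯` and `♭`, hence passes between the two counit identities. -/
lemma Crossed.flat_star (act : Γ →* (B ≃⋆ₐ[ℂ] B)) (f : Crossed B Γ) :
    Crossed.flat act (Crossed.star act f) = Star.star (Crossed.sharp f) := by
  have h : Crossed.sharp f = ∑ γ ∈ f.support, f γ := rfl
  rw [Crossed.star, Finsupp.sum, map_sum, h, star_sum]
  refine Finset.sum_congr rfl fun γ _ => ?_
  rw [Crossed.flat, Finsupp.lsum_single]
  change act γ⁻¹⁻¹ (act γ⁻¹ _) = _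
  rw [inv_inv, act_act_inv]

namespace EvAlgebra

variable {act : Γ →* (B ≃⋆ₐ[ℂ] B)} {𝒜 : EvAlgebra act A} {Δ : A →⋆ₙₐ[ℂ] Mult 𝒜.Fiber}

lemma IsComultiplication.exists_rep₁ (hΔ : 𝒜.IsComultiplication Δ) (a : A) {u : A}
    (hu : u ∈ 𝒜.gr 1 1) : ∃ g, RepVia (Δ a) (leg₁ hu) g := by
  obtain ⟨g, hg⟩ := hΔ.right_one a 1 u hu
  exact ⟨g, (rightOne_iff hu).1 hg⟩

lemma IsComultiplication.exists_rep₂ (hΔ : 𝒜.IsComultiplication Δ) (a : A) {u : A}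
    (hu : u ∈ 𝒜.gr 1 1) : ∃ g, RepVia (Δ a) (leg₂ hu) g := by
  obtain ⟨g, hg⟩ := hΔ.right_two a 1 u hu
  exact ⟨g, (rightTwo_iff hu).1 hg⟩

lemma RepVia.isT₁ {x y u : A} {hu : u ∈ 𝒜.gr 1 1} {g : 𝒜.prodGamma}
    (h : RepVia (Δ x) (leg₂ hu) g) (e : u * y = y) : 𝒜.IsT₁ Δ x y (mulR₂ y g) :=
  ⟨u, hu, g, e, (rightTwo_iff hu).2 h, by rw [sub_self]; exact zero_mem _⟩

lemma RepVia.isT₄ {x y u : A} {hu : u ∈ 𝒜.gr 1 1} {g : 𝒜.prodGamma}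
    (h : RepVia (Δ y) (leg₁ hu) g) (e : u * x = x) : 𝒜.IsT₄ Δ x y (mulR₁ x g) :=
  ⟨u, hu, g, e, (rightOne_iff hu).2 h, by rw [sub_self]; exact zero_mem _⟩

lemma IsComultiplication.exists_T₁ (hΔ : 𝒜.IsComultiplication Δ) (x y : A) :
    ∃ t, 𝒜.IsT₁ Δ x y t := by
  obtain ⟨u, hu, e⟩ := 𝒜.exists_unit {y}
  obtain ⟨g, hg⟩ := hΔ.exists_rep₂ x hu
  exact ⟨_, hg.isT₁ (e y (by simp))⟩

lemma IsComultiplication.exists_T₄ (hΔ : 𝒜.IsComultiplication Δ) (x y : A) :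
    ∃ t, 𝒜.IsT₄ Δ x y t := by
  obtain ⟨u, hu, e⟩ := 𝒜.exists_unit {x}
  obtain ⟨g, hg⟩ := hΔ.exists_rep₁ y hu
  exact ⟨_, hg.isT₄ (e x (by simp))⟩

lemma sub_mem_trans {V : Type*} [AddCommGroup V] [Module ℂ V] {M : Submodule ℂ V} {a b c : V}
    (h : a - b ∈ M) (h' : b - c ∈ M) : a - c ∈ M := by
  simpa using add_mem h h'

lemma sub_mem_symm {V : Type*} [AddCommGroup V] [Module ℂ V] {M : Submodule ℂ V} {a b : V}
    (h : a - b ∈ M) : b - a ∈ M := by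
  simpa using neg_mem h

/-- `T₁(x ⊗ y)` can be computed with any local unit. -/
lemma IsT₁.sub_mem (hΔ : 𝒜.IsComultiplication Δ) {x y : A} {t : A ⊗[ℂ] A} (h : 𝒜.IsT₁ Δ x y t)
    {v : A} {hv : v ∈ 𝒜.gr 1 1} {g : 𝒜.prodGamma} (hg : RepVia (Δ x) (leg₂ hv) g)
    (e : v * y = y) : t - mulR₂ y g ∈ 𝒜.balancedLeft := by
  classical
  obtain ⟨u, hu, G, e', hG, ht⟩ := h
  rw [rightTwo_iff hu] at hG
  -- The representatives for `u` and for `v` are both restrictions of one for `w`.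
  obtain ⟨w, hw, hw'⟩ := 𝒜.exists_unit {u, v}
  obtain ⟨K, hK⟩ := hΔ.exists_rep₂ x hw
  have aux : ∀ {u : A} (hu : u ∈ 𝒜.gr 1 1) {G : 𝒜.prodGamma}, RepVia (Δ x) (leg₂ hu) G →
      w * u = u → u * y = y → mulR₂ y (G : A ⊗[ℂ] A) - mulR₂ y K ∈ 𝒜.balancedLeft := by
    intro u hu G hG e e'
    have := mulR₂_balancedLeft y (toFiber_eq_left (hG.unique (hK.shrink₂ hw hu e)))
    rw [map_sub] at this
    change _ - mulR₂ y (mulR₂ u (K : A ⊗[ℂ] A)) ∈ _ at this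
    rwa [mulR₂_mulR₂, e'] at this
  exact sub_mem_trans ht (sub_mem_trans (aux hu hG (hw' u (by simp)) e')
    (sub_mem_symm (aux hv hg (hw' v (by simp)) e)))

lemma IsT₄.sub_mem (hΔ : 𝒜.IsComultiplication Δ) {x y : A} {t : A ⊗[ℂ] A} (h : 𝒜.IsT₄ Δ x y t)
    {v : A} {hv : v ∈ 𝒜.gr 1 1} {g : 𝒜.prodGamma} (hg : RepVia (Δ y) (leg₁ hv) g)
    (e : v * x = x) : t - mulR₁ x g ∈ 𝒜.balancedLeft := by
  classical
  obtain ⟨u, hu, G, e', hG, ht⟩ := h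
  rw [rightOne_iff hu] at hG
  obtain ⟨w, hw, hw'⟩ := 𝒜.exists_unit {u, v}
  obtain ⟨K, hK⟩ := hΔ.exists_rep₁ y hw
  have aux : ∀ {u : A} (hu : u ∈ 𝒜.gr 1 1) {G : 𝒜.prodGamma}, RepVia (Δ y) (leg₁ hu) G →
      w * u = u → u * x = x → mulR₁ x (G : A ⊗[ℂ] A) - mulR₁ x K ∈ 𝒜.balancedLeft := by
    intro u hu G hG e e'
    have := mulR₁_balancedLeft x (toFiber_eq_left (hG.unique (hK.shrink₁ hw hu e)))
    rw [map_sub] at this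
    change _ - mulR₁ x (mulR₁ u (K : A ⊗[ℂ] A)) ∈ _ at this
    rwa [mulR₁_mulR₁, e'] at this
  exact sub_mem_trans ht (sub_mem_trans (aux hu hG (hw' u (by simp)) e')
    (sub_mem_symm (aux hv hg (hw' v (by simp)) e)))

lemma IsT₁.indep (hΔ : 𝒜.IsComultiplication Δ) {x y : A} {t t' : A ⊗[ℂ] A}
    (h : 𝒜.IsT₁ Δ x y t) (h' : 𝒜.IsT₁ Δ x y t') : t - t' ∈ 𝒜.balancedLeft := by
  obtain ⟨u, hu, g, e, hg, ht⟩ := h'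
  exact sub_mem_trans (h.sub_mem hΔ ((rightTwo_iff hu).1 hg) e) (sub_mem_symm ht)

lemma IsT₄.indep (hΔ : 𝒜.IsComultiplication Δ) {x y : A} {t t' : A ⊗[ℂ] A}
    (h : 𝒜.IsT₄ Δ x y t) (h' : 𝒜.IsT₄ Δ x y t') : t - t' ∈ 𝒜.balancedLeft := by
  obtain ⟨u, hu, g, e, hg, ht⟩ := h'
  exact sub_mem_trans (h.sub_mem hΔ ((rightOne_iff hu).1 hg) e) (sub_mem_symm ht)

/-- `T₄(a ⊗ p) (1 ⊗ y) = T₁(p ⊗ y) (a ⊗ 1)` -/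
lemma IsT₄.mulR₂_sub {a p y : A} {t τ : A ⊗[ℂ] A} (h : 𝒜.IsT₄ Δ a p t) (h' : 𝒜.IsT₁ Δ p y τ) :
    mulR₂ y t - mulR₁ a τ ∈ 𝒜.balancedLeft := by
  obtain ⟨u, hu, g, eu, hg, ht⟩ := h
  obtain ⟨v, hv, G, ev, hG, hτ⟩ := h'
  rw [rightOne_iff hu] at hg
  rw [rightTwo_iff hv] at hG
  have key : 𝒜.toFiber (𝒜.mapProd 𝒜.isGraded_id (isGraded_mulRight hv) g) =
      𝒜.toFiber (𝒜.mapProd (isGraded_mulRight hu) 𝒜.isGraded_id G) := by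
    refine toFiber_ext_right fun w => ?_
    have e1 : 𝒜.mapProd 𝒜.isGraded_id (isGraded_mulRight hv) g * w = g * leg₂ hv w :=
      Subtype.ext (mulR₂_mul_left v _ _)
    have e2 : 𝒜.mapProd (isGraded_mulRight hu) 𝒜.isGraded_id G * w = G * leg₁ hu w :=
      Subtype.ext (mulR₁_mul_left u _ _)
    have e3 : leg₁ hu (leg₂ hv w) = leg₂ hv (leg₁ hu w) := Subtype.ext (mulL₁_mulL₂ u v _)
    rw [e1, e2, ← hg, ← hG, e3]
  have h1 := mulR₁_balancedLeft a (mulR₂_balancedLeft y (toFiber_eq_left key))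
  change mulR₁ a (mulR₂ y (mulR₂ v (g : A ⊗[ℂ] A) - mulR₁ u (G : A ⊗[ℂ] A))) ∈ _ at h1
  rw [map_sub, map_sub, mulR₂_mulR₂, ev, ← mulR₁_mulR₂ u, mulR₁_mulR₁, eu, mulR₁_mulR₂] at h1
  have h2 := mulR₂_balancedLeft y ht
  have h3 := mulR₁_balancedLeft a hτ
  rw [map_sub] at h2 h3
  exact sub_mem_trans h2 (sub_mem_trans h1 (sub_mem_symm h3))

/-- `((a ⊗ 1) Δ(f)) (1 ⊗ u) = (a ⊗ 1) (Δ(f) (1 ⊗ u))` -/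
lemma IsT₁.mulR₂_sub_of_leftOne {a f u : A} (ha : a ∈ 𝒜.gr 1 1) {τ : 𝒜.prodGamma}
    (hτ : 𝒜.LeftOne (Δ f) a τ) {s : A ⊗[ℂ] A} (hs : 𝒜.IsT₁ Δ f u s) :
    mulR₂ u (τ : A ⊗[ℂ] A) - mulL₁ a s ∈ 𝒜.balancedLeft := by
  obtain ⟨v, hv, G, ev, hG, hs⟩ := hs
  rw [rightTwo_iff hv] at hG
  have key : 𝒜.toFiber (𝒜.mapProd 𝒜.isGraded_id (isGraded_mulRight hv) τ) =
      𝒜.toFiber (leg₁ ha G) := by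
    refine toFiber_ext_right fun w' => toFiber_ext_left fun w => ?_
    have e1 : w * (𝒜.mapProd 𝒜.isGraded_id (isGraded_mulRight hv) τ * w') =
        (w * τ) * leg₂ hv w' := by
      rw [mul_assoc]; exact congrArg _ (Subtype.ext (mulR₂_mul_left v _ _))
    have e2 : w * (leg₁ ha G * w') = 𝒜.mapProd (isGraded_mulRight ha) 𝒜.isGraded_id w * (G * w') := by
      refine Subtype.ext ?_
      change (w : A ⊗[ℂ] A) * (mulL₁ a (G : A ⊗[ℂ] A) * w') = mulR₁ a (w : A ⊗[ℂ] A) * (G * w')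
      rw [mulR₁_mul_left, mulL₁_mul]
    rw [e1, e2, toFiber_mul _ (w * τ), toFiber_mul, toFiber_mul _ (𝒜.mapProd _ _ w), ← hG,
      ← hτ w (𝒜.mapProd (isGraded_mulRight ha) 𝒜.isGraded_id w) rfl, Mult.right_mul_left]
  have h1 := mulR₂_balancedLeft u (toFiber_eq_left key)
  change mulR₂ u (mulR₂ v (τ : A ⊗[ℂ] A) - mulL₁ a (G : A ⊗[ℂ] A)) ∈ _ at h1
  rw [map_sub, mulR₂_mulR₂, ev, ← mulL₁_mulR₂] at h1
  have h2 := mulL₁_balancedLeft ha hs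
  rw [map_sub] at h2
  exact sub_mem_trans h1 (sub_mem_symm h2)

/-! ### The involution -/

lemma LeftOne.star {y u : A} {g : 𝒜.prodGamma} (h : 𝒜.LeftOne (Δ y) u g) :
    𝒜.RightOne (Δ (star y)) (star u) (𝒜.starProd g) := by
  intro w w' e
  have h1 := h (𝒜.starProd w) (𝒜.starProd w') (by
    change Star.star (w' : A ⊗[ℂ] A) = mulR₁ u (Star.star (w : A ⊗[ℂ] A))
    rw [e, star_mulL₁, star_star])
  rw [map_star]
  change Star.star ((Δ y).right (Star.star (𝒜.toFiber w'))) = _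
  rw [← toFiber_starProd, h1, StarMul.star_mul, toFiber_starProd, toFiber_starProd, star_star]

lemma RightOne.star {y u : A} {g : 𝒜.prodGamma} (h : 𝒜.RightOne (Δ y) u g) :
    𝒜.LeftOne (Δ (star y)) (star u) (𝒜.starProd g) := by
  intro w w' e
  have h1 := h (𝒜.starProd w) (𝒜.starProd w') (by
    change Star.star (w' : A ⊗[ℂ] A) = mulL₁ u (Star.star (w : A ⊗[ℂ] A))
    rw [e, star_mulR₁, star_star])
  rw [map_star]
  change Star.star ((Δ y).left (Star.star (𝒜.toFiber w'))) = _
  rw [← toFiber_starProd, h1, StarMul.star_mul, toFiber_starProd, toFiber_starProd, star_star]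

lemma IsT₂.star {x y : A} {t : A ⊗[ℂ] A} (h : 𝒜.IsT₂ Δ x y t) :
    𝒜.IsT₄ Δ (star x) (star y) (star t) := by
  obtain ⟨u, hu, g, e, hg, ht⟩ := h
  refine ⟨Star.star u, star_mem_one hu, 𝒜.starProd g, by rw [← StarMul.star_mul, e], hg.star, ?_⟩
  have := star_balancedRight ht
  rwa [star_sub, star_mulL₁] at this

lemma IsT₄.star {x y : A} {t : A ⊗[ℂ] A} (h : 𝒜.IsT₄ Δ x y t) :
    𝒜.IsT₂ Δ (star x) (star y) (star t) := by
  obtain ⟨u, hu, g, e, hg, ht⟩ := h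
  refine ⟨Star.star u, star_mem_one hu, 𝒜.starProd g, by rw [← StarMul.star_mul, e], hg.star, ?_⟩
  have := star_balancedLeft ht
  rwa [star_sub, star_mulR₁] at this

/-- The map `m ⊗ n ↦ m S(n)`. -/
def mulS (S : A ≃ₗ[ℂ] A) : A ⊗[ℂ] A →ₗ[ℂ] A :=
  TensorProduct.lift ((LinearMap.mul ℂ A).compl₂ (S : A →ₗ[ℂ] A))

lemma mulS_tmul (S : A ≃ₗ[ℂ] A) (m n : A) : mulS S (m ⊗ₜ n) = m * S n := rfl

/-! ### The antipode and the range of `T₁` -/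

section Antipode

variable {ε : A →ₗ[ℂ] Crossed B Γ} {S : A ≃ₗ[ℂ] A}

lemma IsAntipode.map_rR (hS : 𝒜.IsAntipode Δ ε S) (b : B) (x : A) :
    S (𝒜.rR b x) = 𝒜.sL b (S x) :=
  LinearMap.congr_fun (f := S.toLinearMap ∘ₗ 𝒜.rR b) (g := 𝒜.sL b ∘ₗ S.toLinearMap) (𝒜.hom_ext
    fun γ γ' x hx => by
      change S (𝒜.rR b x) = 𝒜.sL b (S x)
      rw [𝒜.rR_eq b hx, hS.r_linear, 𝒜.sR_eq _ (hS.graded hx), act_inv_act]) x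

lemma IsAntipode.mulS_balancedRight (hS : 𝒜.IsAntipode Δ ε S) {t : A ⊗[ℂ] A}
    (ht : t ∈ 𝒜.balancedRight) : mulS S t = 0 := by
  refine (Submodule.mem_bot ℂ).1 (span_map_le (f := mulS S) ?_ ht)
  rintro _ ⟨b, a, c, rfl⟩
  rw [Submodule.mem_bot, map_sub, mulS_tmul, mulS_tmul, hS.map_rR, 𝒜.mul_sL', sub_self]

lemma mulS_mulL₁ (x : A) (t : A ⊗[ℂ] A) : mulS S (mulL₁ x t) = x * mulS S t :=
  tensor_induction_eq (f := mulS S ∘ₗ mulL₁ x) (g := LinearMap.mulLeft ℂ x ∘ₗ mulS S)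
    (fun a c => by simp [mulL₁_tmul, mulS_tmul, mul_assoc]) t

lemma IsAntipode.mulS_mulL₂ (hS : 𝒜.IsAntipode Δ ε S) (x : A) (t : A ⊗[ℂ] A) :
    mulS S (mulL₂ x t) = mulS S t * S x :=
  tensor_induction_eq (f := mulS S ∘ₗ mulL₂ x) (g := LinearMap.mulRight ℂ (S x) ∘ₗ mulS S)
    (fun a c => by simp [mulL₂_tmul, mulS_tmul, mul_assoc, hS.map_mul]) t

/-- `∑ v₁ S(q v₂) = r(ε♯(v)) S(q)` -/
lemma IsAntipode.mulS_eq (hΔ : 𝒜.IsComultiplication Δ) (hS : 𝒜.IsAntipode Δ ε S) {v q : A}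
    {t : A ⊗[ℂ] A} (h : 𝒜.IsT₁ Δ (star v) (star q) (star t)) :
    mulS S t = 𝒜.rL (Crossed.sharp (ε v)) (S q) := by
  -- After left multiplication by `x` the sum is computed from `T₂(x ⊗ v)`: `∑ x v₁ S(q v₂) = (∑ x
  -- v₁ S(v₂)) S(q) = x r(ε♯(v)) S(q)`.
  refine sub_eq_zero.1 (𝒜.eq_zero_of_mul _ fun x => ?_)
  obtain ⟨t₂, ht₂⟩ := hΔ.exists_T₄ (star x) (star v)
  have h1 := star_balancedLeft (ht₂.mulR₂_sub h)
  rw [star_sub, star_mulR₂, star_mulR₁, star_star, star_star, star_star] at h1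
  have h2 := hS.mulS_balancedRight h1
  have h3 := hS.antipode_right x v (star t₂) (by simpa using ht₂.star)
  change mulS S (star t₂) = _ at h3
  rw [map_sub, hS.mulS_mulL₂, mulS_mulL₁, h3, ← 𝒜.mul_rL', ← mul_sub] at h2
  rw [← neg_sub, mul_neg, h2, neg_zero]

/-- `∑ s(ε♯(p₂)) p₁ a = p a` -/
lemma IsCounit.lift_T₄ (hε : 𝒜.IsCounit Δ ε) {a p : A} {t : A ⊗[ℂ] A} (h : 𝒜.IsT₄ Δ a p t) :
    TensorProduct.lift (𝒜.sL ∘ₗ Crossed.sharp ∘ₗ ε).flip t = p * a := by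
  have h1 := congrArg star (hε.counit_right _ _ _ h.star)
  rw [StarMul.star_mul, star_star, star_star] at h1
  rw [← h1]
  clear h h1
  induction t using TensorProduct.induction_on with
  | zero => simp
  | add s t hs ht => simp only [map_add, star_add, hs, ht]
  | tmul m n =>
    rw [TensorProduct.star_tmul]
    change 𝒜.sL (Crossed.sharp (ε n)) m = star (𝒜.sR (Crossed.flat act (ε (star n))) (star m))
    rw [𝒜.star_sR, star_star, hε.map_star, Crossed.flat_star, star_star]

/-- The conjugate linear map `p ⊗ (m ⊗ n) ↦ p* ⊗ m* S(n*)`. -/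
def starMulS (S : A ≃ₗ[ℂ] A) : A ⊗[ℂ] (A ⊗[ℂ] A) →ₗ⋆[ℂ] A ⊗[ℂ] A :=
  TensorProduct.lift (LinearMap.mk₂'ₛₗ (starRingEnd ℂ) (starRingEnd ℂ)
    (fun (p : A) (t : A ⊗[ℂ] A) => star p ⊗ₜ[ℂ] mulS S (star t))
    (by simp [TensorProduct.add_tmul]) (by simp [TensorProduct.smul_tmul'])
    (by simp [TensorProduct.tmul_add]) (by simp))

lemma starMulS_tmul (p : A) (t : A ⊗[ℂ] A) :
    starMulS S (p ⊗ₜ t) = star p ⊗ₜ mulS S (star t) := rfl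

/-- The last two legs are contracted by multiplication after applying `S`. Since `S` exchanges `r`
and `s`, this absorbs the balancing between them. The involution turns the right balancing of the
first two legs into a left one. -/
lemma IsAntipode.starMulS_balancedMixed (hS : 𝒜.IsAntipode Δ ε S) {t : A ⊗[ℂ] (A ⊗[ℂ] A)}
    (ht : t ∈ 𝒜.balancedMixed) : starMulS S t ∈ 𝒜.balancedLeft := by
  refine span_map_le (f := starMulS S) ?_ ht
  rintro _ (⟨b, a, m, c, rfl⟩ | ⟨b, a, m, c, rfl⟩)
  · rw [map_sub, starMulS_tmul, starMulS_tmul, TensorProduct.star_tmul, TensorProduct.star_tmul,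
      mulS_tmul, mulS_tmul, 𝒜.star_sR, 𝒜.star_rR, ← 𝒜.rL_mul]
    exact Submodule.subset_span ⟨_, _, _, rfl⟩
  · rw [map_sub, starMulS_tmul, starMulS_tmul, TensorProduct.star_tmul, TensorProduct.star_tmul,
      mulS_tmul, mulS_tmul, 𝒜.star_sL', 𝒜.star_rL', hS.map_rR, 𝒜.mul_sL', sub_self]
    exact zero_mem _

lemma IsAntipode.starMulS_assoc (hS : 𝒜.IsAntipode Δ ε S) (t : A ⊗[ℂ] A) (q : A) :
    starMulS S (TensorProduct.assoc ℂ A A A (star t ⊗ₜ star q)) = mulR₂ (S q) t := by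
  induction t using TensorProduct.induction_on with
  | zero => simp
  | add s t hs ht => simp only [star_add, TensorProduct.add_tmul, map_add, hs, ht]
  | tmul m n =>
    rw [TensorProduct.star_tmul, TensorProduct.assoc_tmul, starMulS_tmul, TensorProduct.star_tmul,
      mulS_tmul, star_star, star_star, star_star]
    rfl

/-- The range of `T₁` is everything. -/
lemma IsAntipode.exists_T₁_dense (hΔ : 𝒜.IsComultiplication Δ) (hε : 𝒜.IsCounit Δ ε)
    (hS : 𝒜.IsAntipode Δ ε S) (p₀ q₀ : A) :
    ∃ (n : ℕ) (x y : Fin n → A) (t : Fin n → A ⊗[ℂ] A),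
      (∀ i, 𝒜.IsT₁ Δ (x i) (y i) (t i)) ∧ ∑ i, t i - p₀ ⊗ₜ q₀ ∈ 𝒜.balancedLeft := by
  classical
  -- The preimage is `∑ p₁ ⊗ S(p₂) q₀` for `p₀`, obtained by applying `id ⊗ S` to `(1 ⊗ S⁻¹(q₀))
  -- Δ(p₀)`. Formally `T₁` maps it to `∑ p₁ ⊗ p₂ S(p₃) q₀ = ∑ p₁ ⊗ r(ε♯(p₂)) q₀ = ∑ s(ε♯(p₂)) p₁ ⊗
  -- q₀ = p₀ ⊗ q₀`.
  obtain ⟨t₃, ht₃⟩ := hΔ.exists_T₁ (star p₀) (star (S.symm q₀))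
  obtain ⟨n, p, q, e₃⟩ := exists_fin_sum_tmul (star t₃)
  choose τ hτ using fun i => hΔ.exists_T₁ (p i) (S (q i))
  obtain ⟨a, ha, ha₁, ha₂⟩ := 𝒜.exists_tensor_unit_right {p₀} (Finset.univ.image τ)
  obtain ⟨t₄, ht₄⟩ := hΔ.exists_T₄ a p₀
  obtain ⟨m, u, v, rfl⟩ := exists_fin_sum_tmul t₄
  choose t ht using fun i => hΔ.exists_T₄ a (p i)
  choose t' ht' using fun j => hΔ.exists_T₁ (star (v j)) (star (S.symm q₀))
  refine ⟨n, p, fun i => S (q i), τ, hτ, ?_⟩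
  -- Coassociativity is stated with factors on the far left and far right, so it is applied to
  -- adjoints with the extra factor `a*`. As `a` is a right unit for `p₀` and for the first legs of
  -- the `τ i`, it disappears afterwards.
  have h1 := hΔ.coassoc (star a) (star p₀) (star (S.symm q₀)) n m (fun i => star (p i))
    (fun i => star (q i)) (fun j => star (u j)) (fun j => star (v j)) (fun i => star (t i)) t'
    (by
      have := congrArg star e₃
      rw [star_star, star_sum] at this
      simp only [TensorProduct.star_tmul] at this
      rwa [← this])
    (by simpa only [TensorProduct.star_tmul, star_sum] using ht₄.star)
    (fun i => (ht i).star) ht'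
  have h2 := hS.starMulS_balancedMixed h1
  rw [map_sub, map_sum, map_sum] at h2
  simp only [hS.starMulS_assoc, starMulS_tmul, star_star] at h2
  have h3 : ∀ j, mulS S (star (t' j)) = 𝒜.rL (Crossed.sharp (ε (v j))) q₀ := fun j => by
    rw [hS.mulS_eq hΔ (v := v j) (q := S.symm q₀) (by rw [star_star]; exact ht' j),
      S.apply_symm_apply]
  simp only [h3] at h2
  have h4 : ∑ i, τ i - ∑ i, mulR₂ (S (q i)) (t i) ∈ 𝒜.balancedLeft := by
    rw [← Finset.sum_sub_distrib]
    refine Submodule.sum_mem _ fun i _ => sub_mem_symm ?_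
    have := (ht i).mulR₂_sub (hτ i)
    rwa [(ha₂ (τ i) (Finset.mem_image_of_mem _ (Finset.mem_univ i))).1] at this
  have h5 := hε.lift_T₄ ht₄
  rw [map_sum, ha₁ p₀ (by simp)] at h5
  have h6 : ∑ j, u j ⊗ₜ[ℂ] 𝒜.rL (Crossed.sharp (ε (v j))) q₀ - p₀ ⊗ₜ q₀ ∈ 𝒜.balancedLeft := by
    rw [← h5, TensorProduct.sum_tmul, ← Finset.sum_sub_distrib]
    exact Submodule.sum_mem _ fun j _ => sub_mem_symm (Submodule.subset_span ⟨_, _, _, rfl⟩)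
  exact sub_mem_trans h4 (sub_mem_trans h2 h6)

end Antipode

end EvAlgebra

end Canonical

/-! ## The pentagon identity for `T₁` -/

section AlgebraicPentagon

variable {B Γ A : Type*}
  [NonUnitalCommRing B] [Module ℂ B] [IsScalarTower ℂ B B] [SMulCommClass ℂ B B]
  [StarRing B] [StarModule ℂ B] [Group Γ]
  [NonUnitalRing A] [Module ℂ A] [IsScalarTower ℂ A A] [SMulCommClass ℂ A A]
  [StarRing A] [StarModule ℂ A]

namespace EvAlgebra

variable {act : Γ →* (B ≃⋆ₐ[ℂ] B)} {𝒜 : EvAlgebra act A} {Δ : A →⋆ₙₐ[ℂ] Mult 𝒜.Fiber}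

variable (𝒜) in
/-- The map `p ⊗ m ⊗ c ↦ p ⊗ m u ⊗ c` on the matching components of the first two legs. -/
lemma exists_matching (u : A) : ∃ Ψ : A ⊗[ℂ] (A ⊗[ℂ] A) →ₗ[ℂ] A ⊗[ℂ] (A ⊗[ℂ] A),
    (∀ γ γ' δ p m c, p ∈ 𝒜.gr γ γ' → m ∈ 𝒜.gr γ' δ → Ψ (p ⊗ₜ (m ⊗ₜ c)) = p ⊗ₜ ((m * u) ⊗ₜ c)) ∧
    ∀ γ γ' δ δ' p m c, p ∈ 𝒜.gr γ γ' → m ∈ 𝒜.gr δ δ' → δ ≠ γ' → Ψ (p ⊗ₜ (m ⊗ₜ c)) = 0 := by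
  classical
  choose P hP using fun ε : Γ => 𝒜.exists_graded_ext
    (fun δ _ => if δ = ε then (LinearMap.mulRight ℂ u) else 0)
  obtain ⟨F, hF⟩ := 𝒜.exists_graded_ext
    (fun _ γ' => (TensorProduct.mk ℂ A (A ⊗[ℂ] A)).compl₂ ((P γ').rTensor A))
  have h : ∀ γ γ' p m c, p ∈ 𝒜.gr γ γ' →
      TensorProduct.lift F (p ⊗ₜ (m ⊗ₜ c)) = p ⊗ₜ (P γ' m ⊗ₜ c) := fun γ γ' p m c hp => by
    rw [TensorProduct.lift.tmul, hF γ γ' p hp]; rfl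
  refine ⟨TensorProduct.lift F, fun γ γ' δ p m c hp hm => ?_, fun γ γ' δ δ' p m c hp hm hne => ?_⟩
  · rw [h _ _ _ _ _ hp, hP _ _ _ _ hm, if_pos rfl]; rfl
  · rw [h _ _ _ _ _ hp, hP _ _ _ _ hm, if_neg hne]
    simp

/-- The mixed relation `a s(b) ⊗ m = a ⊗ m r(b)` involves right actions, which become left actions
by `γ'(b)` and `δ(b)` for `a ∈ A_{γ,γ'}` and `m ∈ A_{δ,δ'}`. For `δ = γ'` this is a left balancing
relation; the other components are annihilated by `Ψ`. -/
lemma matching_balancedMixed {u : A} {Ψ : A ⊗[ℂ] (A ⊗[ℂ] A) →ₗ[ℂ] A ⊗[ℂ] (A ⊗[ℂ] A)}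
    (h : ∀ γ γ' δ p m c, p ∈ 𝒜.gr γ γ' → m ∈ 𝒜.gr γ' δ →
      Ψ (p ⊗ₜ (m ⊗ₜ c)) = p ⊗ₜ ((m * u) ⊗ₜ c))
    (h₀ : ∀ γ γ' δ δ' p m c, p ∈ 𝒜.gr γ γ' → m ∈ 𝒜.gr δ δ' → δ ≠ γ' → Ψ (p ⊗ₜ (m ⊗ₜ c)) = 0)
    {t : A ⊗[ℂ] (A ⊗[ℂ] A)} (ht : t ∈ 𝒜.balancedMixed) : Ψ t ∈ 𝒜.balancedTriple := by
  refine span_map_le (f := Ψ) ?_ ht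
  rintro _ (⟨b, a, m, c, rfl⟩ | ⟨b, a, m, c, rfl⟩)
  · rw [map_sub]
    induction a using 𝒜.gr_induction with
    | zero => simp
    | add a a' ha ha' =>
      simp only [map_add, TensorProduct.add_tmul, add_sub_add_comm]
      exact add_mem ha ha'
    | mem γ γ' a ha =>
      induction m using 𝒜.gr_induction with
      | zero => simp
      | add m m' hm hm' =>
        simp only [map_add, TensorProduct.add_tmul, TensorProduct.tmul_add, add_sub_add_comm]
        exact add_mem hm hm'
      | mem δ δ' m hm =>
        rw [𝒜.sR_eq b ha, 𝒜.rR_eq b hm]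
        by_cases e : δ = γ'
        · subst e
          rw [h _ _ _ _ _ _ (𝒜.sL_mem _ ha) hm, h _ _ _ _ _ _ ha (𝒜.rL_mem _ hm), ← 𝒜.rL_mul]
          exact Submodule.subset_span (Or.inl ⟨_, _, _, _, rfl⟩)
        · rw [h₀ _ _ _ _ _ _ _ (𝒜.sL_mem _ ha) hm e, h₀ _ _ _ _ _ _ _ ha (𝒜.rL_mem _ hm) e,
            sub_zero]
          exact zero_mem _
  · rw [map_sub]
    induction a using 𝒜.gr_induction with
    | zero => simp
    | add a a' ha ha' =>
      simp only [map_add, TensorProduct.add_tmul, add_sub_add_comm]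
      exact add_mem ha ha'
    | mem γ γ' a ha =>
      induction m using 𝒜.gr_induction with
      | zero => simp
      | add m m' hm hm' =>
        simp only [map_add, TensorProduct.add_tmul, TensorProduct.tmul_add, add_sub_add_comm]
        exact add_mem hm hm'
      | mem δ δ' m hm =>
        by_cases e : δ = γ'
        · subst e
          rw [h _ _ _ _ _ _ ha (𝒜.sL_mem _ hm), h _ _ _ _ _ _ ha hm, ← 𝒜.sL_mul]
          exact Submodule.subset_span (Or.inr ⟨_, _, _, _, rfl⟩)
        · rw [h₀ _ _ _ _ _ _ _ ha (𝒜.sL_mem _ hm) e, h₀ _ _ _ _ _ _ _ ha hm e, sub_zero]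
          exact zero_mem _

lemma matching_assoc {u : A} {Ψ : A ⊗[ℂ] (A ⊗[ℂ] A) →ₗ[ℂ] A ⊗[ℂ] (A ⊗[ℂ] A)}
    (h : ∀ γ γ' δ p m c, p ∈ 𝒜.gr γ γ' → m ∈ 𝒜.gr γ' δ →
      Ψ (p ⊗ₜ (m ⊗ₜ c)) = p ⊗ₜ ((m * u) ⊗ₜ c)) {t : A ⊗[ℂ] A} (ht : t ∈ 𝒜.prodGamma) (c : A) :
    Ψ (TensorProduct.assoc ℂ A A A (t ⊗ₜ c)) = TensorProduct.assoc ℂ A A A (mulR₂ u t ⊗ₜ c) := by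
  rw [mem_prodGamma] at ht
  induction ht using Submodule.span_induction with
  | zero => simp
  | add t₁ t₂ _ _ h₁ h₂ => simp only [TensorProduct.add_tmul, map_add, h₁, h₂]
  | smul z t _ h => simp only [← TensorProduct.smul_tmul', map_smul, h]
  | mem t ht =>
    obtain ⟨g, γ', a, c', ha, hc, rfl⟩ := Set.mem_iUnion.1 ht
    rw [TensorProduct.assoc_tmul, h _ _ _ _ _ _ ha hc]; rfl

lemma matching_tmul {u : A} {Ψ : A ⊗[ℂ] (A ⊗[ℂ] A) →ₗ[ℂ] A ⊗[ℂ] (A ⊗[ℂ] A)}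
    (h : ∀ γ γ' δ p m c, p ∈ 𝒜.gr γ γ' → m ∈ 𝒜.gr γ' δ →
      Ψ (p ⊗ₜ (m ⊗ₜ c)) = p ⊗ₜ ((m * u) ⊗ₜ c)) {γ γ' γ'' : Γ} {p : A} (hp : p ∈ 𝒜.gr γ γ')
    {t : A ⊗[ℂ] A} (ht : t ∈ Submodule.span ℂ (𝒜.matched γ' γ'')) (v : A) :
    Ψ (p ⊗ₜ mulR₂ v t) = p ⊗ₜ (t * (u ⊗ₜ v)) := by
  induction ht using Submodule.span_induction with
  | zero => simp
  | add t₁ t₂ _ _ h₁ h₂ => simp only [TensorProduct.tmul_add, add_mul, map_add, h₁, h₂]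
  | smul z t _ h => rw [smul_mul_assoc, TensorProduct.tmul_smul, ← h, map_smul,
      TensorProduct.tmul_smul, map_smul]
  | mem t ht =>
    obtain ⟨δ, a, c', ha, hc, rfl⟩ := ht
    rw [mulR₂_tmul, h _ _ _ _ _ _ hp ha]; simp

lemma assoc_balancedLeft {t : A ⊗[ℂ] A} (ht : t ∈ 𝒜.balancedLeft) (c : A) :
    TensorProduct.assoc ℂ A A A (t ⊗ₜ c) ∈ 𝒜.balancedTriple := by
  refine span_map_le (f := (TensorProduct.assoc ℂ A A A).toLinearMap ∘ₗ
    (TensorProduct.mk ℂ (A ⊗[ℂ] A) A).flip c) ?_ ht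
  rintro _ ⟨b, p, q, rfl⟩
  refine Submodule.subset_span (Or.inl ⟨b, p, q, c, ?_⟩)
  rw [map_sub]; rfl

lemma tmul_balancedLeft (p : A) {t : A ⊗[ℂ] A} (ht : t ∈ 𝒜.balancedLeft) :
    p ⊗ₜ[ℂ] t ∈ 𝒜.balancedTriple := by
  refine span_map_le (f := TensorProduct.mk ℂ A (A ⊗[ℂ] A) p) ?_ ht
  rintro _ ⟨b, q, r, rfl⟩
  refine Submodule.subset_span (Or.inr ⟨b, p, q, r, ?_⟩)
  rw [map_sub]; rfl

lemma sL_tmul_sub (b : B) (p : A) (t : A ⊗[ℂ] A) :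
    𝒜.sL b p ⊗ₜ[ℂ] t - p ⊗ₜ[ℂ] (𝒜.rL b).rTensor A t ∈ 𝒜.balancedTriple := by
  induction t using TensorProduct.induction_on with
  | zero => simp
  | add s t hs ht =>
    simp only [map_add, TensorProduct.tmul_add, add_sub_add_comm]
    exact add_mem hs ht
  | tmul q r => exact Submodule.subset_span (Or.inl ⟨b, p, q, r, rfl⟩)

lemma exists_matched_sum {t : A ⊗[ℂ] A} (ht : t ∈ 𝒜.prodGamma) :
    ∃ (n : ℕ) (p q : Fin n → A) (γ γ' γ'' : Fin n → Γ), (∀ i, p i ∈ 𝒜.gr (γ i) (γ' i)) ∧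
      (∀ i, q i ∈ 𝒜.gr (γ' i) (γ'' i)) ∧ t = ∑ i, p i ⊗ₜ q i := by
  rw [mem_prodGamma] at ht
  induction ht using Submodule.span_induction with
  | zero => exact ⟨0, Fin.elim0, Fin.elim0, Fin.elim0, Fin.elim0, Fin.elim0, by simp⟩
  | add t₁ t₂ _ _ h₁ h₂ =>
    obtain ⟨n, p, q, γ, γ', γ'', hp, hq, rfl⟩ := h₁
    obtain ⟨m, r, s, δ, δ', δ'', hr, hs, rfl⟩ := h₂
    refine ⟨n + m, Fin.append p r, Fin.append q s, Fin.append γ δ, Fin.append γ' δ',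
      Fin.append γ'' δ'', fun i => ?_, fun i => ?_, by simp [Fin.sum_univ_add]⟩ <;>
    refine Fin.addCases (fun i => ?_) (fun i => ?_) i <;> simp [hp, hq, hr, hs]
  | smul z t _ h =>
    obtain ⟨n, p, q, γ, γ', γ'', hp, hq, rfl⟩ := h
    refine ⟨n, fun i => z • p i, q, γ, γ', γ'', fun i => Submodule.smul_mem _ _ (hp i), hq, ?_⟩
    rw [Finset.smul_sum]; rfl
  | mem t ht =>
    obtain ⟨g, γ', a, c', ha, hc, rfl⟩ := Set.mem_iUnion.1 ht
    exact ⟨1, fun _ => a, fun _ => c', fun _ => g.1, fun _ => γ', fun _ => g.2,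
      fun _ => ha, fun _ => hc, by simp⟩

/-- Pairs of an element and a representative of its coproduct form a subspace that surjects onto
`A`. A linear section of this surjection gives a linear choice of representatives, which can be
applied to one leg of a tensor. -/
lemma IsComultiplication.exists_T₁_linear (hΔ : 𝒜.IsComultiplication Δ) (z : A) :
    ∃ F : A →ₗ[ℂ] A ⊗[ℂ] A, ∀ q, 𝒜.IsT₁ Δ q z (F q) := by
  obtain ⟨w, hw, e⟩ := 𝒜.exists_unit {z}
  let M : Submodule ℂ (A × 𝒜.prodGamma) :=
    { carrier := {v | RepVia (Δ v.1) (leg₂ hw) v.2}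
      add_mem' := fun {v v'} h h' => by
        have := RepVia.add h h'
        rwa [← map_add] at this
      zero_mem' := by
        have := repVia_zero (𝒜 := 𝒜) (L := leg₂ hw)
        rwa [← map_zero Δ] at this
      smul_mem' := fun c v h => by
        have := RepVia.smul c h
        rwa [← map_smul] at this }
  obtain ⟨σ, hσ⟩ := ((LinearMap.fst ℂ A 𝒜.prodGamma) ∘ₗ M.subtype).exists_rightInverse_of_surjective
    (LinearMap.range_eq_top.2 fun q => by
      obtain ⟨g, hg⟩ := hΔ.exists_rep₂ q hw
      exact ⟨⟨(q, g), hg⟩, rfl⟩)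
  refine ⟨mulR₂ z ∘ₗ 𝒜.prodGamma.toSubmodule.subtype ∘ₗ LinearMap.snd ℂ A 𝒜.prodGamma ∘ₗ
    M.subtype ∘ₗ σ, fun q => ?_⟩
  have h1 : (σ q : A × 𝒜.prodGamma).1 = q := LinearMap.congr_fun hσ q
  have h2 : RepVia (Δ (σ q : A × 𝒜.prodGamma).1) (leg₂ hw) (σ q : A × 𝒜.prodGamma).2 := (σ q).2
  rw [h1] at h2
  exact h2.isT₁ (e z (by simp))

lemma IsComultiplication.exists_leftOne (hΔ : 𝒜.IsComultiplication Δ) {a : A} (ha : a ∈ 𝒜.gr 1 1)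
    (x : A) : ∃ κ : 𝒜.prodGamma, 𝒜.LeftOne (Δ x) a κ ∧ 𝒜.IsT₂ Δ a x κ := by
  obtain ⟨u, hu, e⟩ := 𝒜.exists_unit_right {a}
  obtain ⟨g, hg⟩ := hΔ.left_one x 1 u hu
  refine ⟨leg₁ ha g, fun w w' h => ?_, u, hu, g, e a (by simp), hg, ?_⟩
  · have h1 := hg (𝒜.mapProd (isGraded_mulRight ha) 𝒜.isGraded_id w) w' (by
      rw [h]
      change mulR₁ a (w : A ⊗[ℂ] A) = mulR₁ u (mulR₁ a (w : A ⊗[ℂ] A))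
      rw [mulR₁_mulR₁, e a (by simp)])
    rw [h1, ← toFiber_mul, ← toFiber_mul]
    exact congrArg _ (Subtype.ext (mulR₁_mul_left a _ _))
  · rw [coe_leg₁, sub_self]; exact zero_mem _

lemma IsT₁.r_linear (hΔ : 𝒜.IsComultiplication Δ) {x y : A} {t : A ⊗[ℂ] A} (b : B)
    (h : 𝒜.IsT₁ Δ x y t) : 𝒜.IsT₁ Δ (𝒜.rL b x) y ((𝒜.rL b).rTensor A t) := by
  obtain ⟨u, hu, g, e, hg, ht⟩ := h
  refine ⟨u, hu, _, e, (rightTwo_iff hu).2 (((rightTwo_iff hu).1 hg).r_linear hΔ b), ?_⟩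
  have h1 := map_balancedLeft (f := 𝒜.rL b) (g := LinearMap.id) (fun b' x => 𝒜.rL_sL b b' x)
    (fun _ _ => rfl) ht
  rw [map_sub] at h1
  refine (congrArg (· ∈ 𝒜.balancedLeft) (congrArg _ ?_)).mp h1
  exact tensor_induction_eq (f := TensorProduct.map (𝒜.rL b) LinearMap.id ∘ₗ mulR₂ y)
    (g := mulR₂ y ∘ₗ TensorProduct.map (𝒜.rL b) LinearMap.id) (fun a c => rfl) _

/-- The pentagon identity for `T₁`. -/
lemma IsComultiplication.T₁_pentagon (hΔ : 𝒜.IsComultiplication Δ) (x y z : A) :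
    ∃ (n m k : ℕ) (p q : Fin n → A) (t : Fin n → A ⊗[ℂ] A) (u v : Fin m → A)
      (f g : Fin m → Fin k → A) (s : Fin m → Fin k → A ⊗[ℂ] A),
      𝒜.IsT₁ Δ x y (∑ i, p i ⊗ₜ q i) ∧ (∀ i, 𝒜.IsT₁ Δ (q i) z (t i)) ∧
      𝒜.IsT₁ Δ y z (∑ j, u j ⊗ₜ v j) ∧ (∀ j, 𝒜.IsT₁ Δ x (v j) (∑ l, f j l ⊗ₜ g j l)) ∧
      (∀ j l, 𝒜.IsT₁ Δ (f j l) (u j) (s j l)) ∧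
      ∑ i, p i ⊗ₜ[ℂ] t i - ∑ j, ∑ l, TensorProduct.assoc ℂ A A A (s j l ⊗ₜ g j l) ∈
        𝒜.balancedTriple := by
  classical
  obtain ⟨w, hw, ew⟩ := 𝒜.exists_unit {z}
  obtain ⟨G, hG⟩ := hΔ.exists_rep₂ y hw
  obtain ⟨m, u, v', hv'⟩ := exists_fin_sum_tmul (G : A ⊗[ℂ] A)
  have huv : mulR₂ z (G : A ⊗[ℂ] A) = ∑ j, u j ⊗ₜ (v' j * z) := by
    rw [hv', map_sum]; rfl
  obtain ⟨W, hW, eW, eW'⟩ := 𝒜.exists_tensor_unit (Finset.univ.image fun j => v' j * z)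
    {(G : A ⊗[ℂ] A)}
  replace eW : ∀ j, W * (v' j * z) = v' j * z := fun j =>
    eW _ (Finset.mem_image_of_mem _ (Finset.mem_univ j))
  replace eW' : leg₂ hW G = G := Subtype.ext (eW' _ (by simp)).2
  obtain ⟨X, hX⟩ := hΔ.exists_rep₂ x hW
  obtain ⟨k, f, g, hfg⟩ := exists_fin_sum_tmul (X : A ⊗[ℂ] A)
  choose s hs using fun (j : Fin m) (l : Fin k) => hΔ.exists_T₁ (f l) (u j)
  obtain ⟨P, hP⟩ := hΔ.exists_T₁ x y
  obtain ⟨n, p, q, rfl⟩ := exists_fin_sum_tmul P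
  obtain ⟨F, hF⟩ := hΔ.exists_T₁_linear z
  -- Coassociativity produces a left factor `a ⊗ 1 ⊗ 1`. It is harmless, because `a` is a left unit
  -- for the first legs of `T₁(x ⊗ y)` and of all `s j l`.
  obtain ⟨a, ha, -, ea⟩ := 𝒜.exists_tensor_unit ∅
    (insert (∑ i, p i ⊗ₜ q i) (Finset.univ.image fun jl : Fin m × Fin k => s jl.1 jl.2))
  obtain ⟨κ, hκ, hκ₂⟩ := hΔ.exists_leftOne ha x
  obtain ⟨N, U, V, γ, γ', γ'', hU, hV, eκ⟩ := exists_matched_sum κ.2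
  choose τ hτ hτ₂ using fun l : Fin k => hΔ.exists_leftOne ha (f l)
  have hh : ∀ l, ∃ h : 𝒜.prodGamma, (h : A ⊗[ℂ] A) ∈ Submodule.span ℂ (𝒜.matched (γ' l) (γ'' l)) ∧
      RepVia (Δ (V l)) (leg₂ hW) h := fun l => by
    obtain ⟨h, hh⟩ := hΔ.exists_rep₂ (V l) hW
    exact hh.exists_graded hΔ (isLeg_leg₂ hW) (hV l)
  choose h hh₁ hh₂ using hh
  refine ⟨n, m, k, p, q, fun i => F (q i), u, fun j => v' j * z, fun _ l => f l,
    fun j l => g l * (v' j * z), s, hP, fun i => hF _, huv ▸ hG.isT₁ (ew z (by simp)),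
    fun j => ?_, fun j l => hs j l, ?_⟩
  · have := hX.isT₁ (eW j)
    rw [hfg, map_sum] at this
    exact this
  -- Coassociativity for `x`, with `a` on the left and `v' j * z` on the right. The map `Ψ` then
  -- multiplies the middle leg by `u j` and replaces the mixed relations by left balanced ones.
  have h1 : ∀ j, ∑ l, TensorProduct.assoc ℂ A A A (mulR₂ (u j) (τ l : A ⊗[ℂ] A) ⊗ₜ (g l * (v' j * z))) -
      ∑ l, U l ⊗ₜ ((h l : A ⊗[ℂ] A) * (u j ⊗ₜ (v' j * z))) ∈ 𝒜.balancedTriple := fun j => by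
    obtain ⟨Ψ, hΨ, hΨ₀⟩ := 𝒜.exists_matching (u j)
    have := hΔ.coassoc a x (v' j * z) k N f (fun l => g l * (v' j * z)) U V (fun l => τ l)
      (fun l => mulR₂ (v' j * z) (h l))
      (by
        have := hX.isT₁ (eW j)
        rw [hfg, map_sum] at this
        exact this)
      (eκ ▸ hκ₂) hτ₂ (fun l => (hh₂ l).isT₁ (eW j))
    have := matching_balancedMixed hΨ hΨ₀ this
    rw [map_sub, map_sum, map_sum] at this
    simpa only [matching_assoc hΨ (τ _).2, matching_tmul hΨ (hU _) (hh₁ _)] using this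
  have h2 := Submodule.sum_mem _ fun j (_ : j ∈ Finset.univ) => h1 j
  rw [Finset.sum_sub_distrib] at h2
  -- Summation over `j` reassembles `Δ(y) (1 ⊗ z)`. As `Δ` is multiplicative, `h l * G` stands for
  -- `Δ(V l * y)`, so the last two legs represent `T₁(V l * y ⊗ z)`.
  have h3 : ∑ j, ∑ l, U l ⊗ₜ[ℂ] ((h l : A ⊗[ℂ] A) * (u j ⊗ₜ (v' j * z))) =
      ∑ l, U l ⊗ₜ mulR₂ z ((h l * G : 𝒜.prodGamma) : A ⊗[ℂ] A) := by
    rw [Finset.sum_comm]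
    refine Finset.sum_congr rfl fun l _ => ?_
    rw [← TensorProduct.tmul_sum, ← Finset.mul_sum, ← huv]
    exact congrArg _ (mulR₂_mul z _ _).symm
  have h4 : ∀ l, F (V l * y) - mulR₂ z ((h l * G : 𝒜.prodGamma) : A ⊗[ℂ] A) ∈ 𝒜.balancedLeft :=
    fun l => (hF _).sub_mem hΔ (v := w) (hv := hw) (fun ω => by
      rw [map_mul, Mult.left_mul, hG, mul_assoc, ← hh₂, (isLeg_leg₂ hW).mul, eW']) (ew z (by simp))
  have h5 : ∑ l, U l ⊗ₜ[ℂ] F (V l * y) -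
      ∑ l, U l ⊗ₜ mulR₂ z ((h l * G : 𝒜.prodGamma) : A ⊗[ℂ] A) ∈ 𝒜.balancedTriple := by
    rw [← Finset.sum_sub_distrib]
    refine Submodule.sum_mem _ fun l _ => ?_
    rw [← TensorProduct.tmul_sub]
    exact tmul_balancedLeft _ (h4 l)
  have h6 : mulR₂ y (κ : A ⊗[ℂ] A) - ∑ i, p i ⊗ₜ q i ∈ 𝒜.balancedLeft := by
    have := hP.mulR₂_sub_of_leftOne ha hκ
    rwa [(ea _ (Finset.mem_insert_self _ _)).1] at this
  -- The map `id ⊗ T₁(· ⊗ z)` respects balanced tensors because `Δ` is linear over `r`.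
  have h7 : F.lTensor A (mulR₂ y (κ : A ⊗[ℂ] A) - ∑ i, p i ⊗ₜ q i) ∈ 𝒜.balancedTriple := by
    refine span_map_le (f := F.lTensor A) ?_ h6
    rintro _ ⟨b, a, c, rfl⟩
    rw [map_sub, LinearMap.lTensor_tmul, LinearMap.lTensor_tmul]
    refine sub_mem_trans (sL_tmul_sub b a (F c)) ?_
    rw [← TensorProduct.tmul_sub]
    exact tmul_balancedLeft _ (((hF c).r_linear hΔ b).indep hΔ (hF _))
  have h8 : F.lTensor A (mulR₂ y (κ : A ⊗[ℂ] A) - ∑ i, p i ⊗ₜ q i) =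
      ∑ l, U l ⊗ₜ[ℂ] F (V l * y) - ∑ i, p i ⊗ₜ F (q i) := by
    rw [eκ, map_sub, map_sum, map_sum, map_sum]; rfl
  rw [h8] at h7
  have h9 : ∑ j, ∑ l, TensorProduct.assoc ℂ A A A
        (mulR₂ (u j) (τ l : A ⊗[ℂ] A) ⊗ₜ (g l * (v' j * z))) -
      ∑ j, ∑ l, TensorProduct.assoc ℂ A A A (s j l ⊗ₜ (g l * (v' j * z))) ∈ 𝒜.balancedTriple := by
    rw [← Finset.sum_sub_distrib]
    refine Submodule.sum_mem _ fun j _ => ?_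
    rw [← Finset.sum_sub_distrib]
    refine Submodule.sum_mem _ fun l _ => ?_
    rw [← map_sub, ← TensorProduct.sub_tmul]
    refine assoc_balancedLeft ?_ _
    have := (hs j l).mulR₂_sub_of_leftOne ha (hτ l)
    rwa [(ea (s j l) (Finset.mem_insert_of_mem
      (Finset.mem_image_of_mem (fun jl : Fin m × Fin k => s jl.1 jl.2)
        (Finset.mem_univ (j, l))))).1] at this
  rw [h3] at h2
  exact sub_mem_trans (sub_mem_symm h7) (sub_mem_trans h5
    (sub_mem_trans (sub_mem_symm h2) h9))

end EvAlgebra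

end AlgebraicPentagon

/-! ## The two systems attached to a comultiplication -/

section Systems

variable {B Γ A : Type*}
  [NonUnitalCommRing B] [Module ℂ B] [IsScalarTower ℂ B B] [SMulCommClass ℂ B B]
  [StarRing B] [StarModule ℂ B] [Group Γ]
  [NonUnitalRing A] [Module ℂ A] [IsScalarTower ℂ A A] [SMulCommClass ℂ A A]
  [StarRing A] [StarModule ℂ A]

namespace EvAlgebra

variable {act : Γ →* (B ≃⋆ₐ[ℂ] B)} {𝒜 : EvAlgebra act A} {Δ : A →⋆ₙₐ[ℂ] Mult 𝒜.Fiber}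

/-! ### Transport along semilinear maps exchanging the legs -/

section Transport

variable {σ : ℂ →+* ℂ} (j : A →ₛₗ[σ] A)

/-- The map `a ⊗ c ↦ j(c) ⊗ j(a)`. -/
def swapMap : A ⊗[ℂ] A →ₛₗ[σ] A ⊗[ℂ] A :=
  TensorProduct.lift (LinearMap.mk₂'ₛₗ σ σ (fun a c => j c ⊗ₜ[ℂ] j a)
    (by simp [TensorProduct.tmul_add]) (by simp)
    (by simp [TensorProduct.add_tmul]) (by simp [TensorProduct.smul_tmul']))

lemma swapMap_tmul (a c : A) : swapMap j (a ⊗ₜ c) = j c ⊗ₜ j a := rfl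

/-- The map `a ⊗ c ⊗ d ↦ j(d) ⊗ j(c) ⊗ j(a)`. -/
def swapMap₃ : A ⊗[ℂ] (A ⊗[ℂ] A) →ₛₗ[σ] A ⊗[ℂ] (A ⊗[ℂ] A) :=
  TensorProduct.lift (LinearMap.mk₂'ₛₗ σ σ
    (fun a t => TensorProduct.assoc ℂ A A A (swapMap j t ⊗ₜ[ℂ] j a))
    (by simp [TensorProduct.tmul_add]) (by simp)
    (by simp [TensorProduct.add_tmul]) (by simp [← TensorProduct.smul_tmul']))

lemma swapMap₃_tmul (a : A) (t : A ⊗[ℂ] A) :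
    swapMap₃ j (a ⊗ₜ t) = TensorProduct.assoc ℂ A A A (swapMap j t ⊗ₜ[ℂ] j a) := rfl

lemma swapMap₃_assoc (t : A ⊗[ℂ] A) (c : A) :
    swapMap₃ j (TensorProduct.assoc ℂ A A A (t ⊗ₜ c)) = j c ⊗ₜ swapMap j t := by
  induction t using TensorProduct.induction_on with
  | zero => simp
  | add s t hs ht => simp only [TensorProduct.add_tmul, TensorProduct.tmul_add, map_add, hs, ht]
  | tmul a d => rfl

variable {j} {𝒞 : EvAlgebra act A} {R : A → A → A ⊗[ℂ] A → Prop} {k : B → B}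
  (hs : ∀ b x, j (𝒜.sL b x) = 𝒞.rL (k b) (j x)) (hr : ∀ b x, j (𝒜.rL b x) = 𝒞.sL (k b) (j x))
  (hj : Function.Surjective j)
  (hT : ∀ {x y t}, 𝒜.IsT₁ Δ x y t → 𝒞.canRel R (j y) (j x) (swapMap j t))

include hs hr in
lemma swapMap_balancedLeft {t : A ⊗[ℂ] A} (ht : t ∈ 𝒜.balancedLeft) :
    swapMap j t ∈ 𝒞.balancedLeft := by
  refine span_map_le (f := swapMap j) ?_ ht
  rintro _ ⟨b, a, c, rfl⟩
  rw [map_sub, swapMap_tmul, swapMap_tmul, hs, hr]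
  exact sub_mem_symm (Submodule.subset_span ⟨_, _, _, rfl⟩)

include hs hr in
lemma swapMap₃_balancedTriple {t : A ⊗[ℂ] (A ⊗[ℂ] A)} (ht : t ∈ 𝒜.balancedTriple) :
    swapMap₃ j t ∈ 𝒞.balancedTriple := by
  refine span_map_le (f := swapMap₃ j) ?_ ht
  rintro _ (⟨b, p, q, r, rfl⟩ | ⟨b, p, q, r, rfl⟩)
  · rw [map_sub, swapMap₃_tmul, swapMap₃_tmul, swapMap_tmul, swapMap_tmul,
      TensorProduct.assoc_tmul, TensorProduct.assoc_tmul, hs, hr]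
    exact sub_mem_symm (Submodule.subset_span (Or.inr ⟨_, _, _, _, rfl⟩))
  · rw [map_sub, swapMap₃_tmul, swapMap₃_tmul, swapMap_tmul, swapMap_tmul,
      TensorProduct.assoc_tmul, TensorProduct.assoc_tmul, hs, hr]
    exact sub_mem_symm (Submodule.subset_span (Or.inl ⟨_, _, _, _, rfl⟩))

include hs hr hj hT in
lemma exists_dense_of_swapMap (h : ∀ p q, ∃ (n : ℕ) (x y : Fin n → A) (t : Fin n → A ⊗[ℂ] A),
      (∀ i, 𝒜.IsT₁ Δ (x i) (y i) (t i)) ∧ ∑ i, t i - p ⊗ₜ q ∈ 𝒜.balancedLeft) (p q : A) :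
    ∃ (n : ℕ) (x y : Fin n → A) (t : Fin n → A ⊗[ℂ] A),
      (∀ i, 𝒞.canRel R (x i) (y i) (t i)) ∧ ∑ i, t i - p ⊗ₜ q ∈ 𝒞.balancedLeft := by
  obtain ⟨p, rfl⟩ := hj p
  obtain ⟨q, rfl⟩ := hj q
  obtain ⟨n, x, y, t, h1, h2⟩ := h q p
  refine ⟨n, fun i => j (y i), fun i => j (x i), fun i => swapMap j (t i), fun i => hT (h1 i), ?_⟩
  have := swapMap_balancedLeft hs hr h2
  rwa [map_sub, map_sum] at this

include hs hr hj hT in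
-- Reversing the order of the three legs turns the identity for `T₁` at `z, y, x` into the one for
-- the canonical relation at `x, y, z`. The hypotheses cover both the conjugate linear `x ↦ S(x)*`
-- and the identity combined with an exchange of the structure maps.
lemma exists_pentagon_of_swapMap (hΔ : 𝒜.IsComultiplication Δ) (x y z : A) :
    ∃ (n m k : ℕ) (p q : Fin n → A) (t : Fin n → A ⊗[ℂ] A) (u v : Fin m → A)
    (f g : Fin m → Fin k → A) (s : Fin m → Fin k → A ⊗[ℂ] A),
    𝒞.canRel R y z (∑ i, p i ⊗ₜ q i) ∧ (∀ i, 𝒞.canRel R x (p i) (t i)) ∧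
    𝒞.canRel R x y (∑ j, u j ⊗ₜ v j) ∧ (∀ j, 𝒞.canRel R (u j) z (∑ l, f j l ⊗ₜ g j l)) ∧
    (∀ j l, 𝒞.canRel R (v j) (g j l) (s j l)) ∧
    ∑ i, TensorProduct.assoc ℂ A A A (t i ⊗ₜ q i) - ∑ j, ∑ l, f j l ⊗ₜ[ℂ] s j l ∈
      𝒞.balancedTriple := by
  obtain ⟨x, rfl⟩ := hj x
  obtain ⟨y, rfl⟩ := hj y
  obtain ⟨z, rfl⟩ := hj z
  obtain ⟨n, m, k, p, q, t, u, v, f, g, s, h1, h2, h3, h4, h5, h6⟩ := hΔ.T₁_pentagon z y x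
  have e1 := hT h1
  have e2 := hT h3
  have e3 := fun i => hT (h4 i)
  have e4 := swapMap₃_balancedTriple hs hr h6
  simp only [map_sum, swapMap_tmul] at e1 e2 e3
  simp only [map_sub, map_sum, swapMap₃_tmul, swapMap₃_assoc] at e4
  exact ⟨n, m, k, fun i => j (q i), fun i => j (p i), fun i => swapMap j (t i), fun i => j (v i),
    fun i => j (u i), fun i l => j (g i l), fun i l => j (f i l), fun i l => swapMap j (s i l),
    e1, fun i => hT (h2 i), e2, e3, fun i l => hT (h5 i l), e4⟩

end Transport

/-! ### The left system -/

/-- `g` represents `Δ(y) (u ⊗ 1)`. -/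
def repRel (𝒜 : EvAlgebra act A) (Δ : A →⋆ₙₐ[ℂ] Mult 𝒜.Fiber) (y u : A) (g : A ⊗[ℂ] A) : Prop :=
  ∃ g' : 𝒜.prodGamma, (g' : A ⊗[ℂ] A) = g ∧ 𝒜.RightOne (Δ y) u g'

lemma canRel_repRel {x y : A} {t : A ⊗[ℂ] A} :
    𝒜.canRel (𝒜.repRel Δ) x y t ↔ 𝒜.IsT₄ Δ x y t := by
  constructor
  · rintro ⟨u, hu, _, e, ⟨g, rfl, hg⟩, ht⟩
    exact ⟨u, hu, g, e, hg, ht⟩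
  · rintro ⟨u, hu, g, e, hg, ht⟩
    exact ⟨u, hu, g, e, ⟨g, rfl, hg⟩, ht⟩

/-- The conjugate linear map `x ↦ S(x)*`. -/
def starS (S : A ≃ₗ[ℂ] A) : A →ₗ⋆[ℂ] A where
  toFun x := star (S x)
  map_add' x y := by simp
  map_smul' c x := by simp

lemma swapMap_starS (S : A ≃ₗ[ℂ] A) (t : A ⊗[ℂ] A) : swapMap (starS S) t =
    star (TensorProduct.map S.toLinearMap S.toLinearMap (TensorProduct.comm ℂ A A t)) := by
  induction t using TensorProduct.induction_on with
  | zero => simp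
  | add s t hs ht => simp only [map_add, star_add, hs, ht]
  | tmul a c => rfl

variable {ε : A →ₗ[ℂ] Crossed B Γ} {S : A ≃ₗ[ℂ] A}

/-- By the compatibility of `S` with `Δ`, applying `S` to both legs and flipping carries `T₁` to
`T₂`, and the involution carries `T₂` to `T₄`. Thus `x ↦ S(x)*` transports the density and the
pentagon identity from `T₁` to `T₄`; the remaining properties are direct. -/
lemma coSystem_left (hΔ : 𝒜.IsComultiplication Δ) (hε : 𝒜.IsCounit Δ ε)
    (hS : 𝒜.IsAntipode Δ ε S) {φ : A →ₗ[ℂ] B} (hφ : 𝒜.IsLeftIntegral Δ φ) :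
    CoSystem 𝒜 φ (𝒜.repRel Δ) := by
  have hs : ∀ b x, starS S (𝒜.sL b x) = 𝒜.rL (star b) (starS S x) := fun b x => by
    change star (S _) = 𝒜.rL _ (star (S x))
    rw [hS.s_linear, 𝒜.star_rR]
  have hr : ∀ b x, starS S (𝒜.rL b x) = 𝒜.sL (star b) (starS S x) := fun b x => by
    change star (S _) = 𝒜.sL _ (star (S x))
    rw [hS.r_linear, 𝒜.star_sR]
  have hj : Function.Surjective (starS S) := fun x =>
    ⟨S.symm (star x), by change star (S _) = x; rw [S.apply_symm_apply, star_star]⟩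
  have hT : ∀ {x y t}, 𝒜.IsT₁ Δ x y t →
      𝒜.canRel (𝒜.repRel Δ) (starS S y) (starS S x) (swapMap (starS S) t) := fun {x y t} h => by
    rw [canRel_repRel, swapMap_starS]
    exact (hS.comul _ _ _ h).star
  exact
    { mem := by rintro y u _ ⟨g, rfl, -⟩; exact g.2
      exists_graded := fun {γ γ' y u} hu hy => by
        obtain ⟨g, hg⟩ := hΔ.exists_rep₁ y hu
        obtain ⟨g₁, h₁, h₂⟩ := hg.exists_graded hΔ (isLeg_leg₁ hu) hy
        exact ⟨g₁, h₁, g₁, rfl, (rightOne_iff hu).2 h₂⟩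
      zero := fun {u} hu => ⟨0, rfl, (rightOne_iff hu).2 (by rw [map_zero]; exact repVia_zero)⟩
      add := by
        rintro y y' u _ _ hu ⟨g, rfl, hg⟩ ⟨g', rfl, hg'⟩
        refine ⟨g + g', rfl, (rightOne_iff hu).2 ?_⟩
        rw [map_add]
        exact ((rightOne_iff hu).1 hg).add ((rightOne_iff hu).1 hg')
      star_mul := by
        rintro y y' u u' _ _ _ hu hu' ⟨g, rfl, hg⟩ ⟨g', rfl, hg'⟩ ⟨h, rfl, hh⟩
        exact toFiber_eq_left (((rightOne_iff hu).1 hg).star_mul (isLeg_leg₁ hu)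
          ((rightOne_iff hu').1 hg') ((rightOne_iff hu').1 hh))
      r_linear := by
        rintro y u _ b hu ⟨g, rfl, hg⟩
        exact ⟨_, rfl, (rightOne_iff hu).2 (((rightOne_iff hu).1 hg).r_linear hΔ b)⟩
      s_linear := by
        rintro y u _ b hu ⟨g, rfl, hg⟩
        exact ⟨_, rfl, (rightOne_iff hu).2 (((rightOne_iff hu).1 hg).s_linear hΔ b)⟩
      indep := fun h h' => (canRel_repRel.1 h).indep hΔ (canRel_repRel.1 h')
      invariant := fun h => hφ.invariant _ _ _ (canRel_repRel.1 h)
      dense := exists_dense_of_swapMap hs hr hj hT (hS.exists_T₁_dense hΔ hε)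
      pentagon := exists_pentagon_of_swapMap hs hr hj hT hΔ }

/-! ### The right system -/

/-- `g` represents the flip of `Δ(y) (1 ⊗ u)`. -/
def coRepRel (𝒜 : EvAlgebra act A) (Δ : A →⋆ₙₐ[ℂ] Mult 𝒜.Fiber) (y u : A) (g : A ⊗[ℂ] A) : Prop :=
  ∃ g' : 𝒜.prodGamma, TensorProduct.comm ℂ A A g' = g ∧ 𝒜.RightTwo (Δ y) u g'

lemma comm_mulR₂ (x : A) (t : A ⊗[ℂ] A) :
    TensorProduct.comm ℂ A A (mulR₂ x t) = mulR₁ x (TensorProduct.comm ℂ A A t) :=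
  tensor_induction_eq (f := (TensorProduct.comm ℂ A A).toLinearMap ∘ₗ mulR₂ x)
    (g := mulR₁ x ∘ₗ (TensorProduct.comm ℂ A A).toLinearMap) (fun _ _ => rfl) t

lemma comm_mulL₂ (x : A) (t : A ⊗[ℂ] A) :
    TensorProduct.comm ℂ A A (mulL₂ x t) = mulL₁ x (TensorProduct.comm ℂ A A t) :=
  tensor_induction_eq (f := (TensorProduct.comm ℂ A A).toLinearMap ∘ₗ mulL₂ x)
    (g := mulL₁ x ∘ₗ (TensorProduct.comm ℂ A A).toLinearMap) (fun _ _ => rfl) t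

lemma swapMap_id (t : A ⊗[ℂ] A) :
    swapMap (LinearMap.id : A →ₗ[ℂ] A) t = TensorProduct.comm ℂ A A t :=
  tensor_induction_eq (f := swapMap (LinearMap.id : A →ₗ[ℂ] A))
    (g := (TensorProduct.comm ℂ A A).toLinearMap) (fun _ _ => rfl) t

lemma comm_balancedLeft {t : A ⊗[ℂ] A} (ht : t ∈ 𝒜.balancedLeft) :
    TensorProduct.comm ℂ A A t ∈ 𝒜.co.balancedLeft := by
  rw [← swapMap_id]
  exact swapMap_balancedLeft (k := fun b => b) (fun _ _ => rfl) (fun _ _ => rfl) ht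

lemma comm_balancedLeft' {t : A ⊗[ℂ] A} (ht : t ∈ 𝒜.co.balancedLeft) :
    TensorProduct.comm ℂ A A t ∈ 𝒜.balancedLeft := by
  rw [← swapMap_id]
  exact swapMap_balancedLeft (𝒜 := 𝒜.co) (k := fun b => b) (fun _ _ => rfl) (fun _ _ => rfl) ht

lemma canRel_coRepRel {x y : A} {t : A ⊗[ℂ] A} :
    𝒜.co.canRel (𝒜.coRepRel Δ) x y t ↔ 𝒜.IsT₁ Δ y x (TensorProduct.comm ℂ A A t) := by
  constructor
  · rintro ⟨u, hu, _, e, ⟨g, rfl, hg⟩, ht⟩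
    refine ⟨u, hu, g, e, hg, ?_⟩
    have := comm_balancedLeft' ht
    rwa [map_sub, ← comm_mulR₂, TensorProduct.comm_comm] at this
  · rintro ⟨u, hu, g, e, hg, ht⟩
    refine ⟨u, hu, _, e, ⟨g, rfl, hg⟩, ?_⟩
    have := comm_balancedLeft ht
    rwa [map_sub, comm_mulR₂, TensorProduct.comm_comm] at this

lemma comm_span_matched {γ γ' : Γ} {t : A ⊗[ℂ] A}
    (ht : t ∈ Submodule.span ℂ (𝒜.matched γ γ')) :
    TensorProduct.comm ℂ A A t ∈ Submodule.span ℂ (𝒜.co.matched γ' γ) := by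
  refine span_map_le (f := (TensorProduct.comm ℂ A A).toLinearMap) ?_ ht
  rintro _ ⟨δ, a, c, ha, hc, rfl⟩
  exact Submodule.subset_span ⟨δ, c, a, hc, ha, rfl⟩

lemma comm_mem_prodGamma {t : A ⊗[ℂ] A} (ht : t ∈ 𝒜.prodGamma) :
    TensorProduct.comm ℂ A A t ∈ 𝒜.co.prodGamma := by
  rw [mem_prodGamma] at ht ⊢
  refine span_map_le (f := (TensorProduct.comm ℂ A A).toLinearMap) ?_ ht
  intro t ht
  obtain ⟨⟨γ, γ'⟩, h⟩ := Set.mem_iUnion.1 ht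
  exact 𝒜.co.mem_prodGamma_of_matched (comm_span_matched (Submodule.subset_span h))

lemma comm_star_mul (t t' : A ⊗[ℂ] A) : star (TensorProduct.comm ℂ A A t) *
    TensorProduct.comm ℂ A A t' = TensorProduct.comm ℂ A A (star t * t') := by
  induction t using TensorProduct.induction_on with
  | zero => simp
  | add s t hs ht => simp only [map_add, star_add, add_mul, hs, ht]
  | tmul a c =>
    induction t' using TensorProduct.induction_on with
    | zero => simp
    | add s t hs ht => simp only [map_add, mul_add, hs, ht]
    | tmul a' c' => simp

/-- In `co` the roles of the legs, of `r` and `s`, and of the two degrees are exchanged, so `Δ(y) (1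
⊗ x)` flipped takes the place of `Δ(y) (x ⊗ 1)`. The right integral becomes a left one, and density
and pentagon are those of `T₁` itself. -/
lemma coSystem_right (hΔ : 𝒜.IsComultiplication Δ) (hε : 𝒜.IsCounit Δ ε)
    (hS : 𝒜.IsAntipode Δ ε S) {ψ : A →ₗ[ℂ] B} (hψ : 𝒜.IsRightIntegral Δ ψ) :
    CoSystem 𝒜.co ψ (𝒜.coRepRel Δ) := by
  have hT : ∀ {x y t}, 𝒜.IsT₁ Δ x y t → 𝒜.co.canRel (𝒜.coRepRel Δ) ((LinearMap.id : A →ₗ[ℂ] A) y)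
      ((LinearMap.id : A →ₗ[ℂ] A) x) (swapMap (LinearMap.id : A →ₗ[ℂ] A) t) := fun {x y t} h => by
    rw [canRel_coRepRel, swapMap_id, TensorProduct.comm_comm]
    exact h
  exact
    { mem := by rintro y u _ ⟨g, rfl, -⟩; exact comm_mem_prodGamma g.2
      exists_graded := fun {γ γ' y u} hu hy => by
        replace hu : u ∈ 𝒜.gr 1 1 := hu
        obtain ⟨g, hg⟩ := hΔ.exists_rep₂ y hu
        obtain ⟨g₁, h₁, h₂⟩ := hg.exists_graded hΔ (isLeg_leg₂ (𝒜 := 𝒜) hu) hy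
        exact ⟨_, comm_span_matched h₁, g₁, rfl, (rightTwo_iff (𝒜 := 𝒜) hu).2 h₂⟩
      zero := fun {u} hu => ⟨0, map_zero _,
        (rightTwo_iff (𝒜 := 𝒜) hu).2 (by rw [map_zero]; exact repVia_zero)⟩
      add := by
        rintro y y' u _ _ hu ⟨g, rfl, hg⟩ ⟨g', rfl, hg'⟩
        refine ⟨g + g', map_add _ _ _, (rightTwo_iff (𝒜 := 𝒜) hu).2 ?_⟩
        rw [map_add]
        exact ((rightTwo_iff (𝒜 := 𝒜) hu).1 hg).add ((rightTwo_iff (𝒜 := 𝒜) hu).1 hg')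
      star_mul := by
        rintro y y' u u' _ _ _ hu hu' ⟨g, rfl, hg⟩ ⟨g', rfl, hg'⟩ ⟨h, rfl, hh⟩
        replace hu : u ∈ 𝒜.gr 1 1 := hu
        replace hu' : u' ∈ 𝒜.gr 1 1 := hu'
        have := comm_balancedLeft (toFiber_eq_left
          (((rightTwo_iff (𝒜 := 𝒜) hu).1 hg).star_mul (isLeg_leg₂ (𝒜 := 𝒜) hu)
            ((rightTwo_iff (𝒜 := 𝒜) hu').1 hg') ((rightTwo_iff (𝒜 := 𝒜) hu').1 hh)))
        rw [comm_star_mul, ← comm_mulL₂, ← map_sub]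
        exact this
      r_linear := by
        rintro y u _ b hu ⟨g, rfl, hg⟩
        refine ⟨_, ?_, (rightTwo_iff (𝒜 := 𝒜) hu).2 (((rightTwo_iff (𝒜 := 𝒜) hu).1 hg).s_linear hΔ b)⟩
        exact tensor_induction_eq (f := (TensorProduct.comm ℂ A A).toLinearMap ∘ₗ
          TensorProduct.map LinearMap.id (𝒜.sL b)) (g := (𝒜.sL b).rTensor A ∘ₗ
          (TensorProduct.comm ℂ A A).toLinearMap) (fun _ _ => rfl) _
      s_linear := by
        rintro y u _ b hu ⟨g, rfl, hg⟩
        refine ⟨_, ?_, (rightTwo_iff (𝒜 := 𝒜) hu).2 (((rightTwo_iff (𝒜 := 𝒜) hu).1 hg).r_linear hΔ b)⟩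
        exact tensor_induction_eq (f := (TensorProduct.comm ℂ A A).toLinearMap ∘ₗ
          TensorProduct.map (𝒜.rL b) LinearMap.id) (g := (𝒜.rL b).lTensor A ∘ₗ
          (TensorProduct.comm ℂ A A).toLinearMap) (fun _ _ => rfl) _
      indep := fun h h' => by
        have := comm_balancedLeft ((canRel_coRepRel.1 h).indep hΔ (canRel_coRepRel.1 h'))
        rwa [map_sub, TensorProduct.comm_comm, TensorProduct.comm_comm] at this
      invariant := fun {x y t} h => by
        refine Eq.trans ?_ (hψ.invariant _ _ _ (canRel_coRepRel.1 h))
        exact tensor_induction_eq (f := TensorProduct.lift (𝒜.rL ∘ₗ ψ).flip)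
          (g := TensorProduct.lift (𝒜.rL ∘ₗ ψ) ∘ₗ (TensorProduct.comm ℂ A A).toLinearMap)
          (fun _ _ => rfl) t
      dense := exists_dense_of_swapMap (k := fun b => b) (fun _ _ => rfl) (fun _ _ => rfl)
        Function.surjective_id hT (hS.exists_T₁_dense hΔ hε)
      pentagon := exists_pentagon_of_swapMap (k := fun b => b) (fun _ _ => rfl) (fun _ _ => rfl)
        Function.surjective_id hT hΔ }

end EvAlgebra

end Systems

/-! ## The fundamental unitary of a system -/

section Balanced

variable {B : Type*} [NonUnitalCommRing B] [Module ℂ B] [IsScalarTower ℂ B B]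
  [SMulCommClass ℂ B B] [StarRing B] [StarModule ℂ B]
  {μ : B →ₗ[ℂ] ℂ} (hμ : IsBaseFunctional μ)
  {H₁ H₂ : Type*}
  [NormedAddCommGroup H₁] [InnerProductSpace ℂ H₁] [CompleteSpace H₁]
  [NormedAddCommGroup H₂] [InnerProductSpace ℂ H₂] [CompleteSpace H₂]
  {ρ₁ : Rep μ H₁} {ρ₂ : Rep μ H₂}

include hμ

lemma rep_comm (ρ : Rep μ H₁) (x y : baseVN μ) (ξ : H₁) : ρ x (ρ y ξ) = ρ y (ρ x ξ) := by
  have h : x * y = y * x := Subtype.ext (baseVN_commute hμ x y).eq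
  have h' := congrArg ρ h
  rw [map_mul, map_mul] at h'
  exact DFunLike.congr_fun h' ξ

/-- The elementary tensors are balanced over `N`. -/
lemma tens_balanced (h₁ : Good ρ₁) (h₂ : Good ρ₂) (x : baseVN μ) {ξ : H₁} (hξ : IsBddVec ρ₁ ξ)
    (η : H₂) : tens ρ₁ ρ₂ (ρ₁ x ξ) η = tens ρ₁ ρ₂ ξ (ρ₂ x η) := by
  obtain ⟨ξ, rfl⟩ := hξ
  have e : ρ₁ x ξ.1.1 = (Bdd.map (ρ₁ x) (fun y ζ => rep_comm hμ ρ₁ x y ζ) ξ).1.1 := rfl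
  rw [e, tens_eq_cl hμ h₁ h₂, tens_eq_cl hμ h₁ h₂]
  refine total_elem.ext fun p => ?_
  rw [inner_elem_cl, inner_elem_cl, Bdd.op_map, Inter.adjoint (h₂.op_mem hμ _),
    h₁.op_mem hμ ξ]

end Balanced

/-! ### Compatibility of canonical maps with the actions of `B` and with `D^{1/2}` -/

section FundamentalUnitary

variable {B Γ A : Type*}
  [NonUnitalCommRing B] [Module ℂ B] [IsScalarTower ℂ B B] [SMulCommClass ℂ B B]
  [StarRing B] [StarModule ℂ B] [Group Γ]
  [NonUnitalRing A] [Module ℂ A] [IsScalarTower ℂ A A] [SMulCommClass ℂ A A]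
  [StarRing A] [StarModule ℂ A]
  {act : Γ →* (B ≃⋆ₐ[ℂ] B)} {𝒜 : EvAlgebra act A}
  {μ : B →ₗ[ℂ] ℂ} (hμ : IsBaseFunctional μ) {E : Γ → Mult B} (hE : IsSymmetricCocycle act μ E)
  {ν : A →ₗ[ℂ] ℂ} {φ : A →ₗ[ℂ] B} {R : A → A → A ⊗[ℂ] A → Prop}

open EvAlgebra

section TensL

variable {m₁ m₂ : B →ₗ[ℂ] A →ₗ[ℂ] A} {ρ₁ ρ₂ : Rep μ (GNS ν)} (h₁ : IsInducedRep m₁ ρ₁)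
  (h₂ : IsInducedRep m₂ ρ₂)

/-- The map `p ⊗ q ↦ Λ(f(p)) ⊗ Λ(g(q))`. -/
def tensL (hμ : IsBaseFunctional μ) (h₁ : IsInducedRep m₁ ρ₁) (h₂ : IsInducedRep m₂ ρ₂)
    (f g : A →ₗ[ℂ] A) : A ⊗[ℂ] A →ₗ[ℂ] RT ρ₁ ρ₂ :=
  TensorProduct.lift (LinearMap.mk₂ ℂ (fun p q => tens ρ₁ ρ₂ (Lam ν (f p)) (Lam ν (g q)))
    (fun p p' q => by
      rw [map_add, map_add, tens_add_left hμ h₁.good h₂.good (h₁.bdd _) (h₁.bdd _)])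
    (fun c p q => by
      rw [map_smul, map_smul, tens_smul_left hμ h₁.good h₂.good _ (h₁.bdd _)])
    (fun p q q' => by
      rw [map_add, map_add, tens_add_right hμ h₁.good h₂.good (h₁.bdd _)])
    (fun c p q => by
      rw [map_smul, map_smul, tens_smul_right hμ h₁.good h₂.good (h₁.bdd _)]))

lemma tensL_tmul (f g : A →ₗ[ℂ] A) (p q : A) : tensL hμ h₁ h₂ f g (p ⊗ₜ q) =
    tens ρ₁ ρ₂ (Lam ν (f p)) (Lam ν (g q)) := rfl

lemma tensL_map (f g f' g' : A →ₗ[ℂ] A) (t : A ⊗[ℂ] A) :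
    tensL hμ h₁ h₂ f g (TensorProduct.map f' g' t) = tensL hμ h₁ h₂ (f ∘ₗ f') (g ∘ₗ g') t :=
  tensor_induction_eq (f := tensL hμ h₁ h₂ f g ∘ₗ TensorProduct.map f' g')
    (g := tensL hμ h₁ h₂ (f ∘ₗ f') (g ∘ₗ g')) (fun _ _ => rfl) t

lemma tensL_balancedLeft {α β : Rep μ (GNS ν)} (hβ : IsInducedRep 𝒜.sL β)
    (hα : IsInducedRep 𝒜.rL α) {f g : A →ₗ[ℂ] A} (hf : ∀ b x, f (𝒜.sL b x) = 𝒜.sL b (f x))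
    (hg : ∀ b x, g (𝒜.rL b x) = 𝒜.rL b (g x)) {t : A ⊗[ℂ] A} (ht : t ∈ 𝒜.balancedLeft) :
    tensL hμ hβ hα f g t = 0 := by
  refine (Submodule.mem_bot ℂ).1 (span_map_le (f := tensL hμ hβ hα f g) ?_ ht)
  rintro _ ⟨b, a, c, rfl⟩
  rw [Submodule.mem_bot, map_sub, tensL_tmul, tensL_tmul, hf, hg, ← hβ.induced, ← hα.induced,
    tens_balanced hμ hβ.good hα.good _ (hβ.bdd _), sub_self]

lemma total_tensL {f g : A →ₗ[ℂ] A} (hf : Function.Surjective f) (hg : Function.Surjective g) :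
    Total fun p : A × A => tensL hμ h₁ h₂ f g (p.1 ⊗ₜ p.2) := by
  have h : ∀ {f : A →ₗ[ℂ] A}, Function.Surjective f → Total fun a => Lam ν (f a) := fun {f} hf =>
    (total_Lam ν).of_orthogonal fun x hx i => by
      obtain ⟨i, rfl⟩ := hf i
      exact hx i
  have h3 := h hf
  have h4 := h hg
  have h5 := total_tens hμ h₁.good h₂.good (fun a => h₁.bdd (f a)) (fun a => h₂.bdd (g a)) h3 h4
  exact h5

end TensL

/-- `r(D_{γ}^{1/2})` is multiplicative. -/
lemma EvAlgebra.sqrtD_mul (hE : IsSymmetricCocycle act μ E) (x y : A) :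
    𝒜.sqrtD E (x * y) = 𝒜.sqrtD E x * 𝒜.sqrtD E y := by
  induction x using 𝒜.gr_induction with
  | zero => simp
  | add x x' h h' => simp only [map_add, add_mul, h, h']
  | mem γ γ' x hx =>
    induction y using 𝒜.gr_induction with
    | zero => simp
    | add x x' h h' => simp only [map_add, mul_add, h, h']
    | mem δ δ' y hy =>
      obtain ⟨c, hc⟩ := 𝒜.exists_rL_unit {x}
      obtain ⟨d, hd⟩ := 𝒜.exists_rL_unit {y}
      replace hc := hc x (by simp)
      replace hd := hd y (by simp)
      -- The cocycle identity factors `E_{δ⁻¹γ⁻¹}` into `γ(E_{δ⁻¹})` and `E_{γ⁻¹}`; the translation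
      -- by `γ` is the one caused by moving `r(E_{δ⁻¹})` to the left of `x`.
      rw [𝒜.sqrtD_eq (𝒜.mul_mem hx hy), 𝒜.sqrtD_eq hx, 𝒜.sqrtD_eq hy, 𝒜.rExt_eq _ hd,
        𝒜.mul_rL _ (𝒜.rExt_mem _ hx), 𝒜.rExt_eq _ hc, mul_inv_rev,
        𝒜.rExt_eq (b := act γ d * c) _ (by
          rw [← 𝒜.rL_rL, 𝒜.rL_mul, hc, ← 𝒜.mul_rL _ hx, hd]),
        ← 𝒜.rL_mul, 𝒜.rL_rL, hE.cocycle, inv_inv, mul_comm (act γ d) c, Mult.left_mul_apply,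
        map_mul (act γ⁻¹), act_inv_act, mul_comm _ d, Mult.left_mul_apply, map_mul (act γ),
        act_act_inv]

/-! ### Compatibility of the canonical relation with linear maps -/

lemma EvAlgebra.CoSystem.exists_rep (hR : CoSystem 𝒜 φ R) {u : A} (hu : u ∈ 𝒜.gr 1 1) (y : A) :
    ∃ g, R y u g := by
  induction y using 𝒜.gr_induction with
  | mem γ γ' y hy =>
    obtain ⟨g, -, hg⟩ := hR.exists_graded hu hy
    exact ⟨g, hg⟩
  | zero => exact ⟨0, hR.zero hu⟩
  | add y y' h h' =>
    obtain ⟨g, hg⟩ := h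
    obtain ⟨g', hg'⟩ := h'
    exact ⟨_, hR.add hu hg hg'⟩

lemma EvAlgebra.canRel_mulR₁ {x y u : A} (hu : u ∈ 𝒜.gr 1 1) (e : u * x = x) {g : A ⊗[ℂ] A}
    (hg : R y u g) : 𝒜.canRel R x y (mulR₁ x g) :=
  ⟨u, hu, g, e, hg, by rw [sub_self]; exact zero_mem _⟩

/-- If `t` represents the image of `x ⊗ y`, then `(f ⊗ g) t` represents that of
`k(x) ⊗ l(y)`. -/
structure IsCompat (𝒜 : EvAlgebra act A) (R : A → A → A ⊗[ℂ] A → Prop)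
    (f g k l : A →ₗ[ℂ] A) : Prop where
  left : ∀ b x, f (𝒜.sL b x) = 𝒜.sL b (f x)
  right : ∀ b x, g (𝒜.rL b x) = 𝒜.rL b (g x)
  exists_canRel : ∀ x y t, 𝒜.canRel R x y t → ∃ t', 𝒜.canRel R (k x) (l y) t' ∧
    t' - TensorProduct.map f g t ∈ 𝒜.balancedLeft

/-- By independence of representatives, it suffices to compare one representative for `y` with one
for `l(y)`, taken for a unit common to `x` and `k(x)`. -/
lemma EvAlgebra.CoSystem.isCompat (hR : CoSystem 𝒜 φ R) {f g k l : A →ₗ[ℂ] A}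
    (hf : ∀ b x, f (𝒜.sL b x) = 𝒜.sL b (f x)) (hg : ∀ b x, g (𝒜.rL b x) = 𝒜.rL b (g x))
    (h : ∀ x y u, u ∈ 𝒜.gr 1 1 → u * x = x → u * k x = k x → ∃ w w', R y u w ∧ R (l y) u w' ∧
      mulR₁ (k x) w' - TensorProduct.map f g (mulR₁ x w) ∈ 𝒜.balancedLeft) :
    IsCompat 𝒜 R f g k l where
  left := hf
  right := hg
  exists_canRel x y t ht := by
    classical
    obtain ⟨u, hu, e⟩ := 𝒜.exists_unit {x, k x}
    obtain ⟨w, w', hw, hw', hs⟩ := h x y u hu (e _ (by simp)) (e _ (by simp))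
    refine ⟨_, canRel_mulR₁ hu (e _ (by simp)) hw', sub_mem_trans hs ?_⟩
    rw [← map_sub]
    exact map_balancedLeft hf hg (hR.indep (canRel_mulR₁ hu (e _ (by simp)) hw) ht)

lemma EvAlgebra.map_mulR₁ {f g k : A →ₗ[ℂ] A} (hf : ∀ x p, f (p * x) = p * k x) (x : A)
    (t : A ⊗[ℂ] A) : TensorProduct.map f g (mulR₁ x t) =
      mulR₁ (k x) (TensorProduct.map LinearMap.id g t) :=
  tensor_induction_eq (f := TensorProduct.map f g ∘ₗ mulR₁ x)
    (g := mulR₁ (k x) ∘ₗ TensorProduct.map LinearMap.id g)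
    (fun a c => by simp [mulR₁_tmul, hf]) t

lemma EvAlgebra.map_mulR₁_left {f g : A →ₗ[ℂ] A} (hf : ∀ x p, f (p * x) = f p * x) (x : A)
    (t : A ⊗[ℂ] A) : TensorProduct.map f g (mulR₁ x t) =
      mulR₁ x (TensorProduct.map f g t) :=
  tensor_induction_eq (f := TensorProduct.map f g ∘ₗ mulR₁ x)
    (g := mulR₁ x ∘ₗ TensorProduct.map f g) (fun a c => by simp [mulR₁_tmul, hf]) t

lemma EvAlgebra.CoSystem.isCompat_right_mul (hR : CoSystem 𝒜 φ R) {f : A →ₗ[ℂ] A}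
    (hs : ∀ b x, f (𝒜.sL b x) = 𝒜.sL b (f x)) (hf : ∀ x p, f (p * x) = p * f x) :
    IsCompat 𝒜 R f LinearMap.id f LinearMap.id :=
  hR.isCompat hs (fun _ _ => rfl) fun x y u hu _ _ => by
    obtain ⟨w, hw⟩ := hR.exists_rep hu y
    refine ⟨w, w, hw, hw, ?_⟩
    rw [map_mulR₁ hf, TensorProduct.map_id, LinearMap.id_apply, sub_self]
    exact zero_mem _

lemma EvAlgebra.CoSystem.isCompat_rR (hR : CoSystem 𝒜 φ R) (b : B) :
    IsCompat 𝒜 R (𝒜.rR b) LinearMap.id (𝒜.rR b) LinearMap.id :=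
  hR.isCompat_right_mul (fun c x => (𝒜.sL_rR c b x).symm) fun x p => 𝒜.rR_mul b p x

lemma EvAlgebra.CoSystem.isCompat_sR (hR : CoSystem 𝒜 φ R) (b : B) :
    IsCompat 𝒜 R (𝒜.sR b) LinearMap.id (𝒜.sR b) LinearMap.id :=
  hR.isCompat_right_mul (fun c x => (𝒜.sL_sR c b x).symm) fun x p => 𝒜.sR_mul b p x

lemma EvAlgebra.CoSystem.isCompat_rL (hR : CoSystem 𝒜 φ R) (b : B) :
    IsCompat 𝒜 R (𝒜.rL b) LinearMap.id LinearMap.id (𝒜.rL b) :=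
  hR.isCompat (fun c x => 𝒜.rL_sL b c x) (fun _ _ => rfl) fun x y u hu _ _ => by
    obtain ⟨w, hw⟩ := hR.exists_rep hu y
    refine ⟨w, _, hw, hR.r_linear b hu hw, ?_⟩
    rw [map_mulR₁_left fun x p => 𝒜.rL_mul b p x]
    change mulR₁ x ((𝒜.rL b).rTensor A w) - mulR₁ x ((𝒜.rL b).rTensor A w) ∈ _
    rw [sub_self]
    exact zero_mem _

lemma EvAlgebra.CoSystem.isCompat_sL (hR : CoSystem 𝒜 φ R) (b : B) :
    IsCompat 𝒜 R LinearMap.id (𝒜.sL b) LinearMap.id (𝒜.sL b) :=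
  hR.isCompat (fun _ _ => rfl) (fun c x => (𝒜.rL_sL c b x).symm) fun x y u hu _ _ => by
    obtain ⟨w, hw⟩ := hR.exists_rep hu y
    refine ⟨w, _, hw, hR.s_linear b hu hw, ?_⟩
    rw [map_mulR₁_left fun x p => rfl]
    change mulR₁ x ((𝒜.sL b).lTensor A w) - mulR₁ x ((𝒜.sL b).lTensor A w) ∈ _
    rw [sub_self]
    exact zero_mem _

/-- For matched `p ∈ A_{γ,γ'}` and `q ∈ A_{γ',γ''}` the same `γ'` governs `p s(b) = s(γ'(b)) p` and
`q r(b) = r(γ'(b)) q`. So the factor can be moved across the tensor sign. -/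
lemma EvAlgebra.mulR₁_sL_sub (b : B) (x : A) {g : A ⊗[ℂ] A} (hg : g ∈ 𝒜.prodGamma) :
    mulR₁ (𝒜.sL b x) g - TensorProduct.map LinearMap.id (𝒜.rR b) (mulR₁ x g) ∈
      𝒜.balancedLeft := by
  rw [mem_prodGamma] at hg
  induction hg using Submodule.span_induction with
  | zero => simp
  | add t₁ t₂ _ _ h₁ h₂ =>
    simp only [map_add, add_sub_add_comm]
    exact add_mem h₁ h₂
  | smul z t _ h =>
    simp only [map_smul, ← smul_sub]
    exact Submodule.smul_mem _ _ h
  | mem t ht =>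
    obtain ⟨⟨γ, γ''⟩, γ', p, q, hp, hq, rfl⟩ := Set.mem_iUnion.1 ht
    rw [mulR₁_tmul, mulR₁_tmul, TensorProduct.map_tmul, 𝒜.rR_eq b hq, 𝒜.mul_sL b hp]
    exact Submodule.subset_span ⟨_, _, _, rfl⟩

lemma EvAlgebra.CoSystem.isCompat_middle (hR : CoSystem 𝒜 φ R) (b : B) :
    IsCompat 𝒜 R LinearMap.id (𝒜.rR b) (𝒜.sL b) LinearMap.id :=
  hR.isCompat (fun _ _ => rfl) (fun c x => (𝒜.rL_rR c b x).symm) fun x y u hu _ _ => by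
    obtain ⟨w, hw⟩ := hR.exists_rep hu y
    exact ⟨w, w, hw, hw, mulR₁_sL_sub b x (hR.mem hw)⟩

/-- Homogeneous elements suffice to find compatible representatives. -/
lemma EvAlgebra.CoSystem.exists_compatible (hR : CoSystem 𝒜 φ R) {f g l : A →ₗ[ℂ] A}
    {u : A} (hu : u ∈ 𝒜.gr 1 1)
    (h : ∀ γ γ' y w, y ∈ 𝒜.gr γ γ' → w ∈ Submodule.span ℂ (𝒜.matched γ γ') → R y u w →
      R (l y) u (TensorProduct.map f g w)) (y : A) :
    ∃ w, R y u w ∧ R (l y) u (TensorProduct.map f g w) := by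
  induction y using 𝒜.gr_induction with
  | mem γ γ' y hy =>
    obtain ⟨w, hw, hw'⟩ := hR.exists_graded hu hy
    exact ⟨w, hw', h _ _ _ _ hy hw hw'⟩
  | zero => exact ⟨0, hR.zero hu, by rw [map_zero, map_zero]; exact hR.zero hu⟩
  | add y y' h h' =>
    obtain ⟨w, hw, hw'⟩ := h
    obtain ⟨v, hv, hv'⟩ := h'
    exact ⟨w + v, hR.add hu hw hv, by rw [map_add, map_add]; exact hR.add hu hw' hv'⟩

/-- Linear maps agreeing on the legs of matched tensors. -/
lemma EvAlgebra.map_congr_of_matched {f f' g g' : A →ₗ[ℂ] A} {γ γ' : Γ}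
    (h : ∀ δ, ∀ p ∈ 𝒜.gr γ δ, f p = f' p) (h' : ∀ δ, ∀ q ∈ 𝒜.gr δ γ', g q = g' q)
    {w : A ⊗[ℂ] A} (hw : w ∈ Submodule.span ℂ (𝒜.matched γ γ')) :
    TensorProduct.map f g w = TensorProduct.map f' g' w := by
  refine LinearMap.eqOn_span (f := TensorProduct.map f g) (g := TensorProduct.map f' g') ?_ hw
  rintro _ ⟨δ, p, q, hp, hq, rfl⟩
  rw [TensorProduct.map_tmul, TensorProduct.map_tmul, h _ _ hp, h' _ _ hq]

/-- The second legs of a homogeneous representative have the outer degree `γ'` of `y`. On both sides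
right multiplication by `s(b)` is therefore left multiplication by `s(γ'(b))`. -/
lemma EvAlgebra.CoSystem.isCompat_sR_right (hR : CoSystem 𝒜 φ R) (b : B) :
    IsCompat 𝒜 R LinearMap.id (𝒜.sR b) LinearMap.id (𝒜.sR b) :=
  hR.isCompat (fun _ _ => rfl) (fun c x => (𝒜.rL_sR c b x).symm) fun x y u hu _ _ => by
    obtain ⟨w, hw, hw'⟩ := hR.exists_compatible (f := LinearMap.id) (g := 𝒜.sR b) (l := 𝒜.sR b) hu
      (fun γ γ' y w hy hw hw' => by
        rw [𝒜.sR_eq b hy, map_congr_of_matched (f' := LinearMap.id) (g' := 𝒜.sL (act γ' b))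
          (fun _ _ _ => rfl) (fun _ _ hq => 𝒜.sR_eq b hq) hw]
        exact hR.s_linear _ hu hw') y
    refine ⟨w, _, hw, hw', ?_⟩
    rw [map_mulR₁_left fun x p => rfl]
    change mulR₁ x _ - mulR₁ x _ ∈ _
    rw [sub_self]
    exact zero_mem _

lemma EvAlgebra.exists_rL_tensor_unit (F : Finset A) (t : A ⊗[ℂ] A) :
    ∃ c, (∀ x ∈ F, 𝒜.rL c x = x) ∧ TensorProduct.map (𝒜.rL c) LinearMap.id t = t := by
  classical
  obtain ⟨n, p, q, rfl⟩ := exists_fin_sum_tmul t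
  obtain ⟨c, hc⟩ := 𝒜.exists_rL_unit (F ∪ Finset.univ.image p)
  refine ⟨c, fun x hx => hc x (Finset.mem_union_left _ hx), ?_⟩
  rw [map_sum]
  refine Finset.sum_congr rfl fun i _ => ?_
  rw [TensorProduct.map_tmul,
    hc _ (Finset.mem_union_right _ (Finset.mem_image_of_mem _ (Finset.mem_univ i)))]
  rfl

/-- On first legs of the outer degree `γ` of `y`, the map `D^{1/2}` is again multiplication by
`r(E_{γ⁻¹})`, so linearity of `Δ` over `r` applies. Multiplicativity of `D^{1/2}` takes care of the
factor `x`. -/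
lemma EvAlgebra.CoSystem.isCompat_sqrtD (hR : CoSystem 𝒜 φ R) (hE : IsSymmetricCocycle act μ E) :
    IsCompat 𝒜 R (𝒜.sqrtD E) LinearMap.id (𝒜.sqrtD E) (𝒜.sqrtD E) :=
  hR.isCompat (fun c x => 𝒜.sqrtD_sL c x) (fun _ _ => rfl) fun x y u hu _ _ => by
    obtain ⟨w, hw, hw'⟩ := hR.exists_compatible (f := 𝒜.sqrtD E) (g := LinearMap.id)
      (l := 𝒜.sqrtD E) hu
      (fun γ γ' y w hy hw hw' => by
        -- A common unit `c` replaces the multiplier `E_{γ⁻¹}` by the element `E_{γ⁻¹} c` of `B`,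
        -- for which `r_linear` is available.
        obtain ⟨c, hc, hc'⟩ := 𝒜.exists_rL_tensor_unit {y} w
        replace hc := hc y (by simp)
        rw [𝒜.sqrtD_eq hy, 𝒜.rExt_eq _ hc]
        have e : TensorProduct.map (𝒜.sqrtD E) LinearMap.id w =
            TensorProduct.map (𝒜.rL ((E γ⁻¹).left c)) LinearMap.id w := by
          conv_lhs => rw [← hc']
          rw [← LinearMap.comp_apply, ← TensorProduct.map_comp]
          refine map_congr_of_matched (fun δ p hp => ?_) (fun _ _ _ => rfl) hw
          rw [LinearMap.comp_apply, 𝒜.sqrtD_eq (𝒜.rL_mem c hp), 𝒜.rExt_rL]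
        rw [e]
        exact hR.r_linear _ hu hw') y
    refine ⟨w, _, hw, hw', ?_⟩
    have e : TensorProduct.map (𝒜.sqrtD E) LinearMap.id (mulR₁ x w) =
        mulR₁ (𝒜.sqrtD E x) (TensorProduct.map (𝒜.sqrtD E) LinearMap.id w) :=
      tensor_induction_eq (f := TensorProduct.map (𝒜.sqrtD E) LinearMap.id ∘ₗ mulR₁ x)
        (g := mulR₁ (𝒜.sqrtD E x) ∘ₗ TensorProduct.map (𝒜.sqrtD E) LinearMap.id)
        (fun a c => by simp [mulR₁_tmul, 𝒜.sqrtD_mul hE]) w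
    rw [e, sub_self]
    exact zero_mem _

end FundamentalUnitary

/-! ### Isometry of the canonical map and construction of the unitary -/

section FundamentalUnitary

variable {B Γ A : Type*}
  [NonUnitalCommRing B] [Module ℂ B] [IsScalarTower ℂ B B] [SMulCommClass ℂ B B]
  [StarRing B] [StarModule ℂ B] [Group Γ]
  [NonUnitalRing A] [Module ℂ A] [IsScalarTower ℂ A A] [SMulCommClass ℂ A A]
  [StarRing A] [StarModule ℂ A]
  {act : Γ →* (B ≃⋆ₐ[ℂ] B)} {𝒜 : EvAlgebra act A}
  {μ : B →ₗ[ℂ] ℂ} (hμ : IsBaseFunctional μ) {E : Γ → Mult B} (hE : IsSymmetricCocycle act μ E)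
  {ν : A →ₗ[ℂ] ℂ} {φ : A →ₗ[ℂ] B} (hφ : IsExpectation 𝒜 μ ν φ)
  {R : A → A → A ⊗[ℂ] A → Prop} (hR : EvAlgebra.CoSystem 𝒜 φ R)
  {α β βh : Rep μ (GNS ν)} (hα : IsInducedRep 𝒜.rL α) (hβ : IsInducedRep 𝒜.sL β)
  (hβh : IsInducedRep 𝒜.rR βh)

open EvAlgebra

/-- The map `p ⊗ q ↦ s(φ(q)) p`. -/
def EvAlgebra.slice (𝒜 : EvAlgebra act A) (φ : A →ₗ[ℂ] B) : A ⊗[ℂ] A →ₗ[ℂ] A :=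
  TensorProduct.lift (𝒜.sL ∘ₗ φ).flip

lemma EvAlgebra.slice_tmul (p q : A) : 𝒜.slice φ (p ⊗ₜ q) = 𝒜.sL (φ q) p := rfl

include hφ in
lemma slice_balancedLeft {t : A ⊗[ℂ] A} (ht : t ∈ 𝒜.balancedLeft) : 𝒜.slice φ t = 0 := by
  refine (Submodule.mem_bot ℂ).1 (span_map_le (f := 𝒜.slice φ) ?_ ht)
  rintro _ ⟨b, a, c, rfl⟩
  rw [Submodule.mem_bot, map_sub, slice_tmul, slice_tmul, hφ.left_linear, 𝒜.sL_sL, mul_comm,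
    sub_self]

lemma slice_mulR₁ (x : A) (t : A ⊗[ℂ] A) : 𝒜.slice φ (mulR₁ x t) = 𝒜.slice φ t * x :=
  tensor_induction_eq (f := 𝒜.slice φ ∘ₗ mulR₁ x) (g := LinearMap.mulRight ℂ x ∘ₗ 𝒜.slice φ)
    (fun a c => by simp [mulR₁_tmul, slice_tmul, 𝒜.sL_mul]) t

lemma slice_mulL₁ {u : A} (hu : u ∈ 𝒜.gr 1 1) (t : A ⊗[ℂ] A) :
    𝒜.slice φ (mulL₁ u t) = u * 𝒜.slice φ t :=
  tensor_induction_eq (f := 𝒜.slice φ ∘ₗ mulL₁ u) (g := LinearMap.mulLeft ℂ u ∘ₗ 𝒜.slice φ)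
    (fun a c => by simp [mulL₁_tmul, slice_tmul, mul_sL_one hu]) t

include hμ hφ hE hα hβ in
-- For equal first degrees the Gram operator is supplied by `gram_rL`, which is the reason for
-- `D^{1/2}` in the second leg. For different degrees both sides vanish by orthogonality.
lemma inner_tens_sqrtD {γ γ' δ δ' : Γ} {q q' : A} (hq : q ∈ 𝒜.gr γ γ') (hq' : q' ∈ 𝒜.gr δ δ')
    (p p' : A) : ⟪tens β α (Lam ν p) (Lam ν (𝒜.sqrtD E q)),
      tens β α (Lam ν p') (Lam ν (𝒜.sqrtD E q'))⟫_ℂ =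
      ν (star p * 𝒜.sL (act γ (φ (star q * q'))) p') := by
  obtain ⟨ξ, hξ⟩ := hβ.bdd p
  obtain ⟨ξ', hξ'⟩ := hβ.bdd p'
  obtain ⟨η, hη⟩ := hα.bdd (𝒜.sqrtD E q)
  obtain ⟨η', hη'⟩ := hα.bdd (𝒜.sqrtD E q')
  rw [← hξ, ← hξ', ← hη, ← hη', inner_tens' hμ hβ.good hα.good,
    gram_eq hμ hα.good (c := act γ (φ (star q * q'))) (fun b b' => ?_), hξ, hξ', hβ.induced,
    inner_Lam_of_pos hφ.positive]
  rw [hη, hη', hα.induced, hα.induced, inner_Lam_of_pos hφ.positive]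
  by_cases h : γ = δ
  · subst h
    exact hφ.gram_rL hE hq hq' b b'
  · rw [hφ.gram_rL_of_ne hE hq hq' h, hφ.orthogonal hq hq' h, map_zero, zero_mul, mul_zero,
      map_zero]

include hμ hφ hE in
-- In a matched tensor `p ⊗ q`, the first degree of `q` is the second degree of `p`. Moving `p*`
-- past `s` therefore undoes exactly the twist of `φ(q* q')` in `inner_tens_sqrtD`.
lemma inner_tensL_mulR₁ (x x' : A) {g g' : A ⊗[ℂ] A} (hg : g ∈ 𝒜.prodGamma)
    (hg' : g' ∈ 𝒜.prodGamma) :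
    ⟪tensL hμ hβ hα LinearMap.id (𝒜.sqrtD E) (mulR₁ x g),
      tensL hμ hβ hα LinearMap.id (𝒜.sqrtD E) (mulR₁ x' g')⟫_ℂ =
      ν (star x * (𝒜.slice φ (star g * g') * x')) := by
  rw [mem_prodGamma] at hg hg'
  induction hg using Submodule.span_induction with
  | zero => simp
  | add t₁ t₂ _ _ h₁ h₂ => simp only [map_add, star_add, add_mul, inner_add_left, mul_add, h₁, h₂]
  | smul z t _ h =>
    simp only [map_smul, star_smul, smul_mul_assoc, mul_smul_comm, inner_smul_left, h]
    rfl
  | mem t ht =>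
    obtain ⟨⟨γ, γ''⟩, κ, p, q, hp, hq, rfl⟩ := Set.mem_iUnion.1 ht
    induction hg' using Submodule.span_induction with
    | zero => simp
    | add t₁ t₂ _ _ h₁ h₂ => simp only [map_add, add_mul, inner_add_right, mul_add, h₁, h₂]
    | smul z t _ h =>
      simp only [map_smul, smul_mul_assoc, mul_smul_comm, inner_smul_right, h]
      rfl
    | mem t ht' =>
      obtain ⟨⟨δ, δ''⟩, κ', p', q', hp', hq', rfl⟩ := Set.mem_iUnion.1 ht'
      rw [mulR₁_tmul, mulR₁_tmul, tensL_tmul, tensL_tmul, LinearMap.id_apply, LinearMap.id_apply,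
        inner_tens_sqrtD hμ hE hφ hα hβ hq hq', TensorProduct.star_tmul,
        Algebra.TensorProduct.tmul_mul_tmul, slice_tmul, StarMul.star_mul, mul_assoc,
        𝒜.mul_sL _ (𝒜.star_mem hp), act_inv_act, ← mul_assoc (star p), 𝒜.sL_mul]

include hμ hφ hα hβh in
lemma inner_tens_rR (x y x' y' : A) : ⟪tens α βh (Lam ν x) (Lam ν y),
    tens α βh (Lam ν x') (Lam ν y')⟫_ℂ = ν (star x * 𝒜.rL (φ (star y * y')) x') := by
  obtain ⟨ξ, hξ⟩ := hα.bdd x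
  obtain ⟨ξ', hξ'⟩ := hα.bdd x'
  obtain ⟨η, hη⟩ := hβh.bdd y
  obtain ⟨η', hη'⟩ := hβh.bdd y'
  rw [← hξ, ← hξ', ← hη, ← hη', inner_tens' hμ hα.good hβh.good,
    gram_eq hμ hβh.good (c := φ (star y * y')) (fun b b' => ?_), hξ, hξ', hα.induced,
    inner_Lam_of_pos hφ.positive]
  rw [hη, hη', hβh.induced, hβh.induced, inner_Lam_of_pos hφ.positive, hφ.gram_rR]

include hμ hφ hE hR in
-- With `h` representing `Δ(y* y') (u' ⊗ 1)`, the product `g* g'` is `(u* ⊗ 1) h` up to balancing.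
-- Invariance evaluates the slice of `h`, multiplied by `x'`, as `r(φ(y* y')) x'`, and the unit `u*`
-- is absorbed into `x*`.
lemma inner_tensL_canRel {x y x' y' : A} {t t' : A ⊗[ℂ] A} (ht : 𝒜.canRel R x y t)
    (ht' : 𝒜.canRel R x' y' t') : ⟪tensL hμ hβ hα LinearMap.id (𝒜.sqrtD E) t,
      tensL hμ hβ hα LinearMap.id (𝒜.sqrtD E) t'⟫_ℂ =
      ν (star x * 𝒜.rL (φ (star y * y')) x') := by
  obtain ⟨u, hu, g, e, hg, ht⟩ := ht
  obtain ⟨u', hu', g', e', hg', ht'⟩ := ht'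
  obtain ⟨h, hh⟩ := hR.exists_rep hu' (star y * y')
  have hb := fun {t} => tensL_balancedLeft (t := t) hμ hβ hα (f := LinearMap.id) (g := 𝒜.sqrtD E)
    (fun _ _ => rfl) (fun b x => 𝒜.sqrtD_rL b x)
  have e1 := hb ht
  have e2 := hb ht'
  rw [map_sub, sub_eq_zero] at e1 e2
  have e3 := slice_balancedLeft hφ (hR.star_mul hu hu' hg hg' hh)
  rw [map_sub, sub_eq_zero, slice_mulL₁ (star_mem_one hu)] at e3
  rw [e1, e2, inner_tensL_mulR₁ hμ hE hφ hα hβ x x' (hR.mem hg) (hR.mem hg'), e3, mul_assoc,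
    ← mul_assoc (star x), ← StarMul.star_mul, e, ← slice_mulR₁,
    ← hR.invariant (canRel_mulR₁ hu' e' hh)]
  rfl

/-- `W` is given on elementary tensors by the canonical relation. -/
def IsCanonical (𝒜 : EvAlgebra act A) (R : A → A → A ⊗[ℂ] A → Prop) (E : Γ → Mult B)
    (hμ : IsBaseFunctional μ) (hα : IsInducedRep 𝒜.rL α) (hβ : IsInducedRep 𝒜.sL β)
    (W : RT β α ≃ₗᵢ[ℂ] RT α βh) : Prop :=
  ∀ x y t, 𝒜.canRel R x y t → W.symm (tens α βh (Lam ν x) (Lam ν y)) =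
    tensL hμ hβ hα LinearMap.id (𝒜.sqrtD E) t

include hμ hφ hE hR hβh in
-- The inner products agree by `inner_tensL_canRel` and `inner_tens_rR`, and `dense` makes the image
-- family total. The unitary so obtained is `W*`; hence `W` itself is only known through its
-- inverse.
lemma exists_isCanonical : ∃ W : RT β α ≃ₗᵢ[ℂ] RT α βh, IsCanonical 𝒜 R E hμ hα hβ W := by
  have hex : ∀ x y, ∃ t, 𝒜.canRel R x y t := fun x y => by
    obtain ⟨u, hu, e⟩ := 𝒜.exists_unit {x}
    obtain ⟨g, hg⟩ := hR.exists_rep hu y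
    exact ⟨_, canRel_mulR₁ hu (e x (by simp)) hg⟩
  choose t ht using hex
  have hb := fun {t} => tensL_balancedLeft (t := t) hμ hβ hα (f := LinearMap.id) (g := 𝒜.sqrtD E)
    (fun _ _ => rfl) (fun b x => 𝒜.sqrtD_rL b x)
  have hind : ∀ {x y t'}, 𝒜.canRel R x y t' → tensL hμ hβ hα LinearMap.id (𝒜.sqrtD E) t' =
      tensL hμ hβ hα LinearMap.id (𝒜.sqrtD E) (t x y) := fun h => by
    have := hb (hR.indep h (ht _ _))
    rwa [map_sub, sub_eq_zero] at this
  have hf : Total fun p : A × A => tensL hμ hβ hα LinearMap.id (𝒜.sqrtD E) (t p.1 p.2) := by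
    refine (total_tensL hμ hβ hα (f := LinearMap.id) (fun x => ⟨x, rfl⟩) (𝒜.sqrtD_surjective hE)).of_orthogonal
      fun v hv p => ?_
    obtain ⟨n, x, y, s, hs, hsum⟩ := hR.dense p.1 p.2
    have := hb hsum
    rw [map_sub, sub_eq_zero, map_sum] at this
    rw [← this, sum_inner]
    refine Finset.sum_eq_zero fun i _ => ?_
    rw [hind (hs i)]
    exact hv (x i, y i)
  obtain ⟨U, hU⟩ := exists_isometryEquiv_of_gram
    (e := fun p : A × A => tens α βh (Lam ν p.1) (Lam ν p.2))
    (total_tens hμ hα.good hβh.good hα.bdd hβh.bdd (total_Lam ν) (total_Lam ν)) hf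
    (fun p p' => by
      rw [inner_tensL_canRel hμ hE hφ hR hα hβ (ht _ _) (ht _ _),
        inner_tens_rR hμ hφ hα hβh])
  refine ⟨U.symm, fun x y t' h => ?_⟩
  rw [hind h]
  exact hU (x, y)

/-! ### Intertwining relations -/

variable {W : RT β α ≃ₗᵢ[ℂ] RT α βh} (hW : IsCanonical 𝒜 R E hμ hα hβ W)

lemma EvAlgebra.CoSystem.exists_canRel (hR : CoSystem 𝒜 φ R) (x y : A) :
    ∃ t, 𝒜.canRel R x y t := by
  obtain ⟨u, hu, e⟩ := 𝒜.exists_unit {x}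
  obtain ⟨g, hg⟩ := hR.exists_rep hu y
  exact ⟨_, canRel_mulR₁ hu (e x (by simp)) hg⟩

include hW in
lemma IsCanonical.symm_compat {f g k l : A →ₗ[ℂ] A} (h : IsCompat 𝒜 R f g k l) {x y : A}
    {t : A ⊗[ℂ] A} (ht : 𝒜.canRel R x y t) : W.symm (tens α βh (Lam ν (k x)) (Lam ν (l y))) =
      tensL hμ hβ hα f (𝒜.sqrtD E ∘ₗ g) t := by
  obtain ⟨t', ht', e⟩ := h.exists_canRel x y t ht
  have := tensL_balancedLeft hμ hβ hα (f := LinearMap.id) (g := 𝒜.sqrtD E)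
    (fun _ _ => rfl) (fun b x => 𝒜.sqrtD_rL b x) e
  rw [map_sub, sub_eq_zero, tensL_map] at this
  rw [hW _ _ _ ht', this]
  rfl

include hμ hα hβ hβh hR hW in
-- Goodness of both representations reduces the claim to `π_μ(B)`. There it says that the canonical
-- map carries `k ⊗ l` to `f ⊗ g`, which is the compatibility, once `g` is moved past `D^{1/2}`.
lemma IsCanonical.intertwines {τ : Rep μ (RT β α)} {τ' : Rep μ (RT α βh)} (gτ : Good τ)
    (gτ' : Good τ') {f g k l : B → A →ₗ[ℂ] A} (h : ∀ b, IsCompat 𝒜 R (f b) (g b) (k b) (l b))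
    (hg : ∀ b x, g b (𝒜.sqrtD E x) = 𝒜.sqrtD E (g b x))
    (hτ : ∀ b p q, τ (basePi μ b) (tens β α (Lam ν p) (Lam ν q)) =
      tens β α (Lam ν (f b p)) (Lam ν (g b q)))
    (hτ' : ∀ b x y, τ' (basePi μ b) (tens α βh (Lam ν x) (Lam ν y)) =
      tens α βh (Lam ν (k b x)) (Lam ν (l b y)))
    (x : baseVN μ) (v : RT β α) : W (τ x v) = τ' x (W v) := by
  refine gτ.intertwines hμ gτ' (S := (W : RT β α →L[ℂ] RT α βh)) (fun b v => ?_) x v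
  change W (τ (basePi μ b) v) = τ' (basePi μ b) (W v)
  obtain ⟨v, rfl⟩ := W.symm.surjective v
  rw [W.apply_symm_apply]
  refine W.symm.injective ?_
  rw [W.symm_apply_apply, eq_comm]
  have ht := total_tens hμ hα.good hβh.good hα.bdd hβh.bdd (total_Lam ν) (total_Lam ν)
  refine DFunLike.congr_fun (ht.clm_ext (S := (W.symm : RT α βh →L[ℂ] RT β α) ∘L τ' (basePi μ b))
    (T := τ (basePi μ b) ∘L (W.symm : RT α βh →L[ℂ] RT β α)) fun p => ?_) v
  change W.symm (τ' (basePi μ b) _) = τ (basePi μ b) (W.symm _)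
  obtain ⟨t, ht⟩ := hR.exists_canRel p.1 p.2
  rw [hτ', hW.symm_compat hμ hα hβ (h b) ht, hW _ _ _ ht]
  exact tensor_induction_eq (f := tensL hμ hβ hα (f b) (𝒜.sqrtD E ∘ₗ g b))
    (g := (τ (basePi μ b)).toLinearMap ∘ₗ tensL hμ hβ hα LinearMap.id (𝒜.sqrtD E))
    (fun a c => by
      rw [LinearMap.comp_apply, tensL_tmul, tensL_tmul, LinearMap.comp_apply, ← hg]
      exact (hτ b a _).symm) t

end FundamentalUnitary

/-! ### The operators entering the pentagon equation -/

section Pentagon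

variable {B : Type*} [NonUnitalCommRing B] [Module ℂ B] [IsScalarTower ℂ B B]
  [SMulCommClass ℂ B B] [StarRing B] [StarModule ℂ B] {μ : B →ₗ[ℂ] ℂ} (hμ : IsBaseFunctional μ)
  {H : Type*} [NormedAddCommGroup H] [InnerProductSpace ℂ H] [CompleteSpace H]
  {a b c : Rep μ H} {W : RT b a ≃ₗᵢ[ℂ] RT a c}

/-- The intertwining relations required from a pseudo-multiplicative unitary. -/
structure IntertwinesAmps (a b c : Rep μ H) (W : RT b a ≃ₗᵢ[ℂ] RT a c) : Prop where
  rc : ∀ τ τ', Good τ → Good τ' → IsAmpRight c τ → IsAmpLeft b τ' → ∀ x v, W (τ x v) = τ' x (W v)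
  lc : ∀ τ τ', Good τ → Good τ' → IsAmpLeft c τ → IsAmpLeft c τ' → ∀ x v, W (τ x v) = τ' x (W v)
  la : ∀ τ τ', Good τ → Good τ' → IsAmpLeft a τ → IsAmpRight a τ' → ∀ x v, W (τ x v) = τ' x (W v)
  rb : ∀ τ τ', Good τ → Good τ' → IsAmpRight b τ → IsAmpRight b τ' → ∀ x v, W (τ x v) = τ' x (W v)

/-- The representations, flips, associativity isomorphisms and tensor products of operators that
enter the pentagon equation. -/
structure PentagonData (a b c : Rep μ H) (W : RT b a ≃ₗᵢ[ℂ] RT a c) where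
  (la lc rb rc : Rep μ (RT b a))
  (lb' lc' ra' rb' : Rep μ (RT a c))
  (la'' rb'' : Rep μ (RT c a))
  F : RT a c ≃ₗᵢ[ℂ] RT c a
  F' : RT c la ≃ₗᵢ[ℂ] RT la c
  A₁ : RT rb a ≃ₗᵢ[ℂ] RT b la
  A₂ : RT rb' a ≃ₗᵢ[ℂ] RT a lc
  A₃ : RT ra' c ≃ₗᵢ[ℂ] RT a lc'
  A₄ : RT rc a ≃ₗᵢ[ℂ] RT b la''
  A₅ : RT rb'' a ≃ₗᵢ[ℂ] RT c la
  W₁₂ : RT rb a ≃ₗᵢ[ℂ] RT rb' a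
  W₂₃ : RT a lc ≃ₗᵢ[ℂ] RT a lc'
  W₂₃' : RT b la ≃ₗᵢ[ℂ] RT b ra'
  W₁₂' : RT la c ≃ₗᵢ[ℂ] RT ra' c
  F₂₃ : RT b ra' ≃ₗᵢ[ℂ] RT b la''
  W₁₂'' : RT rc a ≃ₗᵢ[ℂ] RT lb' a
  F₁₂ : RT lb' a ≃ₗᵢ[ℂ] RT rb'' a
  gla : Good la
  glc : Good lc
  grb : Good rb
  grc : Good rc
  glb' : Good lb'
  glc' : Good lc'
  gra' : Good ra'
  grb' : Good rb'
  gla'' : Good la''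
  grb'' : Good rb''
  hla : IsAmpLeft a la
  hlc : IsAmpLeft c lc
  hrb : IsAmpRight b rb
  hrc : IsAmpRight c rc
  hlb' : IsAmpLeft b lb'
  hlc' : IsAmpLeft c lc'
  hra' : IsAmpRight a ra'
  hrb' : IsAmpRight b rb'
  hla'' : IsAmpLeft a la''
  hrb'' : IsAmpRight b rb''
  W_rc : ∀ x v, W (rc x v) = lb' x (W v)
  W_lc : ∀ x v, W (lc x v) = lc' x (W v)
  W_la : ∀ x v, W (la x v) = ra' x (W v)
  W_rb : ∀ x v, W (rb x v) = rb' x (W v)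
  hF : IsFlip F
  hF' : IsFlip F'
  hA₁ : IsAssoc A₁
  hA₂ : IsAssoc A₂
  hA₃ : IsAssoc A₃
  hA₄ : IsAssoc A₄
  hA₅ : IsAssoc A₅
  hW₁₂ : IsTensorMap (W : RT b a →L[ℂ] RT a c) (ContinuousLinearMap.id ℂ H)
    (W₁₂ : RT rb a →L[ℂ] RT rb' a)
  hW₂₃ : IsTensorMap (ContinuousLinearMap.id ℂ H) (W : RT b a →L[ℂ] RT a c)
    (W₂₃ : RT a lc →L[ℂ] RT a lc')
  hW₂₃' : IsTensorMap (ContinuousLinearMap.id ℂ H) (W : RT b a →L[ℂ] RT a c)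
    (W₂₃' : RT b la →L[ℂ] RT b ra')
  hW₁₂' : IsTensorMap (W : RT b a →L[ℂ] RT a c) (ContinuousLinearMap.id ℂ H)
    (W₁₂' : RT la c →L[ℂ] RT ra' c)
  hF₂₃ : IsTensorMap (ContinuousLinearMap.id ℂ H) (F : RT a c →L[ℂ] RT c a)
    (F₂₃ : RT b ra' →L[ℂ] RT b la'')
  hW₁₂'' : IsTensorMap (W : RT b a →L[ℂ] RT a c) (ContinuousLinearMap.id ℂ H)
    (W₁₂'' : RT rc a →L[ℂ] RT lb' a)
  hF₁₂ : IsTensorMap (F : RT a c →L[ℂ] RT c a) (ContinuousLinearMap.id ℂ H)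
    (F₁₂ : RT lb' a →L[ℂ] RT rb'' a)

lemma Commuting.symm {ρ σ : Rep μ H} (h : Commuting ρ σ) : Commuting σ ρ :=
  fun x y => (h y x).symm

section

variable {H₁ H₂ H₁' H₂' : Type*} [NormedAddCommGroup H₁] [InnerProductSpace ℂ H₁] [CompleteSpace H₁]
  [NormedAddCommGroup H₂] [InnerProductSpace ℂ H₂] [CompleteSpace H₂]
  [NormedAddCommGroup H₁'] [InnerProductSpace ℂ H₁'] [CompleteSpace H₁']
  [NormedAddCommGroup H₂'] [InnerProductSpace ℂ H₂'] [CompleteSpace H₂']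
  {ρ₁ : Rep μ H₁} {ρ₂ : Rep μ H₂} {ρ₁' : Rep μ H₁'} {ρ₂' : Rep μ H₂'}

include hμ

lemma exists_tensorMap_left (h₁ : Good ρ₁) (h₂ : Good ρ₂) (h₁' : Good ρ₁')
    (S : H₁ ≃ₗᵢ[ℂ] H₁') (hS : ∀ x ξ, S (ρ₁ x ξ) = ρ₁' x (S ξ)) :
    ∃ X : RT ρ₁ ρ₂ ≃ₗᵢ[ℂ] RT ρ₁' ρ₂, IsTensorMap (S : H₁ →L[ℂ] H₁')
      (ContinuousLinearMap.id ℂ H₂) (X : RT ρ₁ ρ₂ →L[ℂ] RT ρ₁' ρ₂) :=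
  exists_tensorMap hμ h₁ h₂ h₁' h₂ S (LinearIsometryEquiv.refl ℂ H₂) hS fun _ _ => rfl

lemma exists_tensorMap_right (h₁ : Good ρ₁) (h₂ : Good ρ₂) (h₂' : Good ρ₂')
    (T : H₂ ≃ₗᵢ[ℂ] H₂') (hT : ∀ x ξ, T (ρ₂ x ξ) = ρ₂' x (T ξ)) :
    ∃ X : RT ρ₁ ρ₂ ≃ₗᵢ[ℂ] RT ρ₁ ρ₂', IsTensorMap (ContinuousLinearMap.id ℂ H₁)
      (T : H₂ →L[ℂ] H₂') (X : RT ρ₁ ρ₂ →L[ℂ] RT ρ₁ ρ₂') :=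
  exists_tensorMap hμ h₁ h₂ h₁ h₂' (LinearIsometryEquiv.refl ℂ H₁) T (fun _ _ => rfl) hT

end

include hμ in
-- Amplifications exist because the representations commute. The intertwining relations are exactly
-- what is needed for `W ⊗ 1` and `1 ⊗ W` to be defined on the relative tensor products over these
-- amplifications.
lemma IntertwinesAmps.nonempty_pentagonData (ga : Good a) (gb : Good b) (gc : Good c)
    (hab : Commuting a b) (hac : Commuting a c) (hbc : Commuting b c)
    (hW : IntertwinesAmps a b c W) : Nonempty (PentagonData a b c W) := by
  obtain ⟨la, gla, hla⟩ := exists_ampLeft hμ gb ga ga hab.symm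
  obtain ⟨lc, glc, hlc⟩ := exists_ampLeft hμ gb ga gc hbc
  obtain ⟨rb, grb, hrb⟩ := exists_ampRight hμ gb ga gb hab
  obtain ⟨rc, grc, hrc⟩ := exists_ampRight hμ gb ga gc hac
  obtain ⟨lb', glb', hlb'⟩ := exists_ampLeft hμ ga gc gb hab
  obtain ⟨lc', glc', hlc'⟩ := exists_ampLeft hμ ga gc gc hac
  obtain ⟨ra', gra', hra'⟩ := exists_ampRight hμ ga gc ga hac.symm
  obtain ⟨rb', grb', hrb'⟩ := exists_ampRight hμ ga gc gb hbc.symm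
  obtain ⟨la'', gla'', hla''⟩ := exists_ampLeft hμ gc ga ga hac.symm
  obtain ⟨rb'', grb'', hrb''⟩ := exists_ampRight hμ gc ga gb hab
  have W_rc := hW.rc rc lb' grc glb' hrc hlb'
  have W_lc := hW.lc lc lc' glc glc' hlc hlc'
  have W_la := hW.la la ra' gla gra' hla hra'
  have W_rb := hW.rb rb rb' grb grb' hrb hrb'
  obtain ⟨F, hF⟩ := exists_flip hμ ga gc
  obtain ⟨F', hF'⟩ := exists_flip hμ gc gla
  obtain ⟨A₁, hA₁⟩ := exists_assoc hμ gb ga gb ga grb gla hab hrb hla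
  obtain ⟨A₂, hA₂⟩ := exists_assoc hμ ga gc gb ga grb' glc hbc.symm hrb' hlc
  obtain ⟨A₃, hA₃⟩ := exists_assoc hμ ga gc ga gc gra' glc' hac.symm hra' hlc'
  obtain ⟨A₄, hA₄⟩ := exists_assoc hμ gb ga gc ga grc gla'' hac hrc hla''
  obtain ⟨A₅, hA₅⟩ := exists_assoc hμ gc ga gb ga grb'' gla hab hrb'' hla
  obtain ⟨W₁₂, hW₁₂⟩ := exists_tensorMap_left hμ grb ga grb' W W_rb
  obtain ⟨W₂₃, hW₂₃⟩ := exists_tensorMap_right hμ ga glc glc' W W_lc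
  obtain ⟨W₂₃', hW₂₃'⟩ := exists_tensorMap_right hμ gb gla gra' W W_la
  obtain ⟨W₁₂', hW₁₂'⟩ := exists_tensorMap_left hμ gla gc gra' W W_la
  obtain ⟨F₂₃, hF₂₃⟩ := exists_tensorMap_right hμ gb gra' gla'' F
    (hF.intertwines hμ ga gc hra' hla'')
  obtain ⟨W₁₂'', hW₁₂''⟩ := exists_tensorMap_left hμ grc ga glb' W W_rc
  obtain ⟨F₁₂, hF₁₂⟩ := exists_tensorMap_left hμ glb' ga grb'' F
    (hF.intertwines' hμ ga gc hlb' hrb'')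
  exact ⟨{
    la := la, lc := lc, rb := rb, rc := rc, lb' := lb', lc' := lc', ra' := ra', rb' := rb',
    la'' := la'', rb'' := rb'', F := F, F' := F', A₁ := A₁, A₂ := A₂, A₃ := A₃, A₄ := A₄,
    A₅ := A₅, W₁₂ := W₁₂, W₂₃ := W₂₃, W₂₃' := W₂₃', W₁₂' := W₁₂', F₂₃ := F₂₃, W₁₂'' := W₁₂'',
    F₁₂ := F₁₂, gla := gla, glc := glc, grb := grb, grc := grc, glb' := glb', glc' := glc',
    gra' := gra', grb' := grb', gla'' := gla'', grb'' := grb'', hla := hla, hlc := hlc,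
    hrb := hrb, hrc := hrc, hlb' := hlb', hlc' := hlc', hra' := hra', hrb' := hrb',
    hla'' := hla'', hrb'' := hrb'', W_rc := W_rc, W_lc := W_lc, W_la := W_la, W_rb := W_rb,
    hF := hF, hF' := hF', hA₁ := hA₁, hA₂ := hA₂, hA₃ := hA₃, hA₄ := hA₄, hA₅ := hA₅,
    hW₁₂ := hW₁₂, hW₂₃ := hW₂₃, hW₂₃' := hW₂₃', hW₁₂' := hW₁₂', hF₂₃ := hF₂₃,
    hW₁₂'' := hW₁₂'', hF₁₂ := hF₁₂ }⟩

namespace PentagonData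

variable (P : PentagonData a b c W)

/-- The operator `W₁₃`. -/
def W₁₃ : RT b P.ra' ≃ₗᵢ[ℂ] RT P.la c :=
  P.F₂₃.trans (P.A₄.symm.trans (P.W₁₂''.trans (P.F₁₂.trans (P.A₅.trans P.F'))))

/-- The left hand side of the pentagon equation. -/
def lhs : RT P.rb a ≃ₗᵢ[ℂ] RT a P.lc' := P.W₁₂.trans (P.A₂.trans P.W₂₃)

/-- The right hand side of the pentagon equation. -/
def rhs : RT P.rb a ≃ₗᵢ[ℂ] RT a P.lc' :=
  P.A₁.trans (P.W₂₃'.trans (P.W₁₃.trans (P.W₁₂'.trans P.A₃)))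

lemma isPseudoMultiplicativeUnitary (normal : IsNormal a ∧ IsNormal b ∧ IsNormal c)
    (faithful : Function.Injective a ∧ Function.Injective b ∧ Function.Injective c)
    (commuting : Commuting a b ∧ Commuting a c ∧ Commuting b c) {ι : Type*} {v : ι → RT P.rb a}
    (hv : Total v) (h : ∀ i, P.lhs (v i) = P.rhs (v i)) :
    IsPseudoMultiplicativeUnitary a b c W where
  normal := normal
  faithful := faithful
  commuting := commuting
  pentagon := ⟨P.la, P.lc, P.rb, P.rc, P.lb', P.lc', P.ra', P.rb',
    ⟨P.hla, P.hlc, P.hrb, P.hrc, P.hlb', P.hlc', P.hra', P.hrb'⟩, P.W_rc, P.W_lc, P.W_la, P.W_rb,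
    P.F, P.la'', P.rb'', P.F', P.A₁, P.A₂, P.A₃, P.A₄, P.A₅, P.W₁₂, P.W₂₃, P.W₂₃', P.W₁₂', P.F₂₃,
    P.W₁₂'', P.F₁₂, P.W₁₃, ⟨P.hF, P.hla'', P.hrb'', P.hF'⟩,
    ⟨P.hA₁, P.hA₂, P.hA₃, P.hA₄, P.hA₅⟩, P.hW₁₂, P.hW₂₃, P.hW₂₃', P.hW₁₂', P.hF₂₃, P.hW₁₂'',
    P.hF₁₂, fun _ => rfl, fun w => DFunLike.congr_fun (hv.clm_ext
      (S := (P.lhs : RT P.rb a →L[ℂ] RT a P.lc')) (T := (P.rhs : RT P.rb a →L[ℂ] RT a P.lc')) h) w⟩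

include hμ

/-! ### The operators on elementary tensors -/

variable (ga : Good a) (gb : Good b) (gc : Good c)

include ga gb gc

lemma W₁₂_tens {ξ : RT b a} (hξ : IsBddVec P.rb ξ) (η : H) :
    P.W₁₂ (tens P.rb a ξ η) = tens P.rb' a (W ξ) η :=
  P.hW₁₂.map_tens hμ P.grb ga P.grb' ga hξ η

lemma W₁₂'_tens {ξ : RT b a} (hξ : IsBddVec P.la ξ) (η : H) :
    P.W₁₂' (tens P.la c ξ η) = tens P.ra' c (W ξ) η :=
  P.hW₁₂'.map_tens hμ P.gla gc P.gra' gc hξ η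

lemma W₂₃_A₂_tens {ξ η ζ : H} (hξ : IsBddVec a ξ) (hη : IsBddVec b η) :
    P.W₂₃ (P.A₂ (tens P.rb' a (tens a c ξ η) ζ)) = tens a P.lc' ξ (W (tens b a η ζ)) := by
  rw [P.hA₂.map_tens _ _ _ hξ hη]
  exact P.hW₂₃.map_tens hμ ga P.glc ga P.glc' hξ _

lemma W₂₃'_tens {ξ : H} (hξ : IsBddVec b ξ) (η : RT b a) :
    P.W₂₃' (tens b P.la ξ η) = tens b P.ra' ξ (W η) :=
  P.hW₂₃'.map_tens hμ gb P.gla gb P.gra' hξ η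

/-- The flip brings `ζ` next to `ξ`, so that `W` can act on the pair. The final reordering is left
unevaluated, since `W(ξ ⊗ ζ)` need not be an elementary tensor. -/
lemma W₁₃_tens {ξ η ζ : H} (hξ : IsBddVec b ξ) (hη : IsBddVec a η) (hζ : IsBddVec c ζ) :
    P.W₁₃ (tens b P.ra' ξ (tens a c η ζ)) =
      P.F' (P.A₅ (P.F₁₂ (tens P.lb' a (W (tens b a ξ ζ)) η))) := by
  have h1 : P.F₂₃ (tens b P.ra' ξ (tens a c η ζ)) = tens b P.la'' ξ (tens c a ζ η) := by
    refine (P.hF₂₃.map_tens hμ gb P.gra' gb P.gla'' hξ _).trans ?_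
    exact congrArg (tens b P.la'' ξ) (P.hF.map_tens hμ ga gc hη hζ)
  have h2 : P.A₄.symm (tens b P.la'' ξ (tens c a ζ η)) = tens P.rc a (tens b a ξ ζ) η := by
    rw [← P.hA₄.map_tens _ _ _ hξ hζ, P.A₄.symm_apply_apply]
  change P.F' (P.A₅ (P.F₁₂ (P.W₁₂'' (P.A₄.symm (P.F₂₃ _))))) = _
  rw [h1, h2]
  exact congrArg (fun v => P.F' (P.A₅ (P.F₁₂ v))) (P.hW₁₂''.map_tens hμ P.grc ga P.glb' ga
    (P.hrc.isBddVec hμ gb ga hξ hζ) η)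

lemma F'_A₅_F₁₂_tens {ξ η ζ : H} (hξ : IsBddVec a ξ) (hξ' : IsBddVec b ξ) (hη : IsBddVec c η)
    (hζ : IsBddVec a ζ) : P.F' (P.A₅ (P.F₁₂ (tens P.lb' a (tens a c ξ η) ζ))) =
      tens P.la c (tens b a ξ ζ) η := by
  have h1 : P.F₁₂ (tens P.lb' a (tens a c ξ η) ζ) = tens P.rb'' a (tens c a η ξ) ζ := by
    refine (P.hF₁₂.map_tens hμ P.glb' ga P.grb'' ga (P.hlb'.isBddVec hμ ga gc hξ hξ' hη) _).trans ?_
    exact congrArg (tens P.rb'' a · ζ) (P.hF.map_tens hμ ga gc hξ hη)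
  rw [h1, P.hA₅.map_tens _ _ _ hη hξ']
  exact P.hF'.map_tens hμ gc P.gla hη (P.hla.isBddVec hμ gb ga hξ' hξ hζ)

end PentagonData

end Pentagon

/-! ### The pentagon equation and the intertwining relations for `W` -/

section PentagonEquation

variable {B Γ A : Type*}
  [NonUnitalCommRing B] [Module ℂ B] [IsScalarTower ℂ B B] [SMulCommClass ℂ B B]
  [StarRing B] [StarModule ℂ B] [Group Γ]
  [NonUnitalRing A] [Module ℂ A] [IsScalarTower ℂ A A] [SMulCommClass ℂ A A]
  [StarRing A] [StarModule ℂ A]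
  {act : Γ →* (B ≃⋆ₐ[ℂ] B)} {𝒜 : EvAlgebra act A}
  {μ : B →ₗ[ℂ] ℂ} (hμ : IsBaseFunctional μ) {E : Γ → Mult B} (hE : IsSymmetricCocycle act μ E)
  {ν : A →ₗ[ℂ] ℂ} {φ : A →ₗ[ℂ] B}
  {R : A → A → A ⊗[ℂ] A → Prop} (hR : EvAlgebra.CoSystem 𝒜 φ R)
  {α β βh : Rep μ (GNS ν)} (hα : IsInducedRep 𝒜.rL α) (hβ : IsInducedRep 𝒜.sL β)
  (hβh : IsInducedRep 𝒜.rR βh)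

open EvAlgebra

/-! ### Threefold tensors -/

/-- The map `p ⊗ q ⊗ r ↦ Λ(f(p)) ⊗ Λ(g(q)) ⊗ Λ(h(r))`. -/
def tensTriple (hμ : IsBaseFunctional μ) (hα : IsInducedRep 𝒜.rL α) (hβ : IsInducedRep 𝒜.sL β)
    {τ : Rep μ (RT β α)} (gτ : Good τ) (f g h : A →ₗ[ℂ] A) : A ⊗[ℂ] (A ⊗[ℂ] A) →ₗ[ℂ] RT β τ :=
  TensorProduct.lift (LinearMap.mk₂ ℂ
    (fun p t => tens β τ (Lam ν (f p)) (tensL hμ hβ hα g h t))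
    (fun p p' q => by
      rw [map_add, map_add, tens_add_left hμ hβ.good gτ (hβ.bdd _) (hβ.bdd _)])
    (fun c p q => by
      rw [map_smul, map_smul, tens_smul_left hμ hβ.good gτ _ (hβ.bdd _)])
    (fun p q q' => by
      rw [map_add, tens_add_right hμ hβ.good gτ (hβ.bdd _)])
    (fun c p q => by
      rw [map_smul, tens_smul_right hμ hβ.good gτ (hβ.bdd _)]))

lemma tensTriple_tmul {τ : Rep μ (RT β α)} (gτ : Good τ) (f g h : A →ₗ[ℂ] A) (p : A)
    (t : A ⊗[ℂ] A) : tensTriple hμ hα hβ gτ f g h (p ⊗ₜ t) =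
      tens β τ (Lam ν (f p)) (tensL hμ hβ hα g h t) := rfl

lemma tensTriple_balanced {τ : Rep μ (RT β α)} (gτ : Good τ) (hτ : IsAmpLeft α τ)
    {f g h : A →ₗ[ℂ] A} (hf : ∀ b x, f (𝒜.sL b x) = 𝒜.sL b (f x))
    (hg : ∀ b x, g (𝒜.rL b x) = 𝒜.rL b (g x)) (hg' : ∀ b x, g (𝒜.sL b x) = 𝒜.sL b (g x))
    (hh : ∀ b x, h (𝒜.rL b x) = 𝒜.rL b (h x)) {t : A ⊗[ℂ] (A ⊗[ℂ] A)}
    (ht : t ∈ 𝒜.balancedTriple) : tensTriple hμ hα hβ gτ f g h t = 0 := by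
  refine (Submodule.mem_bot ℂ).1 (span_map_le (f := tensTriple hμ hα hβ gτ f g h) ?_ ht)
  rintro _ (⟨b, p, q, r, rfl⟩ | ⟨b, p, q, r, rfl⟩)
  · rw [Submodule.mem_bot, map_sub, tensTriple_tmul, tensTriple_tmul, tensL_tmul, tensL_tmul, hf,
      hg, ← hβ.induced, ← hα.induced, tens_balanced hμ hβ.good gτ _ (hβ.bdd _),
      hτ.map_tens hμ hβ.good hα.good _ (hβ.bdd _), sub_self]
  · rw [Submodule.mem_bot, ← TensorProduct.tmul_sub, tensTriple_tmul,
      tensL_balancedLeft hμ hβ hα hg' hh (Submodule.subset_span ⟨b, q, r, rfl⟩)]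
    simpa using tens_smul_right hμ hβ.good gτ (hβ.bdd (f p)) 0 0

lemma tensL_sum (f g : A →ₗ[ℂ] A) {ρ₁ ρ₂ : Rep μ (GNS ν)} {m₁ m₂ : B →ₗ[ℂ] A →ₗ[ℂ] A}
    (h₁ : IsInducedRep m₁ ρ₁) (h₂ : IsInducedRep m₂ ρ₂) {n : ℕ} (p q : Fin n → A) :
    tensL hμ h₁ h₂ f g (∑ i, p i ⊗ₜ q i) =
      ∑ i, tens ρ₁ ρ₂ (Lam ν (f (p i))) (Lam ν (g (q i))) := map_sum _ _ _

lemma tensL_isBddVec_right (f g : A →ₗ[ℂ] A) {ρ₁ ρ₂ : Rep μ (GNS ν)} {m₁ m₂ : B →ₗ[ℂ] A →ₗ[ℂ] A}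
    (h₁ : IsInducedRep m₁ ρ₁) (h₂ : IsInducedRep m₂ ρ₂) {σ : Rep μ (GNS ν)}
    (hσ : ∀ x, IsBddVec σ (Lam ν x)) {τ : Rep μ (RT ρ₁ ρ₂)} (hτ : IsAmpRight σ τ)
    (t : A ⊗[ℂ] A) : IsBddVec τ (tensL hμ h₁ h₂ f g t) := by
  obtain ⟨n, p, q, rfl⟩ := exists_fin_sum_tmul t
  rw [tensL_sum]
  exact IsBddVec.sum _ fun i => hτ.isBddVec hμ h₁.good h₂.good (h₁.bdd _) (hσ _)

lemma tensL_isBddVec_left (f g : A →ₗ[ℂ] A) {ρ₁ ρ₂ : Rep μ (GNS ν)} {m₁ m₂ : B →ₗ[ℂ] A →ₗ[ℂ] A}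
    (h₁ : IsInducedRep m₁ ρ₁) (h₂ : IsInducedRep m₂ ρ₂) {σ : Rep μ (GNS ν)}
    (hσ : ∀ x, IsBddVec σ (Lam ν x)) {τ : Rep μ (RT ρ₁ ρ₂)} (hτ : IsAmpLeft σ τ)
    (t : A ⊗[ℂ] A) : IsBddVec τ (tensL hμ h₁ h₂ f g t) := by
  obtain ⟨n, p, q, rfl⟩ := exists_fin_sum_tmul t
  rw [tensL_sum]
  exact IsBddVec.sum _ fun i => hτ.isBddVec hμ h₁.good h₂.good (h₁.bdd _) (hσ _) (h₂.bdd _)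

lemma IsAssoc.map_tensL {τ σ : Rep μ (RT β α)} (gτ : Good τ) (gσ : Good σ)
    {F : RT τ α ≃ₗᵢ[ℂ] RT β σ} (hτ : IsAmpRight β τ) (hF : IsAssoc (σ := α) (τ := β) F)
    (f g h : A →ₗ[ℂ] A) (t : A ⊗[ℂ] A) (q : A) :
    F (tens τ α (tensL hμ hβ hα f g t) (Lam ν (h q))) =
      tensTriple hμ hα hβ gσ f g h (TensorProduct.assoc ℂ A A A (t ⊗ₜ q)) := by
  obtain ⟨n, x, y, rfl⟩ := exists_fin_sum_tmul t
  rw [tensL_sum, tens_sum_left hμ gτ hα.good _ fun i =>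
    hτ.isBddVec hμ hβ.good hα.good (hβ.bdd _) (hβ.bdd _), map_sum, TensorProduct.sum_tmul,
    map_sum, map_sum]
  refine Finset.sum_congr rfl fun i _ => ?_
  rw [hF.map_tens _ _ _ (hβ.bdd _) (hβ.bdd _)]
  rfl

/-! ### The pentagon equation for `W` -/

variable {W : RT β α ≃ₗᵢ[ℂ] RT α βh} (hW : IsCanonical 𝒜 R E hμ hα hβ W)
  (P : PentagonData α β βh W)

include hR hE hβh hW in
-- Only `W*` is explicit, so the argument starts from a target `x ⊗ y ⊗ z` and takes for `v` its
-- image under the formula for the inverse of the left side. The algebraic pentagon rewrites `v`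
-- into a form on which the right side can be evaluated with the same result.
lemma IsCanonical.exists_pentagon (x y z : A) : ∃ v : RT P.rb α,
    P.lhs v = tens α P.lc' (Lam ν x) (tens α βh (Lam ν y) (Lam ν z)) ∧
    P.rhs v = tens α P.lc' (Lam ν x) (tens α βh (Lam ν y) (Lam ν z)) := by
  obtain ⟨n, m, k, p, q, t, u, v, f, g, s, h1, h2, h3, h4, h5, h6⟩ := hR.pentagon x y z
  have ga := hα.good
  have gb := hβ.good
  have gc := hβh.good
  refine ⟨∑ i, tens P.rb α (tensL hμ hβ hα LinearMap.id (𝒜.sqrtD E) (t i))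
    (Lam ν (𝒜.sqrtD E (q i))), ?_, ?_⟩
  · have e : ∀ i, P.lhs (tens P.rb α (tensL hμ hβ hα LinearMap.id (𝒜.sqrtD E) (t i))
        (Lam ν (𝒜.sqrtD E (q i)))) = tens α P.lc' (Lam ν x)
          (W (tens β α (Lam ν (p i)) (Lam ν (𝒜.sqrtD E (q i))))) := fun i => by
      change P.W₂₃ (P.A₂ (P.W₁₂ _)) = _
      rw [P.W₁₂_tens hμ ga gb gc (tensL_isBddVec_right hμ _ _ hβ hα hβ.bdd P.hrb _), ← hW _ _ _ (h2 i),
        W.apply_symm_apply, P.W₂₃_A₂_tens hμ ga gb gc (hα.bdd _) (hβ.bdd _)]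
    rw [map_sum, Finset.sum_congr rfl fun i _ => e i, ← tens_sum_right hμ ga P.glc' (hα.bdd _),
      ← map_sum]
    congr 1
    have := hW _ _ _ h1
    rw [tensL_sum] at this
    exact (W.apply_symm_apply (tens α βh (Lam ν y) (Lam ν z))).symm.trans (congrArg W this) |>.symm
  -- By the algebraic pentagon the last two legs are `s j l` with `D^{1/2}` on both. Compatibility
  -- of the canonical map with `D^{1/2}` recognises them as `W*` of `D^{1/2} v j ⊗ D^{1/2} g j l`.
  · have e1 : P.A₁ (∑ i, tens P.rb α (tensL hμ hβ hα LinearMap.id (𝒜.sqrtD E) (t i))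
        (Lam ν (𝒜.sqrtD E (q i)))) = ∑ j, ∑ l, tens β P.la (Lam ν (f j l))
          (W.symm (tens α βh (Lam ν (𝒜.sqrtD E (v j))) (Lam ν (𝒜.sqrtD E (g j l))))) := by
      have := tensTriple_balanced hμ hα hβ P.gla P.hla (f := LinearMap.id) (fun _ _ => rfl)
        (fun b x => 𝒜.sqrtD_rL (E := E) b x) (fun b x => 𝒜.sqrtD_sL (E := E) b x)
        (fun b x => 𝒜.sqrtD_rL (E := E) b x) h6
      rw [map_sub, sub_eq_zero, map_sum, map_sum] at this
      rw [map_sum, Finset.sum_congr rfl fun i _ =>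
        P.hA₁.map_tensL hμ hα hβ P.grb P.gla P.hrb _ _ _ (t i) (q i), this]
      refine Finset.sum_congr rfl fun j _ => ?_
      rw [map_sum]
      refine Finset.sum_congr rfl fun l _ => ?_
      rw [tensTriple_tmul, hW.symm_compat hμ hα hβ (hR.isCompat_sqrtD hE) (h5 j l)]
      rfl
    have e2 : ∀ j l, P.W₁₃ (P.W₂₃' (tens β P.la (Lam ν (f j l))
        (W.symm (tens α βh (Lam ν (𝒜.sqrtD E (v j))) (Lam ν (𝒜.sqrtD E (g j l))))))) =
        P.F' (P.A₅ (P.F₁₂ (tens P.lb' α (W (tens β α (Lam ν (f j l))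
          (Lam ν (𝒜.sqrtD E (g j l))))) (Lam ν (𝒜.sqrtD E (v j)))))) := fun j l => by
      rw [P.W₂₃'_tens hμ ga gb gc (hβ.bdd _), W.apply_symm_apply,
        P.W₁₃_tens hμ ga gb gc (hβ.bdd _) (hα.bdd _) (hβh.bdd _)]
    -- `W` is known on the sum over `l`, not on its summands. The sum is therefore taken before the
    -- remaining flips and the associativity map are evaluated.
    have e3 : ∀ j, ∑ l, P.F' (P.A₅ (P.F₁₂ (tens P.lb' α (W (tens β α (Lam ν (f j l))
          (Lam ν (𝒜.sqrtD E (g j l))))) (Lam ν (𝒜.sqrtD E (v j)))))) =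
        tens P.la βh (tens β α (Lam ν (u j)) (Lam ν (𝒜.sqrtD E (v j)))) (Lam ν z) := fun j => by
      have hb : ∀ l, IsBddVec P.lb' (W (tens β α (Lam ν (f j l)) (Lam ν (𝒜.sqrtD E (g j l))))) :=
        fun l => (P.hrc.isBddVec hμ gb ga (hβ.bdd _) (hβh.bdd _)).map
          (W : RT β α →L[ℂ] RT α βh) P.W_rc
      have e4 : ∑ l, W (tens β α (Lam ν (f j l)) (Lam ν (𝒜.sqrtD E (g j l)))) =
          tens α βh (Lam ν (u j)) (Lam ν z) := by
        have := congrArg W (hW _ _ _ (h4 j))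
        rw [W.apply_symm_apply, tensL_sum, map_sum] at this
        exact this.symm
      rw [← map_sum, ← map_sum, ← map_sum, ← tens_sum_left hμ P.glb' ga _ hb, e4,
        P.F'_A₅_F₁₂_tens hμ ga gb gc (hα.bdd _) (hβ.bdd _) (hβh.bdd _) (hα.bdd _)]
    change P.A₃ (P.W₁₂' (P.W₁₃ (P.W₂₃' (P.A₁ _)))) = _
    rw [e1]
    simp only [map_sum]
    simp only [e2]
    have e5 : ∀ j, ∑ l, P.A₃ (P.W₁₂' (P.F' (P.A₅ (P.F₁₂ (tens P.lb' α (W (tens β α (Lam ν (f j l))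
          (Lam ν (𝒜.sqrtD E (g j l))))) (Lam ν (𝒜.sqrtD E (v j)))))))) =
        P.A₃ (P.W₁₂' (tens P.la βh (tens β α (Lam ν (u j)) (Lam ν (𝒜.sqrtD E (v j))))
          (Lam ν z))) := fun j => by rw [← e3, map_sum, map_sum]
    rw [Finset.sum_congr rfl fun j _ => e5 j, ← map_sum, ← map_sum,
      ← tens_sum_left hμ P.gla gc _ fun j =>
        P.hla.isBddVec hμ gb ga (hβ.bdd _) (hα.bdd _) (hα.bdd _)]
    have e6 : ∑ j, tens β α (Lam ν (u j)) (Lam ν (𝒜.sqrtD E (v j))) =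
        tensL hμ hβ hα LinearMap.id (𝒜.sqrtD E) (∑ j, u j ⊗ₜ v j) := by
      rw [tensL_sum]; rfl
    rw [e6, P.W₁₂'_tens hμ ga gb gc (tensL_isBddVec_left hμ _ _ hβ hα hα.bdd P.hla _),
      ← hW _ _ _ h3, W.apply_symm_apply, P.hA₃.map_tens _ _ _ (hα.bdd _) (hα.bdd _)]

/-! ### Amplifications of induced representations -/

include hμ in
lemma IsAmpLeft.tens_Lam {ρ₁ ρ₂ σ : Rep μ (GNS ν)} {m₁ m₂ m : B →ₗ[ℂ] A →ₗ[ℂ] A}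
    (h₁ : IsInducedRep m₁ ρ₁) (h₂ : IsInducedRep m₂ ρ₂) (hσ : IsInducedRep m σ)
    {τ : Rep μ (RT ρ₁ ρ₂)} (hτ : IsAmpLeft σ τ) (b : B) (p q : A) :
    τ (basePi μ b) (tens ρ₁ ρ₂ (Lam ν p) (Lam ν q)) = tens ρ₁ ρ₂ (Lam ν (m b p)) (Lam ν q) := by
  rw [hτ.map_tens hμ h₁.good h₂.good _ (h₁.bdd p), hσ.induced]

include hμ in
lemma IsAmpRight.tens_Lam {ρ₁ ρ₂ σ : Rep μ (GNS ν)} {m₁ m₂ m : B →ₗ[ℂ] A →ₗ[ℂ] A}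
    (h₁ : IsInducedRep m₁ ρ₁) (h₂ : IsInducedRep m₂ ρ₂) (hσ : IsInducedRep m σ)
    {τ : Rep μ (RT ρ₁ ρ₂)} (hτ : IsAmpRight σ τ) (b : B) (p q : A) :
    τ (basePi μ b) (tens ρ₁ ρ₂ (Lam ν p) (Lam ν q)) = tens ρ₁ ρ₂ (Lam ν p) (Lam ν (m b q)) := by
  rw [hτ.map_tens hμ h₁.good h₂.good _ (h₁.bdd p), hσ.induced]

include hμ hα hβ hβh hR hW in
lemma IsCanonical.intertwinesAmps : IntertwinesAmps α β βh W where
  rc _ _ g g' hτ hτ' := hW.intertwines hμ hR hα hβ hβh g g' (hR.isCompat_middle ·)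
    (fun b x => (𝒜.sqrtD_rR b x).symm) (hτ.tens_Lam hμ hβ hα hβh) (hτ'.tens_Lam hμ hα hβh hβ)
  lc _ _ g g' hτ hτ' := hW.intertwines hμ hR hα hβ hβh g g' (hR.isCompat_rR ·)
    (fun _ _ => rfl) (hτ.tens_Lam hμ hβ hα hβh) (hτ'.tens_Lam hμ hα hβh hβh)
  la _ _ g g' hτ hτ' := hW.intertwines hμ hR hα hβ hβh g g' (hR.isCompat_rL ·)
    (fun _ _ => rfl) (hτ.tens_Lam hμ hβ hα hα) (hτ'.tens_Lam hμ hα hβh hα)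
  rb _ _ g g' hτ hτ' := hW.intertwines hμ hR hα hβ hβh g g' (hR.isCompat_sL ·)
    (fun b x => (𝒜.sqrtD_sL b x).symm) (hτ.tens_Lam hμ hβ hα hβ) (hτ'.tens_Lam hμ hα hβh hβ)

include hμ hα hβ hβh hR hW in
lemma IsCanonical.intertwines_left {αh : Rep μ (GNS ν)} (hαh : IsInducedRep 𝒜.sR αh)
    {τ : Rep μ (RT β α)} {τ' : Rep μ (RT α βh)} (g : Good τ) (g' : Good τ')
    (hτ : IsAmpLeft αh τ) (hτ' : IsAmpLeft αh τ') (x : baseVN μ) (v : RT β α) :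
    W (τ x v) = τ' x (W v) :=
  hW.intertwines hμ hR hα hβ hβh g g' (hR.isCompat_sR ·)
    (fun _ _ => rfl) (hτ.tens_Lam hμ hβ hα hαh) (hτ'.tens_Lam hμ hα hβh hαh) x v

include hμ hα hβ hβh hR hW in
lemma IsCanonical.intertwines_right {αh : Rep μ (GNS ν)} (hαh : IsInducedRep 𝒜.sR αh)
    {τ : Rep μ (RT β α)} {τ' : Rep μ (RT α βh)} (g : Good τ) (g' : Good τ')
    (hτ : IsAmpRight αh τ) (hτ' : IsAmpRight αh τ') (x : baseVN μ) (v : RT β α) :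
    W (τ x v) = τ' x (W v) :=
  hW.intertwines hμ hR hα hβ hβh g g' (hR.isCompat_sR_right ·)
    (fun b x => (𝒜.sqrtD_sR b x).symm) (hτ.tens_Lam hμ hβ hα hαh) (hτ'.tens_Lam hμ hα hβh hαh) x v

include hR hE hβh hW in
lemma IsCanonical.isPseudoMultiplicativeUnitary :
    IsPseudoMultiplicativeUnitary α β βh W := by
  have cab : Commuting α β := hα.commuting hμ hβ fun b c a => 𝒜.rL_sL b c a
  have cac : Commuting α βh := hα.commuting hμ hβh fun b c a => 𝒜.rL_rR b c a
  have cbc : Commuting β βh := hβ.commuting hμ hβh fun b c a => 𝒜.sL_rR b c a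
  have hI := hW.intertwinesAmps hμ hR hα hβ hβh
  obtain ⟨P⟩ := hI.nonempty_pentagonData hμ hα.good hβ.good hβh.good cab cac cbc
  refine P.isPseudoMultiplicativeUnitary ⟨hα.normal, hβ.normal, hβh.normal⟩
    ⟨hα.injective, hβ.injective, hβh.injective⟩ ⟨cab, cac, cbc⟩
    -- Equality is known at the preimages of elementary tensors under the left side; being images of
    -- a total family under a unitary, they are total.
    (v := fun p : A × A × A => P.lhs.symm (tens α P.lc' (Lam ν p.1)
      (tens α βh (Lam ν p.2.1) (Lam ν p.2.2)))) (Total.map ?_ _) fun p => ?_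
  · exact total_tens hμ hα.good P.glc' (ξ := Lam ν)
      (η := fun p : A × A => tens α βh (Lam ν p.1) (Lam ν p.2)) (fun x => hα.bdd x)
      (fun p => P.hlc'.isBddVec hμ hα.good hβh.good (hα.bdd p.1) (hβh.bdd p.1) (hβh.bdd p.2))
      (total_Lam ν) (total_tens hμ hα.good hβh.good hα.bdd hβh.bdd (total_Lam ν) (total_Lam ν))
  · obtain ⟨v, h1, h2⟩ := hW.exists_pentagon hμ hE hR hα hβ hβh P p.1 p.2.1 p.2.2
    rw [← h1, P.lhs.symm_apply_apply, h1, h2]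

include hR hβh hW in
lemma IsCanonical.intertwinesFourth {αh : Rep μ (GNS ν)} (hαh : IsInducedRep 𝒜.sR αh) :
    IntertwinesFourth α β βh αh W := by
  have ca : Commuting αh α := hαh.commuting hμ hα fun b c a => (𝒜.rL_sR c b a).symm
  have cb : Commuting αh β := hαh.commuting hμ hβ fun b c a => (𝒜.sL_sR c b a).symm
  have cc : Commuting αh βh := hαh.commuting hμ hβh fun b c a => 𝒜.sR_rR b c a
  obtain ⟨ld, gld, hld⟩ := exists_ampLeft hμ hβ.good hα.good hαh.good cb.symm
  obtain ⟨rd, grd, hrd⟩ := exists_ampRight hμ hβ.good hα.good hαh.good ca.symm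
  obtain ⟨ld', gld', hld'⟩ := exists_ampLeft hμ hα.good hβh.good hαh.good ca.symm
  obtain ⟨rd', grd', hrd'⟩ := exists_ampRight hμ hα.good hβh.good hαh.good cc.symm
  exact ⟨hαh.normal, hαh.injective, ⟨ca, cb, cc⟩, ld, rd, ld', rd', hld, hrd, hld', hrd',
    hW.intertwines_left hμ hR hα hβ hβh hαh gld gld' hld hld',
    hW.intertwines_right hμ hR hα hβ hβh hαh grd grd' hrd hrd'⟩

end PentagonEquation

/-! ### The unitary `V` and its pentagon equation -/

section RightFundamentalUnitary

variable {B Γ A : Type*}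
  [NonUnitalCommRing B] [Module ℂ B] [IsScalarTower ℂ B B] [SMulCommClass ℂ B B]
  [StarRing B] [StarModule ℂ B] [Group Γ]
  [NonUnitalRing A] [Module ℂ A] [IsScalarTower ℂ A A] [SMulCommClass ℂ A A]
  [StarRing A] [StarModule ℂ A]
  {act : Γ →* (B ≃⋆ₐ[ℂ] B)} {𝒜 : EvAlgebra act A} {Δ : A →⋆ₙₐ[ℂ] Mult 𝒜.Fiber}
  {μ : B →ₗ[ℂ] ℂ} (hμ : IsBaseFunctional μ) {E : Γ → Mult B} (hE : IsSymmetricCocycle act μ E)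
  {ν : A →ₗ[ℂ] ℂ} {ψ : A →ₗ[ℂ] B}
  {α β αh βh : Rep μ (GNS ν)} (hα : IsInducedRep 𝒜.rL α) (hβ : IsInducedRep 𝒜.sL β)
  (hαh : IsInducedRep 𝒜.sR αh) (hβh : IsInducedRep 𝒜.rR βh)

open EvAlgebra

/-- `V` is given on elementary tensors by `T₁`. -/
structure IsCoCanonical (Δ : A →⋆ₙₐ[ℂ] Mult 𝒜.Fiber) (E : Γ → Mult B) (hμ : IsBaseFunctional μ)
    (hα : IsInducedRep 𝒜.rL α) (hβ : IsInducedRep 𝒜.sL β) (V : RT αh β ≃ₗᵢ[ℂ] RT β α) :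
    Prop where
  map_tens : ∀ x y t, 𝒜.IsT₁ Δ x y t → V (tens αh β (Lam ν x) (Lam ν y)) =
    tensL hμ hβ hα (𝒜.co.sqrtD E) LinearMap.id t
  map_tens_sqrtD : ∀ x y t, 𝒜.IsT₁ Δ x y t →
    V (tens αh β (Lam ν (𝒜.co.sqrtD E x)) (Lam ν (𝒜.co.sqrtD E y))) =
      tensL hμ hβ hα (𝒜.co.sqrtD E) (𝒜.co.sqrtD E) t

lemma IsFlip.map_tensL {ρ₁ ρ₂ : Rep μ (GNS ν)} {m₁ m₂ : B →ₗ[ℂ] A →ₗ[ℂ] A}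
    (h₁ : IsInducedRep m₁ ρ₁) (h₂ : IsInducedRep m₂ ρ₂) {F : RT ρ₁ ρ₂ ≃ₗᵢ[ℂ] RT ρ₂ ρ₁}
    (hF : IsFlip F) (f g : A →ₗ[ℂ] A) (t : A ⊗[ℂ] A) :
    F (tensL hμ h₁ h₂ f g t) = tensL hμ h₂ h₁ g f (TensorProduct.comm ℂ A A t) := by
  obtain ⟨n, p, q, rfl⟩ := exists_fin_sum_tmul t
  rw [tensL_sum, map_sum, map_sum]
  simp only [TensorProduct.comm_tmul]
  rw [tensL_sum]
  exact Finset.sum_congr rfl fun i _ => hF.map_tens hμ h₁.good h₂.good (h₁.bdd _) (h₂.bdd _)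

/-- Each intertwining relation of `V` follows from one of the unitary built on `co`, read backwards
between two flips. -/
lemma flip_conj_intertwines {H₁ H₂ H₃ H₄ : Type*} [NormedAddCommGroup H₁] [InnerProductSpace ℂ H₁]
    [CompleteSpace H₁] [NormedAddCommGroup H₂] [InnerProductSpace ℂ H₂] [CompleteSpace H₂]
    [NormedAddCommGroup H₃] [InnerProductSpace ℂ H₃] [CompleteSpace H₃]
    [NormedAddCommGroup H₄] [InnerProductSpace ℂ H₄] [CompleteSpace H₄]
    {τ : Rep μ H₁} {σ₁ : Rep μ H₂} {σ₂ : Rep μ H₃} {τ' : Rep μ H₄} {G₁ : H₁ ≃ₗᵢ[ℂ] H₂}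
    {W : H₃ ≃ₗᵢ[ℂ] H₂} {G₂ : H₃ ≃ₗᵢ[ℂ] H₄} (h₁ : ∀ x v, G₁ (τ x v) = σ₁ x (G₁ v))
    (h : ∀ x v, W (σ₂ x v) = σ₁ x (W v)) (h₂ : ∀ x v, G₂ (σ₂ x v) = τ' x (G₂ v))
    (x : baseVN μ) (v : H₁) :
    (G₁.trans (W.symm.trans G₂)) (τ x v) = τ' x ((G₁.trans (W.symm.trans G₂)) v) := by
  change G₂ (W.symm (G₁ (τ x v))) = τ' x (G₂ (W.symm (G₁ v)))
  rw [h₁, ← h₂]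
  congr 1
  refine W.injective ?_
  rw [W.apply_symm_apply, h, W.apply_symm_apply]

include hμ hE hα hβ hαh hβh in
-- Passing to `co` replaces `(α, β, β̂, α̂)` by `(β, α, α̂, β̂)`. The construction of `W` then
-- yields a unitary from `H α⊗β H` to `H β⊗α̂ H`; its inverse between two flips has the domain and
-- range of `V` and is given by `T₁`.
lemma exists_isCoCanonical (hψ : IsExpectation 𝒜.co μ ν ψ)
    (hR : CoSystem 𝒜.co ψ (𝒜.coRepRel Δ)) :
    ∃ V : RT αh β ≃ₗᵢ[ℂ] RT β α, IsCoCanonical Δ E hμ hα hβ V ∧ IntertwinesAmps β αh α V ∧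
      IntertwinesFourth β αh α βh V := by
  have hα' : IsInducedRep 𝒜.co.sL α := hα
  have hβ' : IsInducedRep 𝒜.co.rL β := hβ
  have hαh' : IsInducedRep 𝒜.co.rR αh := hαh
  have hβh' : IsInducedRep 𝒜.co.sR βh := hβh
  have ga := hα.good
  have gb := hβ.good
  have gah := hαh.good
  have gbh := hβh.good
  obtain ⟨W, hW⟩ := exists_isCanonical hμ hE hψ hR hβ' hα' hαh'
  obtain ⟨G₁, hG₁⟩ := exists_flip hμ gah gb
  obtain ⟨G₂, hG₂⟩ := exists_flip hμ ga gb
  have hI := hW.intertwinesAmps hμ hR hβ' hα' hαh'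
  have cab : Commuting α β := hα.commuting hμ hβ fun b c a => 𝒜.rL_sL b c a
  have caa : Commuting α αh := hα.commuting hμ hαh fun b c a => 𝒜.rL_sR b c a
  have cba : Commuting β αh := hβ.commuting hμ hαh fun b c a => 𝒜.sL_sR b c a
  have cabh : Commuting α βh := hα.commuting hμ hβh fun b c a => 𝒜.rL_rR b c a
  have cbb : Commuting β βh := hβ.commuting hμ hβh fun b c a => 𝒜.sL_rR b c a
  have chh : Commuting αh βh := hαh.commuting hμ hβh fun b c a => 𝒜.sR_rR b c a
  refine ⟨G₁.trans (W.symm.trans G₂), ⟨fun x y t ht => ?_, fun x y t ht => ?_⟩,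
    ⟨fun τ τ' g g' hτ hτ' => ?_, fun τ τ' g g' hτ hτ' => ?_, fun τ τ' g g' hτ hτ' => ?_,
      fun τ τ' g g' hτ hτ' => ?_⟩, ?_⟩
  · change G₂ (W.symm (G₁ _)) = _
    have ht' : 𝒜.co.canRel (𝒜.coRepRel Δ) y x (TensorProduct.comm ℂ A A t) := by
      rw [canRel_coRepRel, TensorProduct.comm_comm]; exact ht
    rw [hG₁.map_tens hμ gah gb (hαh.bdd _) (hβ.bdd _), hW _ _ _ ht', hG₂.map_tensL hμ hα' hβ',
      TensorProduct.comm_comm]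
    rfl
  · change G₂ (W.symm (G₁ _)) = _
    have ht' : 𝒜.co.canRel (𝒜.coRepRel Δ) y x (TensorProduct.comm ℂ A A t) := by
      rw [canRel_coRepRel, TensorProduct.comm_comm]; exact ht
    rw [hG₁.map_tens hμ gah gb (hαh.bdd _) (hβ.bdd _),
      hW.symm_compat hμ hβ' hα' (hR.isCompat_sqrtD hE) ht', hG₂.map_tensL hμ hα' hβ',
      TensorProduct.comm_comm]
    rfl
  · obtain ⟨σ₁, g₁, h₁⟩ := exists_ampLeft hμ gb gah ga cab.symm
    obtain ⟨σ₂, g₂, h₂⟩ := exists_ampRight hμ ga gb gah cba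
    exact flip_conj_intertwines (hG₁.intertwines hμ gah gb hτ h₁) (hI.rc _ _ g₂ g₁ h₂ h₁)
      (hG₂.intertwines hμ ga gb h₂ hτ')
  · obtain ⟨σ₁, g₁, h₁⟩ := exists_ampRight hμ gb gah ga caa.symm
    obtain ⟨σ₂, g₂, h₂⟩ := exists_ampRight hμ ga gb ga cab.symm
    exact flip_conj_intertwines (hG₁.intertwines' hμ gah gb hτ h₁) (hI.rb _ _ g₂ g₁ h₂ h₁)
      (hG₂.intertwines hμ ga gb h₂ hτ')
  · obtain ⟨σ₁, g₁, h₁⟩ := exists_ampRight hμ gb gah gb cba.symm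
    obtain ⟨σ₂, g₂, h₂⟩ := exists_ampLeft hμ ga gb gb cab
    exact flip_conj_intertwines (hG₁.intertwines' hμ gah gb hτ h₁) (hI.la _ _ g₂ g₁ h₂ h₁)
      (hG₂.intertwines' hμ ga gb h₂ hτ')
  · obtain ⟨σ₁, g₁, h₁⟩ := exists_ampLeft hμ gb gah gah cba
    obtain ⟨σ₂, g₂, h₂⟩ := exists_ampLeft hμ ga gb gah caa
    exact flip_conj_intertwines (hG₁.intertwines hμ gah gb hτ h₁) (hI.lc _ _ g₂ g₁ h₂ h₁)
      (hG₂.intertwines' hμ ga gb h₂ hτ')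
  · obtain ⟨ld, gld, hld⟩ := exists_ampLeft hμ gah gb gbh chh
    obtain ⟨rd, grd, hrd⟩ := exists_ampRight hμ gah gb gbh cbb
    obtain ⟨ld', gld', hld'⟩ := exists_ampLeft hμ gb ga gbh cbb
    obtain ⟨rd', grd', hrd'⟩ := exists_ampRight hμ gb ga gbh cabh
    obtain ⟨σ₁, g₁, h₁⟩ := exists_ampRight hμ gb gah gbh chh
    obtain ⟨σ₂, g₂, h₂⟩ := exists_ampRight hμ ga gb gbh cbb
    obtain ⟨κ₁, k₁, l₁⟩ := exists_ampLeft hμ gb gah gbh cbb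
    obtain ⟨κ₂, k₂, l₂⟩ := exists_ampLeft hμ ga gb gbh cabh
    exact ⟨hβh.normal, hβh.injective, ⟨cbb.symm, chh.symm, cabh.symm⟩, ld, rd, ld', rd', hld, hrd,
      hld', hrd', flip_conj_intertwines (hG₁.intertwines' hμ gah gb hld h₁)
        (hW.intertwines_right hμ hR hβ' hα' hαh' hβh' g₂ g₁ h₂ h₁)
        (hG₂.intertwines hμ ga gb h₂ hld'),
      flip_conj_intertwines (hG₁.intertwines hμ gah gb hrd l₁)
        (hW.intertwines_left hμ hR hβ' hα' hαh' hβh' k₂ k₁ l₂ l₁)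
        (hG₂.intertwines' hμ ga gb l₂ hrd')⟩

/-! ### The pentagon equation for `V` -/

variable {V : RT αh β ≃ₗᵢ[ℂ] RT β α} (hV : IsCoCanonical Δ E hμ hα hβ V)
  (P : PentagonData β αh α V)

include hV hαh in
-- Unlike `W`, the operator `V` is explicit on elementary tensors, so both sides can be evaluated
-- directly at `x ⊗ y ⊗ z`. They give the two sides of the algebraic pentagon, with `D̄^{1/2}` on
-- the first two legs.
lemma IsCoCanonical.pentagon (hΔ : 𝒜.IsComultiplication Δ) (x y z : A) :
    P.lhs (tens P.rb β (tens αh β (Lam ν x) (Lam ν y)) (Lam ν z)) =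
      P.rhs (tens P.rb β (tens αh β (Lam ν x) (Lam ν y)) (Lam ν z)) := by
  obtain ⟨n, m, k, p, q, t, u, v, f, g, s, h1, h2, h3, h4, h5, h6⟩ := hΔ.T₁_pentagon x y z
  have ga := hβ.good
  have gb := hαh.good
  have gc := hα.good
  have e := tensTriple_balanced hμ hα hβ P.glc' P.hlc' (f := 𝒜.co.sqrtD E) (g := 𝒜.co.sqrtD E)
    (h := LinearMap.id) (fun b x => 𝒜.co.sqrtD_rL (E := E) b x)
    (fun b x => 𝒜.co.sqrtD_sL (E := E) b x) (fun b x => 𝒜.co.sqrtD_rL (E := E) b x)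
    (fun _ _ => rfl) h6
  rw [map_sub, sub_eq_zero, map_sum, map_sum] at e
  simp only [map_sum] at e
  have hl : P.lhs (tens P.rb β (tens αh β (Lam ν x) (Lam ν y)) (Lam ν z)) =
      ∑ i, tensTriple hμ hα hβ P.glc' (𝒜.co.sqrtD E) (𝒜.co.sqrtD E) LinearMap.id
        (p i ⊗ₜ t i) := by
    change P.W₂₃ (P.A₂ (P.W₁₂ _)) = _
    rw [P.W₁₂_tens hμ ga gb gc (P.hrb.isBddVec hμ gb ga (hαh.bdd _) (hαh.bdd _)),
      hV.map_tens _ _ _ h1, tensL_sum, tens_sum_left hμ P.grb' ga _ fun i =>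
        P.hrb'.isBddVec hμ ga gc (hβ.bdd _) (hαh.bdd _), map_sum, map_sum]
    refine Finset.sum_congr rfl fun i _ => ?_
    rw [P.W₂₃_A₂_tens hμ ga gb gc (hβ.bdd _) (hαh.bdd _), tensTriple_tmul,
      ← hV.map_tens _ _ _ (h2 i)]
    rfl
  have hr₁ : P.W₂₃' (P.A₁ (tens P.rb β (tens αh β (Lam ν x) (Lam ν y)) (Lam ν z))) =
      ∑ j, tens αh P.ra' (Lam ν x) (tens β α (Lam ν (𝒜.co.sqrtD E (u j))) (Lam ν (v j))) := by
    rw [P.hA₁.map_tens _ _ _ (hαh.bdd _) (hαh.bdd _), P.W₂₃'_tens hμ ga gb gc (hαh.bdd _),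
      hV.map_tens _ _ _ h3, tensL_sum, tens_sum_right hμ gb P.gra' (hαh.bdd _)]
    rfl
  have hr₂ : ∀ j, P.W₁₃ (tens αh P.ra' (Lam ν x)
      (tens β α (Lam ν (𝒜.co.sqrtD E (u j))) (Lam ν (v j)))) =
      ∑ l, tens P.la α (tens αh β (Lam ν (𝒜.co.sqrtD E (f j l))) (Lam ν (𝒜.co.sqrtD E (u j))))
        (Lam ν (g j l)) := fun j => by
    rw [P.W₁₃_tens hμ ga gb gc (hαh.bdd _) (hβ.bdd _) (hα.bdd _), hV.map_tens _ _ _ (h4 j),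
      tensL_sum, tens_sum_left hμ P.glb' ga _ fun l =>
        P.hlb'.isBddVec hμ ga gc (hβ.bdd _) (hαh.bdd _) (hα.bdd _), map_sum, map_sum, map_sum]
    exact Finset.sum_congr rfl fun l _ =>
      P.F'_A₅_F₁₂_tens hμ ga gb gc (hβ.bdd _) (hαh.bdd _) (hα.bdd _) (hβ.bdd _)
  -- Both legs already carry `D̄^{1/2}` from the earlier factors, so the second formula in
  -- `IsCoCanonical` is the one needed here.
  have hr₃ : ∀ j l, P.A₃ (P.W₁₂' (tens P.la α (tens αh β (Lam ν (𝒜.co.sqrtD E (f j l)))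
      (Lam ν (𝒜.co.sqrtD E (u j)))) (Lam ν (g j l)))) =
      tensTriple hμ hα hβ P.glc' (𝒜.co.sqrtD E) (𝒜.co.sqrtD E) LinearMap.id
        (TensorProduct.assoc ℂ A A A (s j l ⊗ₜ g j l)) := fun j l => by
    rw [P.W₁₂'_tens hμ ga gb gc (P.hla.isBddVec hμ gb ga (hαh.bdd _) (hβ.bdd _) (hβ.bdd _)),
      hV.map_tens_sqrtD _ _ _ (h5 j l)]
    exact P.hA₃.map_tensL hμ hα hβ P.gra' P.glc' P.hra' (𝒜.co.sqrtD E) (𝒜.co.sqrtD E)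
      LinearMap.id (s j l) (g j l)
  rw [hl, e]
  change _ = P.A₃ (P.W₁₂' (P.W₁₃ (P.W₂₃' (P.A₁ _))))
  rw [hr₁]
  simp only [map_sum, hr₂, hr₃]

include hV hαh in
lemma IsCoCanonical.isPseudoMultiplicativeUnitary (hΔ : 𝒜.IsComultiplication Δ)
    (hI : IntertwinesAmps β αh α V) : IsPseudoMultiplicativeUnitary β αh α V := by
  have cab : Commuting β α := hβ.commuting hμ hα fun b c a => (𝒜.rL_sL c b a).symm
  have cba : Commuting β αh := hβ.commuting hμ hαh fun b c a => 𝒜.sL_sR b c a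
  have caa : Commuting αh α := hαh.commuting hμ hα fun b c a => (𝒜.rL_sR c b a).symm
  obtain ⟨P⟩ := hI.nonempty_pentagonData hμ hβ.good hαh.good hα.good cba cab caa
  refine P.isPseudoMultiplicativeUnitary ⟨hβ.normal, hαh.normal, hα.normal⟩
    ⟨hβ.injective, hαh.injective, hα.injective⟩ ⟨cba, cab, caa⟩
    (v := fun p : (A × A) × A => tens P.rb β (tens αh β (Lam ν p.1.1) (Lam ν p.1.2)) (Lam ν p.2))
    ?_ fun p => hV.pentagon hμ hα hβ hαh P hΔ p.1.1 p.1.2 p.2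
  exact total_tens hμ P.grb hβ.good
    (ξ := fun p : A × A => tens αh β (Lam ν p.1) (Lam ν p.2)) (η := Lam ν)
    (fun p => P.hrb.isBddVec hμ hαh.good hβ.good (hαh.bdd p.1) (hαh.bdd p.2)) hβ.bdd
    (total_tens hμ hαh.good hβ.good hαh.bdd hβ.bdd (total_Lam ν) (total_Lam ν)) (total_Lam ν)

end RightFundamentalUnitary

end

end DynQG

/-! ### Assembly of the theorem -/

theorem mainTheorem5 {B Γ A : Type*}
    [NonUnitalCommRing B] [Module ℂ B] [IsScalarTower ℂ B B] [SMulCommClass ℂ B B]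
    [StarRing B] [StarModule ℂ B] [Group Γ]
    [NonUnitalRing A] [Module ℂ A] [IsScalarTower ℂ A A] [SMulCommClass ℂ A A]
    [StarRing A] [StarModule ℂ A]
    (act : Γ →* (B ≃⋆ₐ[ℂ] B)) (hB : DynQG.HasLocalUnits (Set.univ : Set B))
    (𝒜 : DynQG.EvAlgebra act A) (Δ : A →⋆ₙₐ[ℂ] DynQG.Mult 𝒜.Fiber)
    (ε : A →ₗ[ℂ] DynQG.Crossed B Γ) (S : A ≃ₗ[ℂ] A) (μ : B →ₗ[ℂ] ℂ) (D : Γ → DynQG.Mult B)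
    (φ ψ : A →ₗ[ℂ] B) (hA : DynQG.IsMeasuredHopfAlgebroid 𝒜 Δ ε S μ D φ ψ)
    (hμ : DynQG.BoundedGNS μ)
    (E : Γ → DynQG.Mult B) (hE : DynQG.IsSqrtCocycle act μ D E) :
    ∃ α β αh βh : DynQG.Rep μ (DynQG.GNS (μ ∘ₗ φ)),
      DynQG.IsInducedBy 𝒜.rL α ∧ DynQG.IsInducedBy 𝒜.sL β ∧
      DynQG.IsInducedBy 𝒜.sR αh ∧ DynQG.IsInducedBy 𝒜.rR βh ∧
      ∃ (W : DynQG.RT β α ≃ₗᵢ[ℂ] DynQG.RT α βh) (V : DynQG.RT αh β ≃ₗᵢ[ℂ] DynQG.RT β α),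
        DynQG.IsFundamentalW 𝒜 Δ (μ ∘ₗ φ) E α β βh W ∧
        DynQG.IsFundamentalV 𝒜 Δ (μ ∘ₗ φ) E α β αh V ∧
        DynQG.IsPseudoMultiplicativeUnitary α β βh W ∧ DynQG.IntertwinesFourth α β βh αh W ∧
        DynQG.IsPseudoMultiplicativeUnitary β αh α V ∧ DynQG.IntertwinesFourth β αh α βh V := by
  have bμ : DynQG.IsBaseFunctional μ := ⟨hA.weight.positive, hμ, hB⟩
  have sE := hE.isSymmetricCocycle hB hA.weight
  have hφ : DynQG.IsExpectation 𝒜 μ (μ ∘ₗ φ) φ :=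
    ⟨hA.left_integral.left_linear, hA.left_integral.right_linear, hA.left_integral.graded,
      hA.left_surjective, fun _ => rfl, hA.total.positive⟩
  -- With the legs exchanged, `ψ` plays the part of `φ`. Because `μ ∘ φ = μ ∘ ψ`, the
  -- representations `β` and `α̂` obtained from it act on the same space `H`.
  have hψ : DynQG.IsExpectation 𝒜.co μ (μ ∘ₗ φ) ψ :=
    ⟨hA.right_integral.left_linear, hA.right_integral.right_linear, hA.right_integral.graded,
      hA.right_surjective, fun x => LinearMap.congr_fun hA.coincide x, hA.total.positive⟩
  obtain ⟨α, hα⟩ := hφ.exists_rL bμ sE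
  obtain ⟨βh, hβh⟩ := hφ.exists_rR bμ
  obtain ⟨β, hβ⟩ := hψ.exists_rL bμ sE
  obtain ⟨αh, hαh⟩ := hψ.exists_rR bμ
  replace hβ : DynQG.IsInducedRep 𝒜.sL β := hβ
  replace hαh : DynQG.IsInducedRep 𝒜.sR αh := hαh
  have hR := DynQG.EvAlgebra.coSystem_left hA.comultiplication hA.counit hA.antipode hA.left_integral
  have hR' := DynQG.EvAlgebra.coSystem_right hA.comultiplication hA.counit hA.antipode hA.right_integral
  obtain ⟨W, hW⟩ := DynQG.exists_isCanonical bμ sE hφ hR hα hβ hβh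
  obtain ⟨V, hV, hI, hV₄⟩ := DynQG.exists_isCoCanonical bμ sE hα hβ hαh hβh hψ hR'
  refine ⟨α, β, αh, βh, hα.induced, hβ.induced, hαh.induced, hβh.induced, W, V, ?_, ?_,
    hW.isPseudoMultiplicativeUnitary bμ sE hR hα hβ hβh, hW.intertwinesFourth bμ hR hα hβ hβh hαh,
    hV.isPseudoMultiplicativeUnitary bμ hα hβ hαh hA.comultiplication hI, hV₄⟩
  · intro x y n p q γ γ' hq ht
    rw [hW x y _ (DynQG.EvAlgebra.canRel_repRel.2 ht), DynQG.tensL_sum]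
    exact Finset.sum_congr rfl fun i _ => by rw [𝒜.sqrtD_eq (hq i)]; rfl
  · intro x y n p q γ γ' hp ht
    rw [hV.map_tens x y _ ht, DynQG.tensL_sum]
    exact Finset.sum_congr rfl fun i _ => by
      rw [𝒜.co.sqrtD_eq (γ := γ' i) (γ' := γ i) (hp i)]; rfl
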